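/- Let $k$ be a field. For a connected graded locally finite $k$-algebra $A=\bigoplus_{i\ge 0}A_i$ (that is, $A_0=k$ and $\dim_k A_i<\infty$ for all $i$), let $k_A=A/A_{\ge 1}$ be the trivial right $A$-module, and for a graded free resolution $P$ of $k_A$ let $\mathrm{End}_A(P)$ be the DG algebra spanned by the $A$-linear endomorphisms of $P$ that are homogeneous with respect to both the cohomological degree $p$ and the internal (Adams) degree $i$. An *$A_\infty$-Ext-algebra* of $A$, written $E=\mathrm{Ext}^*_A(k_A,k_A)$, is a bigraded, strictly unital $A_\infty$-algebra $E=\bigoplus_{p,i}E^p_i$, with multiplications $m_n:E^{\otimes n}\to E$ of bidegree $(2-n,0)$ and $m_1=0$, that admits a quasi-isomorphism of $A_\infty$-algebras $E\to\mathrm{End}_A(P)$ for some graded free resolution $P$ of $k_A$. (All morphisms of $A_\infty$-algebras are strictly unital and preserve the Adams degree. Such an $E$ is the cohomology algebra $\bigoplus_p\mathrm{Ext}^p_A(k_A,k_A)$ with a higher $A_\infty$-structure.) Put $E^p=\bigoplus_i E^p_i$; then $m_n$ restricts to a map $(E^1)^{\otimes n}\to E^2$. Let $A$ and $A'$ be connected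 graded locally finite $k$-algebras, and let $E$ and $E'$ be any $A_\infty$-Ext-algebras of $A$ and $A'$, with multiplications $m_n$ and $m'_n$. Suppose that the restrictions of the multiplications to $E^1$ and $E'^1$ are isomorphic: there are Adams-degree-preserving $k$-linear isomorphisms $\varphi_1:E^1\to E'^1$ and $\varphi_2:E^2\to E'^2$ such that $$\varphi_2\bigl(m_n(x_1\otimes\cdots\otimes x_n)\bigr)=m'_n\bigl(\varphi_1(x_1)\otimes\cdots\otimes\varphi_1(x_n)\bigr)\qquad\text{for all } n\ge 1 \text{ and } x_1,\dots,x_n\in E^1 .$$ Then: (a) $A$ and $A'$ are isomorphic as graded $k$-algebras; that is, the algebra $A$ is determined up to isomorphism by the maps $m_n$ restricted to $(E^1)^{\otimes n}$ for all $n$. (b) There is a quasi-isomorphism of $A_\infty$-algebras $E\to E'$; that is, the $A_\infty$-structure of $E$ is determined up to quasi-isomorphism by the maps $m_n$ restricted to $(E^1)^{\otimes n}$ for all $n$. -/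

import Mathlib

open scoped DirectSum

namespace ExtAInf

section AInfinity

/-- The tuple `a₀, …, a_{r-1}, w, a_{r+s}, a_{r+s+1}, …` obtained from the sequence `a` by
replacing the block `a_r, …, a_{r+s-1}` of length `s` by the single entry `w`. -/
def graft {V : Type*} (a : ℕ → V) (r s : ℕ) (w : V) : ℕ → V := fun j =>
  if j < r then a j else if j = r then w else a (j + s - 1)

/-- The exponent of the sign with which `id^{⊗r} ⊗ m_s ⊗ id^{⊗t}` occurs in the Stasheff
identities, evaluated on elements: `r + s t`, plus the Koszul sign `(2 - s)(p₀ + ⋯ + p_{r-1})`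
that arises when `m_s`, of degree `2 - s`, is moved past `a₀ ⊗ ⋯ ⊗ a_{r-1}`, where `a_j` has
degree `p_j`. -/
def graftSign (p : ℕ → ℤ) (r s t : ℕ) : ℤ :=
  (r : ℤ) + (s : ℤ) * (t : ℤ) + (2 - (s : ℤ)) * ∑ j ∈ Finset.range r, p j

/-- A (strictly unital, Adams graded) `A_∞`-algebra structure on the `k`-vector space `V`.
The grading index is `(p, i)`: `p` is the cohomological degree, `i` the Adams degree.
Identities between tensors are stated on homogeneous elements `a₀, …, a_{n-1}`, given as the
first `n` terms of a sequence. -/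
structure AInfinityAlgebra (k : Type*) [Field k] (V : Type*) [AddCommGroup V] [Module k V] where
  /-- the homogeneous piece `V^p_i` -/
  deg : ℤ × ℤ → Submodule k V
  isInternal : DirectSum.IsInternal deg
  /-- the multiplication `m_n : V^{⊗n} → V`, for `n ≥ 1` -/
  m : (n : ℕ) → MultilinearMap k (fun _ : Fin n => V) V
  /-- there is no operation of arity `0` -/
  m_zero : m 0 = 0
  /-- `m_n` has degree `(2 - n, 0)` -/
  m_mem : ∀ (n : ℕ) (v : Fin n → V) (d : Fin n → ℤ × ℤ), (∀ j, v j ∈ deg (d j)) →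
    m n v ∈ deg ((∑ j, (d j).1) + (2 - (n : ℤ)), ∑ j, (d j).2)
  /-- the Stasheff identities
  `∑_{r+s+t=n, s≥1} (-1)^{r+st} m_{r+1+t} (id^{⊗r} ⊗ m_s ⊗ id^{⊗t}) = 0` for `n ≥ 1` -/
  stasheff : ∀ n : ℕ, 1 ≤ n → ∀ (a : ℕ → V) (d : ℕ → ℤ × ℤ), (∀ j, a j ∈ deg (d j)) →
    ∑ s ∈ Finset.Icc 1 n, ∑ r ∈ Finset.range (n - s + 1),
      Int.negOnePow (graftSign (fun j => (d j).1) r s (n - s - r)) •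
        m (r + 1 + (n - s - r))
          (fun j => graft a r s (m s fun i => a (r + i)) j) = 0
  /-- the strict unit -/
  one : V
  one_mem : one ∈ deg (0, 0)
  one_mul : ∀ a, m 2 ![one, a] = a
  mul_one : ∀ a, m 2 ![a, one] = a
  m_one : ∀ n, n ≠ 2 → ∀ v : Fin n → V, (∃ j, v j = one) → m n v = 0

variable {k : Type*} [Field k] {V W : Type*} [AddCommGroup V] [Module k V]
  [AddCommGroup W] [Module k W]

/-- The exponent of the sign with which `m_q (f_{i_1} ⊗ ⋯ ⊗ f_{i_q})` occurs in the Stasheff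
morphism identity, for the composition `c = (i_1, …, i_q)` of `n`:
`(q-1)(i_1-1) + (q-2)(i_2-1) + ⋯ + (i_{q-1}-1)`, plus the Koszul sign arising when each
`f_{i_j}`, of degree `1 - i_j`, is moved past the arguments of `f_{i_1}, …, f_{i_{j-1}}`. -/
def homSign {n : ℕ} (p : ℕ → ℤ) (c : Composition n) : ℤ :=
  (∑ j : Fin c.length, ((c.length : ℤ) - 1 - (j : ℕ)) * ((c.blocksFun j : ℤ) - 1)) +
    ∑ j : Fin c.length, (1 - (c.blocksFun j : ℤ)) * ∑ l ∈ Finset.range (c.sizeUpTo j), p l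

/-- A (unital, Adams degree preserving) morphism of `A_∞`-algebras. -/
structure AInfinityHom (E : AInfinityAlgebra k V) (F : AInfinityAlgebra k W) where
  /-- the component `f_n : V^{⊗n} → W`, for `n ≥ 1` -/
  f : (n : ℕ) → MultilinearMap k (fun _ : Fin n => V) W
  /-- there is no component of arity `0` -/
  f_zero : f 0 = 0
  /-- `f_n` has degree `(1 - n, 0)` -/
  f_mem : ∀ (n : ℕ) (v : Fin n → V) (d : Fin n → ℤ × ℤ), (∀ j, v j ∈ E.deg (d j)) →
    f n v ∈ F.deg ((∑ j, (d j).1) + (1 - (n : ℤ)), ∑ j, (d j).2)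
  /-- the Stasheff morphism identities
  `∑_{r+s+t=n} (-1)^{r+st} f_{r+1+t} (id^{⊗r} ⊗ m_s ⊗ id^{⊗t})
    = ∑_{i_1+⋯+i_q=n} (-1)^w m_q (f_{i_1} ⊗ ⋯ ⊗ f_{i_q})` for `n ≥ 1` -/
  stasheff : ∀ n : ℕ, 1 ≤ n → ∀ (a : ℕ → V) (d : ℕ → ℤ × ℤ), (∀ j, a j ∈ E.deg (d j)) →
    ∑ s ∈ Finset.Icc 1 n, ∑ r ∈ Finset.range (n - s + 1),
      Int.negOnePow (graftSign (fun j => (d j).1) r s (n - s - r)) •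
        f (r + 1 + (n - s - r))
          (fun j => graft a r s (E.m s fun i => a (r + i)) j) =
    ∑ c : Composition n, Int.negOnePow (homSign (fun j => (d j).1) c) •
      F.m c.length (fun j => f (c.blocksFun j) fun i => a (c.sizeUpTo j + i))
  map_one : f 1 (fun _ => E.one) = F.one
  f_one : ∀ n, 2 ≤ n → ∀ v : Fin n → V, (∃ j, v j = E.one) → f n v = 0

/-- `f` is a quasi-isomorphism: `f_1` induces a bijection `ker m_1 / im m_1 → ker m_1 / im m_1`
on cohomology. -/
def AInfinityHom.IsQuasiIso {E : AInfinityAlgebra k V} {F : AInfinityAlgebra k W}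
    (f : AInfinityHom E F) : Prop :=
  (∀ x, E.m 1 ![x] = 0 → (∃ z, f.f 1 ![x] = F.m 1 ![z]) → ∃ y, x = E.m 1 ![y]) ∧
  (∀ y, F.m 1 ![y] = 0 → ∃ x, E.m 1 ![x] = 0 ∧ ∃ z, y - f.f 1 ![x] = F.m 1 ![z])

/-- `E^p = ⨁_i E^p_i`, as a subspace. -/
def AInfinityAlgebra.upper (E : AInfinityAlgebra k V) (p : ℤ) : Submodule k V :=
  ⨆ i : ℤ, E.deg (p, i)

theorem AInfinityAlgebra.m_mem_upper (E : AInfinityAlgebra k V) (n : ℕ)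
    (v : Fin n → V) (hv : ∀ j, v j ∈ E.upper 1) : E.m n v ∈ E.upper 2 := by
  have h : ∀ j, ∃ g : ℤ →₀ V, (∀ i, g i ∈ E.deg (1, i)) ∧ (g.sum fun _ x => x) = v j :=
    fun j => (Submodule.mem_iSup_iff_exists_finsupp _ _).1 (hv j)
  choose g hg hs using h
  have hv' : v = fun j => ∑ i ∈ (g j).support, g j i := by
    funext j
    exact (hs j).symm
  rw [hv', MultilinearMap.map_sum_finset]
  refine Submodule.sum_mem _ fun r _ => ?_
  have := E.m_mem n (fun j => g j (r j)) (fun j => (1, r j)) (fun j => hg j (r j))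
  refine Submodule.mem_iSup_of_mem (∑ j, r j) ?_
  simpa using this

/-- The restriction `(E^1)^{⊗n} → E^2` of the multiplication `m_n`. -/
def AInfinityAlgebra.restr (E : AInfinityAlgebra k V) (n : ℕ) :
    MultilinearMap k (fun _ : Fin n => E.upper 1) (E.upper 2) :=
  ((E.m n).compLinearMap fun _ => (E.upper 1).subtype).codRestrict (E.upper 2)
    fun v => E.m_mem_upper n _ fun j => (v j).2

end AInfinity

section DG

/-- A DG algebra with an Adams grading: `D = ⨁ D^p_i`, with a differential of degree `(1, 0)`
satisfying the graded Leibniz rule. -/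
structure DGAlgebra (k : Type*) [Field k] (D : Type*) [Ring D] [Algebra k D] where
  deg : ℤ × ℤ → Submodule k D
  isInternal : DirectSum.IsInternal deg
  one_mem : (1 : D) ∈ deg (0, 0)
  mul_mem : ∀ {x y : ℤ × ℤ} {a b : D}, a ∈ deg x → b ∈ deg y → a * b ∈ deg (x + y)
  d : D →ₗ[k] D
  d_mem : ∀ {x : ℤ × ℤ} {a : D}, a ∈ deg x → d a ∈ deg (x + (1, 0))
  d_d : ∀ a, d (d a) = 0
  leibniz : ∀ {x : ℤ × ℤ} {a : D} (b : D), a ∈ deg x →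
    d (a * b) = d a * b + Int.negOnePow x.1 • (a * d b)

variable {k : Type*} [Field k] {D : Type*} [Ring D] [Algebra k D]

/-- The operations `m_1 = d`, `m_2 = ` multiplication, `m_n = 0` otherwise. -/
def dgOp (d : D →ₗ[k] D) : (n : ℕ) → MultilinearMap k (fun _ : Fin n => D) D
  | 1 => MultilinearMap.ofSubsingleton k D D (0 : Fin 1) d
  | 2 => MultilinearMap.mkPiAlgebraFin k 2 D
  | _ => 0

theorem dgOp_one (d : D →ₗ[k] D) (v : Fin 1 → D) : dgOp d 1 v = d (v 0) := rfl

theorem dgOp_two (d : D →ₗ[k] D) (v : Fin 2 → D) : dgOp d 2 v = v 0 * v 1 := by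
  simp [dgOp, MultilinearMap.mkPiAlgebraFin_apply]

theorem dgOp_of_three_le (d : D →ₗ[k] D) {n : ℕ} (hn : 3 ≤ n) : dgOp d n = 0 := by
  match n, hn with
  | n + 3, _ => rfl

theorem dgOp_seq_three (d : D →ₗ[k] D) (a : ℕ → D) {n : ℕ} (hn : 3 ≤ n) :
    dgOp d n (fun j => a j) = 0 := by
  rw [dgOp_of_three_le d hn]; rfl

theorem dgOp_graft_zero (d : D →ₗ[k] D) (a : ℕ → D) {r s n : ℕ} (hr : r < n) :
    dgOp d n (fun j => graft a r s 0 j) = 0 :=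
  MultilinearMap.map_coord_zero _ ⟨r, hr⟩ (by simp [graft])

theorem DGAlgebra.d_one (A : DGAlgebra k D) : A.d 1 = 0 := by
  have h := A.leibniz (1 : D) A.one_mem
  simpa using h

/-- A DG algebra, viewed as an `A_∞`-algebra. -/
def DGAlgebra.toAInfinity (A : DGAlgebra k D) : AInfinityAlgebra k D where
  deg := A.deg
  isInternal := A.isInternal
  m := dgOp A.d
  m_zero := rfl
  m_mem := by
    intro n v d hv
    match n with
    | 0 => exact Submodule.zero_mem _
    | 1 =>
      have := A.d_mem (hv 0)
      rw [dgOp_one]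
      convert this using 2
      ext <;> simp
    | 2 =>
      have := A.mul_mem (hv 0) (hv 1)
      rw [dgOp_two]
      convert this using 2
      ext <;> simp [Fin.sum_univ_two]
    | n + 3 => exact Submodule.zero_mem _
  stasheff := by
    intro n hn a d ha
    obtain rfl | rfl | rfl | h4 : n = 1 ∨ n = 2 ∨ n = 3 ∨ 4 ≤ n := by omega
    · simp [dgOp_one, graft, graftSign, A.d_d]
    · have h2 : Finset.Icc 1 2 = {1, 2} := by decide
      rw [h2, Finset.sum_pair (by decide)]
      simp [Finset.sum_range_succ, dgOp_one, dgOp_two, graft, graftSign,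
        A.leibniz _ (ha 0), Int.negOnePow_add]
      abel
    · have h3 : Finset.Icc 1 3 = {1, 2, 3} := by decide
      rw [h3, Finset.sum_insert (by decide), Finset.sum_pair (by decide)]
      simp [Finset.sum_range_succ, dgOp_one, dgOp_two, dgOp_of_three_le A.d (le_refl 3), graft,
        graftSign, mul_assoc, Int.negOnePow_even 2 even_two]
    · refine Finset.sum_eq_zero fun s hs => Finset.sum_eq_zero fun r hr => ?_
      rw [Finset.mem_Icc] at hs
      rw [Finset.mem_range] at hr
      by_cases h3 : 3 ≤ s
      · rw [dgOp_of_three_le A.d h3, zero_apply,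
          dgOp_graft_zero A.d a (by omega), smul_zero]
      · rw [dgOp_seq_three A.d _ (by omega), smul_zero]
  one := 1
  one_mem := A.one_mem
  one_mul := by intro a; simp [dgOp_two]
  mul_one := by intro a; simp [dgOp_two]
  m_one := by
    intro n hn v ⟨j, hj⟩
    match n with
    | 0 => rfl
    | 1 =>
      rw [dgOp_one, ← Fin.eq_zero j, hj, A.d_one]
    | 2 => exact absurd rfl hn
    | n + 3 => rfl

end DG

section Resolution

universe w

variable {k : Type*} [Field k] {A : Type*} [Ring A] [Algebra k A]

/-- The graded algebra `A = ⨁_{i ≥ 0} A_i` is connected (`A_0 = k`) and locally finite. -/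
structure IsConnectedLocallyFinite (𝒜 : ℕ → Submodule k A) : Prop where
  connected : ∀ a ∈ 𝒜 0, ∃! c : k, algebraMap k A c = a
  finite : ∀ i, Module.Finite k (𝒜 i)

/-- A graded free resolution `⋯ → P^{-2} → P^{-1} → P^0 → k_A → 0` of the trivial right
`A`-module `k_A = A / A_{≥ 1}`; right `A`-modules are modules over `Aᵐᵒᵖ`. The total module
`P = ⨁ P^p_s` is bigraded by the complex degree `p ≤ 0` and the Adams degree `s`. -/
structure FreeResolution (𝒜 : ℕ → Submodule k A) (P : Type w) [AddCommGroup P] [Module k P]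
    [Module Aᵐᵒᵖ P] [IsScalarTower k Aᵐᵒᵖ P] where
  deg : ℤ × ℤ → Submodule k P
  isInternal : DirectSum.IsInternal deg
  deg_eq_bot : ∀ p s : ℤ, 0 < p → deg (p, s) = ⊥
  /-- the right action respects the gradings: `P^p_s · A_j ⊆ P^p_{s+j}` -/
  smul_mem : ∀ (p s : ℤ) (j : ℕ) (x : P) (a : A), x ∈ deg (p, s) → a ∈ 𝒜 j →
    MulOpposite.op a • x ∈ deg (p, s + j)
  /-- `P` is graded free: it has a basis of homogeneous elements -/
  free : ∃ (ι : Type w) (b : Module.Basis ι Aᵐᵒᵖ P), ∀ i, ∃ x, b i ∈ deg x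
  /-- the differential, `A`-linear of degree `(1, 0)` -/
  d : P →ₗ[Aᵐᵒᵖ] P
  d_mem : ∀ {y : ℤ × ℤ} {x : P}, x ∈ deg y → d x ∈ deg (y + (1, 0))
  d_d : ∀ x, d (d x) = 0
  /-- the augmentation `P^0 → k_A`, extended by zero to `P` -/
  aug : P →ₗ[k] k
  aug_deg : ∀ y, y ≠ (0, 0) → ∀ x ∈ deg y, aug x = 0
  /-- `aug` is `A`-linear: `A_{≥ 1}` acts on `k_A` as zero -/
  aug_smul : ∀ (j : ℕ) (x : P) (a : A), 0 < j → a ∈ 𝒜 j → aug (MulOpposite.op a • x) = 0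
  aug_d : ∀ x, aug (d x) = 0
  aug_surjective : Function.Surjective aug
  /-- exactness, at `P^0` and at all `P^p` with `p < 0` -/
  exact : ∀ x, d x = 0 → aug x = 0 → ∃ y, d y = x

variable {P : Type w} [AddCommGroup P] [Module k P] [Module Aᵐᵒᵖ P] [IsScalarTower k Aᵐᵒᵖ P]

/-- The `A`-linear endomorphisms of the bigraded right `A`-module `P` that are homogeneous of
degree `z = (p, i)`, i.e. `∏_q Hom_A(P^q, P^{q+p})_i`. -/
def homEnd (A : Type*) [Ring A] [Algebra k A] [Module Aᵐᵒᵖ P] [IsScalarTower k Aᵐᵒᵖ P]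
    (deg : ℤ × ℤ → Submodule k P) (z : ℤ × ℤ) : Submodule k (Module.End Aᵐᵒᵖ P) where
  carrier := {f | ∀ y, ∀ x ∈ deg y, f x ∈ deg (y + z)}
  add_mem' hf hg y x hx := Submodule.add_mem _ (hf y x hx) (hg y x hx)
  zero_mem' _ _ _ := Submodule.zero_mem _
  smul_mem' c _ hf y x hx := Submodule.smul_mem _ c (hf y x hx)

instance homEnd.gradedMonoid (deg : ℤ × ℤ → Submodule k P) :
    SetLike.GradedMonoid (homEnd A deg) where
  one_mem y x hx := by simpa using hx
  mul_mem i j f g hf hg y x hx := by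
    have := hf _ _ (hg y x hx)
    rwa [add_assoc, add_comm j i] at this

theorem of_eq_of (deg : ℤ × ℤ → Submodule k P) {y z : ℤ × ℤ} (h : y = z)
    (f : homEnd A deg y) (g : homEnd A deg z) (hfg : f.1 = g.1) :
    DirectSum.of (fun z => homEnd A deg z) y f = DirectSum.of (fun z => homEnd A deg z) z g := by
  subst h
  rw [Subtype.ext hfg]

theorem isInternal_range_lof {ι : Type*} [DecidableEq ι] (M : ι → Type*)
    [∀ i, AddCommGroup (M i)] [∀ i, Module k (M i)] :
    DirectSum.IsInternal fun i => LinearMap.range (DirectSum.lof k ι M i) := by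
  let g : (⨁ i, M i) →ₗ[k] ⨁ i, LinearMap.range (DirectSum.lof k ι M i) :=
    DirectSum.toModule k ι _ fun i =>
      DirectSum.lof k ι (fun i => LinearMap.range (DirectSum.lof k ι M i)) i ∘ₗ
        (DirectSum.lof k ι M i).rangeRestrict
  have h1 : DirectSum.coeLinearMap _ ∘ₗ g = LinearMap.id := by
    ext i x : 2
    simp [g]
  have h2 : g ∘ₗ DirectSum.coeLinearMap _ = LinearMap.id := by
    ext i x : 2
    obtain ⟨_, y, rfl⟩ := x
    simp [g]
    rfl
  exact ⟨Function.LeftInverse.injective (g := g) fun x => LinearMap.congr_fun h2 x,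
    Function.RightInverse.surjective (g := g) fun x => LinearMap.congr_fun h1 x⟩

namespace FreeResolution

variable {𝒜 : ℕ → Submodule k A} (ρ : FreeResolution 𝒜 P)

/-- The differential `f ↦ d ∘ f - (-1)^p f ∘ d` on endomorphisms of degree `(p, i)`. -/
def dHom (z : ℤ × ℤ) : homEnd A ρ.deg z →ₗ[k] homEnd A ρ.deg (z + (1, 0)) where
  toFun f := ⟨ρ.d * f.1 - Int.negOnePow z.1 • (f.1 * ρ.d), by
    intro y x hx
    have h1 := ρ.d_mem (f.2 y x hx)
    have h2 := f.2 _ _ (ρ.d_mem hx)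
    rw [add_right_comm, add_assoc] at h2
    rw [add_assoc] at h1
    refine Submodule.sub_mem _ h1 ?_
    rcases Int.even_or_odd z.1 with h | h
    · simpa [Int.negOnePow_even _ h] using h2
    · simpa [Int.negOnePow_odd _ h] using h2⟩
  map_add' f g := by
    ext1
    simp [mul_add, add_mul, smul_add]
    abel
  map_smul' c f := by
    ext1
    simp [smul_sub, smul_comm c]

/-- The Koszul dual `End_A(P)`, as a DG algebra: the bigraded space of sums of homogeneous
`A`-linear endomorphisms of `P`, with composition as multiplication. -/
def endDG : DGAlgebra k (⨁ z, homEnd A ρ.deg z) where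
  deg z := LinearMap.range (DirectSum.lof k (ℤ × ℤ) (fun z => homEnd A ρ.deg z) z)
  isInternal := isInternal_range_lof _
  one_mem := ⟨⟨1, SetLike.GradedOne.one_mem⟩, rfl⟩
  mul_mem := by
    rintro x y _ _ ⟨a, rfl⟩ ⟨b, rfl⟩
    refine ⟨⟨a.1 * b.1, SetLike.GradedMul.mul_mem a.2 b.2⟩, ?_⟩
    simp only [DirectSum.lof_eq_of]
    rw [DirectSum.of_mul_of]
    rfl
  d := DirectSum.toModule k (ℤ × ℤ) _ fun z => DirectSum.lof k _ _ (z + (1, 0)) ∘ₗ ρ.dHom z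
  d_mem := by
    rintro x _ ⟨a, rfl⟩
    exact ⟨ρ.dHom x a, by simp⟩
  d_d := by
    intro a
    induction a using DirectSum.induction_on with
    | zero => simp
    | add a b ha hb => rw [map_add, map_add, ha, hb, add_zero]
    | of z f =>
      have h : ρ.dHom _ (ρ.dHom z f) = 0 := by
        ext x
        simp [dHom, mul_sub, sub_mul, ρ.d_d, Int.negOnePow_succ]
      rw [← DirectSum.lof_eq_of k]
      simp [h]
  leibniz := by
    rintro x _ b ⟨f, rfl⟩
    induction b using DirectSum.induction_on with
    | zero => simp
    | add a b ha hb =>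
      rw [mul_add, map_add, ha, hb, map_add, mul_add, mul_add, smul_add]
      abel
    | of y g =>
      have hd : ∀ z f, (DirectSum.toModule k (ℤ × ℤ) (⨁ z, homEnd A ρ.deg z) fun z =>
          DirectSum.lof k _ _ (z + (1, 0)) ∘ₗ ρ.dHom z) (DirectSum.of _ z f) =
          DirectSum.of _ (z + (1, 0)) (ρ.dHom z f) := by
        intro z f
        rw [← DirectSum.lof_eq_of k, DirectSum.toModule_lof]
        rfl
      rw [DirectSum.lof_eq_of, DirectSum.of_mul_of, hd, hd, hd, DirectSum.of_mul_of,
        DirectSum.of_mul_of]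
      have e1 : x + (1, 0) + y = x + y + (1, 0) := add_right_comm _ _ _
      have e2 : x + (y + (1, 0)) = x + y + (1, 0) := (add_assoc _ _ _).symm
      rw [of_eq_of ρ.deg e1 _ ⟨(ρ.dHom x f).1 * g.1, by
          rw [← e1]; exact SetLike.GradedMul.mul_mem (ρ.dHom x f).2 g.2⟩ rfl,
        of_eq_of ρ.deg e2 _ ⟨f.1 * (ρ.dHom y g).1, by
          rw [← e2]; exact SetLike.GradedMul.mul_mem f.2 (ρ.dHom y g).2⟩ rfl]
      have hu : ∀ (u : ℤˣ) (F G : Module.End Aᵐᵒᵖ P), F * u • G = u • (F * G) := by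
        intro u F G
        rcases Int.units_eq_one_or u with rfl | rfl <;> simp
      have hn : ∀ X : ⨁ z, homEnd A ρ.deg z, (-1 : ℤˣ) • X = -X := fun X => neg_one_zsmul X
      rcases Int.even_or_odd x.1 with h | h
      · rw [Int.negOnePow_even _ h, one_smul, ← map_add]
        congr 1
        ext1
        simp [dHom, Int.negOnePow_add, Int.negOnePow_even _ h, mul_sub,
          sub_mul, mul_assoc, hu]
      · rw [Int.negOnePow_odd _ h, hn, ← map_neg, ← map_add]
        congr 1
        ext1
        simp [dHom, Int.negOnePow_add, Int.negOnePow_odd _ h, mul_sub,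
          add_mul, mul_assoc, hu]

end FreeResolution

/-- `E` is an `A_∞`-Ext-algebra `Ext^*_A(k_A, k_A)` of `A`, computed from the free resolution
`ρ` of `k_A`: a minimal model (`m_1 = 0`, with a quasi-isomorphism to `End_A(P)`) of the
DG algebra `End_A(P)`. The quasi-isomorphism identifies `E` with the cohomology of `End_A(P)`,
and `m_2` with the product in cohomology. -/
def IsExtAlgebra {𝒜 : ℕ → Submodule k A} (ρ : FreeResolution 𝒜 P) {V : Type*}
    [AddCommGroup V] [Module k V] (E : AInfinityAlgebra k V) : Prop :=
  E.m 1 = 0 ∧ ∃ f : AInfinityHom E ρ.endDG.toAInfinity, f.IsQuasiIso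

end Resolution

end ExtAInf

/-! The proof recovers the algebra first and compares the `A_∞`-structures afterwards.

Part (a). Choose a homogeneous basis `e_x` of `E^1` in negative Adams degrees, where `e_x` has Adams
degree minus the weight of `x`. For a graded algebra `D`, consider Maurer-Cartan elements: families
`c_x` in `D`, homogeneous of degree the weight of `x`, such that the sum of `c_w ⊗ m_n(e_w)` over
words `w` vanishes in each weight, up to suspension signs and with the products `c_w` taken in
reverse order. These equations involve `E` only through the maps `(E^1)^{⊗n} → E^2`. Every such
element yields a graded homomorphism `A → D` (`exists_algHom`). It deforms the differential on
functionals `P → D`, the augmentation extends uniquely to a solution of the deformed equation on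
`P^0`, and evaluating that solution on the generator of degree zero gives the homomorphism.
Conversely `A` itself carries a Maurer-Cartan element (`exists_forall_stage`), built weight by
weight. The obstruction to the equation is a class in `E^2` which vanishes automatically, and the
remaining error is a class in `E^1` which is absorbed into the letters. The values of this element
generate `A` (`Stage.map_eq_zero`). Since the restricted multiplications agree, the element of `A`
is also Maurer-Cartan for `E'` and gives `A' → A`. Modulo products the letters are detected by this
homomorphism (`map_c_eq_zero`), so it is onto (`exists_surjective_algHom`). By symmetry there is a
graded surjection `A → A'`, and finite dimensionality in each degree makes it an isomorphism.

Part (b). The isomorphism turns the resolution over `A'` into one over `A`, so that `E` and `E'` are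
minimal models of the endomorphism algebras of two resolutions `P`, `P'` of the same module. Instead
of inverting a quasi-isomorphism, one uses `Hom_A(P, P')`, on which both algebras act. Starting from
a comparison map `g₀ : P → P'`, one builds by induction on word length an `A_∞`-morphism `h`
together with maps `G` that intertwine the two twisting cochains (`PartialHom.succ`). A Bianchi
identity (`bstar_modDefect`) shows that the error of `h` is a coboundary, hence zero by minimality,
and that the error of `G` is then a cocycle, hence removable. All this takes place on the suspension
of `E^{≥ 1}`, in the language of words: `bstar` is the transpose of a coderivation and `hpull` that
of a coalgebra morphism. The part of `E` in degrees `≤ 0` is the line through the strict unit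
(`exists_eq_smul_one`), over which the morphism is extended at the end (`bstar_unitExt`). -/

namespace ExtAInf

/-! ### Decompositions of words and coderivations -/

section Splits

/-- The sum of `f u v` over all decompositions `w = u ++ v`. -/
def splitSum {Y R : Type*} [AddCommMonoid R] : (List Y → List Y → R) → List Y → R
  | f, [] => f [] []
  | f, x :: w => f [] (x :: w) + splitSum (fun u v => f (x :: u) v) w

section Monoid
variable {Y Y' R S : Type*} [AddCommMonoid R] [AddCommMonoid S]

@[simp] theorem splitSum_nil (f : List Y → List Y → R) : splitSum f [] = f [] [] := rfl

theorem splitSum_cons (f : List Y → List Y → R) (x : Y) (w : List Y) :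
    splitSum f (x :: w) = f [] (x :: w) + splitSum (fun u v => f (x :: u) v) w := rfl

theorem splitSum_congr {f g : List Y → List Y → R} {w : List Y}
    (h : ∀ u v, u ++ v = w → f u v = g u v) : splitSum f w = splitSum g w := by
  induction w generalizing f g with
  | nil => exact h [] [] rfl
  | cons x w ih =>
    rw [splitSum_cons, splitSum_cons, h [] _ rfl,
      ih (f := fun u v => f (x :: u) v) (g := fun u v => g (x :: u) v)]
    intro u v huv
    exact h _ _ (by simp [huv])

theorem splitSum_add (f g : List Y → List Y → R) (w : List Y) :
    splitSum (fun u v => f u v + g u v) w = splitSum f w + splitSum g w := by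
  induction w generalizing f g with
  | nil => rfl
  | cons x w ih => simp only [splitSum_cons, ih]; abel

theorem splitSum_eq_zero {f : List Y → List Y → R} {w : List Y}
    (h : ∀ u v, u ++ v = w → f u v = 0) : splitSum f w = 0 := by
  rw [splitSum_congr (g := fun _ _ => 0) h]
  clear h
  induction w with
  | nil => rfl
  | cons x w ih => rw [splitSum_cons, zero_add]; exact ih

theorem map_splitSum {H : Type*} [FunLike H R S] [AddMonoidHomClass H R S] (φ : H)
    (f : List Y → List Y → R) (w : List Y) :
    φ (splitSum f w) = splitSum (fun u v => φ (f u v)) w := by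
  induction w generalizing f with
  | nil => rfl
  | cons x w ih => simp only [splitSum_cons, map_add, ih]

theorem splitSum_mem {M : Type*} [SetLike M R] [AddSubmonoidClass M R] (N : M)
    {f : List Y → List Y → R} {w : List Y} (h : ∀ u v, u ++ v = w → f u v ∈ N) :
    splitSum f w ∈ N := by
  induction w generalizing f with
  | nil => exact h [] [] rfl
  | cons x w ih =>
    exact add_mem (h [] _ rfl) (ih fun u v huv => h _ _ (by simp [huv]))

/-- Either order of cutting enumerates the decompositions into three pieces. -/
theorem splitSum_assoc (f : List Y → List Y → List Y → R) (w : List Y) :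
    splitSum (fun s t => splitSum (fun u v => f u v t) s) w =
      splitSum (fun u r => splitSum (fun v t => f u v t) r) w := by
  induction w generalizing f with
  | nil => rfl
  | cons x w ih =>
    simp only [splitSum_cons, splitSum_nil, splitSum_add, ih, add_assoc]

theorem splitSum_comm {Z : Type*} (f : List Y → List Y → List Z → List Z → R) (w : List Y)
    (z : List Z) : splitSum (fun a b => splitSum (fun c d => f a b c d) z) w =
      splitSum (fun c d => splitSum (fun a b => f a b c d) w) z := by
  induction w generalizing f with
  | nil => rfl
  | cons x w ih => simp only [splitSum_cons, splitSum_add, ih]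

theorem splitSum_map (g : Y' → Y) (f : List Y → List Y → R) (w : List Y') :
    splitSum f (w.map g) = splitSum (fun u v => f (u.map g) (v.map g)) w := by
  induction w generalizing f with
  | nil => rfl
  | cons x w ih => simp only [List.map_cons, splitSum_cons, ih, List.map_nil]

/-- The cut falls either before the marked letter `y` or after it. -/
theorem splitSum_append_cons (f : List Y → List Y → R) (a : List Y) (y : Y) (t : List Y) :
    splitSum f (a ++ y :: t) = splitSum (fun u v => f u (v ++ y :: t)) a +
      splitSum (fun u v => f (a ++ y :: u) v) t := by
  induction a generalizing f with
  | nil => rfl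
  | cons x a ih => simp only [List.cons_append, splitSum_cons, ih, add_assoc]

theorem splitSum_eq_last {f : List Y → List Y → R} {w : List Y}
    (h : ∀ u v, u ++ v = w → v ≠ [] → f u v = 0) : splitSum f w = f w [] := by
  induction w generalizing f with
  | nil => rfl
  | cons x w ih =>
    rw [splitSum_cons, h [] _ rfl (by simp), zero_add]
    exact ih (f := fun u v => f (x :: u) v) fun u v huv hv => h _ _ (by simp [huv]) hv

theorem splitSum_eq_first {f : List Y → List Y → R} {w : List Y}
    (h : ∀ u v, u ++ v = w → u ≠ [] → f u v = 0) : splitSum f w = f [] w := by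
  cases w with
  | nil => rfl
  | cons x w =>
    rw [splitSum_cons, splitSum_eq_zero, add_zero]
    intro u v huv
    exact h _ _ (by simp [huv]) (by simp)

theorem splitSum_eq_ends {f : List Y → List Y → R} {w : List Y} (hw : w ≠ [])
    (h : ∀ u v, u ++ v = w → u ≠ [] → v ≠ [] → f u v = 0) :
    splitSum f w = f [] w + f w [] := by
  cases w with
  | nil => exact absurd rfl hw
  | cons x w =>
    rw [splitSum_cons, splitSum_eq_last (f := fun u v => f (x :: u) v)]
    intro u v huv hv
    exact h _ _ (by simp [huv]) (by simp) hv

theorem splitSum_eq_range (f : List Y → List Y → R) (w : List Y) :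
    splitSum f w = ∑ i ∈ Finset.range (w.length + 1), f (w.take i) (w.drop i) := by
  induction w generalizing f with
  | nil => simp
  | cons x w ih =>
    rw [splitSum_cons, ih, List.length_cons, Finset.sum_range_succ' _ (w.length + 1), add_comm]
    rfl

end Monoid

section Group
variable {Y R : Type*} [AddCommGroup R]

theorem splitSum_sub (f g : List Y → List Y → R) (w : List Y) :
    splitSum (fun u v => f u v - g u v) w = splitSum f w - splitSum g w := by
  induction w generalizing f g with
  | nil => rfl
  | cons x w ih => simp only [splitSum_cons, ih]; abel

theorem splitSum_neg (f : List Y → List Y → R) (w : List Y) :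
    splitSum (fun u v => -f u v) w = -splitSum f w := by
  induction w generalizing f with
  | nil => rfl
  | cons x w ih => simp only [splitSum_cons, ih]; abel

end Group

/-- The sum of `α (σ u ++ b v :: t)` over all decompositions `w = u ++ v ++ t`: the transpose of
the coderivation of the tensor coalgebra with corestriction `b`. -/
def bstar {Y R : Type*} [AddCommMonoid R] (σ : Y → Y) (b : List Y → Y) (α : List Y → R)
    (w : List Y) : R :=
  splitSum (fun u r => splitSum (fun v t => α (u.map σ ++ b v :: t)) r) w

/-- Co-Leibniz rule, transposed: the letter produced by `b` lies in one of the two pieces, and when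
it lies in the second, `σ` has acted on the whole first piece. -/
theorem bstar_splitSum {Y R : Type*} [AddCommMonoid R] (σ : Y → Y) (b : List Y → Y)
    (f : List Y → List Y → R) (w : List Y) :
    bstar σ b (splitSum f) w =
      splitSum (fun s t => bstar σ b (fun u => f u t) s) w +
      splitSum (fun s t => bstar σ b (fun v => f (s.map σ) v) t) w := by
  simp only [bstar, splitSum_append_cons, splitSum_add, splitSum_map]
  rw [add_comm]
  congr 1
  · rw [splitSum_assoc]
    refine splitSum_congr fun u r _ => ?_
    exact (splitSum_assoc (fun v t' t => f (u.map σ ++ b v :: t') t) r).symm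
  · rw [splitSum_congr (g := fun u r => splitSum (fun u1 u2 => splitSum (fun v t =>
      f (u1.map σ) (u2.map σ ++ b v :: t)) r) u)]
    · exact splitSum_assoc (fun u1 u2 r => splitSum (fun v t =>
        f (u1.map σ) (u2.map σ ++ b v :: t)) r) w
    · exact fun u r _ => splitSum_comm _ _ _

theorem bstar_sub {Y R : Type*} [AddCommGroup R] (σ : Y → Y) (b : List Y → Y)
    (α β : List Y → R) (w : List Y) :
    bstar σ b (fun l => α l - β l) w = bstar σ b α w - bstar σ b β w := by
  simp only [bstar, splitSum_sub]

theorem map_bstar {Y R S H : Type*} [AddCommMonoid R] [AddCommMonoid S] [FunLike H R S]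
    [AddMonoidHomClass H R S] (φ : H) (σ : Y → Y) (b : List Y → Y) (α : List Y → R)
    (w : List Y) : φ (bstar σ b α w) = bstar σ b (fun l => φ (α l)) w := by
  simp only [bstar, map_splitSum]

/-- Linearity in every letter. -/
def ListLin (k : Type*) {U R : Type*} [Field k] [AddCommGroup U] [Module k U]
    [AddCommGroup R] [Module k R] (α : List U → R) : Prop :=
  ∀ u t, IsLinearMap k fun x => α (u ++ x :: t)

section Lin
variable {k U U' R S : Type*} [Field k] [AddCommGroup U] [Module k U] [AddCommGroup U']
  [Module k U'] [AddCommGroup R] [Module k R] [AddCommGroup S] [Module k S]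

theorem ListLin.map_zero {α : List U → R} (h : ListLin k α) (u t : List U) :
    α (u ++ 0 :: t) = 0 := (h u t).map_zero

theorem ListLin.map_zero_cons {α : List U → R} (h : ListLin k α) (t : List U) :
    α (0 :: t) = 0 := (h [] t).map_zero

theorem ListLin.cons {α : List U → R} (h : ListLin k α) (y : U) :
    ListLin k fun l => α (y :: l) := fun u t => h (y :: u) t

theorem _root_.IsLinearMap.add' {f g : U → R} (hf : IsLinearMap k f) (hg : IsLinearMap k g) :
    IsLinearMap k fun x => f x + g x :=
  ⟨fun x y => by rw [hf.map_add, hg.map_add]; abel,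
    fun c x => by rw [hf.map_smul, hg.map_smul, smul_add]⟩

theorem _root_.IsLinearMap.sub' {f g : U → R} (hf : IsLinearMap k f) (hg : IsLinearMap k g) :
    IsLinearMap k fun x => f x - g x :=
  ⟨fun x y => by rw [hf.map_add, hg.map_add]; abel,
    fun c x => by rw [hf.map_smul, hg.map_smul, smul_sub]⟩

theorem _root_.IsLinearMap.comp' {f : U' → R} {g : U → U'} (hf : IsLinearMap k f)
    (hg : IsLinearMap k g) : IsLinearMap k fun x => f (g x) :=
  ⟨fun x y => by rw [hg.map_add, hf.map_add], fun c x => by rw [hg.map_smul, hf.map_smul]⟩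

theorem ListLin.add {α β : List U → R} (hα : ListLin k α) (hβ : ListLin k β) :
    ListLin k fun l => α l + β l := fun u t => (hα u t).add' (hβ u t)

theorem ListLin.sub {α β : List U → R} (hα : ListLin k α) (hβ : ListLin k β) :
    ListLin k fun l => α l - β l := fun u t => (hα u t).sub' (hβ u t)

theorem ListLin.comp {α : List U → R} (h : ListLin k α) (φ : R →ₗ[k] S) :
    ListLin k fun l => φ (α l) := fun u t => φ.isLinear.comp' (h u t)

theorem ListLin.map {α : List U → R} (h : ListLin k α) (φ : U' →ₗ[k] U) :
    ListLin k fun l => α (l.map φ) := fun u t => by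
  simp only [List.map_append, List.map_cons]
  exact (h (u.map φ) (t.map φ)).comp' φ.isLinear

theorem ListLin.ite_length {α : List U → R} (h : ListLin k α) (n : ℕ) :
    ListLin k fun l => if l.length = n then α l else 0 := fun u t => by
  by_cases hn : u.length + (t.length + 1) = n
  · have : (fun x => if (u ++ x :: t).length = n then α (u ++ x :: t) else 0) =
        fun x => α (u ++ x :: t) := by
      funext x; rw [if_pos (by simpa using hn)]
    rw [this]; exact h u t
  · have : (fun x => if (u ++ x :: t).length = n then α (u ++ x :: t) else 0) =
        fun _ => (0 : R) := by
      funext x; rw [if_neg (by simpa using hn)]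
    rw [this]; exact ⟨fun _ _ => by simp, fun _ _ => by simp⟩

theorem isLinearMap_splitSum {Y : Type*} {f : U → List Y → List Y → R} {w : List Y}
    (h : ∀ u v, u ++ v = w → IsLinearMap k fun x => f x u v) :
    IsLinearMap k fun x => splitSum (f x) w := by
  constructor
  · intro x y
    rw [← splitSum_add]
    exact splitSum_congr fun u v huv => (h u v huv).map_add x y
  · intro c x
    have := map_splitSum (DistribSMul.toAddMonoidHom R c) (f x) w
    simp only [DistribSMul.toAddMonoidHom_apply] at this
    rw [this]
    exact splitSum_congr fun u v huv => (h u v huv).map_smul c x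

theorem listLin_splitSum {f : List U → List U → R} (h1 : ∀ v, ListLin k fun u => f u v)
    (h2 : ∀ u, ListLin k fun v => f u v) : ListLin k (splitSum f) := by
  intro a t
  simp only [splitSum_append_cons]
  exact (isLinearMap_splitSum fun u v _ => h2 u v t).add'
    (isLinearMap_splitSum fun u v _ => h1 v a u)

theorem ListLin.bstar {α : List U → R} (h : ListLin k α) (σ : U →ₗ[k] U) {b : List U → U}
    (hb : ListLin k b) : ListLin k (bstar σ b α) := by
  refine listLin_splitSum (fun r => ?_) fun u => listLin_splitSum (fun t => ?_) fun v => ?_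
  · intro a t
    refine isLinearMap_splitSum fun v s _ => ?_
    simp only [List.map_append, List.map_cons, List.append_assoc, List.cons_append]
    exact (h (a.map σ) (t.map σ ++ b v :: s)).comp' σ.isLinear
  · exact fun a s => (h (u.map σ) t).comp' (hb a s)
  · intro a s
    simpa only [List.append_assoc, List.cons_append] using h (u.map σ ++ b v :: a) s

end Lin
end Splits

/-! ### Morphisms of tensor coalgebras -/

section Pull

/-- Auxiliary to `hpull`: `c` is the block under construction. -/
def hpullAux {Y Y' R : Type*} [AddCommMonoid R] (h : List Y → Y') :
    (List Y' → R) → List Y → List Y → R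
  | α, c, [] => α [h c]
  | α, c, x :: w => hpullAux h α (c ++ [x]) w + hpullAux h (fun l => α (h c :: l)) [x] w

/-- The sum of `α [h w₁, …, h w_q]` over all decompositions `w = w₁ ++ ⋯ ++ w_q` into nonempty
blocks: the transpose of the morphism of tensor coalgebras with corestriction `h`. -/
def hpull {Y Y' R : Type*} [AddCommMonoid R] (h : List Y → Y') (α : List Y' → R) : List Y → R
  | [] => α []
  | x :: w => hpullAux h α [x] w

section Monoid
variable {Y Y' R S : Type*} [AddCommMonoid R] [AddCommMonoid S]

@[simp] theorem hpull_nil (h : List Y → Y') (α : List Y' → R) : hpull h α [] = α [] := rfl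

/-- Summing over the place where the open block `c` is closed replaces the letter-by-letter
recursion by a recursion on the first block, the form taken by `hpull_cons`. -/
theorem hpullAux_eq (h : List Y → Y') (α : List Y' → R) (c w : List Y) :
    hpullAux h α c w = splitSum (fun u v => hpull h (fun l => α (h (c ++ u) :: l)) v) w := by
  induction w generalizing α c with
  | nil => simp [hpullAux]
  | cons x w ih =>
    rw [hpullAux, splitSum_cons, ih (c := c ++ [x]), add_comm]
    simp [hpull]

theorem hpull_cons (h : List Y → Y') (α : List Y' → R) (x : Y) (w : List Y) :
    hpull h α (x :: w) = splitSum (fun u v => hpull h (fun l => α (h (x :: u) :: l)) v) w := by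
  rw [hpull, hpullAux_eq]
  rfl

/-- Induction on the length of a list, in the form used with `hpull_cons`. -/
theorem list_length_induction {motive : List Y → Prop} (nil : motive [])
    (cons : ∀ x w, (∀ v : List Y, v.length ≤ w.length → motive v) → motive (x :: w))
    (w : List Y) : motive w := by
  obtain ⟨n, hn⟩ : ∃ n, w.length ≤ n := ⟨_, le_rfl⟩
  induction n generalizing w with
  | zero => rw [List.length_eq_zero_iff.1 (Nat.le_zero.1 hn)]; exact nil
  | succ n ih =>
    cases w with
    | nil => exact nil
    | cons x w => exact cons x w fun v hv => ih v (by simp at hn; omega)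

theorem length_le_of_append {u v w : List Y} (h : u ++ v = w) : v.length ≤ w.length := by
  simp [← h]

theorem length_le_of_append' {u v w : List Y} (h : u ++ v = w) : u.length ≤ w.length := by
  simp [← h]

theorem hpull_congr {h h' : List Y → Y'} (α : List Y' → R) {w : List Y}
    (H : ∀ u : List Y, u.length ≤ w.length → h u = h' u) : hpull h α w = hpull h' α w := by
  induction w using list_length_induction generalizing α with
  | nil => rfl
  | cons x w ih =>
    rw [hpull_cons, hpull_cons]
    refine splitSum_congr fun u v huv => ?_
    have h1 := length_le_of_append huv
    have h2 := length_le_of_append' huv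
    rw [H (x :: u) (by simpa using h2), ih v h1 _ fun u hu => H u (by simp; omega)]

theorem map_hpull {H : Type*} [FunLike H R S] [AddMonoidHomClass H R S] (φ : H)
    (h : List Y → Y') (α : List Y' → R) (w : List Y) :
    φ (hpull h α w) = hpull h (fun l => φ (α l)) w := by
  induction w using list_length_induction generalizing α with
  | nil => rfl
  | cons x w ih =>
    rw [hpull_cons, hpull_cons, map_splitSum]
    exact splitSum_congr fun u v huv => ih v (length_le_of_append huv) _

theorem hpull_add (h : List Y → Y') (α β : List Y' → R) (w : List Y) :
    hpull h (fun l => α l + β l) w = hpull h α w + hpull h β w := by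
  induction w using list_length_induction generalizing α β with
  | nil => rfl
  | cons x w ih =>
    rw [hpull_cons, hpull_cons, hpull_cons, ← splitSum_add]
    exact splitSum_congr fun u v huv => ih v (length_le_of_append huv) _ _

theorem hpull_eq_zero {h : List Y → Y'} {α : List Y' → R} (w : List Y)
    (H : ∀ l, α l = 0) : hpull h α w = 0 := by
  induction w using list_length_induction generalizing α with
  | nil => exact H _
  | cons x w ih =>
    rw [hpull_cons]
    exact splitSum_eq_zero fun u v huv => ih v (length_le_of_append huv) fun l => H _

theorem hpull_map {Z Z' : Type*} {h : List Y → Y'} {h' : List Z → Z'} {s : Z → Y} {s' : Z' → Y'}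
    (H : ∀ u, h (u.map s) = s' (h' u)) (α : List Y' → R) (w : List Z) :
    hpull h α (w.map s) = hpull h' (fun l => α (l.map s')) w := by
  induction w using list_length_induction generalizing α with
  | nil => rfl
  | cons x w ih =>
    rw [List.map_cons, hpull_cons, hpull_cons, splitSum_map]
    refine splitSum_congr fun u v huv => ?_
    rw [ih v (length_le_of_append huv), ← List.map_cons, H]
    rfl

/-- Compatibility with deconcatenation: cutting a list of blocks is the same as cutting the word at
a block boundary. -/
theorem hpull_splitSum (h : List Y → Y') (f : List Y' → List Y' → R) (w : List Y) :
    hpull h (splitSum f) w =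
      splitSum (fun u v => hpull h (fun l => hpull h (fun l' => f l l') v) u) w := by
  induction w using list_length_induction generalizing f with
  | nil => rfl
  | cons x w ih =>
    rw [splitSum_cons, hpull_nil, hpull_cons h (splitSum f), hpull_cons h (f [])]
    simp only [hpull_cons]
    rw [splitSum_assoc (fun u v b => hpull h (fun l =>
      hpull h (fun l' => f (h (x :: u) :: l) l') b) v) w, ← splitSum_add]
    refine splitSum_congr fun u v huv => ?_
    rw [← ih v (length_le_of_append huv) fun l l' => f (h (x :: u) :: l) l', ← hpull_add]
    rfl

theorem hpull_mem {M : Type*} [SetLike M R] [AddSubmonoidClass M R] (N : M) {h : List Y → Y'}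
    {α : List Y' → R} {w : List Y} (H : ∀ l : List (List Y), l.flatten = w →
      α (l.map h) ∈ N) : hpull h α w ∈ N := by
  induction w using list_length_induction generalizing α with
  | nil => exact H [] rfl
  | cons x w ih =>
    rw [hpull_cons]
    refine splitSum_mem N fun u v huv => ih v (length_le_of_append huv) fun l hl => ?_
    have := H ((x :: u) :: l) (by simp [hl, huv])
    simpa using this

end Monoid

/-- Only the decomposition into a single block evaluates the map on all of `w`. This isolates the
effect of a correction made in one word length. -/
theorem hpull_of_singleton {Y Y' R : Type*} [AddCommGroup R] {h h' : List Y → Y'}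
    (α : List Y' → R) {w : List Y} (hw : w ≠ [])
    (H : ∀ u : List Y, u.length < w.length → h u = h' u) :
    hpull h' α w = hpull h α w + (α [h' w] - α [h w]) := by
  cases w with
  | nil => exact absurd rfl hw
  | cons x w =>
    rw [← sub_eq_iff_eq_add', hpull_cons, hpull_cons, ← splitSum_sub, splitSum_eq_last]
    · rfl
    · intro u v huv hv
      have h0 : 0 < v.length := List.length_pos_iff.2 hv
      have h1 : u.length + v.length = w.length := by simp [← huv]
      rw [H (x :: u) (by simp; omega), hpull_congr (h := h) (h' := h'), sub_self]
      exact fun u hu => H u (by simp; omega)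

theorem hpull_eq_single {Y Y' R : Type*} [AddCommMonoid R] {h : List Y → Y'}
    {α : List Y' → R} {w : List Y} (hw : w ≠ []) (H : ∀ l, l.length ≠ 1 → α l = 0) :
    hpull h α w = α [h w] := by
  cases w with
  | nil => exact absurd rfl hw
  | cons x w =>
    rw [hpull_cons, splitSum_eq_last]
    · rfl
    · intro u v _ hv
      cases v with
      | nil => exact absurd rfl hv
      | cons y v =>
        rw [hpull_cons]
        refine splitSum_eq_zero fun a b _ => hpull_eq_zero _ fun l => H _ (by simp)

section Lin
variable {k U U' R : Type*} [Field k] [AddCommGroup U] [Module k U] [AddCommGroup U']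
  [Module k U'] [AddCommGroup R] [Module k R]

theorem isLinearMap_hpull {Y Y' : Type*} {h : List Y → Y'} {α : U → List Y' → R} (w : List Y)
    (H : ∀ l, IsLinearMap k fun x => α x l) : IsLinearMap k fun x => hpull h (α x) w := by
  induction w using list_length_induction generalizing α with
  | nil => exact H []
  | cons x w ih =>
    simp only [hpull_cons]
    exact isLinearMap_splitSum fun u v huv => ih v (length_le_of_append huv) fun l => H _

theorem ListLin.hpull {α : List U' → R} (hα : ListLin k α) {h : List U → U'}
    (hh : ListLin k h) : ListLin k (hpull h α) := by
  have key : ∀ w : List U, ∀ α : List U' → R, ListLin k α → ∀ u x t, w = u ++ x :: t →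
      IsLinearMap k fun x => ExtAInf.hpull h α (u ++ x :: t) := by
    intro w
    induction w using list_length_induction with
    | nil => intro α _ u x t h; simp at h
    | cons y w ih =>
      intro α hα u x t hw
      cases u with
      | nil =>
        simp only [List.nil_append, hpull_cons]
        exact isLinearMap_splitSum fun a b _ => isLinearMap_hpull b fun l =>
          (hα [] l).comp' (hh [] a)
      | cons z u =>
        simp only [List.cons_append, List.cons.injEq] at hw
        simp only [List.cons_append, hpull_cons, splitSum_append_cons]
        refine (isLinearMap_splitSum fun a b hab => ?_).add'
          (isLinearMap_splitSum fun a b _ => ?_)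
        · refine ih (b ++ x :: t) ?_ _ (hα.cons _) b x t rfl
          simp [hw.2, ← hab]
        · exact isLinearMap_hpull b fun l => (hα [] l).comp' (hh (z :: u) a)
  exact fun u t => ⟨fun x y => (key _ α hα u 0 t rfl).map_add x y,
    fun c x => (key _ α hα u 0 t rfl).map_smul c x⟩

/-- The failure of `h` to satisfy the equations of a morphism of `A_∞`-algebras. -/
def homDefect (σ : U → U) (b : List U → U) (b' : List U' → U') (h : List U → U') (w : List U) :
    U' := hpull h b' w - bstar σ b h w

theorem isLinearMap_cons_hpull {Y : Type*} {α : List U' → R} (hα : ListLin k α)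
    {h : List Y → U'} (v : List Y) : IsLinearMap k fun y => hpull h (fun l => α (y :: l)) v :=
  isLinearMap_hpull v fun l => hα [] l

/-- The action of a morphism of tensor coalgebras on the coderivations, one block at a time. -/
theorem hpull_bstar_sub_cons {σ : U → U} {σ' : U' → U'} {b : List U → U} {b' : List U' → U'}
    {h : List U → U'} (hh : ListLin k h) (hσ : ∀ l, h (l.map σ) = σ' (h l)) (hb : b [] = 0)
    (hb' : b' [] = 0) {α : List U' → R} (hα : ListLin k α) (x : U) (w : List U) :
    hpull h (bstar σ' b' α) (x :: w) - bstar σ b (hpull h α) (x :: w) =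
      splitSum (fun s v => hpull h (fun l => α (homDefect σ b b' h (x :: s) :: l)) v +
        (hpull h (bstar σ' b' fun l => α (σ' (h (x :: s)) :: l)) v -
          bstar σ b (hpull h fun l => α (σ' (h (x :: s)) :: l)) v)) w := by
  -- Either the block replaced by `b'` starts at `y`, or `y` is passed over and receives `σ'`. Empty
  -- blocks contribute nothing because `b' [] = 0`.
  have e1 : ∀ y τ, bstar σ' b' α (y :: τ) =
      splitSum (fun v t => α (b' (y :: v) :: t)) τ + bstar σ' b' (fun l => α (σ' y :: l)) τ := by
    intro y τ
    simp only [bstar, splitSum_cons, List.map_nil, List.nil_append, hb', hα.map_zero_cons,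
      zero_add, List.map_cons, List.cons_append]
  -- The terms in which `b'` consumes an initial run of blocks reassemble, by associativity of
  -- cutting, into `hpull h b'` on the union of those blocks.
  have e2 : hpull h (bstar σ' b' α) (x :: w) =
      splitSum (fun s v => hpull h (fun l => α (hpull h b' (x :: s) :: l)) v) w +
      splitSum (fun s v => hpull h (bstar σ' b' fun l => α (σ' (h (x :: s)) :: l)) v) w := by
    rw [hpull_cons]
    simp only [e1, hpull_add, splitSum_add]
    congr 1
    rw [splitSum_congr fun u v _ =>
      hpull_splitSum h (fun a t => α (b' (h (x :: u) :: a) :: t)) v]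
    rw [← splitSum_assoc (fun u v1 v2 => hpull h (fun l =>
      hpull h (fun l' => α (b' (h (x :: u) :: l) :: l')) v2) v1)]
    refine splitSum_congr fun s v _ => ?_
    have := (isLinearMap_cons_hpull hα (h := h) v)
    rw [show hpull h (fun l => α (hpull h b' (x :: s) :: l)) v =
      this.mk' _ (hpull h b' (x :: s)) from rfl, map_hpull, hpull_cons]
    rfl
  -- Here the subword replaced by `b` lies either inside the first block, which gives `bstar σ b h`,
  -- or beyond it; in the latter case `hσ` turns the `σ` acting on the first block into `σ'` of its
  -- value.
  have e3 : bstar σ b (hpull h α) (x :: w) =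
      splitSum (fun s v => hpull h (fun l => α (bstar σ b h (x :: s) :: l)) v) w +
      splitSum (fun s v => bstar σ b (hpull h fun l => α (σ' (h (x :: s)) :: l)) v) w := by
    have e4 : ∀ s v, hpull h (fun l => α (bstar σ b h (x :: s) :: l)) v =
        splitSum (fun a c => hpull h (fun l => α (h (b (x :: a) :: c) :: l)) v) s +
        splitSum (fun a r => splitSum (fun d c =>
          hpull h (fun l => α (h (σ x :: a.map σ ++ b d :: c) :: l)) v) r) s := by
      intro s v
      have := (isLinearMap_cons_hpull hα (h := h) v)
      rw [show hpull h (fun l => α (bstar σ b h (x :: s) :: l)) v =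
        this.mk' _ (bstar σ b h (x :: s)) from rfl, map_bstar]
      simp only [bstar, splitSum_cons, List.map_nil, List.nil_append, hb, hh.map_zero_cons,
        List.map_cons]
      have h0 : (this.mk' _) (0 : U') = (0 : R) := map_zero _
      rw [h0, zero_add]
      rfl
    have e5 : bstar σ b (hpull h α) (x :: w) =
        splitSum (fun v t => hpull h α (b (x :: v) :: t)) w +
        splitSum (fun u r => splitSum (fun v t =>
          hpull h α (σ x :: (u.map σ ++ b v :: t))) r) w := by
      have h0 : hpull h α (0 :: x :: w) = 0 := (hα.hpull hh).map_zero_cons _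
      simp only [bstar, splitSum_cons, List.map_nil, List.nil_append, hb, h0, zero_add,
        List.map_cons, List.cons_append]
    rw [e5]
    simp only [e4, splitSum_add, hpull_cons, splitSum_append_cons, splitSum_map, add_assoc]
    rw [splitSum_assoc (fun a c v => hpull h (fun l => α (h (b (x :: a) :: c) :: l)) v)]
    congr 1
    rw [add_comm]
    congr 1
    · rw [splitSum_assoc (fun a r v => splitSum (fun d c =>
          hpull h (fun l => α (h (σ x :: a.map σ ++ b d :: c) :: l)) v) r)]
      refine splitSum_congr fun u r _ => ?_
      exact (splitSum_assoc (fun d c v =>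
        hpull h (fun l => α (h (σ x :: u.map σ ++ b d :: c) :: l)) v) r).symm
    · simp only [bstar]
      rw [← splitSum_assoc (fun s a r => splitSum (fun v t => hpull h
        (fun l => α (σ' (h (x :: s)) :: l)) (a.map σ ++ b v :: t)) r)]
      refine splitSum_congr fun u r _ => ?_
      rw [splitSum_comm]
      refine splitSum_congr fun a c _ => splitSum_congr fun v t _ => ?_
      rw [← hσ (x :: a)]
      rfl
  have : ∀ s v, hpull h (fun l => α (homDefect σ b b' h (x :: s) :: l)) v =
      hpull h (fun l => α (hpull h b' (x :: s) :: l)) v -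
      hpull h (fun l => α (bstar σ b h (x :: s) :: l)) v := fun s v =>
    (isLinearMap_cons_hpull hα (h := h) v).map_sub _ _
  rw [e2, e3]
  simp only [this, splitSum_add, splitSum_sub]
  abel

/-- Iterating the one-block formula places a single defect in one block of a decomposition. In
length at most `n` a nonzero defect needs a block of length `n`, hence the whole word. -/
theorem hpull_bstar_sub {σ : U → U} {σ' : U' → U'} {b : List U → U} {b' : List U' → U'}
    {h : List U → U'} (hh : ListLin k h) (hσ : ∀ l, h (l.map σ) = σ' (h l)) (hb : b [] = 0)
    (hb' : b' [] = 0) {n : ℕ}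
    (hn : ∀ w : List U, w.length < n → homDefect σ b b' h w = 0)
    {α : List U' → R} (hα : ListLin k α) (w : List U) (hw : w.length ≤ n) :
    hpull h (bstar σ' b' α) w - bstar σ b (hpull h α) w = α [homDefect σ b b' h w] := by
  induction w using list_length_induction generalizing α with
  | nil =>
    have h1 : h [0] = 0 := hh.map_zero_cons []
    have h2 : hpull h α [0] = 0 := (hα.hpull hh).map_zero_cons []
    simp [bstar, homDefect, hb, hb', hα.map_zero_cons, h1, h2]
  | cons x w ih =>
    rw [hpull_bstar_sub_cons hh hσ hb hb' hα, splitSum_eq_last]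
    · rw [ih [] (by simp) (hα.cons _) (by simp)]
      have : homDefect σ b b' h [] = 0 := by
        have h1 : h [0] = 0 := hh.map_zero_cons []
        simp [homDefect, hb', bstar, hb, h1]
      rw [this, (hα.cons _).map_zero_cons, add_zero]
      rfl
    · intro u v huv hv
      have h1 : u.length + v.length = w.length := by simp [← huv]
      have h2 : 0 < v.length := List.length_pos_iff.2 hv
      simp at hw
      rw [ih v (by omega) (hα.cons _) (by omega), hn (x :: u) (by simp; omega), hn v (by omega),
        (hα.cons _).map_zero_cons, add_zero]
      exact hpull_eq_zero _ fun l => hα.map_zero_cons l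

end Lin
end Pull

/-! ### Homogeneous components -/

section Grading
variable {k V W : Type*} [Field k] [AddCommGroup V] [Module k V] [AddCommGroup W] [Module k W]
  {deg : ℤ × ℤ → Submodule k V} {deg' : ℤ × ℤ → Submodule k W}

/-- The linear endomorphism acting on the homogeneous piece of degree `z` as the scalar `ε z`. -/
noncomputable def gscale (h : DirectSum.IsInternal deg) (ε : ℤ × ℤ → k) : V →ₗ[k] V :=
  (DirectSum.toModule k (ℤ × ℤ) V fun z => ε z • (deg z).subtype) ∘ₗ
    (LinearEquiv.ofBijective (DirectSum.coeLinearMap deg) h).symm.toLinearMap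

theorem gscale_apply (h : DirectSum.IsInternal deg) (ε : ℤ × ℤ → k) {z : ℤ × ℤ} {x : V}
    (hx : x ∈ deg z) : gscale h ε x = ε z • x := by
  have : (LinearEquiv.ofBijective (DirectSum.coeLinearMap deg) h).symm x =
      DirectSum.lof k _ (fun z => deg z) z ⟨x, hx⟩ := by
    rw [LinearEquiv.symm_apply_eq]
    exact (DirectSum.coeLinearMap_lof (R := k) deg z ⟨x, hx⟩).symm
  rw [gscale, LinearMap.comp_apply, LinearEquiv.coe_coe, this, DirectSum.toModule_lof]
  rfl

theorem homogeneous_induction (h : DirectSum.IsInternal deg) {p : V → Prop} (x : V)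
    (hom : ∀ z, ∀ x ∈ deg z, p x) (zero : p 0) (add : ∀ x y, p x → p y → p (x + y)) : p x := by
  have hx : x ∈ ⨆ z, deg z := by rw [h.submodule_iSup_eq_top]; trivial
  exact Submodule.iSup_induction deg (motive := p) hx hom zero add

theorem homogeneous_ext {M F G : Type*} [AddCommMonoid M] [FunLike F V M]
    [AddMonoidHomClass F V M] [FunLike G V M] [AddMonoidHomClass G V M]
    (h : DirectSum.IsInternal deg) {f : F} {g : G}
    (H : ∀ z, ∀ x ∈ deg z, f x = g x) (x : V) : f x = g x :=
  homogeneous_induction h x H (by rw [map_zero, map_zero]) fun x y hx hy => by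
    rw [map_add, map_add, hx, hy]

/-- The projection onto the homogeneous piece of degree `z`. -/
noncomputable def gproj (h : DirectSum.IsInternal deg) (z : ℤ × ℤ) : V →ₗ[k] V :=
  gscale h (Pi.single z 1)

theorem gproj_of_mem (h : DirectSum.IsInternal deg) {z : ℤ × ℤ} {x : V} (hx : x ∈ deg z) :
    gproj h z x = x := by
  rw [gproj, gscale_apply h _ hx, Pi.single_eq_same, one_smul]

theorem gproj_of_ne (h : DirectSum.IsInternal deg) {y z : ℤ × ℤ} {x : V} (hx : x ∈ deg y)
    (hyz : y ≠ z) : gproj h z x = 0 := by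
  rw [gproj, gscale_apply h _ hx, Pi.single_eq_of_ne hyz, zero_smul]

theorem gproj_mem (h : DirectSum.IsInternal deg) (z : ℤ × ℤ) (x : V) : gproj h z x ∈ deg z := by
  refine homogeneous_induction (p := fun x => gproj h z x ∈ deg z) h x (fun y x hx => ?_)
    (by simp) fun x y hx hy => ?_
  · by_cases hyz : y = z
    · subst hyz; rw [gproj_of_mem h hx]; exact hx
    · rw [gproj_of_ne h hx hyz]; exact zero_mem _
  · rw [map_add]; exact add_mem hx hy

theorem eq_zero_of_mem_of_mem (h : DirectSum.IsInternal deg) {y z : ℤ × ℤ} {x : V}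
    (hy : x ∈ deg y) (hz : x ∈ deg z) (hyz : y ≠ z) : x = 0 := by
  rw [← gproj_of_mem h hz, gproj_of_ne h hy hyz]

theorem map_gproj (h : DirectSum.IsInternal deg) (h' : DirectSum.IsInternal deg') (f : V →ₗ[k] W)
    {c : ℤ × ℤ} (hf : ∀ y, ∀ x ∈ deg y, f x ∈ deg' (y + c)) (z : ℤ × ℤ) (x : V) :
    f (gproj h z x) = gproj h' (z + c) (f x) := by
  refine homogeneous_ext (f := f ∘ₗ gproj h z) (g := gproj h' (z + c) ∘ₗ f) h
    (fun y x hx => ?_) x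
  by_cases hyz : y = z
  · subst hyz
    simp [gproj_of_mem h hx, gproj_of_mem h' (hf _ _ hx)]
  · have : y + c ≠ z + c := fun e => hyz (add_right_cancel e)
    simp [gproj_of_ne h hx hyz, gproj_of_ne h' (hf _ _ hx) this]

theorem eq_zero_of_gproj (h : DirectSum.IsInternal deg) {x : V} (hx : ∀ z, gproj h z x = 0) :
    x = 0 := by
  obtain ⟨y, rfl⟩ := h.surjective x
  have : y = 0 := by
    ext z
    have h1 : ∀ y : ⨁ z, deg z, gproj h z (DirectSum.coeAddMonoidHom deg y) = (y z : V) := by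
      intro y
      induction y using DirectSum.induction_on with
      | zero => simp
      | add a b ha hb => simp [ha, hb]
      | of i a =>
        rw [DirectSum.coeAddMonoidHom_of]
        by_cases hiz : i = z
        · subst hiz; rw [gproj_of_mem h a.2, DirectSum.of_eq_same]
        · rw [gproj_of_ne h a.2 hiz, DirectSum.of_eq_of_ne _ _ _ (Ne.symm hiz)]; rfl
    rw [← h1, hx]; rfl
  rw [this, map_zero]

end Grading

/-! ### Graded free resolutions: bases and primitives -/

section Resolution
universe w w'
variable {k : Type*} [Field k] {A : Type*} [Ring A] [Algebra k A]
  {P : Type w} [AddCommGroup P] [Module k P] [Module Aᵐᵒᵖ P] [IsScalarTower k Aᵐᵒᵖ P]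
  {P' : Type w'} [AddCommGroup P'] [Module k P'] [Module Aᵐᵒᵖ P'] [IsScalarTower k Aᵐᵒᵖ P']

/-- The `A`-linear maps that are homogeneous of degree `z`. -/
def homDeg (A : Type*) [Ring A] [Algebra k A] [Module Aᵐᵒᵖ P] [IsScalarTower k Aᵐᵒᵖ P]
    [Module Aᵐᵒᵖ P'] [IsScalarTower k Aᵐᵒᵖ P'] (deg : ℤ × ℤ → Submodule k P)
    (deg' : ℤ × ℤ → Submodule k P') (z : ℤ × ℤ) : Submodule k (P →ₗ[Aᵐᵒᵖ] P') where
  carrier := {f | ∀ y, ∀ x ∈ deg y, f x ∈ deg' (y + z)}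
  add_mem' hf hg y x hx := Submodule.add_mem _ (hf y x hx) (hg y x hx)
  zero_mem' _ _ _ := Submodule.zero_mem _
  smul_mem' c _ hf y x hx := Submodule.smul_mem _ c (hf y x hx)

theorem algebraMap_op_smul (c : k) (x : P) : MulOpposite.op (algebraMap k A c) • x = c • x := by
  rw [← MulOpposite.algebraMap_apply, algebraMap_smul]

/-- A functional killed by the right action of `A_{≥ 1}`, i.e. an `A`-linear map to `k_A`. -/
def IsTrivial (𝒜 : ℕ → Submodule k A) (γ : P →ₗ[k] k) : Prop :=
  ∀ (j : ℕ) (x : P) (a : A), 0 < j → a ∈ 𝒜 j → γ (MulOpposite.op a • x) = 0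

theorem IsTrivial.comp_linear (γ : P' →ₗ[k] k) {𝒜 : ℕ → Submodule k A} (hγ : IsTrivial 𝒜 γ)
    (f : P →ₗ[Aᵐᵒᵖ] P') :
    IsTrivial 𝒜 (γ ∘ₗ f.restrictScalars k) := fun j x a hj ha => by
  simp [hγ j _ a hj ha]

/-- Homogeneous multiples of basis elements generate `P` additively. Only additivity is asked of the
maps, so projections and functionals that are not `A`-linear can be compared in this way. -/
theorem basis_ext {ι P M F G : Type*} [AddCommGroup P] [Module Aᵐᵒᵖ P] [AddCommMonoid M]
    [FunLike F P M] [AddMonoidHomClass F P M]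
    [FunLike G P M] [AddMonoidHomClass G P M] (𝒜 : ℕ → Submodule k A) [GradedAlgebra 𝒜]
    (b : Module.Basis ι Aᵐᵒᵖ P) {f : F} {g : G}
    (H : ∀ i j, ∀ a ∈ 𝒜 j, f (MulOpposite.op a • b i) = g (MulOpposite.op a • b i)) (x : P) :
    f x = g x := by
  have h1 : ∀ i (a : A), f (MulOpposite.op a • b i) = g (MulOpposite.op a • b i) := by
    intro i a
    induction a using DirectSum.Decomposition.inductionOn 𝒜 with
    | zero => simp
    | homogeneous a => exact H i _ a a.2
    | add a c ha hc => rw [MulOpposite.op_add, add_smul, map_add, map_add, ha, hc]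
  rw [← b.linearCombination_repr x, Finsupp.linearCombination_apply, Finsupp.sum, map_sum, map_sum]
  exact Finset.sum_congr rfl fun i _ => h1 i _

namespace FreeResolution
variable {𝒜 : ℕ → Submodule k A} (ρ : FreeResolution 𝒜 P) (ρ' : FreeResolution 𝒜 P')

theorem isTrivial_aug : IsTrivial 𝒜 ρ.aug := ρ.aug_smul

theorem exists_basis : ∃ (ι : Type w) (b : Module.Basis ι Aᵐᵒᵖ P) (δ : ι → ℤ × ℤ),
    ∀ i, b i ∈ ρ.deg (δ i) := by
  obtain ⟨ι, b, hb⟩ := ρ.free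
  choose δ hδ using hb
  exact ⟨ι, b, δ, hδ⟩

theorem smul_mem' {y : ℤ × ℤ} {j : ℕ} {x : P} {a : A} (hx : x ∈ ρ.deg y) (ha : a ∈ 𝒜 j) :
    MulOpposite.op a • x ∈ ρ.deg (y + (0, (j : ℤ))) := by
  have := ρ.smul_mem y.1 y.2 j x a hx ha
  rwa [show y + (0, (j : ℤ)) = (y.1, y.2 + j) by ext <;> simp]

theorem exists_unit : ∃ e ∈ ρ.deg (0, 0), ρ.aug e = 1 := by
  obtain ⟨x, hx⟩ := ρ.aug_surjective 1
  refine ⟨gproj ρ.isInternal (0, 0) x, gproj_mem _ _ _, ?_⟩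
  rw [← hx]
  refine homogeneous_ext (f := ρ.aug ∘ₗ gproj ρ.isInternal (0, 0)) (g := ρ.aug) ρ.isInternal
    (fun y x hx => ?_) x
  by_cases hy : y = (0, 0)
  · subst hy; simp [gproj_of_mem _ hx]
  · simp [gproj_of_ne _ hx hy, ρ.aug_deg y hy x hx]

/-- A chosen element of `P^0` of augmentation `1`. -/
noncomputable def e : P := ρ.exists_unit.choose

theorem e_mem : ρ.e ∈ ρ.deg (0, 0) := ρ.exists_unit.choose_spec.1

@[simp] theorem aug_e : ρ.aug ρ.e = 1 := ρ.exists_unit.choose_spec.2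

theorem eq_zero_of_pos {y : ℤ × ℤ} {x : P} (hx : x ∈ ρ.deg y) (hy : 0 < y.1) : x = 0 := by
  have := ρ.deg_eq_bot y.1 y.2 hy
  rw [show y = (y.1, y.2) from rfl, this] at hx
  exact (Submodule.mem_bot k).1 hx

theorem d_eq_zero {y : ℤ × ℤ} {x : P} (hx : x ∈ ρ.deg y) (hy : 0 ≤ y.1) : ρ.d x = 0 :=
  ρ.eq_zero_of_pos (ρ.d_mem hx) (by simp; omega)

@[simp] theorem d_e : ρ.d ρ.e = 0 := ρ.d_eq_zero ρ.e_mem le_rfl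

/-- `y` is a primitive of `x`, of augmentation zero and compatible with the gradings. -/
def IsPrimitive (x y : P) : Prop :=
  ρ.d y = x ∧ ρ.aug y = 0 ∧ ∀ z, x ∈ ρ.deg z → y ∈ ρ.deg (z - (1, 0))

theorem exists_isPrimitive {z : ℤ × ℤ} {x : P} (hx : x ∈ ρ.deg z) (hd : ρ.d x = 0)
    (ha : ρ.aug x = 0) : ∃ y, ρ.IsPrimitive x y := by
  -- Zero lies in every degree, and a primitive must follow all degrees of `x`; a nonzero `x` has
  -- only one.
  by_cases h0 : x = 0
  · exact ⟨0, by simp [IsPrimitive, h0]⟩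
  obtain ⟨y, rfl⟩ := ρ.exact x hd ha
  set y' := gproj ρ.isInternal (z - (1, 0)) y with hy'
  have hm : y' ∈ ρ.deg (z - (1, 0)) := gproj_mem _ _ _
  have hd' : ρ.d y' = ρ.d y := by
    have := map_gproj ρ.isInternal ρ.isInternal (ρ.d.restrictScalars k) (c := (1, 0))
      (fun y x hx => ρ.d_mem hx) (z - (1, 0)) y
    rw [sub_add_cancel] at this
    rw [hy']
    exact this.trans (gproj_of_mem _ hx)
  -- Subtracting a multiple of the cycle `e` kills the augmentation and leaves the differential
  -- unchanged.
  refine ⟨y' - ρ.aug y' • ρ.e, ?_, by simp, fun z' hz' => ?_⟩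
  · rw [map_sub, hd', ← algebraMap_op_smul (A := A), map_smul]; simp
  · obtain rfl : z = z' := by
      by_contra hne
      exact h0 (eq_zero_of_mem_of_mem ρ.isInternal hx hz' hne)
    refine sub_mem hm ?_
    by_cases hz : z - (1, 0) = (0, 0)
    · rw [hz]; exact Submodule.smul_mem _ _ ρ.e_mem
    · rw [ρ.aug_deg _ hz _ hm, zero_smul]; exact zero_mem _

open Classical in
/-- A choice of primitives. -/
noncomputable def prim (x : P) : P :=
  if h : ∃ y, ρ.IsPrimitive x y then h.choose else 0

theorem isPrimitive_prim {z : ℤ × ℤ} {x : P} (hx : x ∈ ρ.deg z) (hd : ρ.d x = 0)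
    (ha : ρ.aug x = 0) : ρ.IsPrimitive x (ρ.prim x) := by
  have h := ρ.exists_isPrimitive hx hd ha
  rw [prim, dif_pos h]
  exact h.choose_spec

theorem aug_prim (x : P) : ρ.aug (ρ.prim x) = 0 := by
  rw [prim]; split_ifs with h
  · exact h.choose_spec.2.1
  · exact map_zero _

theorem prim_mem {z : ℤ × ℤ} {x : P} (hx : x ∈ ρ.deg z) : ρ.prim x ∈ ρ.deg (z - (1, 0)) := by
  rw [prim]; split_ifs with h
  · exact h.choose_spec.2.2 z hx
  · exact zero_mem _

end FreeResolution

section Basis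
variable {𝒜 : ℕ → Submodule k A} [GradedAlgebra 𝒜]

theorem isTrivial_op_smul (h𝒜 : IsConnectedLocallyFinite 𝒜) {γ : P →ₗ[k] k} (hγ : IsTrivial 𝒜 γ)
    {x : P} (hx : γ x = 0) (a : A) : γ (MulOpposite.op a • x) = 0 := by
  induction a using DirectSum.Decomposition.inductionOn 𝒜 with
  | zero => simp
  | @homogeneous i a =>
    rcases Nat.eq_zero_or_pos i with rfl | hi
    · obtain ⟨c, hc, -⟩ := h𝒜.connected a a.2
      rw [← hc, algebraMap_op_smul, map_smul, hx, smul_zero]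
    · exact hγ i x a hi a.2
  | add a c ha hc => rw [MulOpposite.op_add, add_smul, map_add, ha, hc, add_zero]

theorem isTrivial_ext (h𝒜 : IsConnectedLocallyFinite 𝒜) {ι : Type*} (b : Module.Basis ι Aᵐᵒᵖ P)
    {γ γ' : P →ₗ[k] k} (hγ : IsTrivial 𝒜 γ) (hγ' : IsTrivial 𝒜 γ')
    (H : ∀ i, γ (b i) = γ' (b i)) (x : P) : γ x = γ' x := by
  refine basis_ext 𝒜 b (fun i j a ha => ?_) x
  rcases Nat.eq_zero_or_pos j with rfl | hj
  · obtain ⟨c, hc, -⟩ := h𝒜.connected a ha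
    rw [← hc, algebraMap_op_smul, map_smul, map_smul, H]
  · rw [hγ j _ a hj ha, hγ' j _ a hj ha]

variable (ρ : FreeResolution 𝒜 P) (ρ' : FreeResolution 𝒜 P')

/-- Homogeneity is obtained as commutation with the projections, an identity that can be tested on
homogeneous multiples of the basis. -/
theorem constr_mem_homDeg {ι : Type*} (b : Module.Basis ι Aᵐᵒᵖ P) {δ : ι → ℤ × ℤ}
    (hδ : ∀ i, b i ∈ ρ.deg (δ i)) {z : ℤ × ℤ} {g : ι → P'} (hg : ∀ i, g i ∈ ρ'.deg (δ i + z)) :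
    b.constr ℕ g ∈ homDeg A ρ.deg ρ'.deg z := by
  intro y x hx
  have key : ∀ x, gproj ρ'.isInternal (y + z) (b.constr ℕ g x) =
      b.constr ℕ g (gproj ρ.isInternal y x) := by
    refine basis_ext (f := gproj ρ'.isInternal (y + z) ∘ₗ (b.constr ℕ g).restrictScalars k)
      (g := (b.constr ℕ g).restrictScalars k ∘ₗ gproj ρ.isInternal y) 𝒜 b fun i j a ha => ?_
    have h1 := ρ.smul_mem' (hδ i) ha
    have h2 := ρ'.smul_mem' (hg i) ha
    by_cases hy : δ i + (0, (j : ℤ)) = y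
    · subst hy
      rw [show δ i + z + (0, (j : ℤ)) = δ i + (0, (j : ℤ)) + z by abel] at h2
      simp [gproj_of_mem _ h1, Module.Basis.constr_basis, gproj_of_mem _ h2]
    · have hy' : δ i + z + (0, (j : ℤ)) ≠ y + z := fun e => hy (by
        rw [add_right_comm] at e; exact add_right_cancel e)
      simp [gproj_of_ne _ h1 hy, Module.Basis.constr_basis, gproj_of_ne _ h2 hy']
  rw [← gproj_of_mem ρ.isInternal hx, ← key]
  exact gproj_mem _ _ _

/-- The action of `A` moves only the Adams degree, so the `A`-linear map that kills all basis
elements of other cohomological degrees is the projection onto cohomological degree `y.1`. -/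
theorem mem_span_basis {ι : Type*} (b : Module.Basis ι Aᵐᵒᵖ P) {δ : ι → ℤ × ℤ}
    (hδ : ∀ i, b i ∈ ρ.deg (δ i)) {y : ℤ × ℤ} {x : P} (hx : x ∈ ρ.deg y)
    (N : Submodule Aᵐᵒᵖ P) (hN : ∀ i, (δ i).1 = y.1 → b i ∈ N) : x ∈ N := by
  classical
  have key : ∀ x, b.constr ℕ (fun i => if (δ i).1 = y.1 then b i else 0) x =
      gscale ρ.isInternal (fun z => if z.1 = y.1 then 1 else 0) x := by
    refine basis_ext 𝒜 b fun i j a ha => ?_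
    rw [gscale_apply _ _ (ρ.smul_mem' (hδ i) ha), map_smul, b.constr_basis]
    simp only [Prod.fst_add, add_zero]
    split_ifs <;> simp
  have := key x
  rw [gscale_apply _ _ hx, if_pos rfl, one_smul] at this
  rw [← this, b.constr_apply]
  refine Submodule.sum_mem _ fun i _ => Submodule.smul_mem _ _ ?_
  split_ifs with h
  · exact hN i h
  · exact zero_mem _

end Basis
end Resolution

/-! ### Comparison maps and homotopies between resolutions -/

section Lifting
universe w w'
variable {k : Type*} [Field k] {A : Type*} [Ring A] [Algebra k A]
  {P : Type w} [AddCommGroup P] [Module k P] [Module Aᵐᵒᵖ P] [IsScalarTower k Aᵐᵒᵖ P]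
  {P' : Type w'} [AddCommGroup P'] [Module k P'] [Module Aᵐᵒᵖ P'] [IsScalarTower k Aᵐᵒᵖ P']
  {𝒜 : ℕ → Submodule k A} [GradedAlgebra 𝒜]

theorem units_smul_smul_self {M : Type*} [AddCommGroup M] (s : ℤˣ) (x : M) : s • s • x = x := by
  rw [smul_smul, Int.units_mul_self, one_smul]

theorem map_units_smul {M N F : Type*} [AddCommGroup M] [AddCommGroup N] [FunLike F M N]
    [AddMonoidHomClass F M N] (f : F) (s : ℤˣ) (x : M) : f (s • x) = s • f x := by
  rw [Units.smul_def, Units.smul_def, map_zsmul]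

theorem units_smul_mem {M S : Type*} [AddCommGroup M] [SetLike S M] [AddSubgroupClass S M]
    {N : S} (s : ℤˣ) {x : M} (hx : x ∈ N) : s • x ∈ N := by
  rw [Units.smul_def]; exact zsmul_mem hx _

theorem homDeg_cast {deg : ℤ × ℤ → Submodule k P} {deg' : ℤ × ℤ → Submodule k P'} {y z : ℤ × ℤ}
    (h : y = z) {f : P →ₗ[Aᵐᵒᵖ] P'} (hf : f ∈ homDeg A deg deg' y) : f ∈ homDeg A deg deg' z :=
  h ▸ hf

namespace FreeResolution
variable (h𝒜 : IsConnectedLocallyFinite 𝒜) (ρ : FreeResolution 𝒜 P) (ρ' : FreeResolution 𝒜 P')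

omit [GradedAlgebra 𝒜] in
theorem comp_d_mem {z : ℤ × ℤ} {f : P →ₗ[Aᵐᵒᵖ] P'} (hf : f ∈ homDeg A ρ.deg ρ'.deg z) :
    f ∘ₗ ρ.d ∈ homDeg A ρ.deg ρ'.deg (z + (1, 0)) := fun y x hx => by
  have := hf _ _ (ρ.d_mem hx)
  rwa [add_assoc, add_comm (1, 0) z] at this

omit [GradedAlgebra 𝒜] in
theorem d_comp_mem {z : ℤ × ℤ} {f : P →ₗ[Aᵐᵒᵖ] P'} (hf : f ∈ homDeg A ρ.deg ρ'.deg z) :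
    ρ'.d ∘ₗ f ∈ homDeg A ρ.deg ρ'.deg (z + (1, 0)) := fun y x hx => by
  have := ρ'.d_mem (hf _ _ hx)
  rwa [add_assoc] at this

include h𝒜 in
/-- A cocycle in the complex of homogeneous maps between two resolutions is a coboundary as soon
as its composite with the augmentation vanishes. -/
theorem exists_homotopy_of_aug_eq_zero {z : ℤ × ℤ} (s : ℤˣ) {ψ : P →ₗ[Aᵐᵒᵖ] P'}
    (hψ : ψ ∈ homDeg A ρ.deg ρ'.deg z) (hd : ∀ x, ρ'.d (ψ x) = s • ψ (ρ.d x))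
    (ha : ∀ x, ρ'.aug (ψ x) = 0) :
    ∃ h ∈ homDeg A ρ.deg ρ'.deg (z - (1, 0)), (∀ x, ρ'.aug (h x) = 0) ∧
      ∀ x, ψ x = ρ'.d (h x) + s • h (ρ.d x) := by
  obtain ⟨ι, b, δ, hδ⟩ := ρ.exists_basis
  -- Successive approximations: each stage solves the homotopy equation on the basis, using the
  -- previous stage on the differentials. As `P` vanishes in positive degrees, stage `n` is final in
  -- cohomological degrees above `-n`.
  obtain ⟨H, H0, HS⟩ : ∃ H : ℕ → (P →ₗ[Aᵐᵒᵖ] P'), H 0 = 0 ∧ ∀ n, H (n + 1) =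
      b.constr ℕ fun i => ρ'.prim (ψ (b i) - s • H n (ρ.d (b i))) :=
    ⟨fun n => Nat.rec 0
      (fun _ g => b.constr ℕ fun i => ρ'.prim (ψ (b i) - s • g (ρ.d (b i)))) n,
      rfl, fun _ => rfl⟩
  have H1 : ∀ n i, H (n + 1) (b i) = ρ'.prim (ψ (b i) - s • H n (ρ.d (b i))) := fun n i => by
    rw [HS, b.constr_basis]
  have Haug : ∀ n x, ρ'.aug (H n x) = 0 := by
    intro n
    cases n with
    | zero => intro x; simp [H0]
    | succ n =>
      refine basis_ext (f := ρ'.aug ∘ₗ (H (n + 1)).restrictScalars k) (g := (0 : P →ₗ[k] k)) 𝒜 b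
        fun i j a ha => ?_
      simp only [LinearMap.comp_apply, LinearMap.restrictScalars_apply, map_smul,
        LinearMap.zero_apply]
      exact isTrivial_op_smul h𝒜 ρ'.isTrivial_aug (by rw [H1]; exact ρ'.aug_prim _) a
  have Hmem : ∀ n, H n ∈ homDeg A ρ.deg ρ'.deg (z - (1, 0)) := by
    intro n
    induction n with
    | zero => rw [H0]; exact Submodule.zero_mem _
    | succ n ih =>
      rw [HS]
      refine constr_mem_homDeg (𝒜 := 𝒜) ρ ρ' b hδ fun i => ?_
      rw [← add_sub_assoc]
      refine ρ'.prim_mem (sub_mem (hψ _ _ (hδ i)) (units_smul_mem _ ?_))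
      have := ih _ _ (ρ.d_mem (hδ i))
      rwa [add_assoc, add_sub_cancel] at this
  have key : ∀ n : ℕ, ∀ y, -(n : ℤ) < y.1 → ∀ x ∈ ρ.deg y, H (n + 1) x = H n x ∧
      ψ x = ρ'.d (H n x) + s • H n (ρ.d x) := by
    intro n
    induction n with
    | zero =>
      intro y hy x hx
      have : x = 0 := ρ.eq_zero_of_pos hx (by simpa using hy)
      simp [this]
    | succ n ih =>
      intro y hy x hx
      let N : Submodule Aᵐᵒᵖ P :=
        LinearMap.eqLocus (H (n + 2)) (H (n + 1)) ⊓
          LinearMap.eqLocus ψ (ρ'.d ∘ₗ H (n + 1) + s • (H (n + 1) ∘ₗ ρ.d))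
      suffices hN : x ∈ N by
        obtain ⟨h1, h2⟩ := hN
        exact ⟨h1, by simpa [LinearMap.mem_eqLocus] using h2⟩
      refine mem_span_basis (𝒜 := 𝒜) ρ b hδ hx N fun i hi => ?_
      have hy' : -(n : ℤ) < (δ i + (1, 0)).1 := by
        rw [Prod.fst_add, hi]; push_cast at hy; simp only; omega
      have hdi := ih _ hy' _ (ρ.d_mem (hδ i))
      set t := ψ (b i) - s • H n (ρ.d (b i)) with ht
      have htm : t ∈ ρ'.deg (δ i + z) := by
        refine sub_mem (hψ _ _ (hδ i)) (units_smul_mem _ ?_)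
        have := Hmem n _ _ (ρ.d_mem (hδ i))
        rwa [add_assoc, add_sub_cancel] at this
      -- The element to be integrated is a cycle because the homotopy equation already holds one
      -- degree higher, where `ρ.d (b i)` lies.
      have htd : ρ'.d t = 0 := by
        rw [ht, map_sub, hd, map_units_smul, hdi.2, ρ.d_d, map_zero, smul_zero, add_zero, sub_self]
      have hta : ρ'.aug t = 0 := by
        rw [ht, map_sub, ha, map_units_smul, Haug, smul_zero, sub_zero]
      have hp := ρ'.isPrimitive_prim htm htd hta
      refine ⟨?_, ?_⟩
      · change H (n + 2) (b i) = H (n + 1) (b i)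
        rw [H1 (n + 1), H1, hdi.1]
      · change ψ (b i) = ρ'.d (H (n + 1) (b i)) + s • H (n + 1) (ρ.d (b i))
        rw [H1, hp.1, hdi.1, ht, sub_add_cancel]
  have stable : ∀ (m n : ℕ) y, -(n : ℤ) < y.1 → ∀ x ∈ ρ.deg y, H (n + m) x = H n x := by
    intro m n y hy x hx
    induction m with
    | zero => rfl
    | succ m ih =>
      rw [← ih]
      exact (key (n + m) y (by push_cast; omega) x hx).1
  -- On each basis element, take a stage that is already final in its degree.
  let h : P →ₗ[Aᵐᵒᵖ] P' := b.constr ℕ fun i => H ((-(δ i).1).toNat + 1) (b i)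
  have hH : ∀ n : ℕ, ∀ y, -(n : ℤ) < y.1 → ∀ x ∈ ρ.deg y, h x = H n x := by
    intro n y hy x hx
    refine mem_span_basis (𝒜 := 𝒜) ρ b hδ hx (LinearMap.eqLocus h (H n)) fun i hi => ?_
    change h (b i) = H n (b i)
    rw [b.constr_basis]
    rw [← stable n ((-(δ i).1).toNat + 1) (δ i) (by push_cast; omega) _ (hδ i),
      add_comm _ n, stable _ n (δ i) (by omega) _ (hδ i)]
  refine ⟨h, ?_, ?_, ?_⟩
  · intro y x hx
    rw [hH ((-y.1).toNat + 1) y (by push_cast; omega) x hx]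
    exact Hmem ((-y.1).toNat + 1) y x hx
  · intro x
    refine homogeneous_ext (f := ρ'.aug ∘ₗ h.restrictScalars k) (g := (0 : P →ₗ[k] k))
      ρ.isInternal (fun y x hx => ?_) x
    have := hH ((-y.1).toNat + 1) y (by push_cast; omega) x hx
    simp [this, Haug]
  · intro x
    refine homogeneous_ext (f := ψ) (g := ρ'.d ∘ₗ h + s • (h ∘ₗ ρ.d))
      ρ.isInternal (fun y x hx => ?_) x
    have h1 : -(((-y.1).toNat + 1 : ℕ) : ℤ) < y.1 := by push_cast; omega
    simp only [LinearMap.add_apply, LinearMap.smul_apply, LinearMap.comp_apply]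
    rw [hH _ y h1 x hx, hH _ (y + (1, 0)) (h1.trans_le (by simp)) _ (ρ.d_mem hx)]
    exact (key _ y h1 x hx).2

include h𝒜 in
/-- Lifting of `A`-linear functionals along the augmentation. -/
theorem exists_lift_of_isTrivial {z : ℤ × ℤ} {γ : P →ₗ[k] k} (hγ : IsTrivial 𝒜 γ)
    (hz : ∀ y, y + z ≠ 0 → ∀ x ∈ ρ.deg y, γ x = 0) :
    ∃ g ∈ homDeg A ρ.deg ρ'.deg z, ∀ x, ρ'.aug (g x) = γ x := by
  obtain ⟨ι, b, δ, hδ⟩ := ρ.exists_basis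
  refine ⟨b.constr ℕ fun i => γ (b i) • ρ'.e, constr_mem_homDeg (𝒜 := 𝒜) ρ ρ' b hδ fun i => ?_, ?_⟩
  · by_cases h : δ i + z = 0
    · rw [h]; exact Submodule.smul_mem _ _ ρ'.e_mem
    · rw [hz _ h _ (hδ i), zero_smul]; exact zero_mem _
  · intro x
    refine isTrivial_ext h𝒜 b (IsTrivial.comp_linear ρ'.aug ρ'.isTrivial_aug
      (b.constr ℕ fun i => γ (b i) • ρ'.e)) hγ (fun i => ?_) x
    simp [b.constr_basis]

include h𝒜 in
/-- A cocycle whose composite with the augmentation is the coboundary of an `A`-linear functional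
is a coboundary. -/
theorem exists_homotopy {z : ℤ × ℤ} (s : ℤˣ) {φ : P →ₗ[Aᵐᵒᵖ] P'}
    (hφ : φ ∈ homDeg A ρ.deg ρ'.deg z) (hd : ∀ x, ρ'.d (φ x) = s • φ (ρ.d x))
    {γ : P →ₗ[k] k} (hγ : IsTrivial 𝒜 γ)
    (hz : ∀ y, y + (z - (1, 0)) ≠ 0 → ∀ x ∈ ρ.deg y, γ x = 0)
    (ha : ∀ x, ρ'.aug (φ x) = γ (ρ.d x)) :
    ∃ h ∈ homDeg A ρ.deg ρ'.deg (z - (1, 0)), ∀ x, φ x = ρ'.d (h x) + s • h (ρ.d x) := by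
  -- The sign cancels against the one in `s • g (ρ.d x)`, so that subtracting the coboundary of `g`
  -- removes the augmentation of `φ`.
  obtain ⟨g, hg, hga⟩ := exists_lift_of_isTrivial (γ := s • γ) h𝒜 ρ ρ'
    (fun j x a hj haj => by simp [hγ j x a hj haj]) (z := z - (1, 0))
    (fun y hy x hx => by simp [hz y hy x hx])
  have hg' : ρ'.d ∘ₗ g + s • (g ∘ₗ ρ.d) ∈ homDeg A ρ.deg ρ'.deg z :=
    add_mem (homDeg_cast (by abel) (ρ.d_comp_mem ρ' hg))
      (units_smul_mem _ (homDeg_cast (by abel) (ρ.comp_d_mem ρ' hg)))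
  obtain ⟨h, hh, -, hφh⟩ := exists_homotopy_of_aug_eq_zero h𝒜 ρ ρ' s
    (ψ := φ - (ρ'.d ∘ₗ g + s • (g ∘ₗ ρ.d))) (sub_mem hφ hg') (fun x => by
      simp [hd, ρ.d_d, ρ'.d_d, smul_sub]) (fun x => by
      simp [ha, ρ'.aug_d, hga, units_smul_smul_self])
  refine ⟨h + g, add_mem hh hg, fun x => ?_⟩
  have := hφh x
  simp only [LinearMap.sub_apply, LinearMap.add_apply, LinearMap.smul_apply, LinearMap.comp_apply]
    at this
  rw [sub_eq_iff_eq_add] at this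
  rw [this]
  simp only [LinearMap.add_apply, map_add, smul_add]
  abel

include h𝒜 in
/-- Every `A`-linear functional that is a cocycle lifts to a cocycle. -/
theorem exists_cocycle_lift {z : ℤ × ℤ} (s : ℤˣ) {β : P →ₗ[k] k} (hβ : IsTrivial 𝒜 β)
    (hz : ∀ y, y + z ≠ 0 → ∀ x ∈ ρ.deg y, β x = 0) (hd : ∀ x, β (ρ.d x) = 0) :
    ∃ φ ∈ homDeg A ρ.deg ρ'.deg z, (∀ x, ρ'.d (φ x) = s • φ (ρ.d x)) ∧
      ∀ x, ρ'.aug (φ x) = β x := by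
  obtain ⟨g, hg, hga⟩ := exists_lift_of_isTrivial h𝒜 ρ ρ' hβ hz
  -- The failure of the lift `g` to be a cocycle is itself a cocycle, for the opposite sign, and has
  -- zero augmentation because `β` vanishes on boundaries. The primitive `h` also has zero
  -- augmentation, so `g - h` still lifts `β`.
  obtain ⟨h, hh, hha, hgh⟩ := exists_homotopy_of_aug_eq_zero h𝒜 ρ ρ' (-s)
    (ψ := ρ'.d ∘ₗ g - s • (g ∘ₗ ρ.d)) (z := z + (1, 0))
    (sub_mem (ρ.d_comp_mem ρ' hg) (units_smul_mem _ (ρ.comp_d_mem ρ' hg)))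
    (fun x => by simp [ρ.d_d, ρ'.d_d, Units.neg_smul])
    (fun x => by simp [ρ'.aug_d, hga, hd])
  refine ⟨g - h, sub_mem hg (homDeg_cast (by abel) hh), fun x => ?_, fun x => ?_⟩
  · have := hgh x
    simp only [LinearMap.sub_apply, LinearMap.smul_apply, LinearMap.comp_apply,
      Units.neg_smul] at this
    simp only [LinearMap.sub_apply, map_sub, smul_sub]
    rw [sub_eq_iff_eq_add] at this
    rw [this]; abel
  · simp [hga, hha]

include h𝒜 in
theorem exists_comparison : ∃ g ∈ homDeg A ρ.deg ρ'.deg 0, (∀ x, ρ'.d (g x) = g (ρ.d x)) ∧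
    ∀ x, ρ'.aug (g x) = ρ.aug x := by
  obtain ⟨g, hg, hd, ha⟩ := exists_cocycle_lift h𝒜 ρ ρ' (z := 0) 1 ρ.isTrivial_aug
    (fun y hy x hx => ρ.aug_deg y (by rw [add_zero] at hy; exact hy) x hx) ρ.aug_d
  exact ⟨g, hg, by simpa using hd, ha⟩

include h𝒜 in
theorem exists_homotopy_one {g : P →ₗ[Aᵐᵒᵖ] P'} (hg : g ∈ homDeg A ρ.deg ρ'.deg 0)
    (hd : ∀ x, ρ'.d (g x) = g (ρ.d x)) (ha : ∀ x, ρ'.aug (g x) = ρ.aug x)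
    {g' : P' →ₗ[Aᵐᵒᵖ] P} (hg' : g' ∈ homDeg A ρ'.deg ρ.deg 0)
    (hd' : ∀ x, ρ.d (g' x) = g' (ρ'.d x)) (ha' : ∀ x, ρ.aug (g' x) = ρ'.aug x) :
    ∃ h ∈ homDeg A ρ.deg ρ.deg (0 - (1, 0)), ∀ x, g' (g x) - x = ρ.d (h x) + h (ρ.d x) := by
  obtain ⟨h, hh, -, hx⟩ := exists_homotopy_of_aug_eq_zero h𝒜 ρ ρ (z := 0) 1
    (ψ := g' ∘ₗ g - LinearMap.id) (fun y x hx => sub_mem (by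
      have := hg' _ _ (hg _ _ hx); simpa using this) (by simpa using hx))
    (fun x => by simp [hd', hd]) (fun x => by simp [ha', ha])
  exact ⟨h, hh, by simpa using hx⟩

omit [GradedAlgebra 𝒜] in
/-- A `k`-linear contraction of the augmented resolution, in degree `0`. -/
theorem exists_contraction : ∃ r : P →ₗ[k] P,
    (∀ y, ∀ x ∈ ρ.deg y, r x ∈ ρ.deg (y - (1, 0))) ∧
    (∀ y : ℤ × ℤ, y.1 = 0 → ∀ x ∈ ρ.deg y, ρ.d (r x) = x - ρ.aug x • ρ.e) ∧
    (∀ y : ℤ × ℤ, y.1 ≠ 0 → ∀ x ∈ ρ.deg y, r x = 0) ∧ r ρ.e = 0 := by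
  classical
  let v := fun z => Module.Basis.ofVectorSpace k (ρ.deg z)
  let b := ρ.isInternal.collectedBasis v
  have hb : ∀ i, b i ∈ ρ.deg i.1 := fun i => ρ.isInternal.collectedBasis_mem v i
  have hpos : ∀ y : ℤ × ℤ, ∀ x ∈ ρ.deg y, x - ρ.aug x • ρ.e ∈ ρ.deg y := by
    intro y x hx
    by_cases hy : y = (0, 0)
    · subst hy; exact sub_mem hx (Submodule.smul_mem _ _ ρ.e_mem)
    · rw [ρ.aug_deg y hy x hx, zero_smul, sub_zero]; exact hx
  have hspan : ∀ (y : ℤ × ℤ) (N : Submodule k P), (∀ i, i.1 = y → b i ∈ N) → ρ.deg y ≤ N := by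
    intro y N hN x hx
    have hr : b.constr ℕ (fun i => if i.1 = y then b i else 0) = gproj ρ.isInternal y := by
      refine b.ext fun i => ?_
      rw [b.constr_basis]
      split_ifs with h
      · rw [gproj_of_mem _ (h ▸ hb i)]
      · rw [gproj_of_ne _ (hb i) h]
    have := gproj_of_mem ρ.isInternal hx
    rw [← hr, b.constr_apply] at this
    rw [← this]
    refine Submodule.sum_mem _ fun i _ => Submodule.smul_mem _ _ ?_
    split_ifs with h
    · exact hN i h
    · exact zero_mem _
  let r₀ : P →ₗ[k] P := b.constr ℕ fun i =>
    if i.1.1 = 0 then ρ.prim (b i - ρ.aug (b i) • ρ.e) else 0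
  have hr₀ : ∀ i, r₀ (b i) = if i.1.1 = 0 then ρ.prim (b i - ρ.aug (b i) • ρ.e) else 0 :=
    fun i => b.constr_basis _ _ _
  have h1 : ∀ y, ∀ x ∈ ρ.deg y, r₀ x ∈ ρ.deg (y - (1, 0)) := by
    intro y
    refine hspan y ((ρ.deg (y - (1, 0))).comap r₀) ?_
    rintro i rfl
    rw [Submodule.mem_comap, hr₀]
    split_ifs
    · exact ρ.prim_mem (hpos _ _ (hb i))
    · exact zero_mem _
  have h2 : ∀ y : ℤ × ℤ, y.1 = 0 → ∀ x ∈ ρ.deg y, ρ.d (r₀ x) = x - ρ.aug x • ρ.e := by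
    intro y hy
    refine hspan y (LinearMap.eqLocus (ρ.d.restrictScalars k ∘ₗ r₀)
      (LinearMap.id - (LinearMap.toSpanSingleton k P ρ.e) ∘ₗ ρ.aug)) ?_
    rintro i rfl
    have h3 := hpos _ _ (hb i)
    have := ρ.isPrimitive_prim h3 (ρ.d_eq_zero h3 hy.ge) (by simp)
    change ρ.d (r₀ (b i)) = b i - ρ.aug (b i) • ρ.e
    rw [hr₀, if_pos hy, this.1]
  have h3 : ∀ y : ℤ × ℤ, y.1 ≠ 0 → ∀ x ∈ ρ.deg y, r₀ x = 0 := by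
    intro y hy
    refine hspan y (LinearMap.ker r₀) ?_
    rintro i rfl
    rw [LinearMap.mem_ker, hr₀, if_neg hy]
  have h4 : ρ.d (r₀ ρ.e) = 0 := by rw [h2 _ rfl _ ρ.e_mem]; simp
  -- Normalisation to `r e = 0`. The correction takes values in multiples of the cycle `r₀ e`, so
  -- the contraction identity survives.
  refine ⟨r₀ - (LinearMap.toSpanSingleton k P (r₀ ρ.e)) ∘ₗ ρ.aug, fun y x hx => ?_,
    fun y hy x hx => ?_, fun y hy x hx => ?_, by simp⟩
  · by_cases hy : y = (0, 0)
    · subst hy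
      exact sub_mem (h1 _ _ hx) (Submodule.smul_mem _ _ (h1 _ _ ρ.e_mem))
    · simp [ρ.aug_deg y hy x hx, h1 _ _ hx]
  · have h5 : ρ.d (ρ.aug x • r₀ ρ.e) = 0 := by
      rw [← algebraMap_op_smul (A := A), map_smul, h4, smul_zero]
    simp [h2 y hy x hx, h5]
  · have : y ≠ (0, 0) := fun h => hy (by simp [h])
    simp [h3 y hy x hx, ρ.aug_deg y this x hx]

end FreeResolution
end Lifting

/-! ### Homogeneous words and degrees of functions on words -/

section Homogeneous
variable {k U U' R S : Type*} [Field k] [AddCommGroup U] [Module k U] [AddCommGroup U']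
  [Module k U'] [AddCommGroup R] [Module k R] [AddCommGroup S] [Module k S]

/-- The letters of the word `l` are homogeneous, of the degrees listed in `ds`. -/
abbrev HomogWord (deg : ℤ × ℤ → Submodule k U) (l : List U) (ds : List (ℤ × ℤ)) : Prop :=
  List.Forall₂ (fun x z => x ∈ deg z) l ds

/-- `α` maps words of total degree `z` to `T (z + c)`. -/
def WordDeg (deg : ℤ × ℤ → Submodule k U) (T : ℤ × ℤ → Submodule k R) (c : ℤ × ℤ)
    (α : List U → R) : Prop :=
  ∀ l ds, HomogWord deg l ds → α l ∈ T (ds.sum + c)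

variable {deg : ℤ × ℤ → Submodule k U} {deg' : ℤ × ℤ → Submodule k U'}
  {T : ℤ × ℤ → Submodule k R}

theorem HomogWord.of_append {u v : List U} {ds : List (ℤ × ℤ)} (h : HomogWord deg (u ++ v) ds) :
    ∃ du dv, ds = du ++ dv ∧ HomogWord deg u du ∧ HomogWord deg v dv := by
  induction u generalizing ds with
  | nil => exact ⟨[], ds, rfl, .nil, h⟩
  | cons x u ih =>
    obtain ⟨z, ds', hx, h', rfl⟩ := List.forall₂_cons_left_iff.1 h
    obtain ⟨du, dv, rfl, hu, hv⟩ := ih h'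
    exact ⟨z :: du, dv, rfl, .cons hx hu, hv⟩

theorem HomogWord.append {u v : List U} {du dv : List (ℤ × ℤ)} (hu : HomogWord deg u du)
    (hv : HomogWord deg v dv) : HomogWord deg (u ++ v) (du ++ dv) :=
  List.rel_append hu hv

theorem HomogWord.map {l : List U} {ds : List (ℤ × ℤ)} (h : HomogWord deg l ds) {f : U → U'}
    (hf : ∀ z, ∀ x ∈ deg z, f x ∈ deg' z) : HomogWord deg' (l.map f) ds := by
  induction h with
  | nil => exact .nil
  | cons hx _ ih => exact .cons (hf _ _ hx) ih

/-- Letters are split into homogeneous components one at a time, from the left. Identities involving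
Koszul signs are thereby reduced to homogeneous words. -/
theorem ListLin.eq_zero_of_homogeneous {α : List U → R} (hα : ListLin k α)
    (hdeg : DirectSum.IsInternal deg) {n : ℕ}
    (H : ∀ l ds, HomogWord deg l ds → l.length = n → α l = 0) (l : List U) (hl : l.length = n) :
    α l = 0 := by
  suffices ∀ (t u : List U) (du : List (ℤ × ℤ)), HomogWord deg u du →
      u.length + t.length = n → α (u ++ t) = 0 from this l [] [] .nil (by simpa using hl)
  intro t
  induction t with
  | nil =>
    intro u du hu hn
    rw [List.append_nil]
    exact H u du hu (by simpa using hn)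
  | cons x t ih =>
    intro u du hu hn
    refine homogeneous_induction (p := fun x => α (u ++ x :: t) = 0) hdeg x (fun z x hx => ?_)
      (hα.map_zero u t) fun x y hx hy => by rw [(hα u t).map_add, hx, hy, add_zero]
    have := ih (u ++ [x]) (du ++ [z]) (hu.append (.cons hx .nil)) (by simp at hn ⊢; omega)
    simpa using this

theorem ListLin.map_sign {α : List U → R} (hα : ListLin k α) {σ : U → U} {ε : ℤ × ℤ → ℤ}
    (hσ : ∀ z, ∀ x ∈ deg z, σ x = (ε z).negOnePow • x) {l : List U} {ds : List (ℤ × ℤ)}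
    (hl : HomogWord deg l ds) : α (l.map σ) = ((ds.map ε).sum).negOnePow • α l := by
  induction hl generalizing α with
  | nil => simp
  | @cons x z l ds hx hl ih =>
    have := ih (hα.cons (σ x))
    have h : α ((ε z).negOnePow • x :: l) = (ε z).negOnePow • α (x :: l) :=
      map_units_smul ((hα [] l).mk' _) _ x
    rw [List.map_cons, List.map_cons, List.sum_cons, this, hσ _ _ hx, h, smul_smul, mul_comm,
      ← Int.negOnePow_add]

theorem sum_map_fst (ds : List (ℤ × ℤ)) : (ds.map Prod.fst).sum = ds.sum.1 := by
  induction ds with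
  | nil => rfl
  | cons z ds ih => simp [ih]

theorem wordDeg_splitSum {f : List U → List U → R} {c : ℤ × ℤ}
    (h : ∀ u v du dv, HomogWord deg u du → HomogWord deg v dv →
      f u v ∈ T (du.sum + dv.sum + c)) : WordDeg deg T c (splitSum f) := by
  intro l ds hl
  refine splitSum_mem _ fun u v huv => ?_
  subst huv
  obtain ⟨du, dv, rfl, hu, hv⟩ := hl.of_append
  rw [List.sum_append]
  exact h u v du dv hu hv

theorem WordDeg.bstar {α : List U → R} {c : ℤ × ℤ} (hα : WordDeg deg T c α) {σ : U → U}
    (hσ : ∀ z, ∀ x ∈ deg z, σ x ∈ deg z) {b : List U → U} (hb : WordDeg deg deg (1, 0) b) :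
    WordDeg deg T ((1, 0) + c) (bstar σ b α) := by
  refine wordDeg_splitSum fun u r du dr hu hr => splitSum_mem _ fun v t hvt => ?_
  subst hvt
  obtain ⟨dv, dt, rfl, hv, ht⟩ := hr.of_append
  have := hα _ _ ((hu.map (f := σ) hσ).append (.cons (hb v dv hv) ht))
  rw [List.sum_append, List.sum_cons] at this
  rw [List.sum_append]
  convert this using 2
  abel

theorem WordDeg.hpull {α : List U' → R} {c : ℤ × ℤ} (hα : WordDeg deg' T c α) {h : List U → U'}
    (hh : WordDeg deg deg' 0 h) : WordDeg deg T c (hpull h α) := by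
  intro l ds hl
  refine hpull_mem _ fun L hL => ?_
  suffices ∃ DS, HomogWord deg' (L.map h) DS ∧ DS.sum = ds.sum by
    obtain ⟨DS, h1, h2⟩ := this
    rw [← h2]; exact hα _ _ h1
  subst hL
  induction L generalizing ds with
  | nil => obtain rfl := List.forall₂_nil_left_iff.1 hl; exact ⟨[], .nil, rfl⟩
  | cons u L ih =>
    rw [List.flatten_cons] at hl
    obtain ⟨du, dv, rfl, hu, hv⟩ := hl.of_append
    obtain ⟨DS, h1, h2⟩ := ih _ hv
    refine ⟨(du.sum + 0) :: DS, .cons (hh _ _ hu) h1, ?_⟩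
    rw [List.sum_cons, h2, List.sum_append, add_zero]

end Homogeneous

/-! ### Coderivations of square zero -/

section Coderivation
variable {k U R : Type*} [Field k] [AddCommGroup U] [Module k U] [AddCommGroup R] [Module k R]
  {σ : U →ₗ[k] U} {b : List U → U}

/-- When `b` vanishes on words of length at most one, every replacement that contributes shortens
the word. This is where `m_1 = 0` enters the inductions on length. -/
theorem bstar_congr {α β : List U → R} (hα : ListLin k α) (hβ : ListLin k β) (hb0 : b [] = 0)
    (hb1 : ∀ x, b [x] = 0) {w : List U} (H : ∀ l : List U, l.length < w.length → α l = β l) :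
    bstar σ b α w = bstar σ b β w := by
  refine splitSum_congr fun u r hur => splitSum_congr fun v t hvt => ?_
  match v with
  | [] => rw [hb0, hα.map_zero, hβ.map_zero]
  | [x] => rw [hb1, hα.map_zero, hβ.map_zero]
  | x :: y :: v =>
    refine H _ ?_
    rw [← hur, ← hvt]
    simp

theorem bstar_cons (hb0 : b [] = 0) {α : List U → R} (hα : ListLin k α) (x : U) (w : List U) :
    bstar σ b α (x :: w) = splitSum (fun v t => α (b (x :: v) :: t)) w +
      bstar σ b (fun l => α (σ x :: l)) w := by
  simp only [bstar, splitSum_cons, List.map_nil, List.nil_append, hb0, hα.map_zero_cons,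
    zero_add, List.map_cons, List.cons_append]

/-- Replacements of two disjoint blocks cancel in pairs, since `b` anticommutes with `σ`; nested
replacements are collected by the identity `hbb` for the corestriction. -/
theorem bstar_bstar (hb : ListLin k b) (hb0 : b [] = 0)
    (hσ : ∀ l, b (l.map σ) = -σ (b l)) (hbb : ∀ l, bstar σ b b l = 0) {α : List U → R}
    (hα : ListLin k α) (w : List U) : bstar σ b (bstar σ b α) w = 0 := by
  induction w generalizing α with
  | nil =>
    change bstar σ b α [b []] = 0
    rw [hb0]
    exact (hα.bstar σ hb).map_zero_cons []
  | cons x w ih =>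
    have hBα := hα.bstar σ hb
    rw [bstar_cons hb0 hBα]
    simp only [bstar_cons hb0 hα]
    -- The induction hypothesis removes the terms in which both replacements avoid the first letter.
    have e1 : bstar σ b (fun l => splitSum (fun v t => α (b (σ x :: v) :: t)) l +
        bstar σ b (fun l => α (σ (σ x) :: l)) l) w =
        bstar σ b (splitSum fun v t => α (b (σ x :: v) :: t)) w := by
      have := bstar_sub σ b (fun l => splitSum (fun v t => α (b (σ x :: v) :: t)) l +
        bstar σ b (fun l => α (σ (σ x) :: l)) l) (bstar σ b fun l => α (σ (σ x) :: l)) w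
      rw [ih (hα.cons _), sub_zero] at this
      rw [← this]
      congr 1
      funext l
      exact add_sub_cancel_right _ _
    rw [e1, bstar_splitSum, splitSum_add]
    have e2 : splitSum (fun s t => bstar σ b (fun v => α (b (σ x :: s.map σ) :: v)) t) w =
        -splitSum (fun v t => bstar σ b (fun l => α (σ (b (x :: v)) :: l)) t) w := by
      rw [← splitSum_neg]
      refine splitSum_congr fun s t _ => ?_
      have h3 : b (σ x :: s.map σ) = -σ (b (x :: s)) := hσ (x :: s)
      rw [h3]
      have h4 : ∀ (y : U) l, α (-y :: l) = -α (y :: l) := fun y l => (hα [] l).map_neg y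
      simp only [h4]
      exact (map_bstar (-(LinearMap.id : R →ₗ[k] R)) σ b _ t).symm
    have e3 : splitSum (fun v t => splitSum (fun v_1 t => α (b (b (x :: v) :: v_1) :: t)) t) w +
        splitSum (fun s t => bstar σ b (fun u => α (b (σ x :: u) :: t)) s) w = 0 := by
      rw [← splitSum_assoc (fun v v1 t => α (b (b (x :: v) :: v1) :: t)), ← splitSum_add]
      refine splitSum_eq_zero fun s t _ => ?_
      have h5 : α (bstar σ b b (x :: s) :: t) = 0 := by rw [hbb, hα.map_zero_cons]
      rw [bstar_cons hb0 hb] at h5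
      rw [show α ((splitSum (fun v t => b (b (x :: v) :: t)) s +
        bstar σ b (fun l => b (σ x :: l)) s) :: t) = ((hα [] t).mk' _) (splitSum (fun v t =>
        b (b (x :: v) :: t)) s + bstar σ b (fun l => b (σ x :: l)) s) from rfl, map_add,
        map_splitSum, map_bstar] at h5
      exact h5
    rw [e2, show ∀ a c d : R, a + c + (d + -c) = a + d from fun a c d => by abel]
    exact e3

end Coderivation

/-! ### Convolution of families of operators and the Bianchi identity -/

section Convolution
variable {Y S L M N : Type*} [Ring S] [AddCommGroup L] [Module S L] [AddCommGroup M] [Module S M]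
  [AddCommGroup N] [Module S N]

/-- The convolution product of two families of operators indexed by words. -/
def conv (α : List Y → N →ₗ[S] M) (β : List Y → L →ₗ[S] N) (w : List Y) : L →ₗ[S] M :=
  splitSum (fun u v => α u ∘ₗ β v) w

theorem splitSum_comp (f : List Y → List Y → N →ₗ[S] M) (g : L →ₗ[S] N) (w : List Y) :
    splitSum f w ∘ₗ g = splitSum (fun u v => f u v ∘ₗ g) w := by
  induction w generalizing f with
  | nil => rfl
  | cons x w ih => simp only [splitSum_cons, LinearMap.add_comp, ih]

theorem comp_splitSum (f : List Y → List Y → L →ₗ[S] N) (g : N →ₗ[S] M) (w : List Y) :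
    g ∘ₗ splitSum f w = splitSum (fun u v => g ∘ₗ f u v) w := by
  induction w generalizing f with
  | nil => rfl
  | cons x w ih => simp only [splitSum_cons, LinearMap.comp_add, ih]

theorem conv_assoc {K : Type*} [AddCommGroup K] [Module S K] (α : List Y → N →ₗ[S] M)
    (β : List Y → L →ₗ[S] N) (γ : List Y → K →ₗ[S] L) (w : List Y) :
    conv (conv α β) γ w = conv α (conv β γ) w := by
  simp only [conv, splitSum_comp, comp_splitSum]
  exact splitSum_assoc (fun u v t => (α u ∘ₗ β v) ∘ₗ γ t) w

theorem conv_sub_left (α α' : List Y → N →ₗ[S] M) (β : List Y → L →ₗ[S] N) (w : List Y) :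
    conv (fun l => α l - α' l) β w = conv α β w - conv α' β w := by
  simp only [conv, LinearMap.sub_comp, splitSum_sub]

theorem conv_sub_right (α : List Y → N →ₗ[S] M) (β β' : List Y → L →ₗ[S] N) (w : List Y) :
    conv α (fun l => β l - β' l) w = conv α β w - conv α β' w := by
  simp only [conv, LinearMap.comp_sub, splitSum_sub]

theorem conv_map (σ : Y → Y) (α : List Y → N →ₗ[S] M) (β : List Y → L →ₗ[S] N) (w : List Y) :
    conv α β (w.map σ) = conv (fun l => α (l.map σ)) (fun l => β (l.map σ)) w := by
  rw [conv, splitSum_map]; rfl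

theorem bstar_comp (σ : Y → Y) (b : List Y → Y) (α : List Y → N →ₗ[S] M) (g : L →ₗ[S] N)
    (w : List Y) : bstar σ b α w ∘ₗ g = bstar σ b (fun l => α l ∘ₗ g) w := by
  simp only [bstar, splitSum_comp]

theorem comp_bstar (σ : Y → Y) (b : List Y → Y) (α : List Y → L →ₗ[S] N) (g : N →ₗ[S] M)
    (w : List Y) : g ∘ₗ bstar σ b α w = bstar σ b (fun l => g ∘ₗ α l) w := by
  simp only [bstar, comp_splitSum]

theorem bstar_conv (σ : Y → Y) (b : List Y → Y) (α : List Y → N →ₗ[S] M)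
    (β : List Y → L →ₗ[S] N) (w : List Y) :
    bstar σ b (conv α β) w =
      conv (bstar σ b α) β w + conv (fun l => α (l.map σ)) (bstar σ b β) w := by
  have := bstar_splitSum σ b (fun u v => α u ∘ₗ β v) w
  simp only [conv, bstar_comp, comp_bstar]
  exact this

end Convolution

section ListLinConv
variable {k S U L M N : Type*} [Field k] [Ring S] [AddCommGroup U] [Module k U] [AddCommGroup L]
  [Module S L] [AddCommGroup M] [Module S M] [AddCommGroup N] [Module S N] [Module k M]
  [Module k N] [SMulCommClass S k M] [SMulCommClass S k N]
  [LinearMap.CompatibleSMul N M k S]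

theorem ListLin.conv {α : List U → N →ₗ[S] M} {β : List U → L →ₗ[S] N} (hα : ListLin k α)
    (hβ : ListLin k β) : ListLin k (conv α β) := by
  refine listLin_splitSum (fun v u t => ?_) fun v u t => ?_
  · have : IsLinearMap k fun f : N →ₗ[S] M => f ∘ₗ β v :=
      ⟨fun _ _ => LinearMap.add_comp _ _ _, fun _ _ => LinearMap.smul_comp _ _ _⟩
    exact this.comp' (hα u t)
  · have : IsLinearMap k fun f : L →ₗ[S] N => α v ∘ₗ f :=
      ⟨fun _ _ => LinearMap.comp_add _ _ _, fun _ _ => LinearMap.comp_smul _ _ _⟩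
    exact this.comp' (hβ u t)

/-- The defect of `G` as a morphism of modules, over the coderivation `b`, from `F` to `Φ`. -/
def modDefect (σ : U → U) (b : List U → U) (F : List U → L →ₗ[S] L) (Φ : List U → M →ₗ[S] M)
    (G : List U → L →ₗ[S] M) (w : List U) : L →ₗ[S] M :=
  ExtAInf.conv (fun l => G (l.map σ)) F w - ExtAInf.conv Φ G w - bstar σ b G w

/-- A Bianchi identity: expand by the co-Leibniz rule, drop `b² = 0`, replace `bstar σ b F` by the
convolution square of `F`, and reassociate. The last term is the failure of `Φ` to satisfy the
equation that `F` satisfies. -/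
theorem bstar_modDefect {σ : U →ₗ[k] U} {b : List U → U} (hb : ListLin k b) (hb0 : b [] = 0)
    (hσσ : ∀ x, σ (σ x) = x) (hσ : ∀ l, b (l.map σ) = -σ (b l)) (hbb : ∀ l, bstar σ b b l = 0)
    {F : List U → L →ₗ[S] L} (hF : ∀ l, ExtAInf.conv (fun l => F (l.map σ)) F l = bstar σ b F l)
    {Φ : List U → M →ₗ[S] M} {G : List U → L →ₗ[S] M} (hG : ListLin k G) (w : List U) :
    bstar σ b (modDefect σ b F Φ G) w =
      ExtAInf.conv (fun l => modDefect σ b F Φ G (l.map σ)) F w +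
      ExtAInf.conv (fun l => Φ (l.map σ)) (modDefect σ b F Φ G) w +
      ExtAInf.conv (fun l => ExtAInf.conv (fun l => Φ (l.map σ)) Φ l - bstar σ b Φ l) G w := by
  have hmm : ∀ l : List U, (l.map σ).map σ = l := fun l => by
    rw [List.map_map]
    exact (List.map_congr_left fun x _ => hσσ x).trans (List.map_id l)
  have h1 : ∀ l, bstar σ b (fun l => G (l.map σ)) l = -bstar σ b G (l.map σ) := by
    intro l
    simp only [bstar, splitSum_map, ← splitSum_neg]
    refine splitSum_congr fun u r _ => splitSum_congr fun v t _ => ?_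
    rw [hσ, (hG _ _).map_neg, neg_neg, List.map_append, List.map_cons]
  have hF' : bstar σ b F = ExtAInf.conv (fun l => F (l.map σ)) F := funext fun l => (hF l).symm
  have e1 : bstar σ b (modDefect σ b F Φ G) w =
      -ExtAInf.conv (fun l => bstar σ b G (l.map σ)) F w +
      ExtAInf.conv G (ExtAInf.conv (fun l => F (l.map σ)) F) w -
      (ExtAInf.conv (bstar σ b Φ) G w + ExtAInf.conv (fun l => Φ (l.map σ)) (bstar σ b G) w) := by
    have h2 : bstar σ b (modDefect σ b F Φ G) w =
      bstar σ b (ExtAInf.conv (fun l => G (l.map σ)) F) w - bstar σ b (ExtAInf.conv Φ G) w -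
      bstar σ b (bstar σ b G) w := by
      rw [← bstar_sub, ← bstar_sub]; rfl
    rw [h2, bstar_bstar hb hb0 hσ hbb hG, sub_zero, bstar_conv, bstar_conv, hF',
      funext h1]
    simp only [hmm]
    congr 2
    simp only [ExtAInf.conv, LinearMap.neg_comp, splitSum_neg]
  have e2 : ∀ l, modDefect σ b F Φ G (l.map σ) = ExtAInf.conv G (fun l => F (l.map σ)) l -
      ExtAInf.conv (fun l => Φ (l.map σ)) (fun l => G (l.map σ)) l - bstar σ b G (l.map σ) := by
    intro l
    rw [modDefect, conv_map, conv_map]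
    simp only [hmm]
  rw [e1, funext e2, conv_sub_left, conv_sub_left, conv_sub_left]
  have e3 : ExtAInf.conv (fun l => Φ (l.map σ)) (modDefect σ b F Φ G) w =
      ExtAInf.conv (fun l => Φ (l.map σ)) (ExtAInf.conv (fun l => G (l.map σ)) F) w -
      ExtAInf.conv (fun l => Φ (l.map σ)) (ExtAInf.conv Φ G) w -
      ExtAInf.conv (fun l => Φ (l.map σ)) (bstar σ b G) w := by
    rw [← conv_sub_right, ← conv_sub_right]; rfl
  rw [e3]
  have a1 := conv_assoc G (fun l => F (l.map σ)) F w
  have a2 := conv_assoc (fun l => Φ (l.map σ)) (fun l => G (l.map σ)) F w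
  have a3 := conv_assoc (fun l => Φ (l.map σ)) Φ G w
  rw [← a1, ← a2, ← a3]
  abel

end ListLinConv

/-! ### Bar models and the cohomology of `Hom_A(P, P')` -/

section BarModel
universe w w'
variable {k : Type*} [Field k] {A : Type*} [Ring A] [Algebra k A]
  {P : Type w} [AddCommGroup P] [Module k P] [Module Aᵐᵒᵖ P] [IsScalarTower k Aᵐᵒᵖ P]
  {P' : Type w'} [AddCommGroup P'] [Module k P'] [Module Aᵐᵒᵖ P'] [IsScalarTower k Aᵐᵒᵖ P']
  {𝒜 : ℕ → Submodule k A}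

/-- The augmentation ideal `U` of an `A_∞`-Ext-algebra, with `U^q_i` the piece of cohomological
degree `q + 1`, together with a quasi-isomorphism to `End_A(P)`, in terms of the bar
construction: `b` is the corestriction of the differential and `F` the twisting cochain, extended
by the differential of `P` on the empty word. -/
structure BarModel (ρ : FreeResolution 𝒜 P) (U : Type*) [AddCommGroup U] [Module k U] where
  deg : ℤ × ℤ → Submodule k U
  isInternal : DirectSum.IsInternal deg
  deg_neg : ∀ z : ℤ × ℤ, z.1 < 0 → deg z = ⊥
  σ : U →ₗ[k] U
  σ_apply : ∀ z, ∀ x ∈ deg z, σ x = z.1.negOnePow • x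
  b : List U → U
  b_lin : ListLin k b
  b_nil : b [] = 0
  b_singleton : ∀ x, b [x] = 0
  b_deg : WordDeg deg deg (1, 0) b
  b_b : ∀ l, bstar σ b b l = 0
  F : List U → P →ₗ[Aᵐᵒᵖ] P
  F_lin : ListLin k F
  F_nil : F [] = ρ.d
  F_deg : WordDeg deg (homDeg A ρ.deg ρ.deg) (1, 0) F
  F_F : ∀ l, conv (fun l => F (l.map σ)) F l = bstar σ b F l
  inj : ∀ z, ∀ x ∈ deg z, ∀ g ∈ homDeg A ρ.deg ρ.deg z,
    (∀ p, F [x] p = ρ.d (g p) - z.1.negOnePow • g (ρ.d p)) → x = 0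
  surj : ∀ z : ℤ × ℤ, 0 ≤ z.1 → ∀ φ ∈ homDeg A ρ.deg ρ.deg (z + (1, 0)),
    (∀ p, ρ.d (φ p) = -(z.1.negOnePow • φ (ρ.d p))) → ∃ x ∈ deg z, ∃ g ∈ homDeg A ρ.deg ρ.deg z,
      ∀ p, φ p = F [x] p + (ρ.d (g p) - z.1.negOnePow • g (ρ.d p))

namespace BarModel
variable {U U' : Type*} [AddCommGroup U] [Module k U] [AddCommGroup U'] [Module k U']

section One
variable {ρ : FreeResolution 𝒜 P} (M : BarModel ρ U)

theorem σ_mem {z : ℤ × ℤ} {x : U} (hx : x ∈ M.deg z) : M.σ x ∈ M.deg z := by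
  rw [M.σ_apply z x hx]; exact units_smul_mem _ hx

theorem σ_σ (x : U) : M.σ (M.σ x) = x :=
  homogeneous_ext (f := M.σ ∘ₗ M.σ) (g := (LinearMap.id : U →ₗ[k] U)) M.isInternal
    (fun z x hx => by simp [M.σ_apply z x hx, units_smul_smul_self]) x

theorem map_σ {R : Type*} [AddCommGroup R] [Module k R] {α : List U → R} (hα : ListLin k α)
    {l : List U} {ds : List (ℤ × ℤ)} (hl : HomogWord M.deg l ds) :
    α (l.map M.σ) = ds.sum.1.negOnePow • α l := by
  rw [hα.map_sign (ε := Prod.fst) M.σ_apply hl, sum_map_fst]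

theorem b_σ (l : List U) : M.b (l.map M.σ) = -M.σ (M.b l) := by
  rw [← add_eq_zero_iff_eq_neg]
  have h1 := M.b_lin.map M.σ
  have h2 := M.b_lin.comp M.σ
  refine (h1.add h2).eq_zero_of_homogeneous M.isInternal (fun l ds hl _ => ?_) l rfl
  rw [M.map_σ M.b_lin hl, M.σ_apply _ _ (M.b_deg l ds hl)]
  simp [Int.negOnePow_succ]

/-- The one-letter case of the twisting cochain equation, in which `b` contributes nothing. -/
theorem F_cocycle {z : ℤ × ℤ} {x : U} (hx : x ∈ M.deg z) (p : P) :
    ρ.d (M.F [x] p) = -(z.1.negOnePow • M.F [x] (ρ.d p)) := by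
  have h := M.F_F [x]
  have h1 : M.F [0] = 0 := M.F_lin.map_zero_cons []
  have h2 : ∀ y, M.F [y, 0] = 0 := fun y => M.F_lin.map_zero [y] []
  have h3 : M.F [0, x] = 0 := M.F_lin.map_zero_cons [x]
  have h4 : M.F [M.σ x] = z.1.negOnePow • M.F [x] := by
    simpa using M.map_σ M.F_lin (l := [x]) (ds := [z]) (.cons hx .nil)
  simp only [conv, bstar, splitSum_cons, splitSum_nil, List.map_nil, List.nil_append, List.map_cons,
    List.cons_append, M.b_nil, M.b_singleton, h1, h2, h3, M.F_nil, add_zero, h4] at h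
  have := LinearMap.congr_fun h p
  simp only [LinearMap.add_apply, LinearMap.comp_apply, LinearMap.smul_apply,
    LinearMap.zero_apply] at this
  exact eq_neg_of_add_eq_zero_left this

end One

section Independence
-- The component of degree `z` is recovered from the action on elements of degree `y` by projecting
-- to degree `y + z`.
theorem homDeg_coe_injective (ρ : FreeResolution 𝒜 P) (ρ' : FreeResolution 𝒜 P') :
    Function.Injective (DirectSum.coeLinearMap (homDeg A ρ.deg ρ'.deg)) := by
  have key : ∀ (ψ : ⨁ z, homDeg A ρ.deg ρ'.deg z) (y z : ℤ × ℤ), ∀ x ∈ ρ.deg y,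
      gproj ρ'.isInternal (y + z) (DirectSum.coeLinearMap (homDeg A ρ.deg ρ'.deg) ψ x) =
        (ψ z).1 x := by
    intro ψ y z x hx
    induction ψ using DirectSum.induction_on with
    | zero => simp
    | add a b ha hb => simp [ha, hb]
    | of i f =>
      have hf := f.2 y x hx
      rw [DirectSum.coeLinearMap_of]
      by_cases hiz : i = z
      · subst hiz; rw [DirectSum.of_eq_same, gproj_of_mem _ hf]
      · rw [DirectSum.of_eq_of_ne _ _ _ (Ne.symm hiz),
          gproj_of_ne _ hf fun e => hiz (add_left_cancel e)]
        rfl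
  refine (injective_iff_map_eq_zero _).2 fun ψ hψ => ?_
  ext z : 2
  refine LinearMap.ext fun x => homogeneous_ext (f := (ψ z).1) (g := (0 : P →ₗ[Aᵐᵒᵖ] P'))
    ρ.isInternal (fun y x hx => ?_) x
  rw [← key ψ y z x hx, hψ]
  simp

/-- Linear maps defined degreewise on the homogeneous maps. -/
theorem exists_extend (ρ : FreeResolution 𝒜 P) (ρ' : FreeResolution 𝒜 P') {X : Type*}
    [AddCommGroup X] [Module k X] (L : ∀ z, homDeg A ρ.deg ρ'.deg z →ₗ[k] X) :
    ∃ f : (P →ₗ[Aᵐᵒᵖ] P') →ₗ[k] X, ∀ z φ, f φ.1 = L z φ := by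
  have hi : LinearMap.ker (DirectSum.coeLinearMap (homDeg A ρ.deg ρ'.deg)) = ⊥ :=
    LinearMap.ker_eq_bot'.2 fun ψ hψ => homDeg_coe_injective ρ ρ' (hψ.trans (map_zero _).symm)
  obtain ⟨g, hg⟩ := LinearMap.exists_leftInverse_of_injective (K := k)
    (V := ⨁ z, homDeg A ρ.deg ρ'.deg z) (V' := P →ₗ[Aᵐᵒᵖ] P')
    (DirectSum.coeLinearMap (homDeg A ρ.deg ρ'.deg)) hi
  refine ⟨DirectSum.toModule k _ _ L ∘ₗ g, fun z φ => ?_⟩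
  have h := LinearMap.congr_fun hg (DirectSum.lof k _ _ z φ)
  rw [LinearMap.comp_apply, DirectSum.coeLinearMap_lof] at h
  rw [LinearMap.comp_apply, h]
  simp

end Independence

section Sections
variable [GradedAlgebra 𝒜] (h𝒜 : IsConnectedLocallyFinite 𝒜)
  {ρ : FreeResolution 𝒜 P} {ρ' : FreeResolution 𝒜 P'} (M' : BarModel ρ' U')
  {g₀ : P →ₗ[Aᵐᵒᵖ] P'} (hg₀ : g₀ ∈ homDeg A ρ.deg ρ'.deg 0)
  (hd₀ : ∀ x, ρ'.d (g₀ x) = g₀ (ρ.d x)) (ha₀ : ∀ x, ρ'.aug (g₀ x) = ρ.aug x)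

omit [GradedAlgebra 𝒜] in
theorem comp_mem_homDeg {P₁ P₂ P₃ : Type*} [AddCommGroup P₁] [Module k P₁] [Module Aᵐᵒᵖ P₁]
    [IsScalarTower k Aᵐᵒᵖ P₁] [AddCommGroup P₂] [Module k P₂] [Module Aᵐᵒᵖ P₂]
    [IsScalarTower k Aᵐᵒᵖ P₂] [AddCommGroup P₃] [Module k P₃] [Module Aᵐᵒᵖ P₃]
    [IsScalarTower k Aᵐᵒᵖ P₃] {d₁ : ℤ × ℤ → Submodule k P₁} {d₂ : ℤ × ℤ → Submodule k P₂}
    {d₃ : ℤ × ℤ → Submodule k P₃} {y z : ℤ × ℤ} {f : P₂ →ₗ[Aᵐᵒᵖ] P₃} {g : P₁ →ₗ[Aᵐᵒᵖ] P₂}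
    (hf : f ∈ homDeg A d₂ d₃ y) (hg : g ∈ homDeg A d₁ d₂ z) :
    f ∘ₗ g ∈ homDeg A d₁ d₃ (z + y) := fun x p hp => by
  rw [← add_assoc]; exact hf _ _ (hg x p hp)

include h𝒜 hg₀ hd₀ ha₀ in
theorem exists_inverse : ∃ g₁ ∈ homDeg A ρ'.deg ρ.deg 0, (∀ x, ρ.d (g₁ x) = g₁ (ρ'.d x)) ∧
    (∃ h ∈ homDeg A ρ.deg ρ.deg (0 - (1, 0)), ∀ x, g₁ (g₀ x) - x = ρ.d (h x) + h (ρ.d x)) ∧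
    ∃ h ∈ homDeg A ρ'.deg ρ'.deg (0 - (1, 0)),
      ∀ x, g₀ (g₁ x) - x = ρ'.d (h x) + h (ρ'.d x) := by
  obtain ⟨g₁, hg₁, hd₁, ha₁⟩ := FreeResolution.exists_comparison h𝒜 ρ' ρ
  exact ⟨g₁, hg₁, hd₁,
    FreeResolution.exists_homotopy_one h𝒜 ρ ρ' hg₀ hd₀ ha₀ hg₁ hd₁ ha₁,
    FreeResolution.exists_homotopy_one h𝒜 ρ' ρ hg₁ hd₁ ha₁ hg₀ hd₀ ha₀⟩

include h𝒜 hg₀ hd₀ ha₀ in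
-- The comparison map `g₀` is a homotopy equivalence. Composing with its inverse turns the
-- hypothesis into a coboundary in `End_A(P')`, where `inj` applies; the homotopy `g₀ g₁ ∼ id`
-- contributes the second term of the primitive.
theorem eq_zero_of_comp {z : ℤ × ℤ} {x : U'} (hx : x ∈ M'.deg z) {g : P →ₗ[Aᵐᵒᵖ] P'}
    (hg : g ∈ homDeg A ρ.deg ρ'.deg z)
    (H : ∀ p, M'.F [x] (g₀ p) = ρ'.d (g p) - z.1.negOnePow • g (ρ.d p)) : x = 0 := by
  obtain ⟨g₁, hg₁, hd₁, -, h, hh, hh'⟩ := exists_inverse h𝒜 hg₀ hd₀ ha₀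
  have hF : M'.F [x] ∈ homDeg A ρ'.deg ρ'.deg (z + (1, 0)) := by
    simpa using M'.F_deg [x] [z] (.cons hx .nil)
  refine M'.inj z x hx (g ∘ₗ g₁ + z.1.negOnePow • (M'.F [x] ∘ₗ h)) (add_mem
    (homDeg_cast (by abel) (comp_mem_homDeg hg hg₁)) (units_smul_mem _
    (homDeg_cast (by abel) (comp_mem_homDeg hF hh)))) fun p => ?_
  have h1 := H (g₁ p)
  rw [hd₁] at h1
  have h2 := hh' p
  rw [sub_eq_iff_eq_add] at h2
  rw [h2, map_add, map_add] at h1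
  have h3 := M'.F_cocycle hx (h p)
  simp only [LinearMap.add_apply, LinearMap.smul_apply, LinearMap.comp_apply, map_add, smul_add,
    map_units_smul, units_smul_smul_self, h3, smul_neg] at h1 ⊢
  rw [← sub_eq_zero] at h1 ⊢
  rw [← h1]
  abel

include h𝒜 hg₀ hd₀ ha₀ in
-- The counterpart of `eq_zero_of_comp`, with the homotopy `g₁ g₀ ∼ id`: in shifted degrees `≥ 0`,
-- composition with `g₀` identifies `U'` with the cohomology of `Hom_A(P, P')`.
theorem exists_rep {z : ℤ × ℤ} (hz : 0 ≤ z.1) {φ : P →ₗ[Aᵐᵒᵖ] P'}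
    (hφ : φ ∈ homDeg A ρ.deg ρ'.deg (z + (1, 0)))
    (hd : ∀ p, ρ'.d (φ p) = -(z.1.negOnePow • φ (ρ.d p))) :
    ∃ x ∈ M'.deg z, ∃ g ∈ homDeg A ρ.deg ρ'.deg z,
      ∀ p, φ p = M'.F [x] (g₀ p) + (ρ'.d (g p) - z.1.negOnePow • g (ρ.d p)) := by
  obtain ⟨g₁, hg₁, hd₁, ⟨h, hh, hh'⟩, -⟩ := exists_inverse h𝒜 hg₀ hd₀ ha₀
  obtain ⟨x, hx, g, hg, H⟩ := M'.surj z hz (φ ∘ₗ g₁)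
    (homDeg_cast (by abel) (comp_mem_homDeg hφ hg₁)) (fun p => by simp [hd, hd₁])
  refine ⟨x, hx, g ∘ₗ g₀ + z.1.negOnePow • (φ ∘ₗ h), add_mem
    (homDeg_cast (by abel) (comp_mem_homDeg hg hg₀)) (units_smul_mem _
    (homDeg_cast (by abel) (comp_mem_homDeg hφ hh))), fun p => ?_⟩
  have h1 := H (g₀ p)
  rw [LinearMap.comp_apply] at h1
  have h2 := hh' p
  rw [sub_eq_iff_eq_add] at h2
  rw [h2, map_add, map_add] at h1
  simp only [LinearMap.add_apply, LinearMap.smul_apply, LinearMap.comp_apply, map_add, smul_add,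
    map_units_smul, units_smul_smul_self, hd, smul_neg, hd₀] at h1 ⊢
  rw [← sub_eq_zero] at h1 ⊢
  rw [← h1]
  abel

end Sections
end BarModel
end BarModel

section MapInto
variable {k X Y : Type*} [Field k] [AddCommGroup X] [Module k X] [AddCommGroup Y] [Module k Y]

theorem exists_linear_section (T : X →ₗ[k] Y) (N : Submodule k X) :
    ∃ L : Y →ₗ[k] X, ∀ y ∈ N.map T, L y ∈ N ∧ T (L y) = y := by
  obtain ⟨s, hs⟩ := (T.submoduleMap N).exists_rightInverse_of_surjective
    (LinearMap.range_eq_top.2 (T.submoduleMap_surjective N))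
  obtain ⟨L, hL⟩ := LinearMap.exists_extend (N.subtype ∘ₗ s)
  refine ⟨L, fun y hy => ?_⟩
  have h1 : L y = (s ⟨y, hy⟩ : X) := LinearMap.congr_fun hL ⟨y, hy⟩
  have h2 := congrArg Subtype.val (LinearMap.congr_fun hs ⟨y, hy⟩)
  rw [h1]
  exact ⟨(s ⟨y, hy⟩).2, h2⟩

end MapInto

/-! ### Obstruction theory for morphisms of bar models -/

section Modules
universe w w'
variable {k : Type*} [Field k] {A : Type*} [Ring A] [Algebra k A]

theorem WordDeg.conv {U : Type*} [AddCommGroup U] [Module k U]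
    {P₁ P₂ P₃ : Type*} [AddCommGroup P₁] [Module k P₁] [Module Aᵐᵒᵖ P₁]
    [IsScalarTower k Aᵐᵒᵖ P₁] [AddCommGroup P₂] [Module k P₂] [Module Aᵐᵒᵖ P₂]
    [IsScalarTower k Aᵐᵒᵖ P₂] [AddCommGroup P₃] [Module k P₃] [Module Aᵐᵒᵖ P₃]
    [IsScalarTower k Aᵐᵒᵖ P₃] {d₁ : ℤ × ℤ → Submodule k P₁} {d₂ : ℤ × ℤ → Submodule k P₂}
    {d₃ : ℤ × ℤ → Submodule k P₃} {deg : ℤ × ℤ → Submodule k U} {c c' : ℤ × ℤ}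
    {α : List U → P₂ →ₗ[Aᵐᵒᵖ] P₃} {β : List U → P₁ →ₗ[Aᵐᵒᵖ] P₂}
    (hα : WordDeg deg (homDeg A d₂ d₃) c α) (hβ : WordDeg deg (homDeg A d₁ d₂) c' β) :
    WordDeg deg (homDeg A d₁ d₃) (c + c') (conv α β) :=
  wordDeg_splitSum fun u v du dv hu hv =>
    homDeg_cast (by abel) (BarModel.comp_mem_homDeg (hα u du hu) (hβ v dv hv))

theorem WordDeg.sub {U R : Type*} [AddCommGroup U] [Module k U] [AddCommGroup R] [Module k R]
    {deg : ℤ × ℤ → Submodule k U} {T : ℤ × ℤ → Submodule k R} {c : ℤ × ℤ} {α β : List U → R}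
    (hα : WordDeg deg T c α) (hβ : WordDeg deg T c β) : WordDeg deg T c fun l => α l - β l :=
  fun l ds hl => sub_mem (hα l ds hl) (hβ l ds hl)

theorem WordDeg.add {U R : Type*} [AddCommGroup U] [Module k U] [AddCommGroup R] [Module k R]
    {deg : ℤ × ℤ → Submodule k U} {T : ℤ × ℤ → Submodule k R} {c : ℤ × ℤ} {α β : List U → R}
    (hα : WordDeg deg T c α) (hβ : WordDeg deg T c β) : WordDeg deg T c fun l => α l + β l :=
  fun l ds hl => add_mem (hα l ds hl) (hβ l ds hl)

variable {P : Type w} [AddCommGroup P] [Module k P] [Module Aᵐᵒᵖ P] [IsScalarTower k Aᵐᵒᵖ P]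
  {P' : Type w'} [AddCommGroup P'] [Module k P'] [Module Aᵐᵒᵖ P'] [IsScalarTower k Aᵐᵒᵖ P']
  {𝒜 : ℕ → Submodule k A} {U U' : Type*} [AddCommGroup U] [Module k U] [AddCommGroup U']
  [Module k U'] {ρ : FreeResolution 𝒜 P} {ρ' : FreeResolution 𝒜 P'}

namespace BarModel

section Section
variable [GradedAlgebra 𝒜] (h𝒜 : IsConnectedLocallyFinite 𝒜)
  (M' : BarModel ρ' U') {g₀ : P →ₗ[Aᵐᵒᵖ] P'} (hg₀ : g₀ ∈ homDeg A ρ.deg ρ'.deg 0)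
  (hd₀ : ∀ x, ρ'.d (g₀ x) = g₀ (ρ.d x)) (ha₀ : ∀ x, ρ'.aug (g₀ x) = ρ.aug x)

include h𝒜 hg₀ hd₀ ha₀ in
-- Representatives and primitives must depend linearly on the cocycle, because the corrections made
-- from them have to be multilinear in the letters.
theorem exists_rep_linear : ∃ (sec : (P →ₗ[Aᵐᵒᵖ] P') →ₗ[k] U')
    (hom : (P →ₗ[Aᵐᵒᵖ] P') →ₗ[k] (P →ₗ[Aᵐᵒᵖ] P')), ∀ z : ℤ × ℤ, 0 ≤ z.1 →
    ∀ φ ∈ homDeg A ρ.deg ρ'.deg (z + (1, 0)), (∀ p, ρ'.d (φ p) = -(z.1.negOnePow • φ (ρ.d p))) →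
      sec φ ∈ M'.deg z ∧ hom φ ∈ homDeg A ρ.deg ρ'.deg z ∧
      ∀ p, φ p = M'.F [sec φ] (g₀ p) + (ρ'.d (hom φ p) - z.1.negOnePow • hom φ (ρ.d p)) := by
  let T : ℤ × ℤ → U' × (P →ₗ[Aᵐᵒᵖ] P') →ₗ[k] (P →ₗ[Aᵐᵒᵖ] P') := fun z =>
    { toFun := fun x => M'.F [x.1] ∘ₗ g₀ + (ρ'.d ∘ₗ x.2 - z.1.negOnePow • x.2 ∘ₗ ρ.d)
      map_add' := fun x y => by
        have : M'.F [x.1 + y.1] = M'.F [x.1] + M'.F [y.1] := (M'.F_lin [] []).map_add _ _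
        simp only [Prod.fst_add, Prod.snd_add, this, LinearMap.add_comp, LinearMap.comp_add,
          smul_add]
        abel
      map_smul' := fun c x => by
        have : M'.F [c • x.1] = c • M'.F [x.1] := (M'.F_lin [] []).map_smul _ _
        ext p
        simp [this, smul_add, smul_sub, smul_comm c, LinearMap.map_smul_of_tower] }
  have hT : ∀ z x p, T z x p = M'.F [x.1] (g₀ p) +
      (ρ'.d (x.2 p) - z.1.negOnePow • x.2 (ρ.d p)) := fun z x p => rfl
  choose L hL using fun z => exists_linear_section (T z)
    ((M'.deg z).prod (homDeg A ρ.deg ρ'.deg z))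
  -- The sign in `T` depends on the degree, so the sections of different degrees are glued along the
  -- direct sum of the homogeneous maps. A cocycle of degree `y` is represented in degree `y - (1,
  -- 0)`.
  obtain ⟨f, hf⟩ := exists_extend ρ ρ' fun y => L (y - (1, 0)) ∘ₗ (homDeg A ρ.deg ρ'.deg y).subtype
  refine ⟨LinearMap.fst k _ _ ∘ₗ f, LinearMap.snd k _ _ ∘ₗ f, fun z hz φ hφ hd => ?_⟩
  have h1 : f φ = L z φ := by
    rw [hf _ ⟨φ, hφ⟩, add_sub_cancel_right]
    rfl
  obtain ⟨x, hx, g, hg, H⟩ := exists_rep h𝒜 M' hg₀ hd₀ ha₀ hz hφ hd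
  obtain ⟨h2, h3⟩ := hL z φ ⟨(x, g), ⟨hx, hg⟩, LinearMap.ext fun p => (H p).symm⟩
  rw [← h1] at h2 h3
  refine ⟨h2.1, h2.2, fun p => ?_⟩
  exact (LinearMap.congr_fun h3 p).symm.trans (hT z (f φ) p)

end Section

section Locality
variable (M : BarModel ρ U) (M' : BarModel ρ' U')

/-- `W_l` measures the failure of `G` to be a morphism of twisted modules along `h`. -/
abbrev defect (h : List U → U') (G : List U → P →ₗ[Aᵐᵒᵖ] P') : List U → P →ₗ[Aᵐᵒᵖ] P' :=
  modDefect M.σ M.b M.F (hpull h M'.F) G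

/-- The space `U` lives in nonnegative degrees, so a homogeneous word of negative total degree
contains a zero letter and every multilinear function vanishes on it. This covers the degrees about
which `surj` says nothing. -/
theorem zero_mem_or_nonneg {l : List U} {ds : List (ℤ × ℤ)} (hl : HomogWord M.deg l ds) :
    0 ≤ ds.sum.1 ∨ 0 ∈ l := by
  induction hl with
  | nil => exact .inl le_rfl
  | @cons x z l ds hx _ ih =>
    by_cases hz : z.1 < 0
    · rw [M.deg_neg z hz, Submodule.mem_bot] at hx
      exact .inr (hx ▸ List.mem_cons_self)
    · rcases ih with ih | ih
      · left
        rw [List.sum_cons, Prod.fst_add]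
        omega
      · exact .inr (List.mem_cons_of_mem _ ih)

variable {M M'}

theorem listLin_defect {h : List U → U'} {G : List U → P →ₗ[Aᵐᵒᵖ] P'} (hh : ListLin k h)
    (hG : ListLin k G) : ListLin k (M.defect M' h G) :=
  (((hG.map M.σ).conv M.F_lin).sub ((M'.F_lin.hpull hh).conv hG)).sub (hG.bstar M.σ M.b_lin)

theorem wordDeg_defect {h : List U → U'} {G : List U → P →ₗ[Aᵐᵒᵖ] P'}
    (hh : WordDeg M.deg M'.deg 0 h) (hG : WordDeg M.deg (homDeg A ρ.deg ρ'.deg) 0 G) :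
    WordDeg M.deg (homDeg A ρ.deg ρ'.deg) (1, 0) (M.defect M' h G) := by
  have hσ : ∀ z, ∀ x ∈ M.deg z, M.σ x ∈ M.deg z := fun z x hx => M.σ_mem hx
  have h1 : WordDeg M.deg (homDeg A ρ.deg ρ'.deg) 0 fun l => G (l.map M.σ) :=
    fun l ds hl => hG _ _ (hl.map hσ)
  have h2 := h1.conv M.F_deg
  have h3 := (M'.F_deg.hpull hh).conv hG
  have h4 := hG.bstar hσ M.b_deg
  rw [zero_add] at h2
  rw [add_zero] at h3 h4
  exact (h2.sub h3).sub h4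

theorem defect_nil {h : List U → U'} {G : List U → P →ₗ[Aᵐᵒᵖ] P'} (hG : ListLin k G) :
    M.defect M' h G [] = G [] ∘ₗ ρ.d - ρ'.d ∘ₗ G [] := by
  simp [defect, modDefect, conv, bstar, M.b_nil, hG.map_zero_cons, M.F_nil, M'.F_nil]

/-- By minimality `b` and `b'` vanish on single letters, so the value of `h` on `w` itself drops out
of the defect at `w`. -/
theorem homDefect_congr {h h' : List U → U'} (hh : ListLin k h) (hh' : ListLin k h') (w : List U)
    (H : ∀ l : List U, l.length < w.length → h l = h' l) :
    homDefect M.σ M.b M'.b h w = homDefect M.σ M.b M'.b h' w := by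
  rw [homDefect, homDefect, bstar_congr hh hh' M.b_nil M.b_singleton H]
  rcases eq_or_ne w [] with rfl | hw
  · rfl
  · rw [hpull_of_singleton (h := h) (h' := h') M'.b hw H, M'.b_singleton, M'.b_singleton, sub_zero,
      add_zero]

/-- The values on the full word are convolved only with values on the empty word, which are the
differentials and `G []`. The defect therefore moves by the coboundary of the change in `G` and by
`M'.F` of the change in `h`. -/
theorem defect_congr {h h' : List U → U'} {G G' : List U → P →ₗ[Aᵐᵒᵖ] P'} (hG : ListLin k G)
    (hG' : ListLin k G') {w : List U} (hw : w ≠ [])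
    (Hh : ∀ l : List U, l.length < w.length → h l = h' l)
    (HG : ∀ l : List U, l.length < w.length → G l = G' l) (p : P) :
    M.defect M' h' G' w p = M.defect M' h G w p + (G' (w.map M.σ) - G (w.map M.σ)) (ρ.d p) -
      (M'.F [h' w] - M'.F [h w]) (G [] p) - ρ'.d ((G' w - G w) p) := by
  have hn : ([] : List U).length < w.length := List.length_pos_iff.2 hw
  have e1 : conv (fun l => G' (l.map M.σ)) M.F w - conv (fun l => G (l.map M.σ)) M.F w =
      (G' (w.map M.σ) - G (w.map M.σ)) ∘ₗ ρ.d := by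
    rw [← conv_sub_left, conv, splitSum_eq_last, M.F_nil]
    intro u v huv hv
    rw [← HG, sub_self, LinearMap.zero_comp]
    have := List.length_pos_iff.2 hv
    rw [← huv, List.length_map, List.length_append]
    omega
  have e2 : conv (hpull h' M'.F) G' w - conv (hpull h M'.F) G w =
      ρ'.d ∘ₗ (G' w - G w) + (M'.F [h' w] - M'.F [h w]) ∘ₗ G [] := by
    rw [conv, conv, ← splitSum_sub, splitSum_eq_ends hw, HG [] hn,
      hpull_of_singleton M'.F hw Hh, hpull_nil, hpull_nil, M'.F_nil]
    · simp only [LinearMap.add_comp, LinearMap.comp_sub, LinearMap.sub_comp]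
      abel
    · intro u v huv hu hv
      have h1 := List.length_pos_iff.2 hv
      have h2 := List.length_pos_iff.2 hu
      have h3 : u.length + v.length = w.length := by rw [← huv, List.length_append]
      rw [HG v (by omega), hpull_congr M'.F fun l hl => Hh l (by omega), sub_self]
  have e3 := bstar_congr (σ := M.σ) hG hG' M.b_nil M.b_singleton HG
  have e4 : M.defect M' h' G' w - M.defect M' h G w =
      (G' (w.map M.σ) - G (w.map M.σ)) ∘ₗ ρ.d -
      (ρ'.d ∘ₗ (G' w - G w) + (M'.F [h' w] - M'.F [h w]) ∘ₗ G []) := by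
    rw [← e1, ← e2, defect, defect, modDefect, modDefect, e3]
    abel
  have e5 := LinearMap.congr_fun (sub_eq_iff_eq_add.1 e4) p
  rw [e5]
  simp only [LinearMap.add_apply, LinearMap.sub_apply, LinearMap.comp_apply]
  abel

end Locality

section Obstruction
variable {M : BarModel ρ U} {M' : BarModel ρ' U'} {g₀ : P →ₗ[Aᵐᵒᵖ] P'}

variable (M M' g₀) in
/-- `(h, G)` is a morphism up to words of length `n`. -/
structure PartialHom (n : ℕ) (h : List U → U') (G : List U → P →ₗ[Aᵐᵒᵖ] P') : Prop where
  h_lin : ListLin k h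
  h_nil : h [] = 0
  h_deg : WordDeg M.deg M'.deg 0 h
  G_lin : ListLin k G
  G_nil : G [] = g₀
  G_deg : WordDeg M.deg (homDeg A ρ.deg ρ'.deg) 0 G
  homDefect_eq : ∀ l : List U, l.length ≤ n → homDefect M.σ M.b M'.b h l = 0
  defect_eq : ∀ l : List U, l.length ≤ n → M.defect M' h G l = 0

theorem PartialHom.h_σ {n : ℕ} {h : List U → U'} {G : List U → P →ₗ[Aᵐᵒᵖ] P'}
    (H : PartialHom M M' g₀ n h G) (l : List U) : h (l.map M.σ) = M'.σ (h l) := by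
  rw [← sub_eq_zero]
  refine ((H.h_lin.map M.σ).sub (H.h_lin.comp M'.σ)).eq_zero_of_homogeneous M.isInternal
    (fun l ds hl _ => ?_) l rfl
  have := H.h_deg l ds hl
  rw [add_zero] at this
  rw [M.map_σ H.h_lin hl, M'.σ_apply _ _ this, sub_self]

theorem PartialHom.zero (hg₀ : g₀ ∈ homDeg A ρ.deg ρ'.deg 0)
    (hd₀ : ∀ x, ρ'.d (g₀ x) = g₀ (ρ.d x)) :
    PartialHom M M' g₀ 0 (fun _ => 0) (fun l => if l = [] then g₀ else 0) where
  h_lin u t := ⟨fun _ _ => (add_zero 0).symm, fun c _ => (smul_zero c).symm⟩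
  h_nil := rfl
  h_deg l ds _ := Submodule.zero_mem _
  G_lin u t := by
    simp only [List.append_eq_nil_iff, reduceCtorEq, and_false, if_false]
    exact ⟨fun _ _ => (add_zero 0).symm, fun c _ => (smul_zero c).symm⟩
  G_nil := if_pos rfl
  G_deg l ds hl := by
    change (if l = [] then g₀ else 0) ∈ _
    split_ifs with h
    · subst h
      obtain rfl := List.forall₂_nil_left_iff.1 hl
      exact hg₀
    · exact Submodule.zero_mem _
  homDefect_eq l hl := by
    obtain rfl := List.length_eq_zero_iff.1 (Nat.le_zero.1 hl)
    simp [homDefect, bstar, M'.b_nil]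
  defect_eq l hl := by
    obtain rfl := List.length_eq_zero_iff.1 (Nat.le_zero.1 hl)
    ext p
    simp [defect, modDefect, conv, bstar, M'.F_nil, M.F_nil, hd₀]

/-- In the Bianchi identity on words of length `n + 1`, every term with a defect on a shorter word
vanishes; the extreme decompositions remain. -/
theorem PartialHom.bstar_defect {n : ℕ} {h : List U → U'} {G : List U → P →ₗ[Aᵐᵒᵖ] P'}
    (H : PartialHom M M' g₀ n h G) {w : List U} (hw : w.length = n + 1) (p : P) :
    M.defect M' h G (w.map M.σ) (ρ.d p) + ρ'.d (M.defect M' h G w p) +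
      M'.F [homDefect M.σ M.b M'.b h w] (g₀ p) = 0 := by
  have key := bstar_modDefect M.b_lin M.b_nil M.σ_σ M.b_σ M.b_b M.F_F (Φ := hpull h M'.F) H.G_lin w
  change bstar M.σ M.b (M.defect M' h G) w = conv (fun l => M.defect M' h G (l.map M.σ)) M.F w +
    conv (fun l => hpull h M'.F (l.map M.σ)) (M.defect M' h G) w + _ at key
  have e0 : bstar M.σ M.b (M.defect M' h G) w = 0 := by
    rw [bstar_congr (β := fun _ => 0) (listLin_defect H.h_lin H.G_lin)
      (fun _ _ => ⟨fun _ _ => (add_zero 0).symm, fun c _ => (smul_zero c).symm⟩)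
      M.b_nil M.b_singleton fun l hl => H.defect_eq l (by omega)]
    exact splitSum_eq_zero fun _ _ _ => splitSum_eq_zero fun _ _ _ => rfl
  have e1 : conv (fun l => M.defect M' h G (l.map M.σ)) M.F w =
      M.defect M' h G (w.map M.σ) ∘ₗ ρ.d := by
    rw [conv, splitSum_eq_last, M.F_nil]
    intro u v huv hv
    have h1 := List.length_pos_iff.2 hv
    have h3 : u.length + v.length = w.length := by rw [← huv, List.length_append]
    rw [H.defect_eq _ (by rw [List.length_map]; omega), LinearMap.zero_comp]
  have e2 : conv (fun l => hpull h M'.F (l.map M.σ)) (M.defect M' h G) w =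
      ρ'.d ∘ₗ M.defect M' h G w := by
    rw [conv, splitSum_eq_first, List.map_nil, hpull_nil, M'.F_nil]
    intro u v huv hu
    have h1 := List.length_pos_iff.2 hu
    have h3 : u.length + v.length = w.length := by rw [← huv, List.length_append]
    rw [H.defect_eq _ (by omega), LinearMap.comp_zero]
  -- The twisting cochain equation of `M'.F`, pulled back along `h`, fails only through the defect
  -- of `h`, which by `hpull_bstar_sub` appears as a single block.
  have e3 : ∀ l : List U, l.length ≤ n + 1 → conv (fun l => hpull h M'.F (l.map M.σ))
      (hpull h M'.F) l - bstar M.σ M.b (hpull h M'.F) l =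
      M'.F [homDefect M.σ M.b M'.b h l] := by
    intro l hl
    rw [← hpull_bstar_sub H.h_lin H.h_σ M.b_nil M'.b_nil (n := n + 1)
      (fun w hw => H.homDefect_eq w (by omega)) M'.F_lin l hl,
      ← show conv (fun l => M'.F (l.map M'.σ)) M'.F = bstar M'.σ M'.b M'.F from funext M'.F_F]
    congr 1
    have : ∀ l, hpull h M'.F (l.map M.σ) = hpull h (fun l => M'.F (l.map M'.σ)) l :=
      fun l => hpull_map (fun u => H.h_σ u) _ l
    simp only [this]
    have h5 := hpull_splitSum h (fun u v => M'.F (u.map M'.σ) ∘ₗ M'.F v) l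
    refine Eq.trans ?_ h5.symm
    refine splitSum_congr fun u v _ => ?_
    have h6 : ∀ (T : Module.End Aᵐᵒᵖ P'), hpull h (fun l => T ∘ₗ M'.F l) v = T ∘ₗ hpull h M'.F v :=
      fun T => (map_hpull ((AddMonoidHom.mk' (fun f : Module.End Aᵐᵒᵖ P' => T ∘ₗ f)
        fun _ _ => LinearMap.comp_add _ _ _)) _ _ _).symm
    simp only [h6]
    exact map_hpull ((AddMonoidHom.mk' (fun f : Module.End Aᵐᵒᵖ P' => f ∘ₗ hpull h M'.F v)
        fun _ _ => LinearMap.add_comp _ _ _)) _ _ _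
  have e4 : conv (fun l => conv (fun l => hpull h M'.F (l.map M.σ)) (hpull h M'.F) l -
      bstar M.σ M.b (hpull h M'.F) l) G w = M'.F [homDefect M.σ M.b M'.b h w] ∘ₗ g₀ := by
    rw [conv, splitSum_eq_last, e3 w hw.le, H.G_nil]
    intro u v huv hv
    have h1 := List.length_pos_iff.2 hv
    have h3 : u.length + v.length = w.length := by rw [← huv, List.length_append]
    rw [e3 u (by omega), H.homDefect_eq u (by omega), M'.F_lin.map_zero_cons, LinearMap.zero_comp]
  rw [e0, e1, e2, e4] at key
  exact (LinearMap.congr_fun key p).symm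

/-- By `bstar_defect`, the defect of `h` represents a coboundary of `Hom_A(P, P')`, and
`eq_zero_of_comp` kills it. The morphism equation thus holds in the next length before any
correction is made. -/
theorem PartialHom.homDefect_succ {n : ℕ} {h : List U → U'} {G : List U → P →ₗ[Aᵐᵒᵖ] P'}
    [GradedAlgebra 𝒜] (h𝒜 : IsConnectedLocallyFinite 𝒜) (hg₀ : g₀ ∈ homDeg A ρ.deg ρ'.deg 0)
    (hd₀ : ∀ x, ρ'.d (g₀ x) = g₀ (ρ.d x)) (ha₀ : ∀ x, ρ'.aug (g₀ x) = ρ.aug x)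
    (H : PartialHom M M' g₀ n h G) (w : List U) (hw : w.length = n + 1) :
    homDefect M.σ M.b M'.b h w = 0 := by
  have hlin := (M'.b_lin.hpull H.h_lin).sub (H.h_lin.bstar M.σ M.b_lin)
  refine hlin.eq_zero_of_homogeneous M.isInternal (fun l ds hl hln => ?_) w hw
  have hdeg : hpull h M'.b l - bstar M.σ M.b h l ∈ M'.deg (ds.sum + (1, 0)) := by
    have h1 := M'.b_deg.hpull H.h_deg l ds hl
    have h2 := H.h_deg.bstar (fun z x hx => M.σ_mem hx) M.b_deg l ds hl
    rw [add_zero] at h2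
    exact sub_mem h1 h2
  have hW := wordDeg_defect H.h_deg H.G_deg l ds hl
  refine eq_zero_of_comp h𝒜 M' hg₀ hd₀ ha₀ hdeg (g := -M.defect M' h G l) (neg_mem hW)
    fun p => ?_
  have key := H.bstar_defect hln p
  rw [M.map_σ (listLin_defect H.h_lin H.G_lin) hl] at key
  rw [homDefect] at key
  have e : ((ds.sum + (1, 0)).1).negOnePow = -(ds.sum.1).negOnePow := by
    rw [Prod.fst_add, Int.negOnePow_succ]
  rw [e]
  simp only [LinearMap.neg_apply, map_neg, LinearMap.smul_apply, Units.neg_smul,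
    smul_neg, neg_neg] at key ⊢
  rw [← sub_eq_zero, ← key]
  abel

theorem _root_.ExtAInf.ListLin.eq_zero_of_mem {R : Type*} [AddCommGroup R] [Module k R]
    {α : List U → R} (hα : ListLin k α) {l : List U} (h : 0 ∈ l) : α l = 0 := by
  obtain ⟨u, t, rfl⟩ := List.append_of_mem h
  exact hα.map_zero u t

theorem WordDeg.ite_length {R : Type*} [AddCommGroup R] [Module k R]
    {deg : ℤ × ℤ → Submodule k U} {T : ℤ × ℤ → Submodule k R} {c : ℤ × ℤ} {α : List U → R} {n : ℕ}
    (hα : ∀ l ds, HomogWord deg l ds → l.length = n → α l ∈ T (ds.sum + c)) :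
    WordDeg deg T c fun l => if l.length = n then α l else 0 := fun l ds hl => by
  by_cases h : l.length = n
  · simpa only [if_pos h] using hα l ds hl h
  · simp only [if_neg h]
    exact Submodule.zero_mem _

/-- Since `h` has no defect in length `n + 1`, the defect of `G` there is a cocycle. Its class is
added to `h` and its primitive to `G`, which cancels it; by `homDefect_congr` this does not disturb
the equation for `h`. -/
theorem PartialHom.succ {n : ℕ} {h : List U → U'} {G : List U → P →ₗ[Aᵐᵒᵖ] P'}
    [GradedAlgebra 𝒜] (h𝒜 : IsConnectedLocallyFinite 𝒜) (hg₀ : g₀ ∈ homDeg A ρ.deg ρ'.deg 0)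
    (hd₀ : ∀ x, ρ'.d (g₀ x) = g₀ (ρ.d x)) (ha₀ : ∀ x, ρ'.aug (g₀ x) = ρ.aug x)
    {sec : (P →ₗ[Aᵐᵒᵖ] P') →ₗ[k] U'} {hom : (P →ₗ[Aᵐᵒᵖ] P') →ₗ[k] (P →ₗ[Aᵐᵒᵖ] P')}
    (hsec : ∀ z : ℤ × ℤ, 0 ≤ z.1 →
      ∀ φ ∈ homDeg A ρ.deg ρ'.deg (z + (1, 0)), (∀ p, ρ'.d (φ p) = -(z.1.negOnePow • φ (ρ.d p))) →
      sec φ ∈ M'.deg z ∧ hom φ ∈ homDeg A ρ.deg ρ'.deg z ∧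
      ∀ p, φ p = M'.F [sec φ] (g₀ p) + (ρ'.d (hom φ p) - z.1.negOnePow • hom φ (ρ.d p)))
    (H : PartialHom M M' g₀ n h G) :
    PartialHom M M' g₀ (n + 1)
      (fun l => h l + if l.length = n + 1 then sec (M.defect M' h G l) else 0)
      (fun l => G l + if l.length = n + 1 then hom (M.defect M' h G l) else 0) := by
  have hWlin := listLin_defect (M := M) (M' := M') H.h_lin H.G_lin
  have hHD := H.homDefect_succ h𝒜 hg₀ hd₀ ha₀
  have hW : ∀ l ds, HomogWord M.deg l ds → l.length = n + 1 → 0 ≤ ds.sum.1 →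
      sec (M.defect M' h G l) ∈ M'.deg ds.sum ∧
      hom (M.defect M' h G l) ∈ homDeg A ρ.deg ρ'.deg ds.sum ∧
      ∀ p, M.defect M' h G l p = M'.F [sec (M.defect M' h G l)] (g₀ p) +
        (ρ'.d (hom (M.defect M' h G l) p) -
          ds.sum.1.negOnePow • hom (M.defect M' h G l) (ρ.d p)) := by
    intro l ds hl hln h0
    refine hsec _ h0 _ (wordDeg_defect H.h_deg H.G_deg l ds hl) fun p => ?_
    have key := H.bstar_defect hln p
    rw [M.map_σ hWlin hl, hHD l hln, M'.F_lin.map_zero_cons, LinearMap.zero_apply, add_zero,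
      LinearMap.smul_apply] at key
    exact eq_neg_of_add_eq_zero_right key
  have hlinh := H.h_lin.add ((hWlin.comp sec).ite_length (n + 1))
  have hlinG := H.G_lin.add ((hWlin.comp hom).ite_length (n + 1))
  have heqh : ∀ l : List U, l.length < n + 1 →
      h l = h l + if l.length = n + 1 then sec (M.defect M' h G l) else 0 := fun l hl => by
    rw [if_neg (by omega), add_zero]
  have heqG : ∀ l : List U, l.length < n + 1 →
      G l = G l + if l.length = n + 1 then hom (M.defect M' h G l) else 0 := fun l hl => by
    rw [if_neg (by omega), add_zero]
  refine ⟨hlinh, ?_, H.h_deg.add (WordDeg.ite_length fun l ds hl hln => ?_), hlinG, ?_,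
    H.G_deg.add (WordDeg.ite_length fun l ds hl hln => ?_), fun l hl => ?_, fun l hl => ?_⟩
  · rw [← heqh [] (by simp), H.h_nil]
  · rw [add_zero]
    rcases M.zero_mem_or_nonneg hl with h0 | h0
    · exact (hW l ds hl hln h0).1
    · rw [(hWlin.comp sec).eq_zero_of_mem h0]
      exact Submodule.zero_mem _
  · rw [← heqG [] (by simp), H.G_nil]
  · rw [add_zero]
    rcases M.zero_mem_or_nonneg hl with h0 | h0
    · exact (hW l ds hl hln h0).2.1
    · rw [(hWlin.comp hom).eq_zero_of_mem h0]
      exact Submodule.zero_mem _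
  · rw [← homDefect_congr H.h_lin hlinh l fun v hv => heqh v (by omega)]
    rcases Nat.lt_or_eq_of_le hl with hl | hl
    · exact H.homDefect_eq l (by omega)
    · exact hHD l hl
  · rcases eq_or_ne l [] with rfl | hl0
    · have h1 := H.defect_eq [] (by simp)
      rw [defect_nil H.G_lin] at h1
      rw [defect_nil hlinG, ← heqG [] (by simp), h1]
    · rcases Nat.lt_or_eq_of_le hl with hl | hl
      · ext p
        rw [defect_congr H.G_lin hlinG hl0 (fun v hv => heqh v (by omega))
          (fun v hv => heqG v (by omega)), if_neg (by simp; omega),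
          if_neg (by omega), if_neg (by omega), H.defect_eq l (by omega)]
        simp
      · refine (listLin_defect hlinh hlinG).eq_zero_of_homogeneous M.isInternal
          (fun l ds hHl hl => ?_) l hl
        rcases M.zero_mem_or_nonneg hHl with h0 | h0
        · ext p
          have hl0 : l ≠ [] := List.ne_nil_of_length_eq_add_one hl
          rw [defect_congr H.G_lin hlinG hl0 (fun v hv => heqh v (by omega))
            (fun v hv => heqG v (by omega)), if_pos (by simpa using hl), if_pos hl, if_pos hl]
          have e1 : hom (M.defect M' h G (l.map M.σ)) =
              ds.sum.1.negOnePow • hom (M.defect M' h G l) := M.map_σ (hWlin.comp hom) hHl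
          have e2 : M'.F [h l + sec (M.defect M' h G l)] =
              M'.F [h l] + M'.F [sec (M.defect M' h G l)] := (M'.F_lin [] []).map_add _ _
          rw [e1, e2, H.G_nil, (hW l ds hHl hl h0).2.2 p]
          simp only [LinearMap.smul_apply, LinearMap.zero_apply, add_sub_cancel_left]
          abel
        · exact (listLin_defect hlinh hlinG).eq_zero_of_mem h0

/-- The `A_∞`-morphism constructed by induction on the length of words. -/
theorem exists_hom [GradedAlgebra 𝒜] (h𝒜 : IsConnectedLocallyFinite 𝒜)
    (hg₀ : g₀ ∈ homDeg A ρ.deg ρ'.deg 0)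
    (hd₀ : ∀ x, ρ'.d (g₀ x) = g₀ (ρ.d x)) (ha₀ : ∀ x, ρ'.aug (g₀ x) = ρ.aug x) :
    ∃ h : List U → U', ListLin k h ∧ h [] = 0 ∧ WordDeg M.deg M'.deg 0 h ∧
      (∀ l, homDefect M.σ M.b M'.b h l = 0) ∧
      ∀ z, ∀ x ∈ M.deg z, ∃ g ∈ homDeg A ρ.deg ρ'.deg z, ∀ p,
        g₀ (M.F [x] p) - M'.F [h [x]] (g₀ p) = ρ'.d (g p) - z.1.negOnePow • g (ρ.d p) := by
  obtain ⟨sec, hom, hsec⟩ := exists_rep_linear h𝒜 M' hg₀ hd₀ ha₀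
  let step : ℕ → (List U → U') × (List U → P →ₗ[Aᵐᵒᵖ] P') →
      (List U → U') × (List U → P →ₗ[Aᵐᵒᵖ] P') := fun n q =>
    (fun l => q.1 l + if l.length = n + 1 then sec (M.defect M' q.1 q.2 l) else 0,
      fun l => q.2 l + if l.length = n + 1 then hom (M.defect M' q.1 q.2 l) else 0)
  let q : ℕ → (List U → U') × (List U → P →ₗ[Aᵐᵒᵖ] P') := fun n =>
    Nat.rec (fun _ => 0, fun l => if l = [] then g₀ else 0) step n
  have hq : ∀ n, PartialHom M M' g₀ n (q n).1 (q n).2 := fun n => by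
    induction n with
    | zero => exact PartialHom.zero hg₀ hd₀
    | succ n ih => exact ih.succ h𝒜 hg₀ hd₀ ha₀ hsec
  -- Step `n + 1` changes values only on words of length `n + 1`, so each word may be evaluated at
  -- the stage given by its own length.
  have hstab : ∀ n m, n ≤ m → ∀ l : List U, l.length ≤ n → (q m).1 l = (q n).1 l := by
    intro n m hnm l hl
    induction m, hnm using Nat.le_induction with
    | base => rfl
    | succ m hm ih =>
      rw [← ih]
      change (q m).1 l + (if l.length = m + 1 then _ else 0) = _
      rw [if_neg (by omega), add_zero]
  have hlim : ∀ n, ∀ l : List U, l.length ≤ n → (q l.length).1 l = (q n).1 l :=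
    fun n l hl => (hstab _ _ hl l le_rfl).symm
  have hlin : ListLin k fun l => (q l.length).1 l := by
    intro u t
    have := (hq (u.length + (t.length + 1))).h_lin u t
    simpa only [List.length_append, List.length_cons] using this
  refine ⟨fun l => (q l.length).1 l, hlin, (hq 0).h_nil,
    fun l ds hl => (hq l.length).h_deg l ds hl, fun l => ?_, fun z x hx => ?_⟩
  · rw [← (hq l.length).homDefect_eq l le_rfl]
    exact homDefect_congr hlin (hq _).h_lin l fun v hv => hlim _ _ hv.le
  -- On one-letter words the vanishing defect is a homotopy between `g₀ ∘ M.F [x]` and `M'.F [h [x]]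
  -- ∘ g₀`.
  · have H := hq 1
    refine ⟨(q 1).2 [x], by simpa using H.G_deg [x] [z] (.cons hx .nil), fun p => ?_⟩
    have h1 := H.defect_eq [x] le_rfl
    have h2 : ∀ y, (q 1).2 [y, 0] = 0 := fun y => H.G_lin.map_zero [y] []
    have h3 : (q 1).2 [0, x] = 0 := H.G_lin.map_zero_cons [x]
    have h4 : (q 1).2 [0] = 0 := H.G_lin.map_zero_cons []
    have h5 : (q 1).2 [M.σ x] = z.1.negOnePow • (q 1).2 [x] := by
      simpa using M.map_σ H.G_lin (l := [x]) (ds := [z]) (.cons hx .nil)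
    have h6 : hpull (q 1).1 M'.F [x] = M'.F [(q 1).1 [x]] := by
      simp [hpull_cons]
    simp only [defect, modDefect, conv, bstar, splitSum_cons, splitSum_nil, List.map_nil,
      List.nil_append, List.map_cons, List.cons_append, M.b_nil, M.b_singleton, h2, h3, h4, h5,
      H.G_nil, M.F_nil, M'.F_nil, hpull_nil, h6, add_zero, sub_zero] at h1
    have h7 := LinearMap.congr_fun h1 p
    simp only [LinearMap.add_apply, LinearMap.sub_apply, LinearMap.comp_apply,
      LinearMap.smul_apply, LinearMap.zero_apply] at h7
    change _ - M'.F [(q 1).1 [x]] (g₀ p) = _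
    rw [← sub_eq_zero, ← h7]
    abel

end Obstruction
end BarModel
end Modules

/-! ### Bijectivity of the linear part -/

section Bijective
universe w w'
variable {k : Type*} [Field k] {A : Type*} [Ring A] [Algebra k A]
  {P : Type w} [AddCommGroup P] [Module k P] [Module Aᵐᵒᵖ P] [IsScalarTower k Aᵐᵒᵖ P]
  {P' : Type w'} [AddCommGroup P'] [Module k P'] [Module Aᵐᵒᵖ P'] [IsScalarTower k Aᵐᵒᵖ P']
  {𝒜 : ℕ → Submodule k A} {U U' : Type*} [AddCommGroup U] [Module k U] [AddCommGroup U']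
  [Module k U'] {ρ : FreeResolution 𝒜 P} {ρ' : FreeResolution 𝒜 P'}

theorem bijective_of_homogeneous {deg : ℤ × ℤ → Submodule k U} {deg' : ℤ × ℤ → Submodule k U'}
    (hdeg : DirectSum.IsInternal deg) (hdeg' : DirectSum.IsInternal deg') (f : U →ₗ[k] U')
    (hf : ∀ z, ∀ x ∈ deg z, f x ∈ deg' z) (hinj : ∀ z, ∀ x ∈ deg z, f x = 0 → x = 0)
    (hsurj : ∀ z, ∀ y ∈ deg' z, ∃ x, f x = y) : Function.Bijective f := by
  refine ⟨(injective_iff_map_eq_zero f).2 fun x hx => eq_zero_of_gproj hdeg fun z => ?_,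
    fun y => homogeneous_induction hdeg' (p := fun y => ∃ x, f x = y) y hsurj ⟨0, map_zero f⟩ ?_⟩
  · refine hinj z _ (gproj_mem hdeg z x) ?_
    rw [map_gproj hdeg hdeg' f (c := 0) (fun y x hx => by rw [add_zero]; exact hf y x hx), hx,
      map_zero]
  · rintro _ _ ⟨x, rfl⟩ ⟨y, rfl⟩
    exact ⟨x + y, map_add f x y⟩

namespace BarModel
variable {M : BarModel ρ U} {M' : BarModel ρ' U'} {g₀ : P →ₗ[Aᵐᵒᵖ] P'} [GradedAlgebra 𝒜]

omit [GradedAlgebra 𝒜] in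
theorem F_mem (M : BarModel ρ U) {z : ℤ × ℤ} {x : U} (hx : x ∈ M.deg z) :
    M.F [x] ∈ homDeg A ρ.deg ρ.deg (z + (1, 0)) := by
  simpa using M.F_deg [x] [z] (.cons hx .nil)

/-- The homotopy equivalence `g₀` matches the class of `M.F [x]` with that of `M'.F [h [x]]`, and in
both models an element is determined by its class. -/
theorem exists_quasiIso (h𝒜 : IsConnectedLocallyFinite 𝒜) (M : BarModel ρ U)
    (M' : BarModel ρ' U') :
    ∃ h : List U → U', ListLin k h ∧ h [] = 0 ∧ WordDeg M.deg M'.deg 0 h ∧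
      (∀ l, homDefect M.σ M.b M'.b h l = 0) ∧ Function.Bijective fun x => h [x] := by
  obtain ⟨g₀, hg₀, hd₀, ha₀⟩ := FreeResolution.exists_comparison h𝒜 ρ ρ'
  obtain ⟨h, hlin, h0, hdeg, hHD, hg⟩ := exists_hom (M := M) (M' := M') h𝒜 hg₀ hd₀ ha₀
  refine ⟨h, hlin, h0, hdeg, hHD, ?_⟩
  have hdeg1 : ∀ z, ∀ x ∈ M.deg z, h [x] ∈ M'.deg z := fun z x hx => by
    simpa using hdeg [x] [z] (.cons hx .nil)
  obtain ⟨g₁, hg₁, hd₁, ⟨t, ht, htx⟩, t', ht', htx'⟩ := exists_inverse h𝒜 hg₀ hd₀ ha₀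
  refine bijective_of_homogeneous M.isInternal M'.isInternal ((hlin [] []).mk' _) hdeg1
    (fun z x hx hx0 => ?_) fun z y hy => ?_
  · obtain ⟨g, hgz, H⟩ := hg z x hx
    have hx0' : h [x] = 0 := hx0
    refine M.inj z x hx (g₁ ∘ₗ g - t ∘ₗ M.F [x]) (sub_mem
      (homDeg_cast (by abel) (comp_mem_homDeg hg₁ hgz))
      (homDeg_cast (by abel) (comp_mem_homDeg ht (M.F_mem hx)))) fun p => ?_
    have h1 := H p
    rw [hx0', M'.F_lin.map_zero_cons, LinearMap.zero_apply, sub_zero] at h1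
    have h2 := htx (M.F [x] p)
    rw [h1, M.F_cocycle hx] at h2
    simp only [LinearMap.sub_apply, LinearMap.comp_apply, map_sub, map_neg, map_units_smul,
      ← hd₁, smul_sub] at h2 ⊢
    rw [← sub_eq_zero] at h2 ⊢
    rw [← neg_eq_zero, ← h2]
    abel
  · by_cases hz : z.1 < 0
    · rw [M'.deg_neg z hz, Submodule.mem_bot] at hy
      exact ⟨0, by rw [map_zero, hy]⟩
    -- Transport the class of `y` to `End_A(P)` and represent it there by `x`; then `h [x] - y`
    -- represents zero.
    · obtain ⟨x, hx, g, hgz, hφ⟩ := M.surj z (not_lt.1 hz) (g₁ ∘ₗ M'.F [y] ∘ₗ g₀)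
        (homDeg_cast (by abel) (comp_mem_homDeg hg₁ (comp_mem_homDeg (M'.F_mem hy) hg₀)))
        fun p => by
          simp only [LinearMap.comp_apply, hd₁, M'.F_cocycle hy, hd₀, map_neg, map_units_smul]
      obtain ⟨a, ha, H⟩ := hg z x hx
      refine ⟨x, sub_eq_zero.1 (eq_zero_of_comp h𝒜 M' hg₀ hd₀ ha₀
        (x := h [x] - y) (sub_mem (hdeg1 z x hx) hy) (g := t' ∘ₗ M'.F [y] ∘ₗ g₀ - g₀ ∘ₗ g - a)
        (sub_mem (sub_mem (homDeg_cast (by abel) (comp_mem_homDeg ht'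
          (comp_mem_homDeg (M'.F_mem hy) hg₀))) (homDeg_cast (by abel)
            (comp_mem_homDeg hg₀ hgz))) ha) fun p => ?_)⟩
      have e1 : M'.F [h [x] - y] = M'.F [h [x]] - M'.F [y] := (M'.F_lin [] []).map_sub _ _
      have h1 := H p
      have h2 := congrArg g₀ (hφ p)
      have h3 := htx' (M'.F [y] (g₀ p))
      rw [M'.F_cocycle hy] at h3
      rw [e1]
      simp only [LinearMap.sub_apply, LinearMap.comp_apply, map_sub, map_neg, map_units_smul,
        hd₀, smul_sub, map_add] at h1 h2 h3 ⊢
      rw [h2] at h3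
      linear_combination (norm := abel) h3 - h1

end BarModel
end Bijective

/-! ### Multilinear maps as functions on words -/

section Eval
variable {k V R : Type*} [Field k] [AddCommGroup V] [Module k V] [AddCommGroup R] [Module k R]

/-- A family of multilinear maps, evaluated on words. -/
def ev (m : ∀ n, MultilinearMap k (fun _ : Fin n => V) R) (l : List V) : R := m l.length l.get

theorem ev_ofFn (m : ∀ n, MultilinearMap k (fun _ : Fin n => V) R) {n : ℕ} (v : Fin n → V) :
    ev m (List.ofFn v) = m n v := by
  have : ∀ (l : List V) (n : ℕ) (h : l.length = n),
      ev m l = m n fun i => l.get (i.cast h.symm) := by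
    rintro l _ rfl; rfl
  rw [this _ n (by simp)]
  congr 1
  funext i
  simp

theorem ofFn_update {V : Type*} {n : ℕ} [DecidableEq (Fin n)] (v : Fin n → V) (i : Fin n) (x : V) :
    List.ofFn (Function.update v i x) =
      (List.ofFn v).take i ++ x :: (List.ofFn v).drop (i + 1) := by
  have h : List.ofFn (Function.update v i x) = (List.ofFn v).set i x := by
    refine List.ext_getElem (by simp) fun j h1 h2 => ?_
    simp only [List.getElem_ofFn, List.getElem_set, Function.update_apply, Fin.ext_iff, eq_comm]
  rw [h, List.set_eq_take_append_cons_drop, if_pos (by simp)]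

theorem listLin_ev (m : ∀ n, MultilinearMap k (fun _ : Fin n => V) R) : ListLin k (ev m) := by
  intro u t
  have h : ∀ x, ev m (u ++ x :: t) = m (u ++ 0 :: t).length (Function.update (u ++ 0 :: t).get
      ⟨u.length, by simp⟩ x) := fun x => by
    rw [← ev_ofFn, ofFn_update, List.ofFn_get]
    congr 1
    simp
  exact ⟨fun x y => by simp only [h, MultilinearMap.map_update_add],
    fun c x => by simp only [h, MultilinearMap.map_update_smul]⟩

/-- The multilinear maps underlying a function on words. -/
def ListLin.toMultilinear {α : List V → R} (h : ListLin k α) (n : ℕ) :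
    MultilinearMap k (fun _ : Fin n => V) R where
  toFun v := α (List.ofFn v)
  map_update_add' v i x y := by
    simp only [ofFn_update, (h _ _).map_add]
  map_update_smul' v i c x := by
    simp only [ofFn_update, (h _ _).map_smul]

theorem ListLin.ev_toMultilinear {α : List V → R} (h : ListLin k α) (l : List V) :
    ev h.toMultilinear l = α l := by
  change α (List.ofFn l.get) = α l
  rw [List.ofFn_get]

end Eval

/-! ### Suspension signs -/

section Twist
variable {k V R : Type*} [Field k] [AddCommGroup V] [Module k V] [AddCommGroup R] [Module k R]

/-- The exponent `∑ (n - 1 - j) p_j` of the sign relating multilinear maps on `V` to those on its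
suspension. -/
def twSign : List ℤ → ℤ
  | [] => 0
  | p :: l => l.length * p + twSign l

theorem twSign_append (u v : List ℤ) :
    twSign (u ++ v) = twSign u + v.length * u.sum + twSign v := by
  induction u with
  | nil => simp [twSign]
  | cons p u ih => simp [twSign, ih]; ring

/-- Apply the power `π ^ j` to the letter which is followed by `j` other letters, not counting
a suffix, which is assumed to have length `n`. -/
def twist (π : V →ₗ[k] V) (n : ℕ) : List V → List V
  | [] => []
  | x :: l => (π ^ (n + l.length)) x :: twist π n l

theorem twist_length (π : V →ₗ[k] V) (n : ℕ) (l : List V) : (twist π n l).length = l.length := by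
  induction l with
  | nil => rfl
  | cons x l ih => simp [twist, ih]

theorem twist_append (π : V →ₗ[k] V) (n : ℕ) (u v : List V) :
    twist π n (u ++ v) = twist π (n + v.length) u ++ twist π n v := by
  induction u with
  | nil => rfl
  | cons x u ih =>
    simp only [List.cons_append, twist, ih, List.length_append]
    rw [show n + (u.length + v.length) = n + v.length + u.length by omega]

theorem ListLin.twist {α : List V → R} (h : ListLin k α) (π : V →ₗ[k] V) :
    ListLin k fun l => α (twist π 0 l) := by
  intro u t
  simp only [twist_append, List.length_cons, ExtAInf.twist]
  exact (h _ _).comp' (π ^ (0 + t.length)).isLinear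

theorem twist_twist {π : V →ₗ[k] V} (hπ : ∀ x, π (π x) = x) (n : ℕ) (l : List V) :
    twist π n (twist π n l) = l := by
  have h : ∀ m x, (π ^ m) ((π ^ m) x) = x := by
    intro m
    induction m with
    | zero => intro x; rfl
    | succ m ih => intro x; rw [pow_succ', Module.End.mul_apply, Module.End.mul_apply, ←
        Module.End.mul_apply (π ^ m) π, ← pow_succ, pow_succ', Module.End.mul_apply, ih, hπ]
  induction l with
  | nil => rfl
  | cons x l ih => rw [ExtAInf.twist, ExtAInf.twist, twist_length, h, ih]

variable {deg : ℤ × ℤ → Submodule k V}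

/-- A word of homogeneous elements, listed with their degrees. -/
def Graded (deg : ℤ × ℤ → Submodule k V) (w : List (V × (ℤ × ℤ))) : Prop := ∀ q ∈ w, q.1 ∈ deg q.2

abbrev letters (w : List (V × (ℤ × ℤ))) : List V := w.map Prod.fst

abbrev fdegs (w : List (V × (ℤ × ℤ))) : List ℤ := w.map fun q => q.2.1

theorem HomogWord.exists_graded {l : List V} {ds : List (ℤ × ℤ)} (h : HomogWord deg l ds) :
    ∃ w, Graded deg w ∧ letters w = l ∧ w.map Prod.snd = ds := by
  induction h with
  | nil => exact ⟨[], by simp [Graded], rfl, rfl⟩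
  | @cons x z l ds hx _ ih =>
    obtain ⟨w, hw, rfl, rfl⟩ := ih
    refine ⟨(x, z) :: w, ?_, rfl, rfl⟩
    intro q hq
    rcases List.mem_cons.1 hq with rfl | hq
    · exact hx
    · exact hw q hq

theorem Graded.homogWord {w : List (V × (ℤ × ℤ))} (h : Graded deg w) :
    HomogWord deg (letters w) (w.map Prod.snd) := by
  induction w with
  | nil => exact .nil
  | cons q w ih => exact .cons (h q (by simp)) (ih fun q hq => h q (by simp [hq]))

theorem ListLin.map_units_smul {α : List V → R} (hα : ListLin k α) (u t : List V) (s : ℤˣ) (x : V) :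
    α (u ++ (s • x) :: t) = s • α (u ++ x :: t) :=
  ExtAInf.map_units_smul ((hα u t).mk' _) s x

theorem ListLin.map_sign_list {X : Type*} {α : List V → R} (hα : ListLin k α) (ε : X → ℤ)
    (g g' : X → V) (w : List X) (H : ∀ q ∈ w, g' q = (ε q).negOnePow • g q) :
    α (w.map g') = ((w.map ε).sum).negOnePow • α (w.map g) := by
  induction w generalizing α with
  | nil => simp
  | cons q w ih =>
    have := ih (hα.cons (g' q)) fun q hq => H q (by simp [hq])
    rw [List.map_cons, this, List.map_cons, List.map_cons, List.sum_cons, H q (by simp)]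
    rw [show α ((ε q).negOnePow • g q :: List.map g w) = (ε q).negOnePow • α (g q :: List.map g w)
      from hα.map_units_smul [] _ _ _, smul_smul, mul_comm, ← Int.negOnePow_add]

/-- With `π = (-1)^p`, the suspension sign is produced by linear operations on the letters, so the
signed maps remain multilinear on inhomogeneous words. -/
theorem ListLin.twist_apply {α : List V → R} (hα : ListLin k α) {π : V →ₗ[k] V}
    (hπ : ∀ z, ∀ x ∈ deg z, π x = z.1.negOnePow • x) {w : List (V × (ℤ × ℤ))}
    (hw : Graded deg w) :
    α (ExtAInf.twist π 0 (letters w)) = (twSign (fdegs w)).negOnePow • α (letters w) := by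
  have hpow : ∀ z, ∀ x ∈ deg z, ∀ n : ℕ, (π ^ n) x = (n * z.1).negOnePow • x := by
    intro z x hx n
    induction n with
    | zero => simp
    | succ n ih =>
      rw [pow_succ', Module.End.mul_apply, ih, ExtAInf.map_units_smul, hπ z x hx, smul_smul,
        ← Int.negOnePow_add]
      congr 2
      push_cast; ring
  induction w generalizing α with
  | nil => simp [ExtAInf.twist, twSign]
  | cons q w ih =>
    have := ih (hα.cons ((π ^ (0 + (letters w).length)) q.1)) fun q hq => hw q (by simp [hq])
    simp only [letters, List.map_cons, ExtAInf.twist, fdegs, twSign] at this ⊢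
    rw [this, hpow _ _ (hw q (by simp))]
    rw [show ∀ s : ℤˣ, α (s • q.1 :: List.map Prod.fst w) = s • α (q.1 :: List.map Prod.fst w)
      from fun s => hα.map_units_smul [] _ _ _, smul_smul, ← Int.negOnePow_add]
    congr 2
    simp
    ring

end Twist

/-! ### The Stasheff identities on the suspension -/

section Stasheff
variable {k V R : Type*} [Field k] [AddCommGroup V] [Module k V] [AddCommGroup R] [Module k R]
  {deg : ℤ × ℤ → Submodule k V}

/-- The value of a family of multilinear maps on the suspended word. -/
def tev (π : V →ₗ[k] V) (m : ∀ n, MultilinearMap k (fun _ : Fin n => V) R) (l : List V) : R :=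
  ev m (twist π 0 l)

theorem listLin_tev (π : V →ₗ[k] V) (m : ∀ n, MultilinearMap k (fun _ : Fin n => V) R) :
    ListLin k (tev π m) := (listLin_ev m).twist π

theorem tev_apply {π : V →ₗ[k] V} (hπ : ∀ z, ∀ x ∈ deg z, π x = z.1.negOnePow • x)
    (m : ∀ n, MultilinearMap k (fun _ : Fin n => V) R) {w : List (V × (ℤ × ℤ))}
    (hw : Graded deg w) :
    tev π m (letters w) = (twSign (fdegs w)).negOnePow • ev m (letters w) :=
  (listLin_ev m).twist_apply hπ hw

theorem ev_mem {T : ℤ × ℤ → Submodule k R} {m : ∀ n, MultilinearMap k (fun _ : Fin n => V) R}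
    {c : ℤ} (hm : ∀ (n : ℕ) (v : Fin n → V) (d : Fin n → ℤ × ℤ), (∀ j, v j ∈ deg (d j)) →
      m n v ∈ T ((∑ j, (d j).1) + (c - (n : ℤ)), ∑ j, (d j).2)) {w : List (V × (ℤ × ℤ))}
    (hw : Graded deg w) :
    ev m (letters w) ∈ T ((w.map Prod.snd).sum + (c - (w.length : ℤ), 0)) := by
  have h : letters w = List.ofFn fun j : Fin w.length => (w.get j).1 := by
    refine List.ext_getElem (by simp) fun j h1 h2 => ?_
    simp
  have h' : (w.map Prod.snd).sum = (∑ j : Fin w.length, (w.get j).2.1,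
      ∑ j : Fin w.length, (w.get j).2.2) := by
    have : w.map Prod.snd = List.ofFn fun j : Fin w.length => (w.get j).2 := by
      refine List.ext_getElem (by simp) fun j h1 h2 => ?_
      simp
    rw [this, List.sum_ofFn]
    exact Prod.ext Prod.fst_sum Prod.snd_sum
  rw [h, ev_ofFn, h', Prod.mk_add_mk, add_zero]
  exact hm _ _ (fun j => (w.get j).2) fun j => hw _ (List.get_mem w j)

/-- The left-hand side of the Stasheff identities. -/
def stasheffSum (m : ∀ n, MultilinearMap k (fun _ : Fin n => V) V)
    (f : ∀ n, MultilinearMap k (fun _ : Fin n => V) R) (n : ℕ) (a : ℕ → V) (p : ℕ → ℤ) : R :=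
  ∑ s ∈ Finset.Icc 1 n, ∑ r ∈ Finset.range (n - s + 1),
    Int.negOnePow (graftSign p r s (n - s - r)) •
      f (r + 1 + (n - s - r)) (fun j => graft a r s (m s fun i => a (r + i)) j)

theorem Graded.of_append {u v : List (V × (ℤ × ℤ))} (h : Graded deg (u ++ v)) :
    Graded deg u ∧ Graded deg v :=
  ⟨fun q hq => h q (by simp [hq]), fun q hq => h q (by simp [hq])⟩

theorem Graded.append {u v : List (V × (ℤ × ℤ))} (hu : Graded deg u) (hv : Graded deg v) :
    Graded deg (u ++ v) := fun q hq => (List.mem_append.1 hq).elim (hu q) (hv q)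

theorem Graded.cons {x : V} {z : ℤ × ℤ} {v : List (V × (ℤ × ℤ))} (hx : x ∈ deg z)
    (hv : Graded deg v) : Graded deg ((x, z) :: v) := fun q hq =>
  (List.mem_cons.1 hq).elim (fun h => h ▸ hx) (hv q)

theorem sum_snd_fst {V : Type*} (w : List (V × (ℤ × ℤ))) :
    (w.map Prod.snd).sum.1 = (fdegs w).sum := by
  rw [← sum_map_fst, List.map_map]; rfl

theorem negOnePow_eq_of_even {a b : ℤ} (h : Even (a - b)) : a.negOnePow = b.negOnePow := by
  rw [← sub_add_cancel a b, Int.negOnePow_add, Int.negOnePow_even _ h, one_mul]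

/-- Suspending the inner operation, the outer operation and the letters passed over yields the
Stasheff sign times a sign of the whole word, which does not depend on the decomposition. -/
theorem tev_graft {π σ : V →ₗ[k] V} (hπ : ∀ z, ∀ x ∈ deg z, π x = z.1.negOnePow • x)
    (hσ : ∀ z, ∀ x ∈ deg z, σ x = (z.1 - 1).negOnePow • x)
    {m : ∀ n, MultilinearMap k (fun _ : Fin n => V) V}
    (hm : ∀ (n : ℕ) (v : Fin n → V) (d : Fin n → ℤ × ℤ), (∀ j, v j ∈ deg (d j)) →
      m n v ∈ deg ((∑ j, (d j).1) + (2 - (n : ℤ)), ∑ j, (d j).2))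
    (f : ∀ n, MultilinearMap k (fun _ : Fin n => V) R) {u v t : List (V × (ℤ × ℤ))}
    (hu : Graded deg u) (hv : Graded deg v) (ht : Graded deg t) :
    tev π f ((letters u).map σ ++ tev π m (letters v) :: letters t) =
      (twSign (fdegs (u ++ (v ++ t)))).negOnePow • ((u.length : ℤ) + v.length * t.length +
        (2 - (v.length : ℤ)) * (fdegs u).sum).negOnePow •
          ev f (letters u ++ ev m (letters v) :: letters t) := by
  rw [tev_apply hπ m hv, (listLin_tev π f).map_units_smul]
  have h1 : tev π f ((letters u).map σ ++ ev m (letters v) :: letters t) =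
      ((u.map fun q : V × (ℤ × ℤ) => q.2.1 - 1).sum).negOnePow •
        tev π f (letters u ++ ev m (letters v) :: letters t) := by
    have hl : ListLin k fun l => tev π f (l ++ ev m (letters v) :: letters t) := fun a b => by
      simp only [List.append_assoc, List.cons_append]
      exact listLin_tev π f _ _
    have := hl.map_sign_list (fun q : V × (ℤ × ℤ) => q.2.1 - 1) Prod.fst (fun q => σ q.1) u
      fun q hq => hσ _ _ (hu q hq)
    rw [List.map_map]
    exact this
  have h2 : letters u ++ ev m (letters v) :: letters t =
      letters (u ++ (ev m (letters v), (v.map Prod.snd).sum + (2 - (v.length : ℤ), 0)) :: t) := by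
    simp
  rw [h1, h2, tev_apply hπ f (hu.append (.cons (ev_mem hm hv) ht)), ← h2, smul_smul, smul_smul,
    smul_smul, ← Int.negOnePow_add, ← Int.negOnePow_add, ← Int.negOnePow_add]
  congr 1
  apply negOnePow_eq_of_even
  have h3 : (u.map fun q : V × (ℤ × ℤ) => q.2.1 - 1).sum = (fdegs u).sum - u.length := by
    clear hu h1 h2
    induction u with
    | nil => simp
    | cons q u ih => simp [ih]; ring
  simp only [fdegs, List.map_append, List.map_cons, twSign_append, twSign, List.length_append,
    List.length_map, List.length_cons, h3, Prod.fst_add, sum_snd_fst]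
  push_cast
  -- Half the difference of the two exponents.
  exact ⟨-u.length + t.length - v.length * t.length, by ring⟩

/-- A decomposition `u ++ v ++ t` corresponds to the pair `(r, s)` of lengths of `u` and `v`; the
case `s = 0` is harmless because `m 0 = 0`. -/
theorem bstar_tev {π σ : V →ₗ[k] V} (hπ : ∀ z, ∀ x ∈ deg z, π x = z.1.negOnePow • x)
    (hσ : ∀ z, ∀ x ∈ deg z, σ x = (z.1 - 1).negOnePow • x)
    {m : ∀ n, MultilinearMap k (fun _ : Fin n => V) V} (hm0 : m 0 = 0)
    (hm : ∀ (n : ℕ) (v : Fin n → V) (d : Fin n → ℤ × ℤ), (∀ j, v j ∈ deg (d j)) →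
      m n v ∈ deg ((∑ j, (d j).1) + (2 - (n : ℤ)), ∑ j, (d j).2))
    (f : ∀ n, MultilinearMap k (fun _ : Fin n => V) R) {w : List (V × (ℤ × ℤ))}
    (hw : Graded deg w) {a : ℕ → V} {p : ℕ → ℤ} (ha : ∀ j (hj : j < w.length), a j = w[j].1)
    (hp : ∀ j (hj : j < w.length), p j = w[j].2.1) :
    bstar σ (tev π m) (tev π f) (letters w) =
      (twSign (fdegs w)).negOnePow • stasheffSum m f w.length a p := by
  have h1 : bstar σ (tev π m) (tev π f) (letters w) = splitSum (fun u r => splitSum (fun v t =>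
      (twSign (fdegs w)).negOnePow • ((u.length : ℤ) + v.length * t.length +
        (2 - (v.length : ℤ)) * (fdegs u).sum).negOnePow •
          ev f (letters u ++ ev m (letters v) :: letters t)) r) w := by
    rw [bstar, letters, splitSum_map]
    refine splitSum_congr fun u r hur => ?_
    rw [splitSum_map]
    refine splitSum_congr fun v t hvt => ?_
    subst hvt
    subst hur
    exact tev_graft hπ hσ hm f hw.of_append.1 hw.of_append.2.of_append.1
      hw.of_append.2.of_append.2
  have hev0 : ev m [] = 0 := by
    change m 0 _ = 0
    rw [hm0]; rfl
  have hps : ∀ r ≤ w.length, ∑ j ∈ Finset.range r, p j = (fdegs (w.take r)).sum := by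
    intro r hr
    rw [Finset.sum_range, ← List.sum_ofFn]
    congr 1
    refine List.ext_getElem (by simp [hr]) fun j h1 h2 => ?_
    simp at h1
    simp [hp j (by omega)]
  rw [h1, splitSum_eq_range, stasheffSum, Finset.smul_sum]
  simp only [splitSum_eq_range, Finset.smul_sum]
  have h2 : ∀ r ∈ Finset.range (w.length + 1), ∀ F : ℕ → R, F 0 = 0 →
      ∑ s ∈ Finset.range ((w.drop r).length + 1), F s = ∑ s ∈ Finset.Icc 1 (w.length - r), F s := by
    intro r hr F hF
    rw [List.length_drop]
    symm
    refine Finset.sum_subset (fun s hs => ?_) fun s hs hs' => ?_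
    · simp at hs ⊢; omega
    · simp at hs hs'
      rw [show s = 0 by omega, hF]
  rw [Finset.sum_congr rfl fun r hr => h2 r hr _ (by
    simp [hev0, (listLin_ev f).map_zero])]
  rw [Finset.sum_comm' (t' := Finset.Icc 1 w.length)
    (s' := fun s => Finset.range (w.length - s + 1)) (fun r s => by simp; omega)]
  refine Finset.sum_congr rfl fun s hs => Finset.sum_congr rfl fun r hr => ?_
  simp only [Finset.mem_Icc, Finset.mem_range] at hs hr
  have e1 : letters ((w.drop r).take s) = List.ofFn fun i : Fin s => a (r + i) := by
    refine List.ext_getElem (by simp; omega) fun j h1 h2 => ?_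
    simp at h1 h2
    simp [ha (r + j) (by omega)]
  have e2 : letters (w.take r) ++ ev m (letters ((w.drop r).take s)) ::
      letters ((w.drop r).drop s) = List.ofFn fun j : Fin (r + 1 + (w.length - s - r)) =>
        graft a r s (m s fun i => a (r + i)) j := by
    rw [e1, ev_ofFn]
    refine List.ext_getElem (by simp; omega) fun j h1 h2 => ?_
    simp at h1 h2
    rw [List.getElem_append, List.getElem_ofFn]
    simp only [graft, List.length_map, List.length_take, List.getElem_map, List.getElem_take,
      List.getElem_cons, List.getElem_drop]
    simp only [min_eq_left (show r ≤ w.length by omega)]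
    split_ifs with h3 h4 h5 <;> first | omega | skip
    · rw [ha j (by omega)]
    · rfl
    · rw [ha (j + s - 1) (by omega)]
      congr 2
      omega
  rw [e2, ev_ofFn, graftSign, hps r (by omega)]
  simp only [List.length_take, List.length_drop]
  rw [min_eq_left (show r ≤ w.length by omega), min_eq_left (show s ≤ w.length - r by omega),
    Nat.sub_right_comm w.length r s]

end Stasheff

/-! ### Compositions and the morphism identities -/

section CompositionSum
variable {R : Type*} [AddCommMonoid R]

/-- The sum of `Ψ` over all compositions of `n`. -/
def compSum (n : ℕ) (Ψ : List ℕ → R) : R := ∑ c : Composition n, Ψ c.blocks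

theorem compSum_zero (Ψ : List ℕ → R) : compSum 0 Ψ = Ψ [] := by
  have h : ∀ c : Composition 0, c.blocks = [] := fun c =>
    List.eq_nil_of_length_eq_zero ((Composition.length_eq_zero c).2 rfl)
  rw [compSum, Fintype.sum_eq_single ⟨[], by simp, rfl⟩ fun c hc =>
    absurd (Composition.ext (h c)) hc]

theorem compSum_succ (n : ℕ) (Ψ : List ℕ → R) :
    compSum (n + 1) Ψ = ∑ i ∈ Finset.range (n + 1), compSum (n - i) fun B => Ψ ((i + 1) :: B) := by
  simp only [compSum]
  rw [Finset.sum_sigma']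
  symm
  refine Finset.sum_bij (fun (x : Σ i : ℕ, Composition (n - i)) hx =>
    ⟨(x.1 + 1) :: x.2.blocks, ?_, ?_⟩) ?_ ?_ ?_ ?_
  · intro i hi
    rcases List.mem_cons.1 hi with rfl | hi
    · omega
    · exact x.2.blocks_pos hi
  · simp only [Finset.mem_sigma, Finset.mem_range] at hx
    rw [List.sum_cons, x.2.blocks_sum]
    omega
  · intro _ _; exact Finset.mem_univ _
  · rintro ⟨i, c⟩ hx ⟨j, c'⟩ hy h
    simp only [Composition.mk.injEq, List.cons.injEq] at h
    obtain ⟨h1, h2⟩ := h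
    obtain rfl : i = j := by omega
    rw [Composition.ext h2]
  · intro c _
    obtain ⟨B, hpos, hsum⟩ := c
    cases B with
    | nil => simp at hsum
    | cons b B =>
      have hb : 0 < b := hpos (by simp)
      rw [List.sum_cons] at hsum
      refine ⟨⟨b - 1, ⟨B, fun hi => hpos (by simp [hi]), by omega⟩⟩, by simp; omega, ?_⟩
      simp only [Composition.mk.injEq, List.cons.injEq, and_true]
      omega
  · intro _ _; rfl

theorem splitBlocks_cons {Y : Type*} (l : List Y) (b : ℕ) (B : List ℕ) :
    l.splitWrtCompositionAux (b :: B) = l.take b :: (l.drop b).splitWrtCompositionAux B := by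
  simp [List.splitWrtCompositionAux]

/-- A composition of the length is a decomposition into nonempty blocks, and both sums obey the same
recursion on the first block. -/
theorem compSum_split {Y : Type*} (G : List (List Y) → R) (l : List Y) :
    compSum l.length (fun B => G (l.splitWrtCompositionAux B)) = hpull id G l := by
  induction l using list_length_induction generalizing G with
  | nil => rw [List.length_nil, compSum_zero]; rfl
  | cons x w ih =>
    rw [List.length_cons, compSum_succ, hpull_cons, splitSum_eq_range]
    refine Finset.sum_congr rfl fun i _ => ?_
    rw [← ih (w.drop i) (by simp), List.length_drop]
    simp only [splitBlocks_cons, List.take_succ_cons, List.drop_succ_cons, id_eq]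

theorem split_map {Y Z : Type*} (g : Y → Z) (B : List ℕ) (l : List Y) :
    (l.map g).splitWrtCompositionAux B = (l.splitWrtCompositionAux B).map (List.map g) := by
  induction B generalizing l with
  | nil => rfl
  | cons b B ih =>
    simp only [splitBlocks_cons, List.map_cons, List.map_take, ← ih, List.map_drop]

end CompositionSum

section Signs

/-- The exponent of the sign in the Stasheff identities for morphisms, in terms of the list of
degrees, decomposed into blocks. -/
def blockSign : List (List ℤ) → ℤ
  | [] => 0
  | e :: D => D.length * (e.length - 1) + (D.map fun e' => 1 - (e'.length : ℤ)).sum * e.sum +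
      blockSign D

/-- Compares suspending all letters at once with suspending block by block and then suspending the
outputs; `e.sum + (1 - e.length)` is the degree of the value of `f` on the block `e`. -/
theorem even_twSign_flatten (D : List (List ℤ)) :
    Even (twSign D.flatten + blockSign D - ((D.map twSign).sum +
      twSign (D.map fun e => e.sum + (1 - (e.length : ℤ))))) := by
  induction D with
  | nil => simp [twSign, blockSign]
  | cons e D ih =>
    obtain ⟨c, hc⟩ := ih
    have h : (D.map fun e' => 1 - (e'.length : ℤ)).sum = D.length - D.flatten.length := by
      clear hc
      induction D with
      | nil => simp
      | cons e D ih => simp only [List.map_cons, List.sum_cons, ih, List.flatten_cons,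
          List.length_append, List.length_cons]; push_cast; ring
    refine ⟨c + D.length * (e.length - 1), ?_⟩
    simp only [List.flatten_cons, twSign_append, blockSign, List.map_cons, List.sum_cons, twSign,
      List.length_map, h]
    linear_combination hc

theorem homSign_eq_blockSign (B : List ℕ) (ds : List ℤ) (p : ℕ → ℤ) (hB : B.sum ≤ ds.length)
    (hp : ∀ j (hj : j < ds.length), p j = ds[j]) :
    (∑ j : Fin B.length, ((B.length : ℤ) - 1 - (j : ℕ)) * ((B.get j : ℤ) - 1)) +
      ∑ j : Fin B.length, (1 - (B.get j : ℤ)) * ∑ l ∈ Finset.range (B.take j).sum, p l =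
    blockSign (ds.splitWrtCompositionAux B) := by
  induction B generalizing ds p with
  | nil => rfl
  | cons b B ih =>
    rw [List.sum_cons] at hB
    have h := ih (ds.drop b) (fun j => p (b + j)) (by simp; omega) fun j hj => by
      simp at hj
      simp [hp (b + j) (by omega)]
    have hlen : (((ds.drop b).splitWrtCompositionAux B).map fun e' => 1 - (e'.length : ℤ)).sum =
        ∑ j : Fin B.length, (1 - (B.get j : ℤ)) := by
      have : ∀ (B : List ℕ) (ds : List ℤ), B.sum ≤ ds.length →
          ((ds.splitWrtCompositionAux B).map fun e' => 1 - (e'.length : ℤ)) =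
            List.ofFn fun j : Fin B.length => (1 - (B.get j : ℤ)) := by
        intro B
        induction B with
        | nil => intro ds _; rfl
        | cons b B ih =>
          intro ds h
          rw [List.sum_cons] at h
          simp only [splitBlocks_cons, List.map_cons, List.length_cons, List.ofFn_succ]
          rw [ih _ (by simp; omega)]
          simp [show b ≤ ds.length by omega]
      rw [this B _ (by simp; omega), List.sum_ofFn]
    have hlen' : ((ds.drop b).splitWrtCompositionAux B).length = B.length := by
      generalize ds.drop b = l
      clear * -
      induction B generalizing l with
      | nil => rfl
      | cons b B ih => simp [splitBlocks_cons, ih]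
    have hsum : ∑ j ∈ Finset.range b, p j = (ds.take b).sum := by
      rw [Finset.sum_range, ← List.sum_ofFn]
      congr 1
      refine List.ext_getElem (by simp; omega) fun j h1 h2 => ?_
      simp at h1
      simp [hp j (by omega)]
    rw [splitBlocks_cons, blockSign, ← h, hlen, hlen', ← hsum, List.length_take,
      min_eq_left (show b ≤ ds.length by omega)]
    simp only [List.length_cons, Fin.sum_univ_succ, List.get_cons_zero, Fin.val_zero,
      List.take_zero, List.sum_nil, Finset.range_zero, Finset.sum_empty, List.get_cons_succ',
      Fin.val_succ, List.take_succ_cons, List.sum_cons, Finset.sum_range_add, mul_add,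
      Finset.sum_add_distrib, ← Finset.sum_mul]
    push_cast
    have e : ∀ j : Fin B.length, ((B.length : ℤ) + 1 - 1 - ((j : ℕ) + 1)) * ((B.get j : ℤ) - 1) =
      ((B.length : ℤ) - 1 - (j : ℕ)) * ((B.get j : ℤ) - 1) := fun j => by ring
    simp only [e]
    ring

end Signs

section Morphism
variable {k V W : Type*} [Field k] [AddCommGroup V] [Module k V] [AddCommGroup W] [Module k W]
  {deg : ℤ × ℤ → Submodule k V} {deg' : ℤ × ℤ → Submodule k W}

theorem ofFn_blocks {R : Type*} [AddCommGroup R] [Module k R]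
    (f : ∀ n, MultilinearMap k (fun _ : Fin n => V) R) (B : List ℕ) (l : List V) (a : ℕ → V)
    (hB : B.sum ≤ l.length) (ha : ∀ j (hj : j < l.length), a j = l[j]) :
    (List.ofFn fun j : Fin B.length => f (B.get j) fun i => a ((B.take j).sum + i)) =
      (l.splitWrtCompositionAux B).map (ev f) := by
  induction B generalizing l a with
  | nil => rfl
  | cons b B ih =>
    rw [List.sum_cons] at hB
    have h := ih (l.drop b) (fun j => a (b + j)) (by simp; omega) fun j hj => by
      simp at hj
      simp [ha (b + j) (by omega)]
    have h2 : List.ofFn (fun i : Fin b => a i) = l.take b := by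
      refine List.ext_getElem (by simp; omega) fun j h1 h2 => ?_
      simp at h1
      simp [ha j (by omega)]
    simp only [List.length_cons, List.ofFn_succ, splitBlocks_cons, List.map_cons]
    rw [← h, ← h2, ev_ofFn]
    simp only [List.get_cons_zero, Fin.val_zero, List.take_zero, List.sum_nil, zero_add,
      List.get_cons_succ', Fin.val_succ, List.take_succ_cons, List.sum_cons, add_assoc]
    rfl

/-- The right-hand side of the Stasheff identities for morphisms. -/
def stasheffHomSum (m' : ∀ n, MultilinearMap k (fun _ : Fin n => W) W)
    (f : ∀ n, MultilinearMap k (fun _ : Fin n => V) W) (n : ℕ) (a : ℕ → V) (p : ℕ → ℤ) : W :=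
  ∑ c : Composition n, Int.negOnePow (homSign p c) •
    m' c.length (fun j => f (c.blocksFun j) fun i => a (c.sizeUpTo j + i))

/-- The companion of `bstar_tev` for the other side of the morphism identities, with the same
overall sign. -/
theorem hpull_tev {π : V →ₗ[k] V} (hπ : ∀ z, ∀ x ∈ deg z, π x = z.1.negOnePow • x)
    {π' : W →ₗ[k] W} (hπ' : ∀ z, ∀ x ∈ deg' z, π' x = z.1.negOnePow • x)
    {m' : ∀ n, MultilinearMap k (fun _ : Fin n => W) W}
    {f : ∀ n, MultilinearMap k (fun _ : Fin n => V) W}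
    (hf : ∀ (n : ℕ) (v : Fin n → V) (d : Fin n → ℤ × ℤ), (∀ j, v j ∈ deg (d j)) →
      f n v ∈ deg' ((∑ j, (d j).1) + (1 - (n : ℤ)), ∑ j, (d j).2)) {w : List (V × (ℤ × ℤ))}
    (hw : Graded deg w) {a : ℕ → V} {p : ℕ → ℤ} (ha : ∀ j (hj : j < w.length), a j = w[j].1)
    (hp : ∀ j (hj : j < w.length), p j = w[j].2.1) :
    hpull (tev π f) (tev π' m') (letters w) =
      (twSign (fdegs w)).negOnePow • stasheffHomSum m' f w.length a p := by
  have h0 : hpull (tev π f) (tev π' m') (letters w) =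
      hpull id (fun L => tev π' m' (L.map fun e => tev π f (letters e))) w := by
    have h1 := hpull_map (h := id) (h' := id) (s := Prod.fst) (s' := List.map Prod.fst)
      (fun _ => rfl) (fun L => tev π' m' (L.map (tev π f))) w
    have h2 := hpull_map (h := tev π f) (h' := id) (s := id) (s' := tev π f)
      (fun u => by rw [List.map_id]; rfl) (tev π' m') (letters w)
    rw [List.map_id] at h2
    rw [h2, h1]
    simp only [List.map_map]
    rfl
  rw [h0, ← compSum_split, compSum, stasheffHomSum, Finset.smul_sum]
  refine Finset.sum_congr rfl fun c _ => ?_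
  have hD : ∀ e ∈ w.splitWrtCompositionAux c.blocks, Graded deg e := by
    intro e he q hq
    refine hw q ?_
    rw [← List.flatten_splitWrtCompositionAux (l := w) c.blocks_sum]
    exact List.mem_flatten.2 ⟨e, he, hq⟩
  have e1 := (listLin_tev π' m').map_sign_list (fun e : List (V × (ℤ × ℤ)) => twSign (fdegs e))
    (fun e => ev f (letters e)) (fun e => tev π f (letters e)) (w.splitWrtCompositionAux c.blocks)
    fun e he => tev_apply hπ f (hD e he)
  rw [e1]
  have e2 : Graded deg' ((w.splitWrtCompositionAux c.blocks).map fun e =>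
      (ev f (letters e), (e.map Prod.snd).sum + (1 - (e.length : ℤ), 0))) := by
    intro q hq
    obtain ⟨e, he, rfl⟩ := List.mem_map.1 hq
    exact ev_mem hf (hD e he)
  have e3 := tev_apply hπ' m' e2
  have e4 : letters ((w.splitWrtCompositionAux c.blocks).map fun e =>
      (ev f (letters e), (e.map Prod.snd).sum + ((1 - (e.length : ℤ), 0) : ℤ × ℤ))) =
      (w.splitWrtCompositionAux c.blocks).map fun e => ev f (letters e) := by
    rw [letters, List.map_map]; rfl
  rw [e4] at e3
  have e5 : (List.ofFn fun j : Fin c.blocks.length => f (c.blocks.get j)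
      fun i => a ((c.blocks.take j).sum + i)) =
      (w.splitWrtCompositionAux c.blocks).map fun e => ev f (letters e) := by
    rw [ofFn_blocks f c.blocks (letters w) a (by rw [c.blocks_sum]; simp)
      (fun j hj => by simp at hj; simp [ha j hj]), letters, split_map, List.map_map]
    rfl
  have e6 : ev m' ((w.splitWrtCompositionAux c.blocks).map fun e => ev f (letters e)) =
      m' c.length (fun j => f (c.blocksFun j) fun i => a (c.sizeUpTo j + i)) := by
    rw [← e5, ev_ofFn]
    rfl
  have e7 : homSign p c = blockSign ((fdegs w).splitWrtCompositionAux c.blocks) :=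
    homSign_eq_blockSign c.blocks (fdegs w) p (by rw [c.blocks_sum]; simp) fun j hj => by
      simp at hj; simp [hp j hj]
  rw [e3, e6, smul_smul, smul_smul, ← Int.negOnePow_add, ← Int.negOnePow_add]
  congr 1
  symm
  apply negOnePow_eq_of_even
  have e8 := even_twSign_flatten ((fdegs w).splitWrtCompositionAux c.blocks)
  rw [List.flatten_splitWrtCompositionAux (by rw [c.blocks_sum]; simp), ← e7] at e8
  convert e8 using 4
  · rw [fdegs, split_map, List.map_map]; rfl
  · rw [fdegs, fdegs, split_map, List.map_map, List.map_map]
    refine List.map_congr_left fun e _ => ?_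
    simp only [Function.comp_apply, Prod.fst_add, sum_snd_fst, List.length_map]

end Morphism

/-! ### Sign operators and bar differentials of arity at most two -/

section Grading
variable {k V : Type*} [Field k] [AddCommGroup V] [Module k V] {deg : ℤ × ℤ → Submodule k V}

theorem isInternal_of_proj (π : ℤ × ℤ → V →ₗ[k] V) (h1 : ∀ z, ∀ x ∈ deg z, π z x = x)
    (h2 : ∀ y z, y ≠ z → ∀ x ∈ deg y, π z x = 0) (h3 : ⨆ z, deg z = ⊤) :
    DirectSum.IsInternal deg := by
  rw [DirectSum.isInternal_submodule_iff_iSupIndep_and_iSup_eq_top]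
  refine ⟨fun z => Submodule.disjoint_def.2 fun x hx hx' => ?_, h3⟩
  have h4 : (⨆ (j) (_ : j ≠ z), deg j) ≤ LinearMap.ker (π z) :=
    iSup₂_le fun j hj x hx => h2 j z hj x hx
  rw [← h1 z x hx]
  exact h4 hx'

/-- `x ↦ (-1)^{p + c} x` in cohomological degree `p`. -/
noncomputable def signMap (h : DirectSum.IsInternal deg) (c : ℤ) : V →ₗ[k] V :=
  gscale h fun z => (((z.1 + c).negOnePow : ℤ) : k)

theorem signMap_apply (h : DirectSum.IsInternal deg) (c : ℤ) :
    ∀ z, ∀ x ∈ deg z, signMap h c x = (z.1 + c).negOnePow • x := fun z x hx => by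
  rw [signMap, gscale_apply h _ hx, Int.cast_smul_eq_zsmul, Units.smul_def]

theorem signMap_zero_apply (h : DirectSum.IsInternal deg) :
    ∀ z, ∀ x ∈ deg z, signMap h 0 x = z.1.negOnePow • x := fun z x hx => by
  rw [signMap_apply h 0 z x hx, add_zero]

end Grading

section BStar
variable {X Y R : Type*} [AddCommMonoid R]

theorem bstar_map {s : X → Y} {σ : X → X} {σ' : Y → Y} {b : List X → X} {b' : List Y → Y}
    (hσ : ∀ x, s (σ x) = σ' (s x)) (hb : ∀ l, s (b l) = b' (l.map s)) (α : List Y → R)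
    (w : List X) : bstar σ' b' α (w.map s) = bstar σ b (fun l => α (l.map s)) w := by
  rw [bstar, bstar, splitSum_map]
  refine splitSum_congr fun u r _ => ?_
  rw [splitSum_map]
  refine splitSum_congr fun v t _ => ?_
  rw [List.map_append, List.map_cons, hb, List.map_map, List.map_map]
  congr 3
  exact funext fun x => (hσ x).symm

theorem hpull_congr_right (h : List X → Y) {α β : List Y → R} {w : List X} (hw : w ≠ [])
    (H : ∀ y l, α (y :: l) = β (y :: l)) : hpull h α w = hpull h β w := by
  cases w with
  | nil => exact absurd rfl hw
  | cons x w =>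
    rw [hpull_cons, hpull_cons]
    simp only [H]

/-- Meant for DG algebras, whose bar differential sees only lists of one or two blocks. -/
theorem hpull_eq_of_length_le_two {R : Type*} [AddCommGroup R] (h : List X → Y) {α : List Y → R}
    {w : List X} (hw : w ≠ []) (H : ∀ l, 3 ≤ l.length → α l = 0) :
    hpull h α w = α [h w] +
      splitSum (fun u v => if u = [] ∨ v = [] then 0 else α [h u, h v]) w := by
  cases w with
  | nil => exact absurd rfl hw
  | cons x w =>
    have key : ∀ u v, hpull h (fun l => α (h (x :: u) :: l)) v =
        (if v = [] then α [h (x :: u)] else 0) +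
          if x :: u = [] ∨ v = [] then 0 else α [h (x :: u), h v] := by
      intro u v
      rcases eq_or_ne v [] with rfl | hv
      · simp
      · rw [hpull_congr_right h (β := fun l => if l = [] then 0 else α (h (x :: u) :: l)) hv
          (by simp), hpull_eq_single hv]
        · simp [hv]
        · intro l hl
          split_ifs with h0
          · rfl
          · have := List.length_pos_iff.2 h0
            exact H _ (by rw [List.length_cons]; omega)
    rw [hpull_cons, splitSum_cons, if_pos (.inl rfl), zero_add]
    simp only [key]
    rw [splitSum_add, splitSum_eq_last (f := fun u v => if v = [] then α [h (x :: u)] else 0)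
      (fun u v _ hv => if_neg hv), if_pos rfl]

theorem splitSum_eq_ends_add {R : Type*} [AddCommGroup R] (g : List X → List X → R) {w : List X}
    (hw : w ≠ []) : splitSum g w = g [] w + g w [] +
      splitSum (fun u v => if u = [] ∨ v = [] then 0 else g u v) w := by
  rw [← sub_eq_iff_eq_add, ← splitSum_sub, splitSum_eq_ends hw]
  · simp
  · intro u v _ hu hv
    simp [hu, hv]

end BStar

/-! ### The bar construction of `E^{≥ 1}` -/

section PosPart
variable {k V : Type*} [Field k] [AddCommGroup V] [Module k V] (E : AInfinityAlgebra k V)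

namespace AInfinityAlgebra

/-- The projection onto the part of nonpositive cohomological degree. -/
noncomputable def nonposProj : V →ₗ[k] V :=
  gscale E.isInternal fun z => if 1 ≤ z.1 then 0 else 1

/-- The part `E^{≥ 1}`. -/
noncomputable def pos : Submodule k V := LinearMap.ker E.nonposProj

variable {E}

theorem mem_pos {z : ℤ × ℤ} (hz : 1 ≤ z.1) {x : V} (hx : x ∈ E.deg z) : x ∈ E.pos := by
  rw [pos, LinearMap.mem_ker, nonposProj, gscale_apply _ _ hx, if_pos hz, zero_smul]

theorem eq_zero_of_mem_pos {z : ℤ × ℤ} (hz : z.1 < 1) {x : V} (hx : x ∈ E.deg z)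
    (h : x ∈ E.pos) : x = 0 := by
  rw [pos, LinearMap.mem_ker, nonposProj, gscale_apply _ _ hx, if_neg (by omega), one_smul] at h
  exact h

variable (E)

theorem nonposProj_idem (x : V) : E.nonposProj (E.nonposProj x) = E.nonposProj x := by
  refine homogeneous_ext (f := E.nonposProj ∘ₗ E.nonposProj) (g := E.nonposProj) E.isInternal
    (fun z x hx => ?_) x
  rw [LinearMap.comp_apply]
  have h : E.nonposProj x = (if 1 ≤ z.1 then (0 : k) else 1) • x := gscale_apply _ _ hx
  rw [h, map_smul, h]
  split_ifs <;> simp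

/-- The projection onto `E^{≥ 1}`. -/
noncomputable def posProj : V →ₗ[k] E.pos :=
  (LinearMap.id - E.nonposProj).codRestrict E.pos fun x => by
    rw [pos, LinearMap.mem_ker, LinearMap.sub_apply, map_sub, nonposProj_idem]
    exact sub_self _

theorem posProj_coe (x : E.pos) : E.posProj x = x := by
  ext
  have h : E.nonposProj x = 0 := x.2
  change (x : V) - E.nonposProj x = x
  rw [h, sub_zero]

theorem posProj_of_mem {x : V} (hx : x ∈ E.pos) : (E.posProj x : V) = x :=
  congrArg Subtype.val (E.posProj_coe ⟨x, hx⟩)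

theorem posProj_of_le {z : ℤ × ℤ} (hz : z.1 < 1) {x : V} (hx : x ∈ E.deg z) : E.posProj x = 0 := by
  ext
  change x - E.nonposProj x = 0
  rw [nonposProj, gscale_apply _ _ hx, if_neg (by omega), one_smul, sub_self]

/-- The shifted grading on `E^{≥ 1}`. -/
noncomputable def posDeg (z : ℤ × ℤ) : Submodule k E.pos :=
  (E.deg (z + (1, 0))).comap E.pos.subtype

theorem posDeg_neg (z : ℤ × ℤ) (hz : z.1 < 0) : E.posDeg z = ⊥ := by
  rw [eq_bot_iff]
  intro x hx
  exact Subtype.ext (eq_zero_of_mem_pos (z := z + (1, 0)) (by simp; omega) hx x.2)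

theorem posProj_mem {z : ℤ × ℤ} {x : V} (hx : x ∈ E.deg (z + (1, 0))) :
    E.posProj x ∈ E.posDeg z := by
  by_cases hz : z.1 < 0
  · rw [E.posProj_of_le (by simp; omega) hx]
    exact zero_mem _
  · have := E.posProj_of_mem (mem_pos (z := z + (1, 0)) (by simp; omega) hx)
    change (E.posProj x : V) ∈ E.deg (z + (1, 0))
    rwa [this]

theorem isInternal_posDeg : DirectSum.IsInternal E.posDeg := by
  refine isInternal_of_proj (fun z => E.posProj ∘ₗ gproj E.isInternal (z + (1, 0)) ∘ₗ
    E.pos.subtype) (fun z x hx => ?_) (fun y z hyz x hx => ?_) ?_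
  · simp only [LinearMap.comp_apply]
    rw [gproj_of_mem E.isInternal (show E.pos.subtype x ∈ E.deg (z + (1, 0)) from hx)]
    exact E.posProj_coe x
  · simp only [LinearMap.comp_apply]
    rw [gproj_of_ne E.isInternal (show E.pos.subtype x ∈ E.deg (y + (1, 0)) from hx)
      fun h => hyz (add_right_cancel h), map_zero]
  · rw [eq_top_iff]
    rintro x -
    rw [← E.posProj_coe x]
    refine homogeneous_induction (p := fun x => E.posProj x ∈ ⨆ z, E.posDeg z) E.isInternal (x : V)
      (fun z x hx => ?_) (by simp) fun x y hx hy => by rw [map_add]; exact add_mem hx hy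
    exact Submodule.mem_iSup_of_mem (z - (1, 0))
      (E.posProj_mem (by rwa [sub_add_cancel]))

theorem exists_graded_of_posDeg {l : List E.pos} {ds : List (ℤ × ℤ)}
    (h : HomogWord E.posDeg l ds) : ∃ w, Graded E.deg w ∧ letters w = l.map Subtype.val ∧
      w.map Prod.snd = ds.map (· + (1, 0)) := by
  induction h with
  | nil => exact ⟨[], by simp [Graded], rfl, rfl⟩
  | @cons x z l ds hx _ ih =>
    obtain ⟨w, hw, h1, h2⟩ := ih
    exact ⟨((x : V), z + (1, 0)) :: w, .cons hx hw, by simp [← h1], by simp [← h2]⟩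

theorem _root_.ExtAInf.sum_map_add_one (ds : List (ℤ × ℤ)) :
    (ds.map (· + ((1, 0) : ℤ × ℤ))).sum = ds.sum + ((ds.length : ℤ), 0) := by
  induction ds with
  | nil => rfl
  | cons z ds ih =>
    simp only [List.map_cons, List.sum_cons, ih, List.length_cons]
    ext
    · simp; ring
    · simp

/-- The sign `(-1)^p`. -/
noncomputable abbrev par : V →ₗ[k] V := signMap E.isInternal 0

/-- The sign `(-1)^{p - 1}`. -/
noncomputable abbrev shiftPar : V →ₗ[k] V := signMap E.isInternal (-1)

theorem shiftPar_apply : ∀ z, ∀ x ∈ E.deg z, E.shiftPar x = (z.1 - 1).negOnePow • x :=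
  signMap_apply _ _

theorem tev_mem {R : Type*} [AddCommGroup R] [Module k R] {T : ℤ × ℤ → Submodule k R}
    {m : ∀ n, MultilinearMap k (fun _ : Fin n => V) R}
    {c : ℤ} (hm : ∀ (n : ℕ) (v : Fin n → V) (d : Fin n → ℤ × ℤ), (∀ j, v j ∈ E.deg (d j)) →
      m n v ∈ T ((∑ j, (d j).1) + (c - (n : ℤ)), ∑ j, (d j).2)) {l : List E.pos}
    {ds : List (ℤ × ℤ)} (h : HomogWord E.posDeg l ds) :
    tev E.par m (l.map Subtype.val) ∈ T (ds.sum + (c, 0)) := by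
  obtain ⟨w, hw, h1, h2⟩ := E.exists_graded_of_posDeg h
  rw [← h1, tev_apply (signMap_zero_apply _) m hw]
  refine units_smul_mem _ ?_
  have h3 := ev_mem hm hw
  have h4 : w.length = ds.length := by
    rw [← List.length_map (f := Prod.snd), h2, List.length_map]
  rw [h2, sum_map_add_one, h4] at h3
  convert h3 using 2
  ext <;> simp

/-- The operations of `E`, transported to the suspension. -/
noncomputable abbrev bar : List V → V := tev E.par E.m

theorem bar_nil : E.bar [] = 0 := by
  change E.m 0 _ = 0
  rw [E.m_zero]; rfl

theorem bar_singleton (h : E.m 1 = 0) (x : V) : E.bar [x] = 0 := by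
  change E.m 1 _ = 0
  rw [h]; rfl

theorem stasheffSum_m {w : List (V × (ℤ × ℤ))} (hw : Graded E.deg w) (hw0 : w ≠ []) :
    stasheffSum E.m E.m w.length (fun j => (w.getD j 0).1) (fun j => (w.getD j 0).2.1) = 0 := by
  -- The identities are stated for infinite sequences; beyond the word the default is the zero
  -- element in degree zero, which is homogeneous.
  refine E.stasheff w.length (List.length_pos_iff.2 hw0) (fun j => (w.getD j 0).1)
    (fun j => (w.getD j 0).2) fun j => ?_
  by_cases hj : j < w.length
  · simp only [List.getD_eq_getElem _ _ hj]
    exact hw _ (List.getElem_mem hj)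
  · simp only [List.getD_eq_default _ _ (not_lt.1 hj)]
    exact zero_mem _

theorem bar_bar (l : List V) : bstar E.shiftPar E.bar E.bar l = 0 := by
  have hl := listLin_tev E.par E.m
  refine (hl.bstar E.shiftPar hl).eq_zero_of_homogeneous E.isInternal (fun l ds h _ => ?_) l rfl
  obtain ⟨w, hw, rfl, -⟩ := h.exists_graded
  rcases eq_or_ne w [] with rfl | hw0
  · change E.bar [E.bar []] = 0
    rw [bar_nil]
    exact hl.map_zero_cons []
  · rw [bstar_tev (signMap_zero_apply _) E.shiftPar_apply E.m_zero E.m_mem E.m hw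
      (a := fun j => (w.getD j 0).1) (p := fun j => (w.getD j 0).2.1)
      (fun j hj => by simp [hj]) (fun j hj => by simp [hj]), E.stasheffSum_m hw hw0, smul_zero]

/-- The operations of `E` on the suspension of `E^{≥ 1}`. -/
noncomputable def posBar (l : List E.pos) : E.pos := E.posProj (E.bar (l.map Subtype.val))

theorem listLin_map_coe {R : Type*} [AddCommGroup R] [Module k R] {α : List V → R}
    (hα : ListLin k α) : ListLin k fun l : List E.pos => α (l.map Subtype.val) :=
  hα.map E.pos.subtype

theorem posBar_lin : ListLin k E.posBar :=
  (E.listLin_map_coe (listLin_tev _ _)).comp E.posProj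

/-- The operations preserve `E^{≥ 1}`, so the projection in `posBar` changes nothing: on a word of
shifted degree `≥ 0` the value has cohomological degree `≥ 2`, and a word of negative shifted degree
contains a zero letter. -/
theorem coe_posBar (l : List E.pos) : (E.posBar l : V) = E.bar (l.map Subtype.val) := by
  rw [← sub_eq_zero]
  refine ((E.posBar_lin.comp E.pos.subtype).sub
    (E.listLin_map_coe (listLin_tev E.par E.m))).eq_zero_of_homogeneous E.isInternal_posDeg
    (fun l ds h _ => sub_eq_zero.2 ?_) l rfl
  by_cases h0 : 0 ≤ ds.sum.1
  · exact E.posProj_of_mem (mem_pos (z := ds.sum + (2, 0)) (by simp; omega)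
      (E.tev_mem E.m_mem h))
  · have h1 : 0 ∈ l := by
      clear * - h h0
      induction h with
      | nil => simp at h0
      | @cons x z l ds hx _ ih =>
        by_cases hz : z.1 < 0
        · rw [E.posDeg_neg z hz, Submodule.mem_bot] at hx
          exact hx ▸ List.mem_cons_self
        · refine List.mem_cons_of_mem _ (ih ?_)
          rw [List.sum_cons, Prod.fst_add] at h0
          omega
    rw [(E.posBar_lin.comp E.pos.subtype).eq_zero_of_mem h1,
      (E.listLin_map_coe (listLin_tev E.par E.m)).eq_zero_of_mem h1]

theorem posBar_deg : WordDeg E.posDeg E.posDeg (1, 0) E.posBar := fun l ds h => by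
  refine E.posProj_mem ?_
  have := E.tev_mem E.m_mem h
  rwa [add_assoc]

/-- The sign on the suspension of `E^{≥ 1}`. -/
noncomputable def posPar : E.pos →ₗ[k] E.pos := signMap E.isInternal_posDeg 0

theorem coe_posPar (x : E.pos) : (E.posPar x : V) = E.shiftPar x := by
  refine homogeneous_ext (f := E.pos.subtype ∘ₗ E.posPar) (g := E.shiftPar ∘ₗ E.pos.subtype)
    E.isInternal_posDeg (fun z x hx => ?_) x
  have h1 : E.posPar x = z.1.negOnePow • x := signMap_zero_apply _ z x hx
  have h2 := E.shiftPar_apply (z + (1, 0)) (x : V) hx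
  simp only [LinearMap.comp_apply, h1, map_units_smul]
  rw [Prod.fst_add, add_sub_cancel_right] at h2
  exact h2.symm

theorem bstar_posBar {R : Type*} [AddCommGroup R] (α : List V → R) (l : List E.pos) :
    bstar E.posPar E.posBar (fun l => α (l.map Subtype.val)) l =
      bstar E.shiftPar E.bar α (l.map Subtype.val) :=
  (bstar_map E.coe_posPar E.coe_posBar α l).symm

theorem posBar_posBar (l : List E.pos) : bstar E.posPar E.posBar E.posBar l = 0 := by
  have h := map_bstar E.pos.subtype E.posPar E.posBar E.posBar l
  have h2 : (fun l => E.pos.subtype (E.posBar l)) = fun l : List E.pos =>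
    E.bar (l.map Subtype.val) := funext E.coe_posBar
  rw [h2, E.bstar_posBar, bar_bar] at h
  exact Subtype.ext h

end AInfinityAlgebra
end PosPart

/-! ### The twisting cochain of a morphism to `End_A(P)` -/

section EndDG
universe w
variable {k : Type*} [Field k] {A : Type*} [Ring A] [Algebra k A]
  {P : Type w} [AddCommGroup P] [Module k P] [Module Aᵐᵒᵖ P] [IsScalarTower k Aᵐᵒᵖ P]
  {𝒜 : ℕ → Submodule k A} (ρ : FreeResolution 𝒜 P)

/-- A DG algebra, identified with the algebra of sums of homogeneous endomorphisms of `P`. -/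
structure EndRep {D : Type*} [Ring D] [Algebra k D] (ρ : FreeResolution 𝒜 P)
    (B : DGAlgebra k D) where
  toEnd : D →ₗ[k] (P →ₗ[Aᵐᵒᵖ] P)
  injective : Function.Injective toEnd
  one : toEnd 1 = LinearMap.id
  mul : ∀ x y, toEnd (x * y) = toEnd x ∘ₗ toEnd y
  mem : ∀ {z x}, x ∈ B.deg z → toEnd x ∈ homDeg A ρ.deg ρ.deg z
  exists_eq : ∀ {z φ}, φ ∈ homDeg A ρ.deg ρ.deg z → ∃ x ∈ B.deg z, toEnd x = φ
  toEnd_d : ∀ {z : ℤ × ℤ} {x}, x ∈ B.deg z →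
    toEnd (B.d x) = ρ.d ∘ₗ toEnd x - z.1.negOnePow • (toEnd x ∘ₗ ρ.d)

/-- The inclusion of `End_A(P)` in the algebra of all endomorphisms. -/
noncomputable def FreeResolution.endRep : EndRep ρ ρ.endDG where
  toEnd := DirectSum.coeLinearMap (homEnd A ρ.deg)
  injective := BarModel.homDeg_coe_injective ρ ρ
  one := map_one (DirectSum.coeRingHom (homEnd A ρ.deg))
  mul := map_mul (DirectSum.coeRingHom (homEnd A ρ.deg))
  mem := by
    rintro z _ ⟨f, rfl⟩
    rw [DirectSum.coeLinearMap_lof]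
    exact f.2
  exists_eq := fun {z φ} hφ => ⟨_, ⟨⟨φ, hφ⟩, rfl⟩, DirectSum.coeLinearMap_lof _ _ _⟩
  toEnd_d := by
    rintro z _ ⟨f, rfl⟩
    have h : ρ.endDG.d (DirectSum.lof k _ (fun z => homEnd A ρ.deg z) z f) =
        DirectSum.lof k _ (fun z => homEnd A ρ.deg z) (z + (1, 0)) (ρ.dHom z f) := by
      change DirectSum.toModule k (ℤ × ℤ) _ _ _ = _
      rw [DirectSum.toModule_lof]
      rfl
    rw [h, DirectSum.coeLinearMap_lof, DirectSum.coeLinearMap_lof]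
    rfl

namespace AInfinityAlgebra
variable {V : Type*} [AddCommGroup V] [Module k V] {E : AInfinityAlgebra k V}
  {ρ} {D : Type*} [Ring D] [Algebra k D] {𝒟 : DGAlgebra k D}

section Model
variable (T : EndRep ρ 𝒟) (f : AInfinityHom E 𝒟.toAInfinity)

/-- The twisting cochain of a morphism to `End_A(P)`. -/
noncomputable def twisting (l : List E.pos) : P →ₗ[Aᵐᵒᵖ] P :=
  if l = [] then ρ.d else -T.toEnd (tev E.par f.f (l.map Subtype.val))

theorem twisting_of_ne {l : List E.pos} (hl : l ≠ []) :
    twisting T f l = -T.toEnd (tev E.par f.f (l.map Subtype.val)) := if_neg hl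

theorem twisting_lin : ListLin k (twisting T f) := fun u t => by
  have h := ((E.listLin_map_coe (listLin_tev E.par f.f)).comp (-T.toEnd)) u t
  simp only [twisting_of_ne T f (List.append_ne_nil_of_right_ne_nil u (List.cons_ne_nil _ t))]
  exact h

theorem twisting_deg : WordDeg E.posDeg (homDeg A ρ.deg ρ.deg) (1, 0) (twisting T f) := by
  intro l ds hl
  rcases eq_or_ne l [] with rfl | h0
  · obtain rfl := List.forall₂_nil_left_iff.1 hl
    intro y x hx
    simpa [twisting] using ρ.d_mem hx
  · rw [twisting_of_ne T f h0]
    exact neg_mem (T.mem (E.tev_mem f.f_mem hl))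

theorem hpull_bar {V' : Type*} [AddCommGroup V'] [Module k V'] {E' : AInfinityAlgebra k V'}
    (f : AInfinityHom E E') {w : List (V × (ℤ × ℤ))} (hw : Graded E.deg w) (hw0 : w ≠ []) :
    bstar E.shiftPar E.bar (tev E.par f.f) (letters w) =
      hpull (tev E.par f.f) E'.bar (letters w) := by
  have h1 := f.stasheff w.length (List.length_pos_iff.2 hw0) (fun j => (w.getD j 0).1)
    (fun j => (w.getD j 0).2) fun j => by
      by_cases hj : j < w.length
      · simp only [List.getD_eq_getElem _ _ hj]
        exact hw _ (List.getElem_mem hj)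
      · simp only [List.getD_eq_default _ _ (not_lt.1 hj)]
        exact zero_mem _
  rw [bstar_tev (signMap_zero_apply _) E.shiftPar_apply E.m_zero E.m_mem f.f hw
      (a := fun j => (w.getD j 0).1) (p := fun j => (w.getD j 0).2.1)
      (fun j hj => by simp [hj]) (fun j hj => by simp [hj]),
    hpull_tev (signMap_zero_apply _) (signMap_zero_apply _) f.f_mem hw
      (a := fun j => (w.getD j 0).1) (p := fun j => (w.getD j 0).2.1)
      (fun j hj => by simp [hj]) (fun j hj => by simp [hj])]
  exact congrArg _ h1

/-- The bar differential of `End_A(P)` is `B [y] = d y` and `B [y, y'] = (-1)^{|y|} y y'`. The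
convolution factors on the empty word supply the commutator with `d`, i.e. the first term. The minus
sign in `twisting` is needed for the quadratic terms: it changes their sign relative to the linear
ones. -/
theorem twisting_twisting (l : List E.pos) : conv (fun l => twisting T f (l.map E.posPar))
    (twisting T f) l = bstar E.posPar E.posBar (twisting T f) l := by
  rw [← sub_eq_zero]
  refine ((((twisting_lin T f).map E.posPar).conv (twisting_lin T f)).sub
    ((twisting_lin T f).bstar E.posPar E.posBar_lin)).eq_zero_of_homogeneous E.isInternal_posDeg
    (fun l ds h _ => sub_eq_zero.2 ?_) l rfl
  rcases eq_or_ne l [] with rfl | hl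
  · have h0 : E.posBar [] = 0 := by
      rw [posBar, List.map_nil, bar_nil, map_zero]
    change twisting T f [] ∘ₗ twisting T f [] = twisting T f [E.posBar []]
    rw [h0, (twisting_lin T f).map_zero_cons]
    exact LinearMap.ext fun x => ρ.d_d x
  set F : List E.pos → D := fun l => tev E.par f.f (l.map Subtype.val) with hF
  have hFlin : ListLin k F := E.listLin_map_coe (listLin_tev E.par f.f)
  have hFdeg : WordDeg E.posDeg 𝒟.deg (1, 0) F := fun l ds h => E.tev_mem f.f_mem h
  have hσ : ∀ {u du}, HomogWord E.posDeg u du →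
      F (u.map E.posPar) = du.sum.1.negOnePow • F u := fun {u du} hu => by
    have := hFlin.map_sign (σ := E.posPar) (ε := Prod.fst)
      (signMap_zero_apply E.isInternal_posDeg) hu
    rwa [sum_map_fst] at this
  set B := 𝒟.toAInfinity.bar with hB
  have hB1 : ∀ y, B [y] = 𝒟.d y := fun y => rfl
  have hB2 : ∀ y y', B [y, y'] = 𝒟.toAInfinity.par y * y' := fun y y' => by
    exact dgOp_two 𝒟.d _
  have hB3 : ∀ l, 3 ≤ l.length → B l = 0 := fun l hl => by
    change dgOp 𝒟.d _ _ = 0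
    rw [dgOp_of_three_le _ (by rwa [twist_length])]
    rfl
  have e1 : bstar E.posPar E.posBar (twisting T f) l = -T.toEnd (B [F l] +
      splitSum (fun u v => if u = [] ∨ v = [] then 0 else B [F u, F v]) l) := by
    rw [← hpull_eq_of_length_le_two F hl hB3]
    obtain ⟨w, hw, h1, h2⟩ := E.exists_graded_of_posDeg h
    have hw0 : w ≠ [] := fun e => by
      rw [e] at h1
      exact hl (List.map_eq_nil_iff.1 h1.symm)
    have h3 := hpull_bar f hw hw0
    rw [h1, ← E.bstar_posBar] at h3
    have h4 := hpull_map (h := tev E.par f.f) (h' := F) (s := Subtype.val) (s' := id)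
      (fun _ => rfl) B l
    simp only [List.map_id] at h4
    rw [← h4, ← hB] at *
    rw [← h3, ← LinearMap.neg_apply, map_bstar]
    refine splitSum_congr fun u r _ => splitSum_congr fun v t _ => ?_
    rw [twisting_of_ne T f (by simp)]
    rfl
  rw [e1, conv, splitSum_eq_ends_add _ hl]
  have e2 : twisting T f ([].map E.posPar) ∘ₗ twisting T f l +
      twisting T f (l.map E.posPar) ∘ₗ twisting T f [] = -T.toEnd (B [F l]) := by
    rw [hB1, T.toEnd_d (hFdeg l ds h), twisting_of_ne T f hl,
      twisting_of_ne T f (l := l.map E.posPar) (by simpa using hl)]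
    change ρ.d ∘ₗ (-T.toEnd (F l)) + (-T.toEnd (F (l.map E.posPar))) ∘ₗ ρ.d = _
    rw [hσ h, map_units_smul, Prod.fst_add, Int.negOnePow_succ]
    simp only [LinearMap.comp_neg, LinearMap.neg_comp, LinearMap.smul_comp, Units.neg_smul]
    abel
  have e3 : splitSum (fun u v => if u = [] ∨ v = [] then 0 else
      twisting T f (u.map E.posPar) ∘ₗ twisting T f v) l =
      -T.toEnd (splitSum (fun u v => if u = [] ∨ v = [] then 0 else B [F u, F v]) l) := by
    rw [map_splitSum, ← splitSum_neg]
    refine splitSum_congr fun u v huv => ?_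
    subst huv
    obtain ⟨du, dv, rfl, hu, hv⟩ := h.of_append
    split_ifs with h0
    · simp
    · rw [not_or] at h0
      rw [twisting_of_ne T f h0.2, twisting_of_ne T f (by simpa using h0.1), hB2, T.mul]
      change (-T.toEnd (F (u.map E.posPar))) ∘ₗ (-T.toEnd (F v)) = _
      have h5 : 𝒟.toAInfinity.par (F u) = (du.sum + (1, 0)).1.negOnePow • F u :=
        signMap_zero_apply _ _ _ (hFdeg u du hu)
      rw [hσ hu, h5, map_units_smul, map_units_smul, Prod.fst_add, Int.negOnePow_succ]
      simp only [LinearMap.comp_neg, LinearMap.neg_comp, LinearMap.smul_comp, Units.neg_smul,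
        neg_neg]
  rw [e2, e3, map_add, neg_add]

theorem twisting_singleton (x : E.pos) :
    twisting T f [x] = -T.toEnd (f.f 1 ![(x : V)]) := by
  rw [twisting_of_ne T f (by simp)]
  congr 2
  change f.f 1 _ = _
  congr 1
  funext i
  rw [Fin.eq_zero i]
  rfl

variable {f}

theorem twisting_inj (hE : E.m 1 = 0) (hf : f.IsQuasiIso) (z : ℤ × ℤ) (x : E.pos)
    (_ : x ∈ E.posDeg z) (g : P →ₗ[Aᵐᵒᵖ] P) (hg : g ∈ homDeg A ρ.deg ρ.deg z)
    (H : ∀ p, twisting T f [x] p = ρ.d (g p) - z.1.negOnePow • g (ρ.d p)) : x = 0 := by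
  obtain ⟨w, hw, rfl⟩ := T.exists_eq hg
  obtain ⟨y, hy⟩ := hf.1 (x : V) (by rw [hE]; rfl) ⟨-w, by
    change _ = 𝒟.d (-w)
    apply T.injective
    rw [map_neg, map_neg, T.toEnd_d hw, ← neg_inj, ← twisting_singleton, neg_neg]
    exact LinearMap.ext H⟩
  rw [hE] at hy
  exact Subtype.ext hy

theorem twisting_surj (hf : f.IsQuasiIso) (z : ℤ × ℤ) (hz : 0 ≤ z.1)
    (φ : P →ₗ[Aᵐᵒᵖ] P) (hφ : φ ∈ homDeg A ρ.deg ρ.deg (z + (1, 0)))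
    (hd : ∀ p, ρ.d (φ p) = -(z.1.negOnePow • φ (ρ.d p))) :
    ∃ x ∈ E.posDeg z, ∃ g ∈ homDeg A ρ.deg ρ.deg z,
      ∀ p, φ p = twisting T f [x] p + (ρ.d (g p) - z.1.negOnePow • g (ρ.d p)) := by
  obtain ⟨y, hy, rfl⟩ := T.exists_eq hφ
  have hyd : 𝒟.d y = 0 := by
    apply T.injective
    rw [T.toEnd_d hy, map_zero, Prod.fst_add, Int.negOnePow_succ]
    refine LinearMap.ext fun p => ?_
    change ρ.d (T.toEnd y p) - (-z.1.negOnePow) • T.toEnd y (ρ.d p) = 0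
    rw [hd, Units.neg_smul, sub_neg_eq_add, neg_add_cancel]
  obtain ⟨x, -, w, hw⟩ := hf.2 y hyd
  let f1 : V →ₗ[k] D := (listLin_ev f.f [] []).mk' _
  have hf1 : ∀ x, f1 x = f.f 1 ![x] := fun x => by
    change f.f 1 _ = _
    congr 1
    funext i
    rw [Fin.eq_zero i]
    rfl
  have hw' : y - f1 x = 𝒟.d w := by rw [hf1]; exact hw
  have hf1deg : ∀ y, ∀ x ∈ E.deg y, f1 x ∈ 𝒟.deg (y + 0) := fun y x hx => by
    rw [hf1]
    have := f.f_mem 1 ![x] (fun _ => y) fun j => by rw [Fin.eq_zero j]; exact hx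
    have e : (∑ _j : Fin 1, y.1 + (1 - ((1 : ℕ) : ℤ)), ∑ _j : Fin 1, y.2) = y + 0 := by
      ext <;> simp
    rw [e] at this
    exact this
  -- The quasi-isomorphism supplies elements that need not be homogeneous; their components in the
  -- right degrees satisfy the same equation.
  have hproj : y = f1 (gproj E.isInternal (z + (1, 0)) x) + 𝒟.d (gproj 𝒟.isInternal z w) := by
    rw [map_gproj E.isInternal 𝒟.isInternal f1 hf1deg,
      map_gproj 𝒟.isInternal 𝒟.isInternal 𝒟.d (fun y x hx => 𝒟.d_mem hx), ← hw', add_zero,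
      ← map_add, add_sub_cancel]
    exact (gproj_of_mem 𝒟.isInternal hy).symm
  have hxm := gproj_mem E.isInternal (z + (1, 0)) x
  have hg := gproj_mem 𝒟.isInternal z w
  have hz' : 1 ≤ (z + ((1, 0) : ℤ × ℤ)).1 := by simp; omega
  -- The sign offsets the one in `twisting`.
  refine ⟨-⟨_, mem_pos hz' hxm⟩, neg_mem hxm, _, T.mem hg, fun p => ?_⟩
  have h2 := congrArg T.toEnd hproj
  rw [map_add, T.toEnd_d hg, hf1] at h2
  have h3 : twisting T f [-⟨_, mem_pos hz' hxm⟩] = -twisting T f [⟨_, mem_pos hz' hxm⟩] :=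
    (twisting_lin T f [] []).map_neg _
  rw [h3, twisting_singleton, neg_neg]
  exact LinearMap.congr_fun h2 p

end Model

/-- The bar construction of an `A_∞`-Ext-algebra. -/
noncomputable def barModel (T : EndRep ρ 𝒟) {f : AInfinityHom E 𝒟.toAInfinity} (hE : E.m 1 = 0)
    (hf : f.IsQuasiIso) : BarModel ρ E.pos where
  deg := E.posDeg
  isInternal := E.isInternal_posDeg
  deg_neg := E.posDeg_neg
  σ := E.posPar
  σ_apply := signMap_zero_apply _
  b := E.posBar
  b_lin := E.posBar_lin
  b_nil := by rw [posBar, List.map_nil, bar_nil, map_zero]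
  b_singleton x := by
    rw [posBar, List.map_cons, List.map_nil, E.bar_singleton hE, map_zero]
  b_deg := E.posBar_deg
  b_b := E.posBar_posBar
  F := twisting T f
  F_lin := twisting_lin T f
  F_nil := if_pos rfl
  F_deg := twisting_deg T f
  F_F := twisting_twisting T f
  inj := twisting_inj T hE hf
  surj := twisting_surj T hf

end AInfinityAlgebra
end EndDG

/-! ### Nonpositive degrees and the augmentation -/

section Unital
universe w
variable {k : Type*} [Field k] {A : Type*} [Ring A] [Algebra k A]
  {P : Type w} [AddCommGroup P] [Module k P] [Module Aᵐᵒᵖ P] [IsScalarTower k Aᵐᵒᵖ P]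
  {𝒜 : ℕ → Submodule k A} {ρ : FreeResolution 𝒜 P}
  {V : Type*} [AddCommGroup V] [Module k V] {E : AInfinityAlgebra k V}
  {D : Type*} [Ring D] [Algebra k D] {𝒟 : DGAlgebra k D}

namespace AInfinityAlgebra

/-- `ε` is an augmentation with kernel `E^{≥ 1}`. -/
structure IsAugmentation (E : AInfinityAlgebra k V) (ε : V →ₗ[k] k) : Prop where
  map_one : ε E.one = 1
  map_pos : ∀ x : E.pos, ε x = 0
  map_deg : ∀ z, z ≠ 0 → ∀ x ∈ E.deg z, ε x = 0
  decomp : ∀ x, x = ε x • E.one + E.posProj x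

theorem d_f_one (hE : E.m 1 = 0) (f : AInfinityHom E 𝒟.toAInfinity) {z : ℤ × ℤ} {x : V}
    (hx : x ∈ E.deg z) : 𝒟.d (f.f 1 ![x]) = 0 := by
  have h := hpull_bar f (w := [(x, z)]) (Graded.cons hx (by simp [Graded])) (by simp)
  have hlin := listLin_tev E.par f.f
  have h1 : ∀ y, tev E.par f.f [y, 0] = 0 := fun y => hlin.map_zero [y] []
  have h2 : tev E.par f.f [0] = 0 := hlin.map_zero_cons []
  have h3 : tev E.par f.f [0, x] = 0 := hlin.map_zero_cons [x]
  simp only [letters, List.map_cons, List.map_nil, bstar, splitSum_cons, splitSum_nil,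
    List.nil_append, List.cons_append, E.bar_nil, E.bar_singleton hE, h1, h2, h3, add_zero,
    hpull_cons, hpull_nil] at h
  have e : tev E.par f.f [x] = f.f 1 ![x] := by
    change f.f 1 _ = _
    congr 1
    funext i
    rw [Fin.eq_zero i]
    rfl
  rw [e] at h
  exact h.symm

/-- A cocycle `φ` of cohomological degree `≤ 0` minus the multiple `aug (φ e)` of the identity has
zero composite with the augmentation, hence is a coboundary. Since `m_1 = 0`, the corresponding
equality holds in `E` itself. -/
theorem exists_eq_smul_one [GradedAlgebra 𝒜] (h𝒜 : IsConnectedLocallyFinite 𝒜)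
    (T : EndRep ρ 𝒟) (hE : E.m 1 = 0) {f : AInfinityHom E 𝒟.toAInfinity} (hf : f.IsQuasiIso)
    {z : ℤ × ℤ} (hz : z.1 ≤ 0) {x : V} (hx : x ∈ E.deg z) :
    ∃ c : k, x = c • E.one ∧ (z ≠ 0 → c = 0) := by
  set φ := T.toEnd (f.f 1 ![x]) with hφ
  have hφ0 : f.f 1 ![x] ∈ 𝒟.deg z := by
    have := f.f_mem 1 ![x] (fun _ => z) fun j => by rw [Fin.eq_zero j]; exact hx
    have e : (∑ _j : Fin 1, z.1 + (1 - ((1 : ℕ) : ℤ)), ∑ _j : Fin 1, z.2) = z := by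
      ext <;> simp
    rw [e] at this
    exact this
  have hφm : φ ∈ homDeg A ρ.deg ρ.deg z := T.mem hφ0
  have hφd : ∀ p, ρ.d (φ p) = z.1.negOnePow • φ (ρ.d p) := fun p => by
    have := LinearMap.congr_fun (T.toEnd_d hφ0) p
    rw [d_f_one hE f hx, map_zero] at this
    exact sub_eq_zero.1 this.symm
  have hφe : φ ρ.e ∈ ρ.deg z := by
    have := hφm _ _ ρ.e_mem
    rwa [show ((0, 0) : ℤ × ℤ) = 0 from rfl, zero_add] at this
  refine ⟨ρ.aug (φ ρ.e), ?_, fun h0 => ρ.aug_deg z h0 _ hφe⟩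
  set c := ρ.aug (φ ρ.e) with hc
  have hc0 : z ≠ 0 → c = 0 := fun h0 => ρ.aug_deg z h0 _ hφe
  have hψm : φ - c • LinearMap.id ∈ homDeg A ρ.deg ρ.deg z := by
    refine sub_mem hφm ?_
    by_cases h0 : z = 0
    · subst h0
      exact Submodule.smul_mem _ _ fun y p hp => by rw [add_zero]; exact hp
    · rw [hc0 h0, zero_smul]
      exact zero_mem _
  have hcz : ∀ p, z.1.negOnePow • c • p = c • p := fun p : P => by
    by_cases h0 : z = 0
    · subst h0
      simp
    · rw [hc0 h0, zero_smul, smul_zero]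
  obtain ⟨h, hh, -, hψ⟩ := FreeResolution.exists_homotopy_of_aug_eq_zero h𝒜 ρ ρ z.1.negOnePow
    hψm (fun p => by
      simp only [LinearMap.sub_apply, LinearMap.smul_apply, LinearMap.id_apply, map_sub, hφd,
        smul_sub, hcz]
      rw [LinearMap.map_smul_of_tower]) (fun p => by
      refine homogeneous_induction
        (p := fun p => ρ.aug ((φ - c • LinearMap.id : P →ₗ[Aᵐᵒᵖ] P) p) = 0)
        ρ.isInternal p (fun y p hp => ?_) (by simp) fun p q hp hq => by
          rw [map_add, map_add, hp, hq, add_zero]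
      have hm := hψm y p hp
      -- Only degree `y = -z` can have a nonzero augmentation. There `y.1 ≥ 0`, so `p - aug p • e`
      -- is a boundary, and `aug ∘ φ` vanishes on boundaries because `φ` commutes with `d` up to
      -- sign.
      by_cases hyz : y + z = 0
      · have hy : 0 ≤ y.1 := by
          have := congrArg Prod.fst hyz
          simp only [Prod.fst_add, Prod.fst_zero] at this
          omega
        obtain ⟨q, hq⟩ := ρ.exact (p - ρ.aug p • ρ.e)
          (by rw [map_sub, ρ.d_eq_zero hp hy, LinearMap.map_smul_of_tower, ρ.d_e, smul_zero,
            sub_zero])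
          (by rw [map_sub, map_smul, ρ.aug_e, smul_eq_mul, _root_.mul_one, sub_self])
        have h1 := congrArg (fun p => ρ.aug (φ p)) hq
        have h2 : ρ.aug (φ (ρ.d q)) = 0 := by
          have h3 := ρ.aug_d (φ q)
          rw [hφd, map_units_smul] at h3
          rw [← units_smul_smul_self z.1.negOnePow (ρ.aug (φ (ρ.d q))), h3, smul_zero]
        simp only [h2, map_sub, LinearMap.map_smul_of_tower, map_smul] at h1
        simp only [LinearMap.sub_apply, LinearMap.smul_apply, LinearMap.id_apply, map_sub,
          map_smul, smul_eq_mul] at h1 ⊢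
        rw [mul_comm c]
        exact h1.symm
      · exact ρ.aug_deg _ hyz _ hm)
  obtain ⟨w, hw, rfl⟩ := T.exists_eq hh
  have hone : f.f 1 ![E.one] = 1 := by
    refine Eq.trans (congrArg _ ?_) f.map_one
    funext i
    rw [Fin.eq_zero i]
    rfl
  have hlin : f.f 1 ![x - c • E.one] = f.f 1 ![x] - c • 1 := by
    let f1 : V →ₗ[k] D := (listLin_ev f.f [] []).mk' _
    have hf1 : ∀ x, f1 x = f.f 1 ![x] := fun x => by
      change f.f 1 _ = _
      congr 1
      funext i
      rw [Fin.eq_zero i]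
      rfl
    rw [← hf1, map_sub, map_smul, hf1, hf1, hone]
  obtain ⟨y, hy⟩ := hf.1 (x - c • E.one) (by rw [hE]; rfl) ⟨w, by
    change _ = 𝒟.d w
    apply T.injective
    rw [hlin, T.toEnd_d hw, map_sub, map_smul, T.one]
    refine LinearMap.ext fun p => ?_
    rw [Prod.fst_sub, Int.negOnePow_sub, Int.negOnePow_one]
    have := hψ p
    simp only [LinearMap.sub_apply, LinearMap.smul_apply, LinearMap.id_apply,
      LinearMap.comp_apply] at this ⊢
    rw [this, mul_neg_one, Units.neg_smul, sub_neg_eq_add]⟩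
  rw [hE] at hy
  exact sub_eq_zero.1 hy

theorem exists_isAugmentation [GradedAlgebra 𝒜] (h𝒜 : IsConnectedLocallyFinite 𝒜)
    (T : EndRep ρ 𝒟) (hE : E.m 1 = 0) {f : AInfinityHom E 𝒟.toAInfinity} (hf : f.IsQuasiIso) :
    ∃ ε, IsAugmentation E ε := by
  -- The morphism sends the unit to the identity of `P`, which fixes an element of augmentation one.
  have hone : E.one ≠ 0 := fun h0 => by
    have h1 := f.map_one
    rw [h0] at h1
    have h2 : f.f 1 (fun _ => (0 : V)) = 0 := (f.f 1).map_coord_zero 0 rfl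
    rw [h2] at h1
    have h3 : (1 : D) = 0 := h1.symm
    have h4 := LinearMap.congr_fun T.one ρ.e
    rw [h3, map_zero] at h4
    have h5 := ρ.aug_e
    rw [← show (LinearMap.id : P →ₗ[Aᵐᵒᵖ] P) ρ.e = ρ.e from rfl, ← h4] at h5
    simp at h5
  obtain ⟨μ, hμ⟩ := LinearMap.exists_leftInverse_of_injective
    (LinearMap.toSpanSingleton k V E.one) (LinearMap.ker_toSpanSingleton k hone)
  have hμ' : ∀ c : k, μ (c • E.one) = c := fun c => LinearMap.congr_fun hμ c
  have h1 : E.nonposProj E.one = E.one := by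
    rw [nonposProj, gscale_apply _ _ E.one_mem, if_neg (by simp), one_smul]
  have h2 : ∀ x, ∃ c : k, E.nonposProj x = c • E.one := fun x =>
    homogeneous_induction (p := fun x => ∃ c : k, E.nonposProj x = c • E.one) E.isInternal x
      (fun z x hx => by
        by_cases hz : 1 ≤ z.1
        · exact ⟨0, by rw [zero_smul]; exact mem_pos hz hx⟩
        · obtain ⟨c, hc, -⟩ := exists_eq_smul_one h𝒜 T hE hf (by omega) hx
          exact ⟨c, by rw [hc, map_smul, h1]⟩)
      ⟨0, by simp⟩ fun x y ⟨c, hc⟩ ⟨c', hc'⟩ => ⟨c + c', by rw [map_add, hc, hc', add_smul]⟩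
  refine ⟨μ ∘ₗ E.nonposProj, ?_, fun x => ?_, fun z hz x hx => ?_, fun x => ?_⟩
  · rw [LinearMap.comp_apply, h1]
    simpa using hμ' 1
  · rw [LinearMap.comp_apply, show E.nonposProj x = 0 from x.2, map_zero]
  · rw [LinearMap.comp_apply]
    by_cases hz1 : 1 ≤ z.1
    · rw [show E.nonposProj x = 0 from mem_pos hz1 hx, map_zero]
    · obtain ⟨c, hc, hc0⟩ := exists_eq_smul_one h𝒜 T hE hf (by omega) hx
      rw [hc, hc0 hz, zero_smul, map_zero, map_zero]
  · obtain ⟨c, hc⟩ := h2 x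
    rw [LinearMap.comp_apply, hc, hμ', ← hc]
    change x = E.nonposProj x + (x - E.nonposProj x)
    abel

end AInfinityAlgebra
end Unital

/-! ### Extension of morphisms over the strict unit -/

section Extension
variable {k V V' : Type*} [Field k] [AddCommGroup V] [Module k V] [AddCommGroup V'] [Module k V']

theorem ListLin.eq_zero_of_letters {R : Type*} [AddCommGroup R] [Module k R] {α : List V → R}
    (hα : ListLin k α) {p : V → Prop}
    (hp : ∀ x, ∃ y z, p y ∧ p z ∧ ∃ c : k, x = c • y + z)
    (H : ∀ l, (∀ x ∈ l, p x) → α l = 0) (l : List V) : α l = 0 := by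
  suffices ∀ (t u : List V), (∀ x ∈ u, p x) → α (u ++ t) = 0 from this l [] (by simp)
  intro t
  induction t with
  | nil =>
    intro u hu
    rw [List.append_nil]
    exact H u hu
  | cons x t ih =>
    intro u hu
    obtain ⟨y, z, hy, hz, c, rfl⟩ := hp x
    have h : ∀ y, p y → α (u ++ y :: t) = 0 := fun y hy => by
      have := ih (u ++ [y]) (by simpa [or_imp, forall_and] using ⟨hu, hy⟩)
      simpa using this
    rw [(hα u t).map_add, (hα u t).map_smul, h y hy, h z hz, smul_zero, add_zero]


namespace AInfinityAlgebra
variable {E : AInfinityAlgebra k V} {E' : AInfinityAlgebra k V'} {ε : V →ₗ[k] k}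
  {ε' : V' →ₗ[k] k}

theorem IsAugmentation.exists_decomp (hε : IsAugmentation E ε) (x : V) :
    ∃ y z, (y = E.one ∨ y ∈ E.pos) ∧ (z = E.one ∨ z ∈ E.pos) ∧ ∃ c : k, x = c • y + z :=
  ⟨E.one, E.posProj x, .inl rfl, .inr (E.posProj x).2, ε x, hε.decomp x⟩

theorem posProj_one : E.posProj E.one = 0 := E.posProj_of_le (by simp) E.one_mem

theorem par_one : E.par E.one = E.one := by
  have := signMap_zero_apply E.isInternal _ _ E.one_mem
  simpa using this

theorem par_par (x : V) : E.par (E.par x) = x :=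
  homogeneous_ext (f := E.par ∘ₗ E.par) (g := (LinearMap.id : V →ₗ[k] V)) E.isInternal
    (fun z x hx => by
      simp only [LinearMap.comp_apply, signMap_zero_apply _ z x hx, map_units_smul,
        units_smul_smul_self, LinearMap.id_apply]) x

theorem par_eq_neg_shiftPar (x : V) : E.par x = -E.shiftPar x :=
  homogeneous_ext (f := E.par) (g := -E.shiftPar) E.isInternal
    (fun z x hx => by
      rw [LinearMap.neg_apply, signMap_zero_apply _ z x hx, E.shiftPar_apply z x hx,
        Int.negOnePow_sub, Int.negOnePow_one, mul_neg_one, Units.neg_smul, neg_neg]) x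

theorem twist_one_mem {n : ℕ} {l : List V} (h : E.one ∈ l) : E.one ∈ twist E.par n l := by
  have hpow : ∀ m : ℕ, (E.par ^ m) E.one = E.one := by
    intro m
    induction m with
    | zero => rfl
    | succ m ih => rw [pow_succ', Module.End.mul_apply, ih, par_one]
  induction l with
  | nil => simp at h
  | cons x l ih =>
    rcases List.mem_cons.1 h with rfl | h
    · rw [twist, hpow]
      exact List.mem_cons_self
    · exact List.mem_cons_of_mem _ (ih h)

theorem bar_one {l : List V} (h : E.one ∈ l) (hl : l.length ≠ 2) : E.bar l = 0 := by
  have h1 := twist_one_mem (n := 0) h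
  obtain ⟨i, hi⟩ := List.mem_iff_get.1 h1
  exact E.m_one _ (by rwa [twist_length]) _ ⟨i, hi⟩

theorem bar_one_left (x : V) : E.bar [E.one, x] = x := by
  have h : E.bar [E.one, x] = E.m 2 ![E.par E.one, x] := by
    change E.m 2 _ = _
    congr 1
    funext i
    fin_cases i <;> rfl
  rw [h, par_one, E.one_mul]

theorem bar_one_right (x : V) : E.bar [x, E.one] = E.par x := by
  have h : E.bar [x, E.one] = E.m 2 ![E.par x, E.one] := by
    change E.m 2 _ = _
    congr 1
    funext i
    fin_cases i <;> rfl
  rw [h, E.mul_one]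

variable (E E' ε) in
/-- The extension of `h` to words which may contain the unit. -/
noncomputable def unitExt (h : List E.pos → E'.pos) (l : List V) : V' :=
  (h (l.map E.posProj) : V') + if l.length = 1 then (l.map ε).sum • E'.one else 0

section UnitExt
variable {h : List E.pos → E'.pos}

theorem unitExt_lin (hh : ListLin k h) : ListLin k (unitExt E E' ε h) := by
  refine ListLin.add ((hh.map E.posProj).comp E'.pos.subtype) fun u t => ?_
  have : (fun x => if (u ++ x :: t).length = 1 then ((u ++ x :: t).map ε).sum • E'.one else 0) =
      fun x => if u = [] ∧ t = [] then ε x • E'.one else 0 := by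
    funext x
    by_cases h : u = [] ∧ t = []
    · obtain ⟨rfl, rfl⟩ := h
      simp
    · rw [if_neg h, if_neg]
      intro h1
      rw [List.length_append, List.length_cons] at h1
      exact h ⟨List.eq_nil_of_length_eq_zero (by omega), List.eq_nil_of_length_eq_zero (by omega)⟩
  rw [this]
  split_ifs
  · exact ⟨fun x y => by rw [map_add, add_smul], fun c x => by rw [map_smul, smul_assoc]⟩
  · exact ⟨fun x y => (add_zero 0).symm, fun c x => (smul_zero c).symm⟩

theorem unitExt_one (hε : IsAugmentation E ε) (hh : ListLin k h) :
    unitExt E E' ε h [E.one] = E'.one := by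
  have : h [0] = 0 := hh.map_zero_cons []
  simp [unitExt, posProj_one, this, hε.map_one]

theorem unitExt_eq_zero (hh : ListLin k h) {l : List V} (h1 : E.one ∈ l) (hl : l.length ≠ 1) :
    unitExt E E' ε h l = 0 := by
  have h0 : (0 : E.pos) ∈ l.map E.posProj := List.mem_map.2 ⟨_, h1, posProj_one⟩
  rw [unitExt, hh.eq_zero_of_mem h0, if_neg hl, add_zero]
  rfl

theorem unitExt_coe (hε : IsAugmentation E ε) (l : List E.pos) :
    unitExt E E' ε h (l.map Subtype.val) = h l := by
  have h1 : (l.map Subtype.val).map E.posProj = l := by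
    rw [List.map_map]
    exact (List.map_congr_left fun x _ => E.posProj_coe x).trans (List.map_id l)
  have h2 : ((l.map Subtype.val).map ε).sum = 0 := by
    rw [List.map_map]
    refine List.sum_eq_zero fun c hc => ?_
    obtain ⟨x, -, rfl⟩ := List.mem_map.1 hc
    exact hε.map_pos x
  rw [unitExt, h1, h2, zero_smul, ite_self, add_zero]

theorem unitExt_deg (hε : IsAugmentation E ε) (hd : WordDeg E.posDeg E'.posDeg 0 h) :
    ∀ l ds, HomogWord E.deg l ds →
      unitExt E E' ε h l ∈ E'.deg (ds.sum + (1 - (l.length : ℤ), 0)) := by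
  intro l ds hl
  refine add_mem ?_ ?_
  · have h1 : HomogWord E.posDeg (l.map E.posProj) (ds.map (· - (1, 0))) := by
      induction hl with
      | nil => exact .nil
      | cons hx _ ih => exact .cons (E.posProj_mem (by rwa [sub_add_cancel])) ih
    have h2 : (ds.map (· - ((1, 0) : ℤ × ℤ))).sum = ds.sum - ((l.length : ℤ), 0) := by
      clear h1
      induction hl with
      | nil => rfl
      | @cons x z l ds _ _ ih =>
        rw [List.map_cons, List.sum_cons, ih, List.sum_cons, List.length_cons]
        ext
        · simp; ring
        · simp
    have h3 := hd _ _ h1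
    rw [h2] at h3
    have h4 : ds.sum - ((l.length : ℤ), 0) + 0 + (1, 0) = ds.sum + (1 - (l.length : ℤ), 0) := by
      ext
      · simp; ring
      · simp
    rw [← h4]
    exact h3
  · split_ifs with h1
    · obtain ⟨x, rfl⟩ := List.length_eq_one_iff.1 h1
      obtain ⟨z, ds', hx, h', rfl⟩ := List.forall₂_cons_left_iff.1 hl
      obtain rfl := List.forall₂_nil_left_iff.1 h'
      by_cases hz : z = 0
      · subst hz
        have := Submodule.smul_mem _ (([x].map ε).sum) E'.one_mem
        simpa using this
      · simp [hε.map_deg z hz x hx]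
    · exact zero_mem _

theorem unitExt_shiftPar (hε : IsAugmentation E ε) (hh : ListLin k h)
    (hd : WordDeg E.posDeg E'.posDeg 0 h) (l : List V) :
    E'.par (unitExt E E' ε h l) = -unitExt E E' ε h (l.map E.shiftPar) := by
  rw [← add_eq_zero_iff_eq_neg]
  have hl := unitExt_lin (E' := E') (ε := ε) hh
  refine ((hl.comp E'.par).add (hl.map E.shiftPar)).eq_zero_of_homogeneous E.isInternal
    (fun l ds h1 hn => ?_) l rfl
  clear hn
  rw [signMap_zero_apply _ _ _ (unitExt_deg hε hd l ds h1),
    hl.map_sign (ε := fun z => z.1 - 1) E.shiftPar_apply h1]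
  have h2 : (ds.map fun z : ℤ × ℤ => z.1 - 1).sum = ds.sum.1 - l.length := by
    induction h1 with
    | nil => rfl
    | @cons x z l ds _ _ ih =>
      rw [List.map_cons, List.sum_cons, ih, List.sum_cons, List.length_cons]
      simp; ring
  have h3 : (ds.sum + (1 - (l.length : ℤ), 0)).1 = ds.sum.1 - l.length + 1 := by
    simp; ring
  rw [h2, h3, Int.negOnePow_succ, Units.neg_smul, neg_add_cancel]

end UnitExt
end AInfinityAlgebra
end Extension

section Unit
variable {k V V' R : Type*} [Field k] [AddCommGroup V] [Module k V] [AddCommGroup V'] [Module k V']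
  [AddCommGroup R] [Module k R]

/-- If `h` vanishes on all words with a letter `e` except `[e]`, then only decompositions in which
the letter `e` forms a block contribute to `hpull h`. -/
theorem hpull_append_unit_cons {Y : Type*} {h : List Y → V'} {e : Y} {e' : V'} (h1 : h [e] = e')
    (h0 : ∀ l, e ∈ l → l.length ≠ 1 → h l = 0) {α : List V' → R} (hα : ListLin k α)
    (u t : List Y) : hpull h α (u ++ e :: t) =
      hpull h (fun l => hpull h (fun l' => α (l ++ e' :: l')) t) u := by
  induction u using list_length_induction generalizing α with
  | nil =>
    rw [List.nil_append, hpull_cons, splitSum_eq_first, h1]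
    · rfl
    · intro a b _ ha
      have : h (e :: a) = 0 := h0 _ List.mem_cons_self (by simpa using ha)
      rw [this]
      exact hpull_eq_zero _ fun l => hα.map_zero_cons l
  | cons x u ih =>
    rw [List.cons_append, hpull_cons, splitSum_append_cons, hpull_cons]
    have : splitSum (fun a b => hpull h (fun l => α (h (x :: (u ++ e :: a)) :: l)) b) t = 0 := by
      refine splitSum_eq_zero fun a b _ => ?_
      rw [h0 _ (by simp) (by simp)]
      exact hpull_eq_zero _ fun l => hα.map_zero_cons l
    rw [this, add_zero]
    exact splitSum_congr fun a b hab => ih b (length_le_of_append hab) (hα.cons _)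

namespace AInfinityAlgebra
variable {E : AInfinityAlgebra k V} {E' : AInfinityAlgebra k V'}

/-- By strict unitality the only surviving terms multiply the unit with its left or right neighbour.
Both give the same shortened word with opposite signs, so they cancel unless the unit stands at an
end of the word. -/
theorem bstar_append_one_cons {h : List V → R} (hh : ListLin k h)
    (h0 : ∀ l, E.one ∈ l → l.length ≠ 1 → h l = 0) (a t : List V) :
    bstar E.shiftPar E.bar h (a ++ E.one :: t) =
      (if t = [] then 0 else h (a.map E.shiftPar ++ t)) -
        if a = [] then 0 else h (a.map E.shiftPar ++ t) := by
  have hb : ∀ v t1, v.length + t1.length ≠ 1 →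
      ∀ u t2, h (u ++ E.bar (v ++ E.one :: t1) :: t2) = 0 :=
    fun v t1 hl u t2 => by
      rw [bar_one (by simp) (by simp; omega), hh.map_zero]
  have e1 : bstar E.shiftPar E.bar h (a ++ E.one :: t) = splitSum (fun u v => splitSum
      (fun t1 t2 => h (u.map E.shiftPar ++ E.bar (v ++ E.one :: t1) :: t2)) t) a := by
    rw [bstar, splitSum_append_cons]
    have : splitSum (fun u v => splitSum (fun v t => h ((a ++ E.one :: u).map E.shiftPar ++
        E.bar v :: t)) v) t = 0 := by
      refine splitSum_eq_zero fun u v _ => splitSum_eq_zero fun v t _ => ?_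
      have e : E.shiftPar E.one = -E.one := by
        rw [← neg_eq_iff_eq_neg, ← par_eq_neg_shiftPar, par_one]
      rw [List.map_append, List.map_cons, List.append_assoc, List.cons_append, e,
        (hh _ _).map_neg, h0 _ (by simp) (by simp; omega), neg_zero]
    rw [this, add_zero]
    refine splitSum_congr fun u v _ => ?_
    rw [splitSum_append_cons, splitSum_eq_zero, zero_add]
    intro v1 v2 _
    exact h0 _ (by simp) (by simp; omega)
  have e2 : ∀ u, splitSum (fun t1 t2 => h (u ++ E.bar ([] ++ E.one :: t1) :: t2)) t =
      if t = [] then 0 else h (u ++ t) := by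
    intro u
    cases t with
    | nil => exact hb [] [] (by simp) u []
    | cons z t =>
      rw [splitSum_cons, hb [] [] (by simp), zero_add, splitSum_eq_first, if_neg (by simp),
        List.nil_append, bar_one_left]
      intro t1 t2 _ h1
      exact hb [] (z :: t1) (by simpa using h1) _ _
  have e3 : ∀ u y, splitSum (fun t1 t2 => h (u ++ E.bar ([y] ++ E.one :: t1) :: t2)) t =
      -h (u ++ E.shiftPar y :: t) := by
    intro u y
    rw [splitSum_eq_first, ← (hh u t).map_neg, ← par_eq_neg_shiftPar]
    · exact congrArg (fun x => h (u ++ x :: t)) (bar_one_right y)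
    · intro t1 t2 _ h1
      exact hb [y] t1 (by have := List.length_pos_iff.2 h1; simp; omega) _ _
  rw [e1]
  rcases List.eq_nil_or_concat a with rfl | ⟨a, y, rfl⟩
  · rw [splitSum_nil, e2, if_pos rfl, sub_zero]
  · rw [List.concat_eq_append, splitSum_append_cons, splitSum_nil, e2, splitSum_eq_last,
      List.nil_append, e3, add_comm,
      if_neg (List.append_ne_nil_of_right_ne_nil a (List.cons_ne_nil y [])), sub_eq_add_neg]
    · simp
    · intro u v _ hv
      exact splitSum_eq_zero fun t1 t2 _ => hb (v ++ [y]) t1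
        (by have := List.length_pos_iff.2 hv; simp; omega) _ _

variable {ε : V →ₗ[k] k} {h : List E.pos → E'.pos}

/-- By linearity each letter is the unit or lies in `E^{≥ 1}`. Without units this is the equation
for `h`. With a unit, both sides reduce to multiplication by the unit at an end of the word, and
both vanish when the unit is interior. -/
theorem bstar_unitExt (hε : IsAugmentation E ε) (hh : ListLin k h)
    (hd : WordDeg E.posDeg E'.posDeg 0 h)
    (H : ∀ l, homDefect E.posPar E.posBar E'.posBar h l = 0) (l : List V) :
    bstar E.shiftPar E.bar (unitExt E E' ε h) l = hpull (unitExt E E' ε h) E'.bar l := by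
  set f := unitExt E E' ε h with hf
  have hlin : ListLin k f := unitExt_lin hh
  have hb' : ListLin k E'.bar := listLin_tev _ _
  rw [← sub_eq_zero]
  refine ((hlin.bstar E.shiftPar (listLin_tev _ _)).sub (hb'.hpull hlin)).eq_zero_of_letters
    (p := fun x => x = E.one ∨ x ∈ E.pos) hε.exists_decomp (fun l hl => sub_eq_zero.2 ?_) l
  by_cases h1 : E.one ∈ l
  · obtain ⟨a, t, rfl⟩ := List.append_of_mem h1
    have h0 : ∀ l, E.one ∈ l → l.length ≠ 1 → f l = 0 := fun l => unitExt_eq_zero hh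
    rw [bstar_append_one_cons hlin h0,
      hpull_append_unit_cons (unitExt_one hε hh) h0 hb']
    rcases eq_or_ne a [] with rfl | ha <;> rcases eq_or_ne t [] with rfl | ht
    · simp only [if_true, sub_zero, hpull_nil]
      exact (bar_one (by simp) (by simp)).symm
    · rw [if_neg ht, if_pos rfl, hpull_nil, hpull_eq_single ht]
      · exact (sub_zero (f t)).trans (bar_one_left (E := E') (f t)).symm
      · intro l h2
        exact bar_one (by simp) (by simpa using h2)
    · rw [if_neg ha, if_pos rfl, hpull_eq_single ha]
      · simp only [hpull_nil, List.cons_append, List.nil_append, bar_one_right, List.append_nil,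
          zero_sub]
        exact (unitExt_shiftPar hε hh hd a).symm
      · intro l h2
        exact bar_one (by simp) (by simpa using h2)
    · rw [if_neg ha, if_neg ht, sub_self, hpull_congr_right (β := fun _ => 0) f ha]
      · exact (hpull_eq_zero _ fun _ => rfl).symm
      · intro y l
        rw [hpull_congr_right (β := fun _ => 0) f ht]
        · exact hpull_eq_zero _ fun _ => rfl
        · intro z l'
          exact bar_one (by simp) (by simp; omega)
  · have hp : ∀ x ∈ l, x ∈ E.pos := fun x hx => (hl x hx).resolve_left fun e => h1 (e ▸ hx)
    lift l to List E.pos using hp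
    have h2 : (fun l : List E.pos => f (l.map Subtype.val)) = fun l => E'.pos.subtype (h l) :=
      funext fun l => unitExt_coe hε l
    rw [← bstar_posBar, h2, ← map_bstar, ← sub_eq_zero.1 (H l),
      hpull_map (h' := h) (s' := Subtype.val) (fun u => unitExt_coe hε u), map_hpull]
    congr 1
    funext l
    exact E'.coe_posBar l

end AInfinityAlgebra
end Unit

/-! ### From bar constructions back to `A_∞`-morphisms -/

section Morphism
variable {k V V' : Type*} [Field k] [AddCommGroup V] [Module k V] [AddCommGroup V'] [Module k V']

namespace AInfinityAlgebra
variable {E : AInfinityAlgebra k V} {E' : AInfinityAlgebra k V'} {ε : V →ₗ[k] k}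
  {h : List E.pos → E'.pos}

theorem unitExt_twist_mem (hε : IsAugmentation E ε) (hh : ListLin k h)
    (hd : WordDeg E.posDeg E'.posDeg 0 h) (n : ℕ) (v : Fin n → V) (d : Fin n → ℤ × ℤ)
    (hv : ∀ j, v j ∈ E.deg (d j)) : unitExt E E' ε h (twist E.par 0 (List.ofFn v)) ∈
      E'.deg ((∑ j, (d j).1) + (1 - (n : ℤ)), ∑ j, (d j).2) := by
  set w : List (V × (ℤ × ℤ)) := List.ofFn fun j => (v j, d j) with hw
  have hwd : Graded E.deg w := by
    intro q hq
    obtain ⟨j, rfl⟩ := List.mem_ofFn.1 hq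
    exact hv j
  have h1 : letters w = List.ofFn v := by
    rw [hw, letters, List.map_ofFn]
    rfl
  rw [← h1, (unitExt_lin hh).twist_apply (signMap_zero_apply _) hwd]
  refine units_smul_mem _ ?_
  have h2 := unitExt_deg hε hd _ _ hwd.homogWord
  have h3 : (w.map Prod.snd).sum = (∑ j, (d j).1, ∑ j, (d j).2) := by
    rw [hw, List.map_ofFn, List.sum_ofFn]
    exact Prod.ext Prod.fst_sum Prod.snd_sum
  rw [h3] at h2
  simpa [h1] using h2

/-- A morphism of `A_∞`-algebras, from a morphism of bar constructions. -/
noncomputable def homOfBar (hε : IsAugmentation E ε) (hh : ListLin k h) (h0 : h [] = 0)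
    (hd : WordDeg E.posDeg E'.posDeg 0 h)
    (H : ∀ l, homDefect E.posPar E.posBar E'.posBar h l = 0) : AInfinityHom E E' where
  f := ((unitExt_lin (E' := E') (ε := ε) hh).twist E.par).toMultilinear
  f_zero := by
    ext v
    change unitExt E E' ε h (twist E.par 0 (List.ofFn v)) = 0
    simp [twist, unitExt, h0]
  f_mem := unitExt_twist_mem hε hh hd
  stasheff n hn a d ha := by
    set f := ((unitExt_lin (E' := E') (ε := ε) hh).twist E.par).toMultilinear with hf
    have hfl : tev E.par f = unitExt E E' ε h := by
      funext l
      rw [tev, hf, ListLin.ev_toMultilinear, twist_twist par_par]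
    set w : List (V × (ℤ × ℤ)) := List.ofFn fun j : Fin n => (a j, d j) with hw
    have hwl : w.length = n := by simp [hw]
    have hwd : Graded E.deg w := by
      intro q hq
      obtain ⟨j, rfl⟩ := List.mem_ofFn.1 hq
      exact ha j
    have hwa : ∀ (j : ℕ) (hj : j < w.length), a j = w[j].1 := fun j hj => by simp [hw]
    have hwp : ∀ (j : ℕ) (hj : j < w.length), (d j).1 = w[j].2.1 := fun j hj => by simp [hw]
    have h1 := bstar_unitExt hε hh hd H (letters w)
    rw [← hfl] at h1
    have hπ : ∀ z, ∀ x ∈ E.deg z, E.par x = z.1.negOnePow • x := signMap_zero_apply _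
    have e1 : bstar E.shiftPar E.bar (tev E.par f) (letters w) = _ :=
      bstar_tev (p := fun j => (d j).1) hπ E.shiftPar_apply E.m_zero E.m_mem f hwd hwa hwp
    have e2 : hpull (tev E.par f) E'.bar (letters w) = _ :=
      hpull_tev (p := fun j => (d j).1) (m' := E'.m) hπ (signMap_zero_apply _)
        (unitExt_twist_mem hε hh hd) hwd hwa hwp
    rw [e1, e2, hwl] at h1
    have h2 := congrArg (fun x => (twSign (fdegs w)).negOnePow • x) h1
    simp only [units_smul_smul_self] at h2
    exact h2
  map_one := by
    change unitExt E E' ε h (twist E.par 0 [E.one]) = _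
    exact unitExt_one hε hh
  f_one n hn v hv := by
    refine unitExt_eq_zero hh (twist_one_mem ?_) ?_
    · obtain ⟨j, hj⟩ := hv
      exact List.mem_ofFn.2 ⟨j, hj⟩
    · rw [twist_length, List.length_ofFn]
      omega

/-- As `m_1` vanishes on both sides, bijectivity of the first component is what matters; that
component is `h [·]` on `E^{≥ 1}` and matches the units. -/
theorem homOfBar_isQuasiIso {ε' : V' →ₗ[k] k} (hε : IsAugmentation E ε)
    (hε' : IsAugmentation E' ε') (hh : ListLin k h) (h0 : h [] = 0)
    (hd : WordDeg E.posDeg E'.posDeg 0 h)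
    (H : ∀ l, homDefect E.posPar E.posBar E'.posBar h l = 0) (hE : E.m 1 = 0) (hE' : E'.m 1 = 0)
    (hb : Function.Bijective fun x => h [x]) : (homOfBar hε hh h0 hd H).IsQuasiIso := by
  have hf : ∀ x, (homOfBar hε hh h0 hd H).f 1 ![x] = h [E.posProj x] + ε x • E'.one := fun x => by
    change unitExt E E' ε h [x] = _
    simp [unitExt]
  have hone : ∀ (c : k) (y : E'.pos), (y : V') + c • E'.one = 0 → y = 0 ∧ c = 0 := by
    intro c y hy
    have h1 := congrArg ε' hy
    rw [map_add, map_smul, hε'.map_one, hε'.map_pos y, map_zero, zero_add, smul_eq_mul,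
      _root_.mul_one] at h1
    rw [h1, zero_smul, add_zero] at hy
    exact ⟨Subtype.ext hy, h1⟩
  constructor
  · rintro x - ⟨z, hz⟩
    refine ⟨0, ?_⟩
    rw [hE'] at hz
    rw [hE]
    rw [hf] at hz
    obtain ⟨h1, h2⟩ := hone _ _ hz
    have h3 : E.posProj x = 0 := hb.1 (h1.trans (hh.map_zero_cons []).symm)
    rw [hε.decomp x, h2, h3, zero_smul, zero_add]
    rfl
  · rintro y -
    obtain ⟨x, hx⟩ := hb.2 (E'.posProj y)
    refine ⟨ε' y • E.one + x, by rw [hE]; rfl, 0, ?_⟩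
    have h1 : E.posProj (ε' y • E.one + x) = x := by
      rw [map_add, map_smul, posProj_one, smul_zero, zero_add, posProj_coe]
    have h2 : ε (ε' y • E.one + x) = ε' y := by
      rw [map_add, map_smul, hε.map_one, hε.map_pos, add_zero, smul_eq_mul, _root_.mul_one]
    rw [hf, hE', h1, h2]
    have hx' : h [x] = E'.posProj y := hx
    rw [hx', add_comm, ← hε'.decomp y, sub_self]
    rfl

end AInfinityAlgebra
end Morphism

/-! ### Change of algebra along an isomorphism, and uniqueness of `E` -/

section Transport
universe w w'
variable {k : Type*} [Field k] {A A' : Type*} [Ring A] [Algebra k A] [Ring A'] [Algebra k A']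
  {𝒜 : ℕ → Submodule k A} {𝒜' : ℕ → Submodule k A'}
  {P : Type w} [AddCommGroup P] [Module k P] [Module Aᵐᵒᵖ P] [IsScalarTower k Aᵐᵒᵖ P]
  {P' : Type w'} [AddCommGroup P'] [Module k P'] [Module A'ᵐᵒᵖ P'] [IsScalarTower k A'ᵐᵒᵖ P']
  [Module Aᵐᵒᵖ P'] [IsScalarTower k Aᵐᵒᵖ P']

/-- Restriction of scalars along an isomorphism of algebras, on linear maps. -/
def restrictHom (ψ : A ≃ₐ[k] A')
    (h : ∀ (a : A) (x : P'), MulOpposite.op a • x = MulOpposite.op (ψ a) • x) :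
    (P' →ₗ[A'ᵐᵒᵖ] P') →ₗ[k] (P' →ₗ[Aᵐᵒᵖ] P') where
  toFun f :=
    { toFun := f
      map_add' := f.map_add
      map_smul' := fun a x => by
        rw [RingHom.id_apply, ← MulOpposite.op_unop a, h, h, map_smul] }
  map_add' _ _ := rfl
  map_smul' _ _ := rfl

namespace FreeResolution
variable (ρ : FreeResolution 𝒜' P') (ψ : A ≃ₐ[k] A') (hψ : ∀ i, (𝒜 i).map ψ.toLinearMap = 𝒜' i)
  (h : ∀ (a : A) (x : P'), MulOpposite.op a • x = MulOpposite.op (ψ a) • x)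

/-- Restriction of scalars of a resolution along an isomorphism of graded algebras. -/
def restrict : FreeResolution 𝒜 P' where
  deg := ρ.deg
  isInternal := ρ.isInternal
  deg_eq_bot := ρ.deg_eq_bot
  smul_mem p s j x a hx ha := by
    rw [h]
    exact ρ.smul_mem p s j x _ hx (hψ j ▸ Submodule.mem_map_of_mem ha)
  free := by
    obtain ⟨ι, b, hb⟩ := ρ.free
    refine ⟨ι, b.mapCoeffs (AlgEquiv.op ψ.symm).toRingEquiv fun c x => ?_, fun i => ?_⟩
    · change MulOpposite.op (ψ.symm c.unop) • x = c • x
      rw [h, ψ.apply_symm_apply]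
      rfl
    · rw [Module.Basis.mapCoeffs_apply]
      exact hb i
  d := restrictHom ψ h ρ.d
  d_mem := ρ.d_mem
  d_d := ρ.d_d
  aug := ρ.aug
  aug_deg := ρ.aug_deg
  aug_smul j x a hj ha := by
    rw [h]
    exact ρ.aug_smul j x _ hj (hψ j ▸ Submodule.mem_map_of_mem ha)
  aug_d := ρ.aug_d
  aug_surjective := ρ.aug_surjective
  exact := ρ.exact

/-- The endomorphism DG algebra is not changed by restriction of scalars along an isomorphism. -/
noncomputable def restrictEndRep : EndRep (ρ.restrict ψ hψ h) ρ.endDG where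
  toEnd := restrictHom ψ h ∘ₗ ρ.endRep.toEnd
  injective x y hxy := ρ.endRep.injective (LinearMap.ext fun p => LinearMap.congr_fun hxy p)
  one := LinearMap.ext fun p => LinearMap.congr_fun ρ.endRep.one p
  mul x y := LinearMap.ext fun p => LinearMap.congr_fun (ρ.endRep.mul x y) p
  mem hx := ρ.endRep.mem hx
  exists_eq {z φ} hφ := by
    have hs : ∀ (a : A'ᵐᵒᵖ) (x : P'), a • x = MulOpposite.op (ψ.symm a.unop) • x := fun a x => by
      rw [h, ψ.apply_symm_apply]
      rfl
    obtain ⟨x, hx, hx'⟩ := ρ.endRep.exists_eq (z := z)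
      (φ := { toFun := φ, map_add' := φ.map_add, map_smul' := fun a x => by
                rw [RingHom.id_apply, hs, hs, map_smul] }) hφ
    exact ⟨x, hx, LinearMap.ext fun p => LinearMap.congr_fun hx' p⟩
  toEnd_d hx := LinearMap.ext fun p => LinearMap.congr_fun (ρ.endRep.toEnd_d hx) p

end FreeResolution
end Transport

section QuasiIso
universe w w'
variable {k : Type*} [Field k] {A A' : Type*} [Ring A] [Algebra k A] [Ring A'] [Algebra k A']
  {𝒜 : ℕ → Submodule k A} {𝒜' : ℕ → Submodule k A'}
  {P : Type w} [AddCommGroup P] [Module k P] [Module Aᵐᵒᵖ P] [IsScalarTower k Aᵐᵒᵖ P]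
  {P' : Type w'} [AddCommGroup P'] [Module k P'] [Module A'ᵐᵒᵖ P'] [IsScalarTower k A'ᵐᵒᵖ P']
  {V V' : Type*} [AddCommGroup V] [Module k V] [AddCommGroup V'] [Module k V']

/-- `A_∞`-Ext-algebras of isomorphic graded algebras are quasi-isomorphic. -/
theorem IsExtAlgebra.exists_quasiIso [GradedAlgebra 𝒜] (h𝒜 : IsConnectedLocallyFinite 𝒜)
    {ρ : FreeResolution 𝒜 P} {ρ' : FreeResolution 𝒜' P'} {E : AInfinityAlgebra k V}
    (hE : IsExtAlgebra ρ E) {E' : AInfinityAlgebra k V'} (hE' : IsExtAlgebra ρ' E')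
    (ψ : A ≃ₐ[k] A') (hψ : ∀ i, (𝒜 i).map ψ.toLinearMap = 𝒜' i) :
    ∃ f : AInfinityHom E E', f.IsQuasiIso := by
  -- Through `ψ`, the second resolution becomes one over `A` with the same endomorphism DG algebra,
  -- so both bar models refer to one algebra and can be compared.
  let _ : Module Aᵐᵒᵖ P' := Module.compHom P' (AlgEquiv.op ψ).toRingEquiv.toRingHom
  have h : ∀ (a : A) (x : P'), MulOpposite.op a • x = MulOpposite.op (ψ a) • x := fun _ _ => rfl
  have : IsScalarTower k Aᵐᵒᵖ P' := ⟨fun c a x => by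
    rw [← MulOpposite.op_unop a, ← MulOpposite.op_smul, h, h, map_smul, MulOpposite.op_smul,
      smul_assoc]⟩
  obtain ⟨hE1, f, hf⟩ := hE
  obtain ⟨hE1', f', hf'⟩ := hE'
  have T := ρ.endRep
  have T' := ρ'.restrictEndRep ψ hψ h
  obtain ⟨ε, hε⟩ := AInfinityAlgebra.exists_isAugmentation h𝒜 T hE1 hf
  obtain ⟨ε', hε'⟩ := AInfinityAlgebra.exists_isAugmentation h𝒜 T' hE1' hf'
  obtain ⟨g, hg, hg0, hgd, hgH, hgb⟩ := BarModel.exists_quasiIso h𝒜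
    (AInfinityAlgebra.barModel T hE1 hf) (AInfinityAlgebra.barModel T' hE1' hf')
  exact ⟨_, AInfinityAlgebra.homOfBar_isQuasiIso hε hε' hg hg0 hgd hgH hE1 hE1' hgb⟩

end QuasiIso

/-! ### Weighted words -/

section Words

/-- A set of letters with positive weights, finitely many of each weight. -/
structure Alphabet (X : Type*) where
  wt : X → ℕ
  wt_pos : ∀ x, 0 < wt x
  letters : ℕ → Finset X
  mem_letters : ∀ {n x}, x ∈ letters n ↔ wt x = n

namespace Alphabet
variable {X : Type*} (𝔛 : Alphabet X)

/-- The weight of a word. -/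
def weight (w : List X) : ℕ := (w.map 𝔛.wt).sum

@[simp] theorem weight_nil : 𝔛.weight [] = 0 := rfl

@[simp] theorem weight_cons (x : X) (w : List X) : 𝔛.weight (x :: w) = 𝔛.wt x + 𝔛.weight w := by
  simp [weight]

@[simp] theorem weight_append (u v : List X) : 𝔛.weight (u ++ v) = 𝔛.weight u + 𝔛.weight v := by
  simp [weight]

theorem finite_setOf_weight_eq (n : ℕ) : {w | 𝔛.weight w = n}.Finite := by
  induction n using Nat.strong_induction_on with
  | _ n ih =>
    refine Set.Finite.subset ((Set.finite_singleton ([] : List X)).union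
      ((Finset.Icc 1 n).finite_toSet.biUnion (t := fun j => ⋃ x ∈ (𝔛.letters j : Set X),
        (fun w => x :: w) '' {w | 𝔛.weight w = n - j}) fun j hj =>
        (𝔛.letters j).finite_toSet.biUnion fun x _ => (ih (n - j) ?_).image _)) ?_
    · have := Finset.mem_Icc.1 (Finset.mem_coe.1 hj)
      omega
    · intro w hw
      cases w with
      | nil => exact .inl rfl
      | cons x w =>
        have h1 : 𝔛.wt x + 𝔛.weight w = n := by simpa using hw
        have h2 := 𝔛.wt_pos x
        refine .inr (Set.mem_biUnion (x := 𝔛.wt x) (by simp; omega) ?_)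
        refine Set.mem_biUnion (x := x) (by simp [𝔛.mem_letters]) ⟨w, ?_, rfl⟩
        change 𝔛.weight w = _
        omega

/-- The words of weight `n`. -/
noncomputable def words (n : ℕ) : Finset (List X) := (𝔛.finite_setOf_weight_eq n).toFinset

variable {𝔛}

@[simp] theorem mem_words {n : ℕ} {w : List X} : w ∈ 𝔛.words n ↔ 𝔛.weight w = n := by
  simp [words]

theorem eq_nil_of_weight_eq_zero {w : List X} (h : 𝔛.weight w = 0) : w = [] := by
  cases w with
  | nil => rfl
  | cons x w =>
    have := 𝔛.wt_pos x
    simp at h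
    omega

variable (𝔛)

theorem words_zero : 𝔛.words 0 = {[]} := by
  ext w
  simp only [mem_words, Finset.mem_singleton]
  exact ⟨eq_nil_of_weight_eq_zero, fun h => by rw [h]; rfl⟩

/-- A pair of words of total weight `n` is a word of weight `n` with a chosen cut. -/
theorem sum_words_append {R : Type*} [AddCommMonoid R] (g : List X → List X → R) (n : ℕ) :
    ∑ ij ∈ Finset.HasAntidiagonal.antidiagonal n, ∑ u ∈ 𝔛.words ij.1, ∑ v ∈ 𝔛.words ij.2, g u v =
      ∑ w ∈ 𝔛.words n, splitSum g w := by
  simp only [splitSum_eq_range, ← Finset.sum_product', Finset.sum_sigma']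
  refine Finset.sum_nbij' (fun q => ⟨q.2.1 ++ q.2.2, q.2.1.length⟩)
    (fun q => ⟨(𝔛.weight (q.1.take q.2), 𝔛.weight (q.1.drop q.2)), q.1.take q.2, q.1.drop q.2⟩)
    ?_ ?_ ?_ ?_ ?_
  · rintro ⟨⟨i, j⟩, u, v⟩ h
    simp only [Finset.mem_sigma, Finset.HasAntidiagonal.mem_antidiagonal,
      Finset.mem_product, mem_words] at h
    simp [h.1, h.2.1, h.2.2]
  · rintro ⟨w, i⟩ h
    simp only [Finset.mem_sigma, mem_words] at h
    simp [← weight_append, h.1]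
  · rintro ⟨⟨i, j⟩, u, v⟩ h
    simp only [Finset.mem_sigma, Finset.HasAntidiagonal.mem_antidiagonal,
      Finset.mem_product, mem_words] at h
    obtain ⟨-, rfl, rfl⟩ := h
    simp
  · rintro ⟨w, i⟩ h
    simp only [Finset.mem_sigma, mem_words, Finset.mem_range] at h
    have : min i w.length = i := by omega
    simp [this]
  · rintro ⟨⟨i, j⟩, u, v⟩ h
    simp

/-- The product of the values of `c` on the letters of a word, in reverse order. -/
def revProd {D : Type*} [Monoid D] (c : X → D) (w : List X) : D := (w.map c).reverse.prod

section Ring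
variable {D : Type*} [Monoid D] (c : X → D)

@[simp] theorem revProd_nil : revProd c [] = 1 := rfl

theorem revProd_append (u v : List X) : revProd c (u ++ v) = revProd c v * revProd c u := by
  simp [revProd]

theorem revProd_cons (x : X) (v : List X) : revProd c (x :: v) = revProd c v * c x := by
  simp [revProd]

@[simp] theorem revProd_singleton (x : X) : revProd c [x] = c x := by
  simp [revProd]

theorem revProd_congr {c c' : X → D} {w : List X} (h : ∀ x ∈ w, c x = c' x) :
    revProd c w = revProd c' w := by
  rw [revProd, revProd, List.map_congr_left h]

end Ring

variable {𝔛} in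
theorem wt_le_of_mem {x : X} {w : List X} (h : x ∈ w) : 𝔛.wt x ≤ 𝔛.weight w :=
  List.le_sum_of_mem (List.mem_map_of_mem h)

variable {𝔛} in
theorem revProd_mem {k D : Type*} [Field k] [Ring D] [Algebra k D] {𝒟 : ℕ → Submodule k D}
    [SetLike.GradedMonoid 𝒟] {c : X → D} (hc : ∀ x, c x ∈ 𝒟 (𝔛.wt x)) (w : List X) :
    revProd c w ∈ 𝒟 (𝔛.weight w) := by
  induction w with
  | nil => exact SetLike.GradedOne.one_mem
  | cons x w ih =>
    rw [revProd_cons, weight_cons, add_comm]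
    exact SetLike.GradedMul.mul_mem ih (hc x)

end Alphabet
end Words

/-! ### Vanishing of tensors tested by functionals -/

section Bilinear
variable {k : Type*} [Field k] {D U R : Type*} [AddCommGroup D] [Module k D] [AddCommGroup U]
  [Module k U] [AddCommGroup R] [Module k R]

/-- The hypothesis says that `∑ x i ⊗ y i` is zero, tested by functionals on the left factor. It
lets Maurer-Cartan equations be used inside arbitrary bilinear expressions. -/
theorem sum_bilinear_eq_zero {ι : Type*} (s : Finset ι) (x : ι → D) (y : ι → U)
    (h : ∀ μ : D →ₗ[k] k, ∑ i ∈ s, μ (x i) • y i = 0) (B : D →ₗ[k] U →ₗ[k] R) :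
    ∑ i ∈ s, B (x i) (y i) = 0 := by
  let β := Module.Basis.ofVectorSpace k D
  have h1 : ∑ i ∈ s, TensorProduct.tmul k (x i) (y i) = 0 := by
    classical
    apply (TensorProduct.equivFinsuppOfBasisLeft β).injective
    rw [map_sum, map_zero]
    ext j
    rw [Finsupp.finsetSum_apply]
    simpa [TensorProduct.equivFinsuppOfBasisLeft_apply_tmul_apply] using h (β.coord j)
  have h2 := congrArg (TensorProduct.lift B) h1
  simpa using h2

end Bilinear

/-! ### Maurer-Cartan elements and the twisted differential -/

section Theta
universe w
variable {k : Type*} [Field k] {A : Type*} [Ring A] [Algebra k A]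
  {P : Type w} [AddCommGroup P] [Module k P] [Module Aᵐᵒᵖ P] [IsScalarTower k Aᵐᵒᵖ P]
  {𝒜 : ℕ → Submodule k A} {ρ : FreeResolution 𝒜 P} {U : Type*} [AddCommGroup U] [Module k U]
  {X : Type*} {D : Type*} [Ring D] [Algebra k D]

namespace BarModel

/-- A basis of `E^1`, in negative Adams degrees. -/
structure LetterBasis (M : BarModel ρ U) (𝔛 : Alphabet X) where
  e : X → U
  mem : ∀ x, e x ∈ M.deg (0, -(𝔛.wt x : ℤ))
  eq_zero : ∀ (n : ℕ) (a : X → k), ∑ x ∈ 𝔛.letters n, a x • e x = 0 →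
    ∀ x ∈ 𝔛.letters n, a x = 0
  exists_eq : ∀ (n : ℕ), 0 < n → ∀ y ∈ M.deg (0, -(n : ℤ)),
    ∃ a : X → k, y = ∑ x ∈ 𝔛.letters n, a x • e x

namespace LetterBasis
variable {M : BarModel ρ U} {𝔛 : Alphabet X} (L : M.LetterBasis 𝔛)

theorem homogWord (w : List X) :
    HomogWord M.deg (w.map L.e) (w.map fun x => (0, -(𝔛.wt x : ℤ))) := by
  induction w with
  | nil => exact .nil
  | cons x w ih => exact .cons (L.mem x) ih

theorem _root_.ExtAInf.Alphabet.sum_degrees (w : List X) :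
    (w.map fun x => ((0, -(𝔛.wt x : ℤ)) : ℤ × ℤ)).sum = (0, -(𝔛.weight w : ℤ)) := by
  induction w with
  | nil => rfl
  | cons x w ih =>
    rw [List.map_cons, List.sum_cons, ih, Alphabet.weight_cons]
    ext <;> simp; ring

theorem F_mem (w : List X) :
    M.F (w.map L.e) ∈ homDeg A ρ.deg ρ.deg (1, -(𝔛.weight w : ℤ)) := by
  have h3 := M.F_deg _ _ (L.homogWord w)
  rw [Alphabet.sum_degrees] at h3
  exact homDeg_cast (by ext <;> simp) h3

theorem b_mem (w : List X) : M.b (w.map L.e) ∈ M.deg (1, -(𝔛.weight w : ℤ)) := by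
  have h3 := M.b_deg _ _ (L.homogWord w)
  rw [Alphabet.sum_degrees] at h3
  simpa using h3

theorem map_σ (w : List X) : (w.map L.e).map M.σ = w.map L.e := by
  rw [List.map_map]
  refine List.map_congr_left fun x _ => ?_
  rw [Function.comp_apply, M.σ_apply _ _ (L.mem x)]
  simp

/-- The Maurer-Cartan equation for `∑ x, c x ⊗ e x`, in weight `n`. -/
def MaurerCartan (c : X → D) (n : ℕ) : Prop :=
  ∀ μ : D →ₗ[k] k, ∑ v ∈ 𝔛.words n, μ (Alphabet.revProd c v) • M.b (v.map L.e) = 0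

/-- The operation on functionals given by the twisting cochain, in weight `n`. -/
noncomputable def theta (c : X → D) (n : ℕ) : (P →ₗ[k] D) →ₗ[k] (P →ₗ[k] D) where
  toFun Ψ := ∑ w ∈ 𝔛.words n, LinearMap.mulLeft k (Alphabet.revProd c w) ∘ₗ Ψ ∘ₗ
    (M.F (w.map L.e)).restrictScalars k
  map_add' Ψ Ψ' := by
    ext p
    simp [mul_add, Finset.sum_add_distrib]
  map_smul' a Ψ := by
    ext p
    simp [Finset.smul_sum]

theorem theta_apply (c : X → D) (n : ℕ) (Ψ : P →ₗ[k] D) (p : P) :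
    L.theta c n Ψ p = ∑ w ∈ 𝔛.words n, Alphabet.revProd c w * Ψ (M.F (w.map L.e) p) := by
  simp [theta]

theorem theta_zero (c : X → D) (Ψ : P →ₗ[k] D) (p : P) : L.theta c 0 Ψ p = Ψ (ρ.d p) := by
  simp [theta_apply, Alphabet.words_zero, M.F_nil]

/-- Composing the operations composes the `M.F` in the order opposite to their coefficients, which
is the reason for reversed products. The twisting cochain equation then replaces a subword `v` by
`M.b v`; the equations in lower weight kill every `v` of weight below `n`, leaving the whole word.
-/
theorem sum_theta_theta {c : X → D} {n : ℕ} (hc : ∀ m < n, L.MaurerCartan c m)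
    (Ψ : P →ₗ[k] D) (p : P) :
    ∑ ij ∈ Finset.HasAntidiagonal.antidiagonal n, L.theta c ij.1 (L.theta c ij.2 Ψ) p =
      ∑ v ∈ 𝔛.words n, Alphabet.revProd c v * Ψ (M.F [M.b (v.map L.e)] p) := by
  have e1 : ∑ ij ∈ Finset.HasAntidiagonal.antidiagonal n, L.theta c ij.1 (L.theta c ij.2 Ψ) p =
      ∑ w ∈ 𝔛.words n, splitSum (fun w u => Alphabet.revProd c (w ++ u) *
        Ψ (M.F (w.map L.e) (M.F (u.map L.e) p))) w := by
    rw [← 𝔛.sum_words_append, ← Finset.Nat.sum_antidiagonal_swap]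
    refine Finset.sum_congr rfl fun ij _ => ?_
    rw [Finset.sum_comm, theta_apply]
    refine Finset.sum_congr rfl fun u _ => ?_
    rw [theta_apply, Finset.mul_sum]
    refine Finset.sum_congr rfl fun v _ => ?_
    rw [Alphabet.revProd_append, mul_assoc]
  have e2 : ∀ w, splitSum (fun w u => Alphabet.revProd c (w ++ u) *
        Ψ (M.F (w.map L.e) (M.F (u.map L.e) p))) w =
      splitSum (fun u r => splitSum (fun v t => Alphabet.revProd c t * (Alphabet.revProd c v *
        (Alphabet.revProd c u * Ψ (M.F (u.map L.e ++ M.b (v.map L.e) :: t.map L.e) p)))) r) w := by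
    intro w
    let φ : (P →ₗ[Aᵐᵒᵖ] P) →+ D :=
      { toFun := fun f => Alphabet.revProd c w * Ψ (f p)
        map_zero' := by simp
        map_add' := fun f g => by simp [mul_add] }
    have h1 := congrArg φ (M.F_F (w.map L.e))
    rw [conv, bstar, splitSum_map, splitSum_map, map_splitSum, map_splitSum] at h1
    convert h1 using 1
    · refine splitSum_congr fun u v huv => ?_
      rw [huv, L.map_σ]
      rfl
    · refine splitSum_congr fun u r hur => ?_
      rw [splitSum_map, map_splitSum]
      refine splitSum_congr fun v t hvt => ?_
      rw [L.map_σ, ← mul_assoc, ← mul_assoc, ← Alphabet.revProd_append, ← Alphabet.revProd_append,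
        hvt, hur]
      rfl
  have e3 : ∀ u t (m : ℕ), m < n → ∑ v ∈ 𝔛.words m, Alphabet.revProd c t * (Alphabet.revProd c v *
        (Alphabet.revProd c u * Ψ (M.F (u.map L.e ++ M.b (v.map L.e) :: t.map L.e) p))) = 0 := by
    intro u t m hm
    rw [← Finset.mul_sum]
    have h1 := sum_bilinear_eq_zero _ _ _ (hc m hm) ((LinearMap.mul k D).compl₂
      (LinearMap.mulLeft k (Alphabet.revProd c u) ∘ₗ Ψ ∘ₗ LinearMap.applyₗ' k p ∘ₗ
        ((M.F_lin (u.map L.e) (t.map L.e)).mk' _)))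
    have h2 : ∑ v ∈ 𝔛.words m, (Alphabet.revProd c v *
        (Alphabet.revProd c u * Ψ (M.F (u.map L.e ++ M.b (v.map L.e) :: t.map L.e) p))) = 0 := h1
    rw [h2, mul_zero]
  rw [e1, Finset.sum_congr rfl fun w _ => e2 w, ← 𝔛.sum_words_append,
    Finset.sum_eq_single (0, n)]
  · rw [𝔛.words_zero, Finset.sum_singleton, ← 𝔛.sum_words_append, Finset.sum_eq_single (n, 0)]
    · simp [𝔛.words_zero]
    · rintro ⟨i, j⟩ h1 h2
      rw [Finset.HasAntidiagonal.mem_antidiagonal] at h1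
      rw [Finset.sum_comm]
      refine Finset.sum_eq_zero fun t _ => e3 _ _ _ ?_
      by_contra h3
      apply h2
      ext <;> simp at * <;> omega
    · intro h
      simp at h
  · rintro ⟨i, j⟩ h1 h2
    rw [Finset.HasAntidiagonal.mem_antidiagonal] at h1
    refine Finset.sum_eq_zero fun u _ => ?_
    rw [← 𝔛.sum_words_append]
    refine Finset.sum_eq_zero fun lm hlm => ?_
    rw [Finset.HasAntidiagonal.mem_antidiagonal] at hlm
    rw [Finset.sum_comm]
    refine Finset.sum_eq_zero fun t _ => e3 _ _ _ ?_
    by_contra h3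
    apply h2
    ext <;> simp at * <;> omega
  · intro h
    simp at h

theorem sum_theta_theta_eq_zero {c : X → D} (hc : ∀ m, L.MaurerCartan c m) (n : ℕ)
    (Ψ : P →ₗ[k] D) (p : P) :
    ∑ ij ∈ Finset.HasAntidiagonal.antidiagonal n, L.theta c ij.1 (L.theta c ij.2 Ψ) p = 0 := by
  rw [L.sum_theta_theta fun m _ => hc m]
  exact sum_bilinear_eq_zero _ _ _ (hc n) ((LinearMap.mul k D).compl₂
    (Ψ ∘ₗ LinearMap.applyₗ' k p ∘ₗ ((M.F_lin [] []).mk' _)))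

end LetterBasis
end BarModel
end Theta

/-! ### `E^1` inside the dual of the algebra -/

section Contraction
universe w
variable {k : Type*} [Field k] {A : Type*} [Ring A] [Algebra k A]
  {P : Type w} [AddCommGroup P] [Module k P] [Module Aᵐᵒᵖ P] [IsScalarTower k Aᵐᵒᵖ P]
  {𝒜 : ℕ → Submodule k A} {ρ : FreeResolution 𝒜 P} {U : Type*} [AddCommGroup U] [Module k U]

/-- A contraction of the augmented resolution, in degree `0`. -/
structure Contraction (ρ : FreeResolution 𝒜 P) where
  r : P →ₗ[k] P
  mem : ∀ {y x}, x ∈ ρ.deg y → r x ∈ ρ.deg (y - (1, 0))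
  d_r : ∀ {y : ℤ × ℤ} {x}, y.1 = 0 → x ∈ ρ.deg y → ρ.d (r x) = x - ρ.aug x • ρ.e
  eq_zero : ∀ {y : ℤ × ℤ} {x}, y.1 ≠ 0 → x ∈ ρ.deg y → r x = 0
  r_e : r ρ.e = 0

namespace Contraction

theorem nonempty (ρ : FreeResolution 𝒜 P) : Nonempty (Contraction ρ) := by
  obtain ⟨r, h1, h2, h3, h4⟩ := ρ.exists_contraction
  exact ⟨⟨r, h1 _ _, fun hy hx => h2 _ hy _ hx, fun hy hx => h3 _ hy _ hx, h4⟩⟩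

variable (κ : Contraction ρ)

theorem eq_add_d_r {y : ℤ × ℤ} {x : P} (hy : y.1 = 0) (hx : x ∈ ρ.deg y) :
    x = ρ.aug x • ρ.e + ρ.d (κ.r x) := by
  rw [κ.d_r hy hx, add_sub_cancel]

/-- The contraction identity makes `p - r (d p)` a cycle, and the resolution is exact. -/
theorem exists_eq_r_d_add {y : ℤ × ℤ} {p : P} (hy : y.1 = -1) (hp : p ∈ ρ.deg y) :
    ∃ q ∈ ρ.deg (y - (1, 0)), p = κ.r (ρ.d p) + ρ.d q := by
  have h1 : κ.r (ρ.d p) ∈ ρ.deg y := by simpa using κ.mem (ρ.d_mem hp)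
  have h2 : ρ.aug p = 0 := ρ.aug_deg y (by rintro rfl; simp at hy) p hp
  have h3 := ρ.isPrimitive_prim (sub_mem hp h1)
    (by rw [map_sub, κ.d_r (by simp [hy]) (ρ.d_mem hp), ρ.aug_d, zero_smul, sub_zero, sub_self])
    (by rw [map_sub, h2, ρ.aug_deg y (by rintro rfl; simp at hy) _ h1, sub_self])
  exact ⟨_, h3.2.2 _ (sub_mem hp h1), by rw [h3.1, add_sub_cancel]⟩

end Contraction

/-- With `γ = aug ∘ F [y] ∘ r` one has `aug ∘ F [y] = γ ∘ d`. The hypothesis makes `γ` an `A`-linear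
functional to `k_A`, so `F [y]` is a coboundary and `y = 0`. This embeds the piece of `E^1` of Adams
degree `-n` in the dual of `A_n`. -/
theorem BarModel.eq_zero_of_aug_F [GradedAlgebra 𝒜] (h𝒜 : IsConnectedLocallyFinite 𝒜)
    (M : BarModel ρ U) (κ : Contraction ρ) {n : ℕ} (hn : 0 < n) {y : U}
    (hy : y ∈ M.deg (0, -(n : ℤ)))
    (h : ∀ a ∈ 𝒜 n, ρ.aug (M.F [y] (κ.r (MulOpposite.op a • ρ.e))) = 0) : y = 0 := by
  have hF := M.F_mem hy
  have hFa : ∀ z, z ≠ (-1, (n : ℤ)) → ∀ p ∈ ρ.deg z, ρ.aug (M.F [y] p) = 0 := fun z hz p hp =>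
    ρ.aug_deg _ (fun h0 => hz (by
      simp only [Prod.ext_iff, Prod.fst_add, Prod.snd_add] at h0 ⊢
      constructor <;> omega)) _ (hF z p hp)
  have hFd : ∀ p, ρ.aug (M.F [y] (ρ.d p)) = 0 := fun p => by
    have h1 := congrArg ρ.aug (M.F_cocycle hy p)
    rw [ρ.aug_d] at h1
    simpa using h1.symm
  set γ : P →ₗ[k] k := ρ.aug ∘ₗ (M.F [y]).restrictScalars k ∘ₗ κ.r with hγ
  have hγd : ∀ p, ρ.aug (M.F [y] p) = γ (ρ.d p) := by
    intro p
    refine homogeneous_ext (f := ρ.aug ∘ₗ (M.F [y]).restrictScalars k)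
      (g := γ ∘ₗ ρ.d.restrictScalars k) ρ.isInternal (fun z p hp => ?_) p
    change ρ.aug (M.F [y] p) = ρ.aug (M.F [y] (κ.r (ρ.d p)))
    by_cases hz : z.1 = -1
    · obtain ⟨q, -, hq⟩ := κ.exists_eq_r_d_add hz hp
      conv_lhs => rw [hq, map_add, map_add, hFd, add_zero]
    · rw [hFa z (fun h0 => hz (by rw [h0])) p hp, κ.eq_zero (y := z + (1, 0)) ?_ (ρ.d_mem hp)]
      · simp
      · simp; omega
  have hγ0 : ∀ z, z ≠ (0, (n : ℤ)) → ∀ x ∈ ρ.deg z, γ x = 0 := fun z hz x hx =>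
    hFa (z - (1, 0)) (fun h0 => hz (by
      simp only [Prod.ext_iff, Prod.fst_sub, Prod.snd_sub] at h0 ⊢
      constructor <;> omega)) _ (κ.mem hx)
  have hγt : IsTrivial 𝒜 γ := by
    intro j x a hj ha
    refine homogeneous_induction (p := fun x => γ (MulOpposite.op a • x) = 0) ρ.isInternal x
      (fun z x hx => ?_) (by simp) fun x y hx hy => by rw [smul_add, map_add, hx, hy, add_zero]
    by_cases hz : z.1 = 0
    -- Write `x` as a multiple of `e` plus a boundary. On the boundary, `γ` becomes the augmentation
    -- of a multiple by `a`, which is zero; on `e`, the hypothesis applies.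
    · rw [κ.eq_add_d_r hz hx, smul_add, map_add, ← map_smul ρ.d, ← hγd, map_smul (M.F [y]),
        ρ.isTrivial_aug _ _ _ hj ha, add_zero, smul_comm, map_smul γ]
      by_cases hjn : j = n
      · subst hjn
        change _ • ρ.aug (M.F [y] (κ.r (MulOpposite.op a • ρ.e))) = 0
        rw [h a ha, smul_zero]
      · rw [hγ0 _ ?_ _ (ρ.smul_mem' ρ.e_mem ha), smul_zero]
        intro h0
        simp only [Prod.ext_iff, Prod.snd_add] at h0
        omega
    · refine hγ0 _ (fun h0 => hz ?_) _ (ρ.smul_mem' hx ha)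
      simpa using congrArg Prod.fst h0
  obtain ⟨g, hg, H⟩ := FreeResolution.exists_homotopy h𝒜 ρ ρ (-1) hF
    (fun p => by simpa using M.F_cocycle hy p) hγt (fun z hz => hγ0 z fun h0 => hz (by
      rw [h0]; ext <;> simp)) hγd
  refine M.inj _ y hy g (homDeg_cast (by abel) hg) fun p => ?_
  rw [H]
  simp [sub_eq_add_neg]

theorem BarModel.finite_deg [GradedAlgebra 𝒜] (h𝒜 : IsConnectedLocallyFinite 𝒜)
    (M : BarModel ρ U) {n : ℕ} (hn : 0 < n) : Module.Finite k (M.deg (0, -(n : ℤ))) := by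
  obtain ⟨κ⟩ := Contraction.nonempty ρ
  have := h𝒜.finite n
  let f : M.deg (0, -(n : ℤ)) →ₗ[k] (𝒜 n →ₗ[k] k) :=
    LinearMap.mk₂ k (fun y a => ρ.aug (M.F [(y : U)] (κ.r (MulOpposite.op (a : A) • ρ.e))))
      (fun y y' a => by
        have : M.F [(y : U) + y'] = M.F [(y : U)] + M.F [(y' : U)] := (M.F_lin [] []).map_add _ _
        simp [this])
      (fun c y a => by
        have : M.F [c • (y : U)] = c • M.F [(y : U)] := (M.F_lin [] []).map_smul _ _
        simp [this])
      (fun y a a' => by simp [add_smul])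
      (fun c y a => by simp [MulOpposite.op_smul])
  refine Module.Finite.of_injective f ((injective_iff_map_eq_zero f).2 fun y hy => ?_)
  exact Subtype.ext (M.eq_zero_of_aug_F h𝒜 κ hn y.2 fun a ha => LinearMap.congr_fun hy ⟨a, ha⟩)

end Contraction

/-! ### The homomorphism classified by a Maurer-Cartan element -/

section Classify
universe w
variable {k : Type*} [Field k] {A : Type*} [Ring A] [Algebra k A]
  {P : Type w} [AddCommGroup P] [Module k P] [Module Aᵐᵒᵖ P] [IsScalarTower k Aᵐᵒᵖ P]
  {𝒜 : ℕ → Submodule k A} {ρ : FreeResolution 𝒜 P} {U : Type*} [AddCommGroup U] [Module k U]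
  {X : Type*} {D : Type*} [Ring D] [Algebra k D]

open Finset.HasAntidiagonal in
theorem sum_antidiagonal_assoc {R : Type*} [AddCommMonoid R] (f : ℕ → ℕ → ℕ → R) (n : ℕ) :
    ∑ p ∈ antidiagonal n, ∑ q ∈ antidiagonal p.2, f p.1 q.1 q.2 =
      ∑ p ∈ antidiagonal n, ∑ q ∈ antidiagonal p.1, f q.1 q.2 p.2 := by
  rw [Finset.sum_sigma', Finset.sum_sigma']
  refine Finset.sum_nbij' (fun x => ⟨(x.1.1 + x.2.1, x.2.2), (x.1.1, x.2.1)⟩)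
    (fun x => ⟨(x.2.1, x.2.2 + x.1.2), (x.2.2, x.1.2)⟩) ?_ ?_ ?_ ?_ ?_
  · rintro ⟨⟨a, b⟩, ⟨c, d⟩⟩ h
    simp only [Finset.mem_sigma, mem_antidiagonal] at h ⊢
    exact ⟨by omega, trivial⟩
  · rintro ⟨⟨a, b⟩, ⟨c, d⟩⟩ h
    simp only [Finset.mem_sigma, mem_antidiagonal] at h ⊢
    exact ⟨by omega, trivial⟩
  · rintro ⟨⟨a, b⟩, ⟨c, d⟩⟩ h
    simp only [Finset.mem_sigma, mem_antidiagonal] at h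
    obtain ⟨-, rfl⟩ := h
    rfl
  · rintro ⟨⟨a, b⟩, ⟨c, d⟩⟩ h
    simp only [Finset.mem_sigma, mem_antidiagonal] at h
    obtain ⟨-, rfl⟩ := h
    rfl
  · rintro ⟨⟨a, b⟩, ⟨c, d⟩⟩ h
    rfl

/-- Vanishing in cohomological degree `p`. -/
def VanishesAt (ρ : FreeResolution 𝒜 P) (p : ℤ) (Ψ : P →ₗ[k] D) : Prop :=
  ∀ y : ℤ × ℤ, y.1 = p → ∀ x ∈ ρ.deg y, Ψ x = 0

namespace BarModel.LetterBasis
variable {M : BarModel ρ U} {𝔛 : Alphabet X} (L : M.LetterBasis 𝔛) (c : X → D)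

theorem vanishesAt_theta {p q : ℤ} (hpq : p + 1 = q) {Ψ : P →ₗ[k] D} (h : VanishesAt ρ q Ψ)
    (j : ℕ) :
    VanishesAt ρ p (L.theta c j Ψ) := fun y hy x hx => by
  rw [theta_apply]
  refine Finset.sum_eq_zero fun w _ => ?_
  rw [h _ (by rw [Prod.fst_add, hy, hpq]) _ (L.F_mem w y x hx), mul_zero]

open Finset.HasAntidiagonal

/-- The total operation on a family of functionals. -/
noncomputable def thetaSum (Ψ : ℕ → P →ₗ[k] D) (s : ℕ) : P →ₗ[k] D :=
  ∑ ij ∈ antidiagonal s, L.theta c ij.1 (Ψ ij.2)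

theorem thetaSum_eq (Ψ : ℕ → P →ₗ[k] D) (s : ℕ) :
    L.thetaSum c Ψ s = L.theta c 0 (Ψ s) + ∑ j ∈ Finset.range s, L.theta c (s - j) (Ψ j) := by
  rw [thetaSum, ← Finset.Nat.sum_antidiagonal_swap,
    Finset.Nat.sum_antidiagonal_eq_sum_range_succ_mk,
    Finset.sum_range_succ, add_comm]
  simp

theorem sum_theta_thetaSum (hc : ∀ m, L.MaurerCartan c m) (Ψ : ℕ → P →ₗ[k] D) (s : ℕ) (p : P) :
    ∑ ij ∈ antidiagonal s, L.theta c ij.1 (L.thetaSum c Ψ ij.2) p = 0 := by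
  simp only [thetaSum, map_sum, LinearMap.sum_apply]
  rw [sum_antidiagonal_assoc (fun a b j => L.theta c a (L.theta c b (Ψ j)) p)]
  exact Finset.sum_eq_zero fun ij _ => L.sum_theta_theta_eq_zero hc _ _ _

/-- If `thetaSum` vanishes in lower weights, it is a cocycle in weight `s`. -/
theorem sum_theta_d (hc : ∀ m, L.MaurerCartan c m) {Ψ : ℕ → P →ₗ[k] D} {s : ℕ}
    (h : ∀ m < s, VanishesAt ρ (-1) (L.thetaSum c Ψ m)) {y : ℤ × ℤ} (hy : y.1 = -2) {q : P}
    (hq : q ∈ ρ.deg y) : (∑ j ∈ Finset.range s, L.theta c (s - j) (Ψ j)) (ρ.d q) = 0 := by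
  have h1 := L.sum_theta_thetaSum c hc Ψ s q
  rw [Finset.sum_eq_single (0, s)] at h1
  · rw [theta_zero, thetaSum_eq, LinearMap.add_apply, theta_zero, ρ.d_d, map_zero, zero_add] at h1
    exact h1
  · rintro ⟨i, m⟩ him hne
    rw [mem_antidiagonal] at him
    have hm : m < s := by
      by_contra h3
      exact hne (by ext <;> simp <;> omega)
    exact L.vanishesAt_theta c (p := -2) (by norm_num) (h m hm) i y hy q hq
  · intro h
    simp at h

variable (κ : Contraction ρ)

/-- The extension of the augmentation to a solution of the twisted equations. -/
noncomputable def psi (s : ℕ) : P →ₗ[k] D :=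
  (if s = 0 then Algebra.linearMap k D ∘ₗ ρ.aug else 0) -
    ∑ j : Fin s, L.theta c (s - j) (psi j) ∘ₗ κ.r
termination_by s
decreasing_by exact j.2

theorem psi_eq (s : ℕ) (x : P) : L.psi c κ s x = (if s = 0 then algebraMap k D (ρ.aug x) else 0) -
    (∑ j ∈ Finset.range s, L.theta c (s - j) (L.psi c κ j)) (κ.r x) := by
  rw [psi, LinearMap.sub_apply, LinearMap.sum_apply, LinearMap.sum_apply,
    Fin.sum_univ_eq_sum_range (fun j => (L.theta c (s - j) (L.psi c κ j) ∘ₗ κ.r) x) s]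
  split_ifs <;> rfl

theorem psi_zero (x : P) : L.psi c κ 0 x = algebraMap k D (ρ.aug x) := by
  rw [psi_eq]
  simp

/-- The recursion for `psi` makes the equation hold at `r (d p)`. The element `p` differs from it by
a boundary, on which the terms of positive weight vanish because the twisted operation squares to
zero. -/
theorem vanishesAt_thetaSum_psi (hc : ∀ m, L.MaurerCartan c m) (s : ℕ) :
    VanishesAt ρ (-1) (L.thetaSum c (L.psi c κ) s) := by
  induction s using Nat.strong_induction_on with
  | _ s ih =>
    intro y hy p hp
    rw [thetaSum_eq, LinearMap.add_apply, theta_zero, psi_eq, ρ.aug_d, map_zero, ite_self, zero_sub,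
      neg_add_eq_zero]
    obtain ⟨q, hq, hpq⟩ := κ.exists_eq_r_d_add hy hp
    conv_rhs => rw [hpq, map_add, L.sum_theta_d c hc ih (by simp [hy]) hq, add_zero]

theorem psi_e (s : ℕ) : L.psi c κ s ρ.e = if s = 0 then 1 else 0 := by
  rw [psi_eq, κ.r_e, map_zero, sub_zero, ρ.aug_e, map_one]

include κ in
/-- Solutions are determined by their values at the generator of degree zero. -/
theorem vanishesAt_zero_of_thetaSum {Ψ : ℕ → P →ₗ[k] D}
    (h : ∀ s, VanishesAt ρ (-1) (L.thetaSum c Ψ s)) (he : ∀ s, Ψ s ρ.e = 0) (s : ℕ) :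
    VanishesAt ρ 0 (Ψ s) := by
  induction s using Nat.strong_induction_on with
  | _ s ih =>
    intro y hy x hx
    have h1 := h s _ (by simp [hy]) _ (κ.mem hx)
    rw [thetaSum_eq, LinearMap.add_apply, theta_zero, LinearMap.sum_apply,
      Finset.sum_eq_zero, add_zero] at h1
    · rw [κ.eq_add_d_r hy hx, map_add, map_smul, he, h1, smul_zero, add_zero]
    · intro j hj
      exact L.vanishesAt_theta c (p := -1) (by norm_num) (ih j (Finset.mem_range.1 hj)) _ _
        (by simp [hy]) _ (κ.mem hx)

/-- Right multiplication by `a`. -/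
def _root_.ExtAInf.rightMul (P : Type*) [AddCommGroup P] [Module k P] [Module Aᵐᵒᵖ P]
    [IsScalarTower k Aᵐᵒᵖ P] (a : A) : P →ₗ[k] P where
  toFun x := MulOpposite.op a • x
  map_add' := smul_add _
  map_smul' _ _ := smul_comm _ _ _

theorem theta_rightMul (j : ℕ) (Ψ : P →ₗ[k] D) (a : A) :
    L.theta c j (Ψ ∘ₗ rightMul P a) = L.theta c j Ψ ∘ₗ rightMul P a := by
  ext p
  simp [theta_apply, rightMul]

theorem theta_mulRight (j : ℕ) (Ψ : P →ₗ[k] D) (y : D) :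
    L.theta c j (LinearMap.mulRight k y ∘ₗ Ψ) = LinearMap.mulRight k y ∘ₗ L.theta c j Ψ := by
  ext p
  simp [theta_apply, mul_assoc]

/-- The components of the classifying homomorphism. -/
noncomputable def chi (s : ℕ) (a : A) : D := L.psi c κ s (MulOpposite.op a • ρ.e)

/-- As functions of `x`, both sides solve the twisted equations and agree at `e`, and a solution on
`P^0` is determined by its value there. Multiplicativity of the classifying map follows. -/
theorem psi_smul (hc : ∀ m, L.MaurerCartan c m) {j : ℕ} {a : A} (ha : a ∈ 𝒜 j) (s : ℕ)
    {y : ℤ × ℤ} (hy : y.1 = 0) {x : P} (hx : x ∈ ρ.deg y) :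
    L.psi c κ s (MulOpposite.op a • x) =
      ∑ ij ∈ antidiagonal s, L.psi c κ ij.1 x * L.chi c κ ij.2 a := by
  let Ψ : ℕ → P →ₗ[k] D := fun s => L.psi c κ s ∘ₗ rightMul P a -
    ∑ ij ∈ antidiagonal s, LinearMap.mulRight k (L.chi c κ ij.2 a) ∘ₗ L.psi c κ ij.1
  have h1 : ∀ s, VanishesAt ρ (-1) (L.thetaSum c Ψ s) := by
    intro s z hz p hp
    have e : L.thetaSum c Ψ s = L.thetaSum c (L.psi c κ) s ∘ₗ rightMul P a -
        ∑ ij ∈ antidiagonal s, LinearMap.mulRight k (L.chi c κ ij.2 a) ∘ₗ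
          L.thetaSum c (L.psi c κ) ij.1 := by
      ext p
      simp only [thetaSum, Ψ, map_sub, theta_rightMul, map_sum, theta_mulRight,
        Finset.sum_sub_distrib, LinearMap.sub_apply, LinearMap.sum_apply, LinearMap.comp_apply]
      rw [sum_antidiagonal_assoc (fun a' b m => LinearMap.mulRight k (L.chi c κ m a)
        (L.theta c a' (L.psi c κ b) p))]
    rw [e, LinearMap.sub_apply, LinearMap.sum_apply, Finset.sum_eq_zero, sub_zero]
    · exact L.vanishesAt_thetaSum_psi c κ hc s _ (by simpa using hz) _ (ρ.smul_mem' hp ha)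
    · intro ij _
      rw [LinearMap.comp_apply, L.vanishesAt_thetaSum_psi c κ hc _ _ hz _ hp, map_zero]
  have h2 : ∀ s, Ψ s ρ.e = 0 := by
    intro s
    simp only [Ψ, LinearMap.sub_apply, LinearMap.sum_apply, LinearMap.comp_apply, psi_e,
      LinearMap.mulRight_apply]
    rw [Finset.sum_eq_single (0, s)]
    · rw [if_pos rfl, one_mul]
      exact sub_self _
    · rintro ⟨i, j⟩ hij hne
      rw [mem_antidiagonal] at hij
      rw [if_neg, zero_mul]
      rintro rfl
      exact hne (by simpa using hij)
    · intro h
      simp at h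
  have h3 := L.vanishesAt_zero_of_thetaSum c κ h1 h2 s y hy x hx
  simpa [Ψ, sub_eq_zero, rightMul] using h3

theorem chi_mul (hc : ∀ m, L.MaurerCartan c m) {i j : ℕ} {a b : A} (ha : a ∈ 𝒜 i) (hb : b ∈ 𝒜 j)
    (s : ℕ) : L.chi c κ s (a * b) =
      ∑ ij ∈ antidiagonal s, L.chi c κ ij.1 a * L.chi c κ ij.2 b := by
  rw [chi, MulOpposite.op_mul, mul_smul,
    L.psi_smul c κ hc hb s (by simp) (ρ.smul_mem' ρ.e_mem ha)]
  rfl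

variable {𝒟 : ℕ → Submodule k D} [GradedAlgebra 𝒟]

theorem theta_mem {c : X → D} (hcm : ∀ x, c x ∈ 𝒟 (𝔛.wt x)) {Ψ : P →ₗ[k] D} {i : ℕ}
    (hΨ : ∀ x, Ψ x ∈ 𝒟 i) (j : ℕ) (x : P) : L.theta c j Ψ x ∈ 𝒟 (j + i) := by
  rw [theta_apply]
  refine sum_mem fun w hw => SetLike.GradedMul.mul_mem ?_ (hΨ _)
  rw [← Alphabet.mem_words.1 hw]
  exact Alphabet.revProd_mem hcm w

theorem psi_mem {c : X → D} (hcm : ∀ x, c x ∈ 𝒟 (𝔛.wt x)) (s : ℕ) (x : P) :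
    L.psi c κ s x ∈ 𝒟 s := by
  induction s using Nat.strong_induction_on generalizing x with
  | _ s ih =>
    rw [psi_eq]
    refine sub_mem ?_ ?_
    · split_ifs with h
      · rw [h]
        exact SetLike.algebraMap_mem_graded _ _
      · exact zero_mem _
    · rw [LinearMap.sum_apply]
      refine sum_mem fun j hj => ?_
      rw [Finset.mem_range] at hj
      have := L.theta_mem hcm (ih j hj) (s - j) (κ.r x)
      rwa [Nat.sub_add_cancel hj.le] at this

/-- All ingredients are homogeneous, and the weight `s - j` lowers the Adams degree by exactly that
amount. Hence on a homogeneous element of `A` only one component of the classifying map survives. -/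
theorem psi_eq_zero (s : ℕ) {y : ℤ × ℤ} (hy : y ≠ (0, (s : ℤ))) {x : P} (hx : x ∈ ρ.deg y) :
    L.psi c κ s x = 0 := by
  induction s using Nat.strong_induction_on generalizing x y with
  | _ s ih =>
    rw [psi_eq, LinearMap.sum_apply, Finset.sum_eq_zero, sub_zero]
    · split_ifs with h
      · rw [ρ.aug_deg y (by rw [h] at hy; exact hy) x hx, map_zero]
      · rfl
    · intro j hj
      rw [Finset.mem_range] at hj
      rw [theta_apply]
      refine Finset.sum_eq_zero fun w hw => ?_
      rw [Alphabet.mem_words] at hw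
      rw [ih j hj _ (L.F_mem w _ _ (κ.mem hx)), mul_zero]
      intro h0
      apply hy
      simp only [Prod.ext_iff, Prod.fst_add, Prod.snd_add, Prod.fst_sub, Prod.snd_sub] at h0 ⊢
      constructor <;> omega

theorem chi_eq_zero {i s : ℕ} (h : i ≠ s) {a : A} (ha : a ∈ 𝒜 i) : L.chi c κ s a = 0 := by
  refine L.psi_eq_zero c κ s (fun h0 => h ?_) (ρ.smul_mem' ρ.e_mem ha)
  have := congrArg Prod.snd h0
  simpa using this

/-- The homomorphism of algebras classified by a Maurer-Cartan element. -/
theorem exists_algHom [GradedAlgebra 𝒜] {c : X → D} (hcm : ∀ x, c x ∈ 𝒟 (𝔛.wt x))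
    (hc : ∀ m, L.MaurerCartan c m) :
    ∃ χ : A →ₐ[k] D, ∀ i, ∀ a ∈ 𝒜 i, χ a ∈ 𝒟 i ∧ χ a = L.chi c κ i a := by
  let f : ∀ i, 𝒜 i →ₗ[k] D := fun i => L.psi c κ i ∘ₗ
    { toFun := fun a => MulOpposite.op (a : A) • ρ.e
      map_add' := fun a b => by simp [add_smul]
      map_smul' := fun c a => by simp [MulOpposite.op_smul] }
  have hf : ∀ i (a : 𝒜 i), f i a = L.chi c κ i a := fun i a => rfl
  let χ' : (⨁ i, 𝒜 i) →ₐ[k] D := DirectSum.toAlgebra k (fun i => 𝒜 i) f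
    (by
      rw [hf]
      change L.psi c κ 0 (MulOpposite.op (1 : A) • ρ.e) = 1
      rw [MulOpposite.op_one, one_smul, psi_e, if_pos rfl])
    (fun {i j} a b => by
      rw [hf, hf, hf]
      change L.chi c κ (i + j) ((a : A) * b) = _
      rw [L.chi_mul c κ hc a.2 b.2, Finset.sum_eq_single (i, j)]
      · rintro ⟨i', j'⟩ h1 h2
        rw [mem_antidiagonal] at h1
        by_cases hi : i = i'
        · subst hi
          exact absurd (by simpa using h1) h2
        · rw [L.chi_eq_zero c κ hi a.2, zero_mul]
      · intro h
        simp at h)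
  refine ⟨χ'.comp (DirectSum.decomposeAlgEquiv 𝒜).toAlgHom, fun i a ha => ?_⟩
  have h1 : χ'.comp (DirectSum.decomposeAlgEquiv 𝒜).toAlgHom a = L.chi c κ i a := by
    change χ' (DirectSum.decompose 𝒜 a) = _
    rw [DirectSum.decompose_of_mem 𝒜 ha]
    exact DirectSum.toModule_lof (M := fun i => 𝒜 i) (φ := f) k i ⟨a, ha⟩
  exact ⟨by rw [h1]; exact L.psi_mem κ hcm i _, h1⟩

end BarModel.LetterBasis
end Classify

/-! ### Behaviour modulo products -/

section Decomposable
universe w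
variable {k : Type*} [Field k] {A : Type*} [Ring A] [Algebra k A]
  {P : Type w} [AddCommGroup P] [Module k P] [Module Aᵐᵒᵖ P] [IsScalarTower k Aᵐᵒᵖ P]
  {𝒜 : ℕ → Submodule k A} {ρ : FreeResolution 𝒜 P} {U : Type*} [AddCommGroup U] [Module k U]
  {X : Type*} {D : Type*} [Ring D] [Algebra k D]

/-- `μ` vanishes on products of elements of positive degree. -/
def KillsProducts (𝒟 : ℕ → Submodule k D) (μ : D →ₗ[k] k) : Prop :=
  ∀ i j, 0 < i → 0 < j → ∀ x ∈ 𝒟 i, ∀ y ∈ 𝒟 j, μ (x * y) = 0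

namespace Alphabet
variable {𝔛 : Alphabet X} {𝒟 : ℕ → Submodule k D}

theorem map_revProd_eq_zero [SetLike.GradedMonoid 𝒟] {c : X → D} (hcm : ∀ x, c x ∈ 𝒟 (𝔛.wt x))
    {μ : D →ₗ[k] k} (hμ : KillsProducts 𝒟 μ) {w : List X} (h0 : w ≠ []) (h1 : w.length ≠ 1) :
    μ (revProd c w) = 0 := by
  obtain ⟨x, y, w, rfl⟩ : ∃ x y u, w = x :: y :: u := by
    match w with
    | [] => exact absurd rfl h0
    | [x] => exact absurd rfl h1
    | x :: y :: u => exact ⟨x, y, u, rfl⟩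
  rw [revProd_cons]
  have := 𝔛.wt_pos y
  exact hμ _ _ (by rw [weight_cons]; omega) (𝔛.wt_pos x) _ (revProd_mem hcm _) _ (hcm x)

variable (𝔛) in
theorem sum_words_eq_sum_letters {R : Type*} [AddCommMonoid R] (n : ℕ) {f : List X → R}
    (h : ∀ w ∈ 𝔛.words n, w.length ≠ 1 → f w = 0) :
    ∑ w ∈ 𝔛.words n, f w = ∑ x ∈ 𝔛.letters n, f [x] := by
  symm
  refine Finset.sum_bij_ne_zero (fun x _ _ => [x]) (fun x hx _ => ?_) (fun x _ _ y _ _ hxy => ?_)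
    (fun w hw hw0 => ?_) fun _ _ _ => rfl
  · simpa using 𝔛.mem_letters.1 hx
  · simpa using hxy
  · obtain ⟨x, rfl⟩ := List.length_eq_one_iff.1 (not_not.1 fun h1 => hw0 (h w hw h1))
    exact ⟨x, 𝔛.mem_letters.2 (by simpa using hw), hw0, rfl⟩

end Alphabet

namespace BarModel.LetterBasis
variable {M : BarModel ρ U} {𝔛 : Alphabet X} (L : M.LetterBasis 𝔛)
  (κ : Contraction ρ) {𝒟 : ℕ → Submodule k D}

theorem sum_aug_F (n : ℕ) (a : X → k) (p : P) :
    ∑ x ∈ 𝔛.letters n, a x * ρ.aug (M.F [L.e x] p) =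
      ρ.aug (M.F [∑ x ∈ 𝔛.letters n, a x • L.e x] p) := by
  let f : U →ₗ[k] k := ρ.aug ∘ₗ LinearMap.applyₗ' k p ∘ₗ (M.F_lin [] []).mk' _
  have h : ∀ y, ρ.aug (M.F [y] p) = f y := fun y => rfl
  simp only [h, map_sum, map_smul, smul_eq_mul]

/-- The values on the letters of a Maurer-Cartan element are detected by the homomorphism that it
classifies, modulo decomposables. -/
theorem map_c_eq_zero [GradedAlgebra 𝒜] [GradedAlgebra 𝒟] (h𝒜 : IsConnectedLocallyFinite 𝒜)
    {c : X → D} (hcm : ∀ x, c x ∈ 𝒟 (𝔛.wt x)) {n : ℕ} (hn : 0 < n) {μ : D →ₗ[k] k}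
    (hμ : KillsProducts 𝒟 μ) (h : ∀ a ∈ 𝒜 n, μ (L.chi c κ n a) = 0) :
    ∀ x ∈ 𝔛.letters n, μ (c x) = 0 := by
  -- By independence of the letters it suffices that `∑ μ (c x) • e x` vanishes in `E^1`, which is
  -- tested on `A_n`.
  refine L.eq_zero n _ (M.eq_zero_of_aug_F h𝒜 κ hn
    (sum_mem fun x hx => Submodule.smul_mem _ _ ?_) fun a ha => ?_)
  · rw [← 𝔛.mem_letters.1 hx]
    exact L.mem x
  · have h1 := h a ha
    set p := κ.r (MulOpposite.op a • ρ.e) with hp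
    -- Every term with `j > 0` is a product of elements of positive degree. For `j = 0`, where `psi`
    -- is the augmentation, only one-letter words survive `μ`.
    rw [chi, psi_eq, if_neg hn.ne', zero_sub, map_neg, neg_eq_zero, LinearMap.sum_apply, map_sum,
      Finset.sum_eq_single 0] at h1
    · rw [Nat.sub_zero, theta_apply, map_sum, 𝔛.sum_words_eq_sum_letters] at h1
      · rw [← sum_aug_F, ← h1]
        refine Finset.sum_congr rfl fun x _ => ?_
        rw [psi_zero, ← Algebra.commutes, ← Algebra.smul_def, map_smul, smul_eq_mul, mul_comm,
          Alphabet.revProd_singleton]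
        rfl
      · intro w hw hw1
        rw [psi_zero, ← Algebra.commutes, ← Algebra.smul_def, map_smul,
          Alphabet.map_revProd_eq_zero hcm hμ _ hw1, smul_zero]
        rintro rfl
        rw [Alphabet.mem_words] at hw
        exact hn.ne hw
    · intro j hj hj0
      rw [Finset.mem_range] at hj
      rw [theta_apply, map_sum]
      refine Finset.sum_eq_zero fun w hw => ?_
      rw [Alphabet.mem_words] at hw
      refine hμ _ j ?_ (Nat.pos_of_ne_zero hj0) _ (Alphabet.revProd_mem hcm w) _
        (L.psi_mem κ hcm j _)
      omega
    · intro h0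
      simp [hn] at h0

end BarModel.LetterBasis
end Decomposable

/-! ### Approximate solutions in the algebra itself -/

section Generate
universe w
variable {k : Type*} [Field k] {A : Type*} [Ring A] [Algebra k A]
  {P : Type w} [AddCommGroup P] [Module k P] [Module Aᵐᵒᵖ P] [IsScalarTower k Aᵐᵒᵖ P]
  {𝒜 : ℕ → Submodule k A} {ρ : FreeResolution 𝒜 P} {U : Type*} [AddCommGroup U] [Module k U]
  {X : Type*}

open Finset.HasAntidiagonal

/-- A homogeneous `A`-linear extension of the augmentation. -/
theorem FreeResolution.exists_lift_aug [GradedAlgebra 𝒜] (h𝒜 : IsConnectedLocallyFinite 𝒜)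
    (ρ : FreeResolution 𝒜 P) : ∃ q : P →ₗ[Aᵐᵒᵖ] A,
      (∀ s : ℕ, ∀ x ∈ ρ.deg (0, s), q x ∈ 𝒜 s) ∧
      (∀ y : ℤ × ℤ, (∀ s : ℕ, y ≠ (0, (s : ℤ))) → ∀ x ∈ ρ.deg y, q x = 0) ∧
      ∀ x ∈ ρ.deg (0, 0), q x = algebraMap k A (ρ.aug x) := by
  obtain ⟨ι, b, δ, hδ⟩ := ρ.exists_basis
  let q : P →ₗ[Aᵐᵒᵖ] A := b.constr ℕ fun i => algebraMap k A (ρ.aug (b i))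
  have hq : ∀ i (a : A), q (MulOpposite.op a • b i) = ρ.aug (b i) • a := fun i a => by
    rw [map_smul, b.constr_basis, op_smul_eq_mul, Algebra.smul_def]
  have hδ0 : ∀ i, δ i ≠ 0 → ρ.aug (b i) = 0 := fun i hi => ρ.aug_deg _ hi _ (hδ i)
  have h1 : ∀ (s : ℕ) x, GradedAlgebra.proj 𝒜 s (q (gproj ρ.isInternal (0, s) x)) =
      q (gproj ρ.isInternal (0, s) x) := by
    intro s
    refine basis_ext (f := GradedAlgebra.proj 𝒜 s ∘ₗ q.restrictScalars k ∘ₗ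
      gproj ρ.isInternal (0, s)) (g := q.restrictScalars k ∘ₗ gproj ρ.isInternal (0, s)) 𝒜 b
      fun i j a ha => ?_
    simp only [LinearMap.comp_apply, LinearMap.restrictScalars_apply]
    by_cases h : δ i + (0, (j : ℤ)) = (0, (s : ℤ))
    · rw [gproj_of_mem _ (h ▸ ρ.smul_mem' (hδ i) ha), hq, map_smul]
      by_cases h0 : δ i = 0
      · rw [h0] at h
        have : j = s := by simpa using h
        subst this
        rw [GradedAlgebra.proj_apply, DirectSum.decompose_of_mem_same _ ha]
      · rw [hδ0 i h0, zero_smul, zero_smul]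
    · rw [gproj_of_ne _ (ρ.smul_mem' (hδ i) ha) h, map_zero, map_zero]
  have h2 : ∀ y : ℤ × ℤ, (∀ s : ℕ, y ≠ (0, (s : ℤ))) → ∀ x, q (gproj ρ.isInternal y x) = 0 := by
    intro y hy
    refine basis_ext (f := q.restrictScalars k ∘ₗ gproj ρ.isInternal y) (g := (0 : P →ₗ[k] A)) 𝒜 b
      fun i j a ha => ?_
    simp only [LinearMap.comp_apply, LinearMap.restrictScalars_apply, LinearMap.zero_apply]
    by_cases h : δ i + (0, (j : ℤ)) = y
    · rw [gproj_of_mem _ (h ▸ ρ.smul_mem' (hδ i) ha), hq, hδ0 i, zero_smul]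
      intro h0
      rw [h0, zero_add] at h
      exact hy j h.symm
    · rw [gproj_of_ne _ (ρ.smul_mem' (hδ i) ha) h, map_zero]
  have h3 : ∀ x, GradedAlgebra.proj 𝒜 0 (q x) = algebraMap k A (ρ.aug x) := by
    refine basis_ext (f := GradedAlgebra.proj 𝒜 0 ∘ₗ q.restrictScalars k)
      (g := Algebra.linearMap k A ∘ₗ ρ.aug) 𝒜 b fun i j a ha => ?_
    simp only [LinearMap.comp_apply, LinearMap.restrictScalars_apply, Algebra.linearMap_apply]
    rw [hq, map_smul, GradedAlgebra.proj_apply]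
    rcases Nat.eq_zero_or_pos j with rfl | hj
    · rw [DirectSum.decompose_of_mem_same _ ha]
      obtain ⟨c, rfl, -⟩ := h𝒜.connected a ha
      rw [algebraMap_op_smul, map_smul, smul_eq_mul, mul_comm, map_mul, Algebra.smul_def]
    · rw [DirectSum.decompose_of_mem_ne _ ha hj.ne', smul_zero, ρ.aug_smul j _ a hj ha, map_zero]
  have h4 : ∀ s : ℕ, ∀ x ∈ ρ.deg (0, s), q x ∈ 𝒜 s := fun s x hx => by
    rw [← gproj_of_mem ρ.isInternal hx, ← h1, GradedAlgebra.proj_apply]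
    exact SetLike.coe_mem _
  refine ⟨q, h4, fun y hy x hx => ?_, fun x hx => ?_⟩
  · rw [← gproj_of_mem ρ.isInternal hx, h2 y hy]
  · rw [← h3, GradedAlgebra.proj_apply, DirectSum.decompose_of_mem_same _ (h4 0 x hx)]

namespace BarModel.LetterBasis
variable {M : BarModel ρ U} {𝔛 : Alphabet X} (L : M.LetterBasis 𝔛)

/-- An approximate solution of the twisted equations, valid up to weight `n`. -/
structure Stage (c : X → A) (q : P →ₗ[Aᵐᵒᵖ] A) (n : ℕ) : Prop where
  c_mem : ∀ x, c x ∈ 𝒜 (𝔛.wt x)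
  q_mem : ∀ s : ℕ, ∀ x ∈ ρ.deg (0, s), q x ∈ 𝒜 s
  q_zero : ∀ y : ℤ × ℤ, (∀ s : ℕ, y ≠ (0, (s : ℤ))) → ∀ x ∈ ρ.deg y, q x = 0
  q_aug : ∀ x ∈ ρ.deg (0, 0), q x = algebraMap k A (ρ.aug x)
  maurerCartan : ∀ m ≤ n, L.MaurerCartan c m
  eq : ∀ s : ℤ, s ≤ n → ∀ p ∈ ρ.deg (-1, s),
    L.thetaSum c (fun _ => q.restrictScalars k) n p = 0

theorem thetaSum_const (c : X → A) (Ψ : P →ₗ[k] A) (n : ℕ) (p : P) :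
    L.thetaSum c (fun _ => Ψ) n p = ∑ j ∈ Finset.range (n + 1), L.theta c j Ψ p := by
  rw [thetaSum, LinearMap.sum_apply, Finset.Nat.sum_antidiagonal_eq_sum_range_succ_mk]

theorem thetaSum_smul (c : X → A) (q : P →ₗ[Aᵐᵒᵖ] A) (m : ℕ) (p : P) (a : A) :
    L.thetaSum c (fun _ => q.restrictScalars k) m (MulOpposite.op a • p) =
      L.thetaSum c (fun _ => q.restrictScalars k) m p * a := by
  simp [thetaSum_const, theta_apply, Finset.sum_mul, mul_assoc]

theorem exists_stage_zero [GradedAlgebra 𝒜] (h𝒜 : IsConnectedLocallyFinite 𝒜) :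
    ∃ c q, L.Stage c q 0 := by
  obtain ⟨q, h1, h2, h3⟩ := ρ.exists_lift_aug h𝒜
  refine ⟨fun _ => 0, q, fun x => zero_mem _, h1, h2, h3, fun m hm μ => ?_, fun s hs p hp => ?_⟩
  · obtain rfl := Nat.le_zero.1 hm
    simp [𝔛.words_zero, M.b_nil]
  · rw [thetaSum_const, Finset.sum_range_one, theta_zero]
    have hd : ρ.d p ∈ ρ.deg (0, s) := by simpa using ρ.d_mem hp
    by_cases h0 : s = 0
    · subst h0
      exact (h3 _ hd).trans (by rw [ρ.aug_d, map_zero])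
    · refine h2 _ (fun t ht => h0 ?_) _ hd
      simp only [Prod.mk.injEq] at ht
      push_cast at hs
      omega

namespace Stage
variable {L} {c : X → A} {q : P →ₗ[Aᵐᵒᵖ] A} {n : ℕ} (S : L.Stage c q n)
include S

theorem theta_eq_zero {y : ℤ × ℤ} {j : ℕ} (h : y.1 ≠ -1 ∨ y.2 < j) {p : P} (hp : p ∈ ρ.deg y) :
    L.theta c j (q.restrictScalars k) p = 0 := by
  rw [theta_apply]
  refine Finset.sum_eq_zero fun w hw => ?_
  rw [Alphabet.mem_words] at hw
  refine mul_eq_zero_of_right _ (S.q_zero _ (fun s hs => ?_) _ (L.F_mem w y p hp))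
  simp only [Prod.ext_iff, Prod.fst_add, Prod.snd_add] at hs
  omega

/-- Words heavier than the Adams degree of `p` contribute nothing, so all sufficiently long partial
sums agree with the one that `eq` controls. -/
theorem thetaSum_eq_zero {m : ℕ} {y : ℤ × ℤ}
    (h : y.1 ≠ -1 ∨ (y.2 ≤ m ∧ y.2 ≤ n)) {p : P} (hp : p ∈ ρ.deg y) :
    L.thetaSum c (fun _ => q.restrictScalars k) m p = 0 := by
  rw [thetaSum_const]
  by_cases hy : y.1 = -1
  · have h1 := h.resolve_left (by simp [hy])
    have h2 := S.eq y.2 h1.2 p (by rw [← hy]; exact hp)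
    rw [thetaSum_const] at h2
    have h3 : ∀ N, y.2 ≤ (N : ℕ) →
        ∑ j ∈ Finset.range (N + 1), L.theta c j (q.restrictScalars k) p =
        ∑ j ∈ Finset.range (y.2.toNat + 1), L.theta c j (q.restrictScalars k) p := fun N hN => by
      refine (Finset.sum_subset (fun j hj => ?_) fun j _ hj => ?_).symm
      · simp only [Finset.mem_range] at hj ⊢
        omega
      · simp only [Finset.mem_range] at hj
        exact S.theta_eq_zero (.inr (by omega)) hp
    rw [h3 m h1.1, ← h3 n h1.2, h2]
  · exact Finset.sum_eq_zero fun j _ => S.theta_eq_zero (.inl hy) hp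

theorem thetaSum_mem [GradedAlgebra 𝒜] (m s : ℕ) {p : P} (hp : p ∈ ρ.deg (-1, s)) :
    L.thetaSum c (fun _ => q.restrictScalars k) m p ∈ 𝒜 s := by
  rw [thetaSum_const]
  refine sum_mem fun j _ => ?_
  by_cases hj : j ≤ s
  · rw [theta_apply]
    refine sum_mem fun w hw => ?_
    rw [Alphabet.mem_words] at hw
    have h1 := L.F_mem w _ _ hp
    rw [hw, show ((-1 : ℤ), (s : ℤ)) + (1, -(j : ℤ)) = (0, ((s - j : ℕ) : ℤ)) by
      ext <;> simp; omega] at h1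
    have h2 := SetLike.GradedMul.mul_mem (Alphabet.revProd_mem S.c_mem w) (S.q_mem _ _ h1)
    rw [hw, Nat.add_sub_cancel' hj] at h2
    exact h2
  · rw [S.theta_eq_zero (.inr (by simpa using hj)) hp]
    exact zero_mem _

/-- Evaluate the total twisted operation applied twice to `q` in two ways. The lower partial sums
vanish in the degrees involved, leaving the left side; `sum_theta_theta` and the lower Maurer-Cartan
equations leave the right side, where `q` is the augmentation. -/
theorem thetaSum_d {p : P} (hp : p ∈ ρ.deg (-2, (n + 1 : ℕ))) :
    L.thetaSum c (fun _ => q.restrictScalars k) (n + 1) (ρ.d p) =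
      ∑ v ∈ 𝔛.words (n + 1), Alphabet.revProd c v *
        algebraMap k A (ρ.aug (M.F [M.b (v.map L.e)] p)) := by
  have h1 : ∑ ij ∈ antidiagonal (n + 1),
      L.theta c ij.1 (L.thetaSum c (fun _ => q.restrictScalars k) ij.2) p =
      ∑ v ∈ 𝔛.words (n + 1), Alphabet.revProd c v * q (M.F [M.b (v.map L.e)] p) := by
    simp only [thetaSum, map_sum, LinearMap.sum_apply]
    rw [sum_antidiagonal_assoc (fun a b _ => L.theta c a (L.theta c b (q.restrictScalars k)) p),
      Finset.sum_eq_single (n + 1, 0)]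
    · exact L.sum_theta_theta (fun m hm => S.maurerCartan m (Nat.le_of_lt_succ hm)) _ p
    · rintro ⟨t, j⟩ h1 h2
      rw [mem_antidiagonal] at h1
      have ht : t ≤ n := by
        by_contra h3
        exact h2 (by ext <;> simp at * <;> omega)
      rw [L.sum_theta_theta (fun m hm => S.maurerCartan m (by simp at hm; omega))]
      exact sum_bilinear_eq_zero _ _ _ (S.maurerCartan t ht) ((LinearMap.mul k A).compl₂
        (q.restrictScalars k ∘ₗ LinearMap.applyₗ' k p ∘ₗ ((M.F_lin [] []).mk' _)))
    · intro h
      simp at h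
  rw [Finset.sum_eq_single (0, n + 1)] at h1
  · rw [theta_zero] at h1
    rw [h1]
    refine Finset.sum_congr rfl fun v hv => ?_
    rw [Alphabet.mem_words] at hv
    have h2 := M.F_mem (L.b_mem v) _ _ hp
    rw [hv, show ((-2 : ℤ), ((n + 1 : ℕ) : ℤ)) + ((1, -((n + 1 : ℕ) : ℤ)) + (1, 0)) = (0, 0) by
      ext <;> simp] at h2
    rw [S.q_aug _ h2]
  · rintro ⟨i, m⟩ h1 h2
    rw [mem_antidiagonal] at h1
    have hm : m ≤ n := by
      by_contra h3
      exact h2 (by ext <;> simp at * <;> omega)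
    rw [theta_apply]
    refine Finset.sum_eq_zero fun w hw => ?_
    rw [Alphabet.mem_words] at hw
    rw [S.thetaSum_eq_zero (.inr ?_) (L.F_mem w _ _ hp), mul_zero]
    simp only [Prod.snd_add] at *
    omega
  · intro h
    simp at h

end Stage
end BarModel.LetterBasis
end Generate

/-! ### Extension of an approximate solution by one weight -/

section Generate
universe w
variable {k : Type*} [Field k] {A : Type*} [Ring A] [Algebra k A]
  {P : Type w} [AddCommGroup P] [Module k P] [Module Aᵐᵒᵖ P] [IsScalarTower k Aᵐᵒᵖ P]
  {𝒜 : ℕ → Submodule k A} {ρ : FreeResolution 𝒜 P} {U : Type*} [AddCommGroup U] [Module k U]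
  {X : Type*}

/-- Left multiplication by `a`, as a map of right modules. -/
def leftMul (a : A) : A →ₗ[Aᵐᵒᵖ] A where
  toFun x := a * x
  map_add' := mul_add a
  map_smul' b x := by
    rw [RingHom.id_apply, ← MulOpposite.op_unop b, op_smul_eq_mul, op_smul_eq_mul, mul_assoc]

/-- The coordinates with respect to a basis of a homogeneous piece. -/
theorem exists_coordinates [GradedAlgebra 𝒜] (h𝒜 : IsConnectedLocallyFinite 𝒜) (n : ℕ) :
    ∃ (d : ℕ) (B : Fin d → A) (μ : Fin d → A →ₗ[k] k), (∀ i, B i ∈ 𝒜 n) ∧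
      (∀ i m, m ≠ n → ∀ a ∈ 𝒜 m, μ i a = 0) ∧ ∀ a ∈ 𝒜 n, a = ∑ i, μ i a • B i := by
  have := h𝒜.finite n
  let b := Module.finBasis k (𝒜 n)
  let π : A →ₗ[k] 𝒜 n := DirectSum.component k ℕ (fun i => 𝒜 i) n ∘ₗ
    (DirectSum.decomposeLinearEquiv 𝒜).toLinearMap
  have hπ : ∀ a, (π a : A) = DirectSum.decompose 𝒜 a n := fun a => rfl
  refine ⟨_, fun i => b i, fun i => b.coord i ∘ₗ π, fun i => (b i).2, fun i m hm a ha => ?_,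
    fun a ha => ?_⟩
  · have : π a = 0 := Subtype.ext (by rw [hπ, DirectSum.decompose_of_mem_ne 𝒜 ha hm]; rfl)
    rw [LinearMap.comp_apply, this, map_zero]
  · have h1 : π a = ⟨a, ha⟩ := Subtype.ext (by rw [hπ, DirectSum.decompose_of_mem_same 𝒜 ha])
    have h2 := congrArg Subtype.val (b.sum_repr ⟨a, ha⟩)
    simp only [LinearMap.comp_apply, h1, Module.Basis.coord_apply]
    push_cast at h2
    exact h2.symm

namespace BarModel.LetterBasis
variable {M : BarModel ρ U} {𝔛 : Alphabet X} {L : M.LetterBasis 𝔛}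

namespace Stage
variable [GradedAlgebra 𝒜] (h𝒜 : IsConnectedLocallyFinite 𝒜)
  {c : X → A} {q : P →ₗ[Aᵐᵒᵖ] A} {n : ℕ} (S : L.Stage c q n)
include S

/-- The obstruction, paired with a functional on the piece of weight `n + 1`. -/
theorem obstruction_eq_zero {μ : A →ₗ[k] k} (hμ : ∀ m, m ≠ n + 1 → ∀ a ∈ 𝒜 m, μ a = 0)
    {y : ℤ × ℤ} (hy : y ≠ (-1, ((n + 1 : ℕ) : ℤ))) {p : P} (hp : p ∈ ρ.deg y) :
    μ (L.thetaSum c (fun _ => q.restrictScalars k) (n + 1) p) = 0 := by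
  by_cases h : y.1 ≠ -1 ∨ y.2 ≤ n
  · rw [S.thetaSum_eq_zero (h.imp_right fun h => ⟨by push_cast; omega, h⟩) hp, map_zero]
  · rw [not_or, not_not] at h
    have h2 : y = (-1, (y.2.toNat : ℤ)) := by ext <;> simp <;> omega
    rw [h2] at hp hy
    refine hμ _ (fun h3 => hy ?_) _ (S.thetaSum_mem _ _ hp)
    rw [h3]

/-- In Adams degree `≤ n` the obstruction, which is `A`-linear, already vanishes; from higher
degrees, multiplication by `A_{≥ 1}` leads beyond `n + 1`, where `μ` is zero. -/
theorem isTrivial_obstruction {μ : A →ₗ[k] k} (hμ : ∀ m, m ≠ n + 1 → ∀ a ∈ 𝒜 m, μ a = 0) :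
    IsTrivial 𝒜 (μ ∘ₗ L.thetaSum c (fun _ => q.restrictScalars k) (n + 1)) := by
  intro j x a hj ha
  refine homogeneous_induction (p := fun x => (μ ∘ₗ L.thetaSum c (fun _ => q.restrictScalars k)
    (n + 1)) (MulOpposite.op a • x) = 0) ρ.isInternal x (fun y x hx => ?_) (by simp)
    fun x y hx hy => by rw [smul_add, map_add, hx, hy, add_zero]
  rw [LinearMap.comp_apply]
  by_cases h : y.1 ≠ -1 ∨ y.2 ≤ n
  · rw [thetaSum_smul, S.thetaSum_eq_zero (h.imp_right fun h => ⟨by push_cast; omega, h⟩) hx,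
      zero_mul, map_zero]
  · rw [not_or, not_not] at h
    refine S.obstruction_eq_zero hμ (fun h0 => ?_) (ρ.smul_mem' hx ha)
    simp only [Prod.ext_iff, Prod.snd_add] at h0
    push_cast at h0
    omega

include h𝒜 in
-- Paired with `μ`, the Maurer-Cartan expression is an element `y` of `E^2`, and `thetaSum_d`
-- exhibits `aug ∘ F [y]` as the coboundary of an `A`-linear functional to `k_A`. Hence `F [y]` is a
-- coboundary and `y = 0`: the next equation comes for free.
theorem maurerCartan_succ : L.MaurerCartan c (n + 1) := by
  intro μ'
  -- The coefficients have degree `n + 1`, so a test functional may be cut off to that degree.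
  set μ : A →ₗ[k] k := μ' ∘ₗ GradedAlgebra.proj 𝒜 (n + 1) with hμ'
  have hμ : ∀ m, m ≠ n + 1 → ∀ a ∈ 𝒜 m, μ a = 0 := fun m hm a ha => by
    rw [hμ', LinearMap.comp_apply, GradedAlgebra.proj_apply, DirectSum.decompose_of_mem_ne 𝒜 ha hm,
      map_zero]
  have hμc : ∀ v ∈ 𝔛.words (n + 1), μ' (Alphabet.revProd c v) = μ (Alphabet.revProd c v) := by
    intro v hv
    rw [hμ', LinearMap.comp_apply, GradedAlgebra.proj_apply, DirectSum.decompose_of_mem_same]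
    rw [← Alphabet.mem_words.1 hv]
    exact Alphabet.revProd_mem S.c_mem v
  rw [Finset.sum_congr rfl fun v hv => by rw [hμc v hv]]
  set y := ∑ v ∈ 𝔛.words (n + 1), μ (Alphabet.revProd c v) • M.b (v.map L.e) with hy
  have hyd : y ∈ M.deg (1, -((n + 1 : ℕ) : ℤ)) := sum_mem fun v hv => Submodule.smul_mem _ _ (by
    have := L.b_mem v
    rwa [Alphabet.mem_words.1 hv] at this)
  have hF := M.F_mem hyd
  obtain ⟨g, hg, H⟩ := FreeResolution.exists_homotopy h𝒜 ρ ρ 1 hF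
    (fun p => by simpa using M.F_cocycle hyd p) (S.isTrivial_obstruction hμ)
    (fun z hz p hp => S.obstruction_eq_zero hμ (fun h0 => hz (by
      rw [h0]; ext <;> simp)) hp) (fun p => by
      refine homogeneous_ext (f := ρ.aug ∘ₗ (M.F [y]).restrictScalars k)
        (g := (μ ∘ₗ L.thetaSum c (fun _ => q.restrictScalars k) (n + 1)) ∘ₗ
          ρ.d.restrictScalars k) ρ.isInternal (fun z p hp => ?_) p
      change ρ.aug (M.F [y] p) = μ (L.thetaSum c (fun _ => q.restrictScalars k) (n + 1) (ρ.d p))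
      by_cases hz : z = (-2, ((n + 1 : ℕ) : ℤ))
      · subst hz
        rw [S.thetaSum_d hp, map_sum]
        let f : U →ₗ[k] k := ρ.aug ∘ₗ LinearMap.applyₗ' k p ∘ₗ (M.F_lin [] []).mk' _
        have h : ∀ y, ρ.aug (M.F [y] p) = f y := fun y => rfl
        simp only [h, hy, map_sum, map_smul, smul_eq_mul]
        refine Finset.sum_congr rfl fun v _ => ?_
        rw [← Algebra.commutes, ← Algebra.smul_def, map_smul, smul_eq_mul, mul_comm]
      · rw [S.obstruction_eq_zero hμ (fun h0 => hz ?_) (ρ.d_mem hp),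
          ρ.aug_deg _ (fun h0 => hz ?_) _ (hF z p hp)]
        · simp only [Prod.ext_iff, Prod.fst_add, Prod.snd_add] at h0 ⊢
          constructor <;> omega
        · simp only [Prod.ext_iff, Prod.fst_add, Prod.snd_add] at h0 ⊢
          constructor <;> omega)
  refine M.inj _ y hyd g (homDeg_cast (by abel) hg) fun p => ?_
  rw [H]
  simp [sub_eq_add_neg]

include h𝒜 in
/-- The obstruction is represented by a letter, up to a coboundary. -/
theorem exists_rep {μ : A →ₗ[k] k} (hμ : ∀ m, m ≠ n + 1 → ∀ a ∈ 𝒜 m, μ a = 0) :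
    ∃ κ : X → k, ∃ g ∈ homDeg A ρ.deg ρ.deg (0, -((n + 1 : ℕ) : ℤ)),
      ∀ p, μ (L.thetaSum c (fun _ => q.restrictScalars k) (n + 1) p) =
        ρ.aug (M.F [∑ x ∈ 𝔛.letters (n + 1), κ x • L.e x] p) - ρ.aug (g (ρ.d p)) := by
  obtain ⟨φ, hφ, hφd, hφa⟩ := FreeResolution.exists_cocycle_lift h𝒜 ρ ρ (-1)
    (z := (0, -((n + 1 : ℕ) : ℤ)) + (1, 0)) (S.isTrivial_obstruction hμ)
    (fun z hz p hp => S.obstruction_eq_zero hμ (fun h0 => hz (by rw [h0]; ext <;> simp)) hp)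
    (fun p => homogeneous_ext
      (f := (μ ∘ₗ L.thetaSum c (fun _ => q.restrictScalars k) (n + 1)) ∘ₗ ρ.d.restrictScalars k)
      (g := (0 : P →ₗ[k] k)) ρ.isInternal (fun z p hp => by
        change μ (L.thetaSum c (fun _ => q.restrictScalars k) (n + 1) (ρ.d p)) = 0
        by_cases hz : z = (-2, ((n + 1 : ℕ) : ℤ))
        · subst hz
          rw [S.thetaSum_d hp]
          have h1 := sum_bilinear_eq_zero _ _ _ (S.maurerCartan_succ h𝒜)
            ((LinearMap.mul k A).compl₂ (Algebra.linearMap k A ∘ₗ ρ.aug ∘ₗ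
              LinearMap.applyₗ' k p ∘ₗ ((M.F_lin [] []).mk' _)))
          exact (congrArg μ h1).trans (map_zero μ)
        · refine S.obstruction_eq_zero hμ (fun h0 => hz ?_) (ρ.d_mem hp)
          simp only [Prod.ext_iff, Prod.fst_add, Prod.snd_add] at h0 ⊢
          constructor <;> omega) p)
  obtain ⟨x, hx, g, hg, H⟩ := M.surj _ le_rfl φ hφ (fun p => by simpa using hφd p)
  obtain ⟨κ, rfl⟩ := L.exists_eq (n + 1) n.succ_pos x hx
  refine ⟨κ, g, hg, fun p => ?_⟩
  have h1 := congrArg ρ.aug (H p)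
  rw [hφa, map_add, map_sub, ρ.aug_d] at h1
  rw [← LinearMap.comp_apply, h1]
  simp [sub_eq_add_neg]

include h𝒜 in
-- Each coordinate of the obstruction in `A_{n+1}` is a class in `E^1` minus a coboundary: the class
-- is subtracted from the letters of weight `n + 1`, the coboundary is absorbed into `q`. Such
-- letters occur in words of weight `≤ n + 1` only alone, and the maps `g i` lower the Adams degree
-- by `n + 1`, so lower weights are untouched.
theorem exists_succ : ∃ c' q', L.Stage c' q' (n + 1) ∧ ∀ x, 𝔛.wt x ≠ n + 1 → c' x = c x := by
  obtain ⟨d, B, μ, hB, hμ0, hμB⟩ := exists_coordinates h𝒜 (n + 1)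
  choose κ g hg H using fun i => S.exists_rep h𝒜 (hμ0 i)
  set c' : X → A := fun x => c x - if 𝔛.wt x = n + 1 then ∑ i, κ i x • B i else 0 with hc'
  set q' : P →ₗ[Aᵐᵒᵖ] A := q + ∑ i, leftMul (B i) ∘ₗ q ∘ₗ g i with hq'
  have hq'x : ∀ x, q' x = q x + ∑ i, B i * q (g i x) := fun x => by
    rw [hq', LinearMap.add_apply, LinearMap.sum_apply]
    rfl
  have hcc : ∀ x, 𝔛.wt x ≠ n + 1 → c' x = c x := fun x hx => by simp [hc', hx]
  have hrev : ∀ w, 𝔛.weight w ≤ n + 1 → w.length ≠ 1 →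
      Alphabet.revProd c' w = Alphabet.revProd c w := by
    intro w hw h1
    refine Alphabet.revProd_congr fun x hx => hcc x fun hxn => h1 ?_
    obtain ⟨u, t, rfl⟩ := List.append_of_mem hx
    rw [Alphabet.weight_append, Alphabet.weight_cons] at hw
    rw [Alphabet.eq_nil_of_weight_eq_zero (𝔛 := 𝔛) (w := u) (by omega),
      Alphabet.eq_nil_of_weight_eq_zero (𝔛 := 𝔛) (w := t) (by omega)]
    rfl
  have hqg : ∀ (s : ℤ) (i), s ≤ n → ∀ x ∈ ρ.deg (0, s), q (g i x) = 0 := fun s i hs x hx => by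
    refine S.q_zero _ (fun t ht => ?_) _ (hg i _ x hx)
    simp only [Prod.ext_iff, Prod.snd_add] at ht
    push_cast at ht
    omega
  refine ⟨c', q', ⟨fun x => ?_, fun s x hx => ?_, fun y hy x hx => ?_, fun x hx => ?_,
    fun m hm μ' => ?_, fun s hs p hp => ?_⟩, hcc⟩
  · refine sub_mem (S.c_mem x) ?_
    split_ifs with h
    · rw [h]
      exact sum_mem fun i _ => Submodule.smul_mem _ _ (hB i)
    · exact zero_mem _
  · rw [hq'x]
    refine add_mem (S.q_mem s x hx) (sum_mem fun i _ => ?_)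
    by_cases hs : n + 1 ≤ s
    · have h1 := hg i _ x hx
      rw [show ((0 : ℤ), (s : ℤ)) + (0, -((n + 1 : ℕ) : ℤ)) = (0, ((s - (n + 1) : ℕ) : ℤ)) by
        ext <;> simp; omega] at h1
      have h2 := SetLike.GradedMul.mul_mem (hB i) (S.q_mem _ _ h1)
      rwa [Nat.add_sub_cancel' hs] at h2
    · rw [hqg s i (by omega) x hx, mul_zero]
      exact zero_mem _
  · rw [hq'x, S.q_zero y hy x hx, zero_add]
    refine Finset.sum_eq_zero fun i _ => ?_
    rw [S.q_zero _ (fun t ht => ?_) _ (hg i _ x hx), mul_zero]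
    refine hy (t + (n + 1)) ?_
    simp only [Prod.ext_iff, Prod.fst_add, Prod.snd_add] at ht ⊢
    push_cast at ht ⊢
    constructor <;> omega
  · rw [hq'x, S.q_aug x hx, Finset.sum_eq_zero, add_zero]
    intro i _
    rw [hqg 0 i (by omega) x hx, mul_zero]
  · have h1 : L.MaurerCartan c m := (Nat.lt_or_ge n m).elim
      (fun h => by
        obtain rfl : m = n + 1 := by omega
        exact S.maurerCartan_succ h𝒜) (S.maurerCartan m)
    rw [← h1 μ']
    refine Finset.sum_congr rfl fun v hv => ?_
    rw [Alphabet.mem_words] at hv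
    -- One-letter words, the only ones affected by the change of `c`, do not enter the Maurer-Cartan
    -- equation since `b` vanishes on them.
    by_cases hv1 : v.length = 1
    · obtain ⟨x, rfl⟩ := List.length_eq_one_iff.1 hv1
      rw [List.map_cons, List.map_nil, M.b_singleton, smul_zero, smul_zero]
    · rw [hrev v (by omega) hv1]
  · have hdp : ρ.d p ∈ ρ.deg (0, s) := by simpa using ρ.d_mem hp
    have e1 : ∀ j ∈ Finset.range (n + 1), L.theta c' (j + 1) (q'.restrictScalars k) p =
        L.theta c (j + 1) (q.restrictScalars k) p - if j = n then
          ∑ i, B i * q (M.F [∑ x ∈ 𝔛.letters (n + 1), κ i x • L.e x] p) else 0 := by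
      intro j hj
      rw [Finset.mem_range] at hj
      have e2 : L.theta c' (j + 1) (q'.restrictScalars k) p =
          L.theta c' (j + 1) (q.restrictScalars k) p := by
        rw [theta_apply, theta_apply]
        refine Finset.sum_congr rfl fun w hw => ?_
        rw [Alphabet.mem_words] at hw
        have h1 := L.F_mem w _ _ hp
        rw [show ((-1 : ℤ), s) + (1, -(𝔛.weight w : ℤ)) = (0, s - (j + 1)) by
          ext <;> simp; omega] at h1
        rw [LinearMap.restrictScalars_apply, hq'x, Finset.sum_eq_zero, add_zero]
        · rfl
        · intro i _
          rw [hqg _ i (by push_cast at hs; omega) _ h1, mul_zero]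
      rw [e2, eq_sub_iff_add_eq', ← eq_sub_iff_add_eq, theta_apply, theta_apply,
        ← Finset.sum_sub_distrib, 𝔛.sum_words_eq_sum_letters]
      · split_ifs with h
        · subst h
          have h2 : ∀ i, q (M.F [∑ x ∈ 𝔛.letters (j + 1), κ i x • L.e x] p) =
              ∑ x ∈ 𝔛.letters (j + 1), κ i x • q (M.F [L.e x] p) := fun i => by
            let f : U →ₗ[k] A := q.restrictScalars k ∘ₗ LinearMap.applyₗ' k p ∘ₗ
              (M.F_lin [] []).mk' _
            have h : ∀ y, q (M.F [y] p) = f y := fun y => rfl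
            simp only [h, map_sum, map_smul]
          simp only [h2, Finset.mul_sum]
          rw [Finset.sum_comm]
          refine Finset.sum_congr rfl fun x hx => ?_
          have h4 : c x - c' x = ∑ i, κ i x • B i := by simp [hc', 𝔛.mem_letters.1 hx]
          rw [← sub_mul, Alphabet.revProd_singleton, Alphabet.revProd_singleton, h4,
            Finset.sum_mul]
          refine Finset.sum_congr rfl fun i _ => ?_
          rw [smul_mul_assoc, mul_smul_comm]
          rfl
        · refine (Finset.sum_eq_zero fun x hx => ?_).symm
          rw [Alphabet.revProd_singleton, Alphabet.revProd_singleton, hcc x, sub_self]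
          rw [𝔛.mem_letters.1 hx]
          omega
      · intro w hw h1
        rw [Alphabet.mem_words] at hw
        rw [hrev w (by omega) h1, sub_self]
    rw [thetaSum_const, Finset.sum_range_succ', Finset.sum_congr rfl e1, Finset.sum_sub_distrib,
      Finset.sum_ite_eq' _ n fun _ => _, if_pos (by simp), theta_zero,
      LinearMap.restrictScalars_apply, hq'x]
    have e3 := L.thetaSum_const c (q.restrictScalars k) (n + 1) p
    rw [Finset.sum_range_succ', theta_zero] at e3
    have e4 : L.thetaSum c (fun _ => q.restrictScalars k) (n + 1) p =
        ∑ i, B i * q (M.F [∑ x ∈ 𝔛.letters (n + 1), κ i x • L.e x] p) -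
          ∑ i, B i * q (g i (ρ.d p)) := by
      have hFx : ∀ i, M.F [∑ x ∈ 𝔛.letters (n + 1), κ i x • L.e x] p ∈
          ρ.deg (0, s - (n + 1)) := fun i => by
        have h1 := M.F_mem (z := (0, -((n + 1 : ℕ) : ℤ)))
          (sum_mem fun x hx => Submodule.smul_mem _ (κ i x) (𝔛.mem_letters.1 hx ▸ L.mem x)) _ _ hp
        rwa [show ((-1 : ℤ), s) + ((0, -((n + 1 : ℕ) : ℤ)) + (1, 0)) = (0, s - (n + 1)) by
          ext <;> simp; omega] at h1
      have hgd : ∀ i, g i (ρ.d p) ∈ ρ.deg (0, s - (n + 1)) := fun i => by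
        have h1 := hg i _ _ hdp
        rwa [show ((0 : ℤ), s) + (0, -((n + 1 : ℕ) : ℤ)) = (0, s - (n + 1)) by
          ext <;> simp; omega] at h1
      -- The top Adams degree is the only new case; below it both sides vanish.
      by_cases hsn : s = n + 1
      · subst hsn
        rw [sub_self] at hFx hgd
        rw [hμB _ (S.thetaSum_mem (n + 1) (n + 1) hp), ← Finset.sum_sub_distrib]
        refine Finset.sum_congr rfl fun i _ => ?_
        rw [H i, S.q_aug _ (hFx i), S.q_aug _ (hgd i), ← mul_sub,
          ← map_sub (algebraMap k A), ← Algebra.commutes,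
          ← Algebra.smul_def]
      · have hz : ∀ t : ℕ, ((0 : ℤ), s - (n + 1)) ≠ (0, (t : ℤ)) := fun t ht => by
          simp only [Prod.mk.injEq] at ht
          push_cast at hs
          omega
        rw [S.thetaSum_eq_zero (.inr ⟨hs, by push_cast at hs; simp; omega⟩) hp,
          Finset.sum_eq_zero fun i _ => by rw [S.q_zero _ hz _ (hFx i), mul_zero],
          Finset.sum_eq_zero fun i _ => by rw [S.q_zero _ hz _ (hgd i), mul_zero], sub_zero]
    rw [e4] at e3
    rw [LinearMap.restrictScalars_apply] at e3
    rw [sub_eq_iff_eq_add] at e3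
    rw [e3]
    abel

end Stage
end BarModel.LetterBasis
end Generate

/-! ### The Maurer-Cartan element of `A` and generation by its letters -/

section Generate
universe w
variable {k : Type*} [Field k] {A : Type*} [Ring A] [Algebra k A]
  {P : Type w} [AddCommGroup P] [Module k P] [Module Aᵐᵒᵖ P] [IsScalarTower k Aᵐᵒᵖ P]
  {𝒜 : ℕ → Submodule k A} {ρ : FreeResolution 𝒜 P} {U : Type*} [AddCommGroup U] [Module k U]
  {X : Type*}

namespace BarModel.LetterBasis
variable {M : BarModel ρ U} {𝔛 : Alphabet X} {L : M.LetterBasis 𝔛}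

/-- Apart from the degrees of the values of `c`, the conditions involve only words of weight at most
`n`. -/
theorem Stage.congr {c c' : X → A} {q : P →ₗ[Aᵐᵒᵖ] A} {n : ℕ} (S : L.Stage c q n)
    (hc' : ∀ x, c' x ∈ 𝒜 (𝔛.wt x)) (h : ∀ x, 𝔛.wt x ≤ n → c' x = c x) : L.Stage c' q n := by
  have hr : ∀ w, 𝔛.weight w ≤ n → Alphabet.revProd c' w = Alphabet.revProd c w := fun w hw =>
    Alphabet.revProd_congr fun x hx => h x ((Alphabet.wt_le_of_mem hx).trans hw)
  refine ⟨hc', S.q_mem, S.q_zero, S.q_aug, fun m hm μ => ?_, fun s hs p hp => ?_⟩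
  · rw [← S.maurerCartan m hm μ]
    refine Finset.sum_congr rfl fun v hv => ?_
    rw [hr v ((Alphabet.mem_words.1 hv).le.trans hm)]
  · rw [← S.eq s hs p hp, thetaSum_const, thetaSum_const]
    refine Finset.sum_congr rfl fun j hj => ?_
    rw [theta_apply, theta_apply]
    refine Finset.sum_congr rfl fun v hv => ?_
    rw [hr v ((Alphabet.mem_words.1 hv).le.trans (Nat.lt_succ_iff.1 (Finset.mem_range.1 hj)))]

variable (L) in
/-- A solution of the twisted equations. -/
theorem exists_forall_stage [GradedAlgebra 𝒜] (h𝒜 : IsConnectedLocallyFinite 𝒜) :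
    ∃ c : X → A, ∀ n, ∃ q, L.Stage c q n := by
  obtain ⟨c0, q0, S0⟩ := L.exists_stage_zero h𝒜
  choose f g hfg hf using fun (n : ℕ) (c : X → A) (h : ∃ q, L.Stage c q n) =>
    h.choose_spec.exists_succ h𝒜
  let F : ∀ n, {c : X → A // ∃ q, L.Stage c q n} :=
    Nat.rec ⟨c0, q0, S0⟩ fun n c => ⟨f n c.1 c.2, _, hfg n c.1 c.2⟩
  have hF : ∀ n x, 𝔛.wt x ≠ n + 1 → (F (n + 1)).1 x = (F n).1 x := fun n =>
    hf n (F n).1 (F n).2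
  have hF' : ∀ x n, 𝔛.wt x ≤ n → (F n).1 x = (F (𝔛.wt x)).1 x := fun x n hn => by
    induction n, hn using Nat.le_induction with
    | base => rfl
    | succ n hn ih => rw [hF n x (by omega), ih]
  -- The value at `x` no longer changes after stage `wt x`. Only `c` passes to the limit; a
  -- different `q` may serve each `n`.
  refine ⟨fun x => (F (𝔛.wt x)).1 x, fun n => ?_⟩
  obtain ⟨q, S⟩ := (F n).2
  refine ⟨q, S.congr (fun x => ?_) fun x hx => (hF' x n hx).symm⟩
  obtain ⟨q', S'⟩ := (F (𝔛.wt x)).2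
  exact S'.c_mem x

/-- The values on the letters generate the algebra. -/
theorem Stage.map_eq_zero [GradedAlgebra 𝒜] {c : X → A} {q : P →ₗ[Aᵐᵒᵖ] A} {n : ℕ}
    (S : L.Stage c q n) (κ : Contraction ρ) (hn : 0 < n) {μ : A →ₗ[k] k} (hμ : KillsProducts 𝒜 μ)
    (h : ∀ x ∈ 𝔛.letters n, μ (c x) = 0) {a : A} (ha : a ∈ 𝒜 n) : μ a = 0 := by
  set p := κ.r (MulOpposite.op a • ρ.e) with hp
  have hx : MulOpposite.op a • ρ.e ∈ ρ.deg (0, (n : ℤ)) := by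
    simpa using ρ.smul_mem' ρ.e_mem ha
  have hpd : p ∈ ρ.deg (-1, (n : ℤ)) := by simpa using κ.mem hx
  -- Since `q` sends `e` acted on by `a` to `a`, the stage equation at `p` expresses `a` through the
  -- letters, up to products.
  have hd : ρ.d p = MulOpposite.op a • ρ.e := by
    rw [hp, κ.d_r rfl hx, ρ.aug_smul n _ a hn ha, zero_smul, sub_zero]
  have h1 := congrArg μ (S.eq n le_rfl p hpd)
  rw [thetaSum_const, Finset.sum_range_succ', theta_zero, hd, LinearMap.restrictScalars_apply,
    map_smul, S.q_aug _ ρ.e_mem, ρ.aug_e, map_one, op_smul_eq_mul, one_mul, map_add, map_sum,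
    map_zero, Finset.sum_eq_zero, zero_add] at h1
  · exact h1
  · intro j hj
    rw [Finset.mem_range] at hj
    have hF : ∀ w ∈ 𝔛.words (j + 1), M.F (w.map L.e) p ∈ ρ.deg (0, ((n - (j + 1) : ℕ) : ℤ)) := by
      intro w hw
      have h2 := L.F_mem w _ _ hpd
      rwa [Alphabet.mem_words.1 hw, show ((-1 : ℤ), (n : ℤ)) + (1, -((j + 1 : ℕ) : ℤ)) =
        (0, ((n - (j + 1) : ℕ) : ℤ)) by ext <;> simp; omega] at h2
    rw [theta_apply, map_sum]
    by_cases hjn : j + 1 = n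
    · subst hjn
      simp only [Nat.sub_self] at hF
      have h2 : ∀ w ∈ 𝔛.words (j + 1), μ (Alphabet.revProd c w *
          q.restrictScalars k (M.F (w.map L.e) p)) =
          ρ.aug (M.F (w.map L.e) p) * μ (Alphabet.revProd c w) := fun w hw => by
        rw [LinearMap.restrictScalars_apply, S.q_aug _ (hF w hw), ← Algebra.commutes,
          ← Algebra.smul_def, map_smul, smul_eq_mul]
      rw [Finset.sum_congr rfl h2, 𝔛.sum_words_eq_sum_letters]
      · refine Finset.sum_eq_zero fun x hx => ?_
        rw [Alphabet.revProd_singleton, h x hx, mul_zero]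
      · intro w hw hw1
        rw [Alphabet.map_revProd_eq_zero S.c_mem hμ _ hw1, mul_zero]
        rintro rfl
        rw [Alphabet.mem_words] at hw
        exact hn.ne hw
    · refine Finset.sum_eq_zero fun w hw => hμ (j + 1) _ j.succ_pos ?_ _ ?_ _
        (S.q_mem _ _ (hF w hw))
      · omega
      · rw [← Alphabet.mem_words.1 hw]
        exact Alphabet.revProd_mem S.c_mem w

end BarModel.LetterBasis
end Generate

/-! ### Graded surjections in both directions -/

section Compare
universe w w'
variable {k : Type*} [Field k] {A A' : Type*} [Ring A] [Algebra k A] [Ring A'] [Algebra k A']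
  {P : Type w} [AddCommGroup P] [Module k P] [Module Aᵐᵒᵖ P] [IsScalarTower k Aᵐᵒᵖ P]
  {P' : Type w'} [AddCommGroup P'] [Module k P'] [Module A'ᵐᵒᵖ P'] [IsScalarTower k A'ᵐᵒᵖ P']
  {𝒜 : ℕ → Submodule k A} {ρ : FreeResolution 𝒜 P}
  {𝒜' : ℕ → Submodule k A'} {ρ' : FreeResolution 𝒜' P'}
  {U U' : Type*} [AddCommGroup U] [Module k U] [AddCommGroup U'] [Module k U'] {X : Type*}
  [GradedAlgebra 𝒜] [GradedAlgebra 𝒜']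

namespace BarModel.LetterBasis
variable {M : BarModel ρ U} {M' : BarModel ρ' U'} {𝔛 : Alphabet X} (L : M.LetterBasis 𝔛)
  (L' : M'.LetterBasis 𝔛)

/-- The Maurer-Cartan element of `A` satisfies the equations of `E'` as well, test functional by
test functional, and so classifies `χ : A' → A`. Its image contains the letters modulo products, and
the letters generate `A`. -/
theorem exists_surjective_algHom (h𝒜 : IsConnectedLocallyFinite 𝒜)
    (h𝒜' : IsConnectedLocallyFinite 𝒜')
    (h : ∀ (n : ℕ) (a : List X → k), ∑ v ∈ 𝔛.words n, a v • M.b (v.map L.e) = 0 →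
      ∑ v ∈ 𝔛.words n, a v • M'.b (v.map L'.e) = 0) :
    ∃ χ : A' →ₐ[k] A, ∀ i, (𝒜' i).map χ.toLinearMap = 𝒜 i := by
  obtain ⟨c, S⟩ := L.exists_forall_stage h𝒜
  choose q S using S
  have hcm := (S 0).c_mem
  obtain ⟨κ⟩ := Contraction.nonempty ρ
  obtain ⟨κ'⟩ := Contraction.nonempty ρ'
  obtain ⟨χ, hχ⟩ := L'.exists_algHom κ' hcm fun m μ =>
    h m (fun v => μ (Alphabet.revProd c v)) ((S m).maurerCartan m le_rfl μ)
  refine ⟨χ, fun n => ?_⟩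
  induction n using Nat.strong_induction_on with
  | _ n ih =>
    refine le_antisymm ?_ fun a ha => ?_
    · rintro _ ⟨a, ha, rfl⟩
      exact (hχ n a ha).1
    rcases Nat.eq_zero_or_pos n with rfl | hn
    · obtain ⟨x, rfl, -⟩ := h𝒜.connected a ha
      exact ⟨algebraMap k A' x, SetLike.algebraMap_mem_graded 𝒜' x, χ.commutes x⟩
    by_contra hna
    -- A functional separating `a` from the image in degree `n`. By induction products of lower
    -- elements lie in the image, so it kills products; it then kills the letters, and finally `a`.
    obtain ⟨f, hf, hf0⟩ := Submodule.exists_dual_map_eq_bot_of_notMem hna inferInstance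
    have hf1 : ∀ b ∈ 𝒜' n, f (χ b) = 0 := fun b hb => by
      have : f (χ b) ∈ ((𝒜' n).map χ.toLinearMap).map f := ⟨_, ⟨b, hb, rfl⟩, rfl⟩
      rwa [hf0] at this
    set μ : A →ₗ[k] k := f ∘ₗ GradedAlgebra.proj 𝒜 n with hμ
    have hμ1 : ∀ b ∈ 𝒜 n, μ b = f b := fun b hb => by
      rw [hμ, LinearMap.comp_apply, GradedAlgebra.proj_apply, DirectSum.decompose_of_mem_same _ hb]
    have hμp : KillsProducts 𝒜 μ := by
      intro i j hi hj x hx y hy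
      have hxy := SetLike.GradedMul.mul_mem hx hy
      by_cases hij : i + j = n
      · rw [← ih i (by omega)] at hx
        rw [← ih j (by omega)] at hy
        obtain ⟨x, hx, rfl⟩ := hx
        obtain ⟨y, hy, rfl⟩ := hy
        have h1 := SetLike.GradedMul.mul_mem hx hy
        rw [hij] at hxy h1
        rw [hμ1 _ hxy]
        have h2 := hf1 _ h1
        rwa [map_mul] at h2
      · rw [hμ, LinearMap.comp_apply, GradedAlgebra.proj_apply,
          DirectSum.decompose_of_mem_ne _ hxy hij, map_zero]
    have h1 := L'.map_c_eq_zero κ' h𝒜' hcm hn hμp fun b hb => by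
      rw [← (hχ n b hb).2, hμ1 _ (hχ n b hb).1, hf1 b hb]
    exact hf (hμ1 a ha ▸ (S n).map_eq_zero κ hn hμp h1 ha)

end BarModel.LetterBasis

/-- Surjections both ways force equal finite dimensions in every degree, so `χ` is injective degree
by degree. -/
theorem exists_algEquiv_of_surjective (h𝒜 : IsConnectedLocallyFinite 𝒜)
    (h𝒜' : IsConnectedLocallyFinite 𝒜') (χ : A →ₐ[k] A') (χ' : A' →ₐ[k] A)
    (h : ∀ i, (𝒜 i).map χ.toLinearMap = 𝒜' i) (h' : ∀ i, (𝒜' i).map χ'.toLinearMap = 𝒜 i) :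
    ∃ ψ : A ≃ₐ[k] A', ∀ i, (𝒜 i).map ψ.toLinearMap = 𝒜' i := by
  have := h𝒜.finite
  have := h𝒜'.finite
  have hr : ∀ i, Module.finrank k (𝒜 i) = Module.finrank k (𝒜' i) := fun i => by
    refine le_antisymm ?_ ?_
    · conv_lhs => rw [← h' i]
      exact Submodule.finrank_map_le _ _
    · conv_lhs => rw [← h i]
      exact Submodule.finrank_map_le _ _
  have hχ : ∀ i, ∀ a ∈ 𝒜 i, χ a ∈ 𝒜' i := fun i a ha => h i ▸ ⟨a, ha, rfl⟩
  have hi : ∀ i, ∀ a ∈ 𝒜 i, χ a = 0 → a = 0 := fun i a ha h0 => by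
    let f : 𝒜 i →ₗ[k] 𝒜' i := χ.toLinearMap.restrict (hχ i)
    have hf : Function.Injective f := by
      rw [LinearMap.injective_iff_surjective_of_finrank_eq_finrank (hr i)]
      rintro ⟨b, hb⟩
      rw [← h i] at hb
      obtain ⟨a, ha, rfl⟩ := hb
      exact ⟨⟨a, ha⟩, rfl⟩
    exact congrArg Subtype.val (@hf ⟨a, ha⟩ 0 (Subtype.ext (h0.trans (by simp))))
  have hp : ∀ i a, χ (GradedAlgebra.proj 𝒜 i a) = GradedAlgebra.proj 𝒜' i (χ a) := by
    intro i a
    simp only [GradedAlgebra.proj_apply]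
    induction a using DirectSum.Decomposition.inductionOn 𝒜 with
    | zero => simp
    | @homogeneous j a =>
      by_cases hij : j = i
      · subst hij
        rw [DirectSum.decompose_of_mem_same _ a.2, DirectSum.decompose_of_mem_same _ (hχ _ _ a.2)]
      · rw [DirectSum.decompose_of_mem_ne _ a.2 hij,
          DirectSum.decompose_of_mem_ne _ (hχ _ _ a.2) hij, map_zero]
    | add a b ha hb => simp [DirectSum.decompose_add, ha, hb]
  refine ⟨AlgEquiv.ofBijective χ ⟨(injective_iff_map_eq_zero χ).2 fun a ha => ?_, ?_⟩, h⟩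
  · apply (DirectSum.decompose 𝒜).injective
    rw [DirectSum.decompose_zero]
    ext i
    refine hi i _ (SetLike.coe_mem _) ?_
    rw [← GradedAlgebra.proj_apply, hp, ha, map_zero]
  · change Function.Surjective χ.toLinearMap
    refine LinearMap.range_eq_top.1 (eq_top_iff.2 ?_)
    rw [← (DirectSum.Decomposition.isInternal 𝒜').submodule_iSup_eq_top]
    refine iSup_le fun i => ?_
    rw [← h i]
    exact LinearMap.map_le_range

end Compare

/-! ### Bases of `E^1` -/

section Letters
universe w w'
variable {k : Type*} [Field k] {A A' : Type*} [Ring A] [Algebra k A] [Ring A'] [Algebra k A']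
  {P : Type w} [AddCommGroup P] [Module k P] [Module Aᵐᵒᵖ P] [IsScalarTower k Aᵐᵒᵖ P]
  {P' : Type w'} [AddCommGroup P'] [Module k P'] [Module A'ᵐᵒᵖ P'] [IsScalarTower k A'ᵐᵒᵖ P']
  {𝒜 : ℕ → Submodule k A} {ρ : FreeResolution 𝒜 P}
  {𝒜' : ℕ → Submodule k A'} {ρ' : FreeResolution 𝒜' P'}
  {U U' : Type*} [AddCommGroup U] [Module k U] [AddCommGroup U'] [Module k U'] {X : Type*}

namespace BarModel

theorem exists_letterBasis [GradedAlgebra 𝒜] (h𝒜 : IsConnectedLocallyFinite 𝒜)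
    (M : BarModel ρ U) : ∃ (X : Type) (𝔛 : Alphabet X), Nonempty (M.LetterBasis 𝔛) := by
  have hfin : ∀ n : ℕ, Module.Finite k (M.deg (0, -((n + 1 : ℕ) : ℤ))) := fun n =>
    M.finite_deg h𝒜 n.succ_pos
  let B := fun n : ℕ => Module.finBasis k (M.deg (0, -((n + 1 : ℕ) : ℤ)))
  -- The index `n` stands for Adams degree `-(n + 1)`, which keeps the weights positive.
  let 𝔛 : Alphabet (Σ n : ℕ, Fin (Module.finrank k (M.deg (0, -((n + 1 : ℕ) : ℤ))))) :=
    { wt := fun x => x.1 + 1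
      wt_pos := fun x => x.1.succ_pos
      letters := fun n => Nat.casesOn n ∅ fun n => Finset.univ.map (Function.Embedding.sigmaMk n)
      mem_letters := by
        rintro (_ | n) ⟨m, i⟩
        · simp
        · simp only [Finset.mem_map, Finset.mem_univ, true_and, Function.Embedding.sigmaMk_apply,
            Nat.add_right_cancel_iff]
          constructor
          · rintro ⟨j, hj⟩
            exact (congrArg Sigma.fst hj).symm
          · rintro rfl
            exact ⟨i, rfl⟩ }
  have hsum : ∀ n (a : _ → k), ∑ x ∈ 𝔛.letters (n + 1), a x • ((B x.1 x.2 : _) : U) =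
      ((∑ i, a ⟨n, i⟩ • B n i : _) : M.deg (0, -((n + 1 : ℕ) : ℤ))) := fun n a => by
    rw [AddSubmonoidClass.coe_finsetSum]
    exact Finset.sum_map _ _ _
  refine ⟨_, 𝔛, ⟨⟨fun x => (B x.1 x.2 : U), fun x => (B x.1 x.2).2, ?_, ?_⟩⟩⟩
  · rintro (_ | n) a h
    · intro x hx
      exact absurd hx (Finset.notMem_empty x)
    · rintro ⟨m, i⟩ hx
      obtain rfl : m = n := Nat.succ.inj (𝔛.mem_letters.1 hx)
      rw [hsum, ZeroMemClass.coe_eq_zero] at h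
      exact Fintype.linearIndependent_iff.1 (B m).linearIndependent (fun i => a ⟨m, i⟩) h i
  · rintro (_ | n) hn y hy
    · exact absurd hn (lt_irrefl 0)
    · refine ⟨fun x => if h : x.1 = n then (B n).repr ⟨y, hy⟩ (h ▸ x.2) else 0, ?_⟩
      rw [hsum]
      simp [(B n).sum_repr]

/-- Transport of a basis along an isomorphism. -/
def LetterBasis.map {M : BarModel ρ U} {M' : BarModel ρ' U'} {𝔛 : Alphabet X}
    (L : M.LetterBasis 𝔛) (t : U →ₗ[k] U')
    (hmem : ∀ n : ℕ, ∀ y ∈ M.deg (0, -(n : ℤ)), t y ∈ M'.deg (0, -(n : ℤ)))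
    (hinj : ∀ n : ℕ, ∀ y ∈ M.deg (0, -(n : ℤ)), t y = 0 → y = 0)
    (hsurj : ∀ n : ℕ, ∀ y ∈ M'.deg (0, -(n : ℤ)), ∃ x ∈ M.deg (0, -(n : ℤ)), t x = y) :
    M'.LetterBasis 𝔛 where
  e x := t (L.e x)
  mem x := hmem _ _ (L.mem x)
  eq_zero n a h := L.eq_zero n a (hinj n _
    (sum_mem fun x hx => Submodule.smul_mem _ _ (𝔛.mem_letters.1 hx ▸ L.mem x))
    (by simpa only [map_sum, map_smul] using h))
  exists_eq n hn y hy := by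
    obtain ⟨x, hx, rfl⟩ := hsurj n y hy
    obtain ⟨a, rfl⟩ := L.exists_eq n hn x hx
    exact ⟨a, by simp only [map_sum, map_smul]⟩

end BarModel
end Letters

/-! ### From the restricted multiplications to the theorem -/

section Restriction
universe w w'
variable {k : Type*} [Field k] {A A' : Type*} [Ring A] [Algebra k A] [Ring A'] [Algebra k A']
  {P : Type w} [AddCommGroup P] [Module k P] [Module Aᵐᵒᵖ P] [IsScalarTower k Aᵐᵒᵖ P]
  {P' : Type w'} [AddCommGroup P'] [Module k P'] [Module A'ᵐᵒᵖ P'] [IsScalarTower k A'ᵐᵒᵖ P']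
  {𝒜 : ℕ → Submodule k A} {ρ : FreeResolution 𝒜 P}
  {𝒜' : ℕ → Submodule k A'} {ρ' : FreeResolution 𝒜' P'}
  {V V' : Type*} [AddCommGroup V] [Module k V] [AddCommGroup V'] [Module k V'] {X : Type*}
  {E : AInfinityAlgebra k V} {E' : AInfinityAlgebra k V'}

namespace AInfinityAlgebra

/-- All letters have cohomological degree one, so the suspension sign depends only on the length of
the word and is the same for `E` and `E'`. -/
theorem coe_posBar_map {e : X → E.pos} {d : X → ℤ} (he : ∀ x, e x ∈ E.posDeg (0, d x))
    {ε : X → E.upper 1} (hε : ∀ x, (e x : V) = ε x) (v : List X) :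
    (E.posBar (v.map e) : V) = (twSign (List.replicate v.length 1)).negOnePow •
      (E.restr v.length fun i => ε (v.get i) : V) := by
  have hw : Graded E.deg (v.map fun x => ((e x : V), ((1 : ℤ), d x))) := by
    intro q hq
    obtain ⟨x, -, rfl⟩ := List.mem_map.1 hq
    simpa using (show (e x : V) ∈ E.deg ((0, d x) + (1, 0)) from he x)
  have h1 := tev_apply (signMap_zero_apply E.isInternal) E.m hw
  have h2 : letters (v.map fun x => ((e x : V), ((1 : ℤ), d x))) =
      List.ofFn fun i => (ε (v.get i) : V) := by
    refine List.ext_getElem (by simp) fun j h1 h2 => ?_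
    simp [hε]
  have h3 : fdegs (v.map fun x => ((e x : V), ((1 : ℤ), d x))) = List.replicate v.length 1 := by
    refine List.ext_getElem (by simp) fun j h1 h2 => ?_
    simp
  have h4 : (v.map e).map Subtype.val = letters (v.map fun x => ((e x : V), ((1 : ℤ), d x))) := by
    rw [List.map_map, letters, List.map_map]
    rfl
  rw [h3] at h1
  rw [coe_posBar, h4, bar, h1, h2, ev_ofFn]
  rfl

theorem mem_upper {p i : ℤ} {x : V} (hx : x ∈ E.deg (p, i)) : x ∈ E.upper p :=
  (le_iSup (fun i => E.deg (p, i)) i) hx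

/-- A linear isomorphism that preserves degrees is surjective in each degree. -/
theorem symm_mem_deg {p : ℤ} (φ : E.upper p ≃ₗ[k] E'.upper p)
    (hφ : ∀ (i : ℤ) (x : E.upper p), (x : V) ∈ E.deg (p, i) → (φ x : V') ∈ E'.deg (p, i)) {i : ℤ}
    {y : E'.upper p} (hy : (y : V') ∈ E'.deg (p, i)) : (φ.symm y : V) ∈ E.deg (p, i) := by
  obtain ⟨g, hg⟩ := ((E'.upper p).subtype ∘ₗ φ.toLinearMap).exists_extend
  have hg' : ∀ x : E.upper p, g x = φ x := fun x => LinearMap.congr_fun hg x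
  have hgd : ∀ j, ∀ x ∈ E.deg (p, j), g x ∈ E'.deg (p, j) := fun j x hx => by
    have := hφ j ⟨x, mem_upper hx⟩ hx
    rwa [← hg'] at this
  have h1 : ∀ x ∈ E.upper p, g (gproj E.isInternal (p, i) x) =
      gproj E'.isInternal (p, i) (g x) := by
    intro x hx
    refine Submodule.iSup_induction (fun j => E.deg (p, j))
      (motive := fun x => g (gproj E.isInternal (p, i) x) = gproj E'.isInternal (p, i) (g x)) hx
      (fun j x hx => ?_) (by simp) fun x y hx hy => by simp [hx, hy]
    by_cases hj : j = i
    · subst hj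
      rw [gproj_of_mem _ hx, gproj_of_mem _ (hgd j x hx)]
    · have hj' : (p, j) ≠ (p, i) := fun h => hj (congrArg Prod.snd h)
      rw [gproj_of_ne _ hx hj', gproj_of_ne _ (hgd j x hx) hj', map_zero]
  have h2 := h1 _ (φ.symm y).2
  rw [hg', φ.apply_symm_apply, gproj_of_mem _ hy] at h2
  have h3 := gproj_mem E.isInternal (p, i) (φ.symm y : V)
  have h4 : φ ⟨_, mem_upper h3⟩ = y := Subtype.ext ((hg' _).symm.trans h2)
  rw [← h4, φ.symm_apply_apply]
  exact h3

end AInfinityAlgebra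

/-- A basis of letters for `E` is carried by `φ₁` to one for `E'` over the same alphabet, and `φ₂`
identifies the two systems of Maurer-Cartan equations. Surjections are then obtained in both
directions. -/
theorem IsExtAlgebra.exists_algEquiv [GradedAlgebra 𝒜] [GradedAlgebra 𝒜']
    (h𝒜 : IsConnectedLocallyFinite 𝒜) (h𝒜' : IsConnectedLocallyFinite 𝒜')
    (hE : IsExtAlgebra ρ E) (hE' : IsExtAlgebra ρ' E')
    (φ₁ : E.upper 1 ≃ₗ[k] E'.upper 1) (φ₂ : E.upper 2 ≃ₗ[k] E'.upper 2)
    (hφ₁ : ∀ (i : ℤ) (x : E.upper 1), (x : V) ∈ E.deg (1, i) → (φ₁ x : V') ∈ E'.deg (1, i))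
    (hφ : ∀ (n : ℕ) (v : Fin n → E.upper 1),
      φ₂ (E.restr n v) = E'.restr n fun j => φ₁ (v j)) :
    ∃ ψ : A ≃ₐ[k] A', ∀ i, (𝒜 i).map ψ.toLinearMap = 𝒜' i := by
  obtain ⟨hE1, f, hf⟩ := hE
  obtain ⟨hE1', f', hf'⟩ := hE'
  set M := AInfinityAlgebra.barModel ρ.endRep hE1 hf
  set M' := AInfinityAlgebra.barModel ρ'.endRep hE1' hf'
  obtain ⟨X, 𝔛, ⟨L⟩⟩ := M.exists_letterBasis h𝒜
  -- An arbitrary linear extension of `φ₁` to all of `V`; only its values on `E^1` are used.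
  obtain ⟨g, hg⟩ := ((E'.upper 1).subtype ∘ₗ φ₁.toLinearMap).exists_extend
  have hg' : ∀ x : E.upper 1, g x = φ₁ x := fun x => LinearMap.congr_fun hg x
  have hdeg : ∀ {n : ℕ} {y : E.pos}, y ∈ M.deg (0, -(n : ℤ)) → (y : V) ∈ E.deg (1, -(n : ℤ)) :=
    fun {n y} hy => by simpa using (show (y : V) ∈ E.deg ((0, -(n : ℤ)) + (1, 0)) from hy)
  have hdeg' : ∀ {n : ℕ} {y : E'.pos}, y ∈ M'.deg (0, -(n : ℤ)) →
      (y : V') ∈ E'.deg (1, -(n : ℤ)) :=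
    fun {n y} hy => by simpa using (show (y : V') ∈ E'.deg ((0, -(n : ℤ)) + (1, 0)) from hy)
  have hgd : ∀ {n : ℕ} {y : E.pos}, y ∈ M.deg (0, -(n : ℤ)) → g y ∈ E'.deg (1, -(n : ℤ)) :=
    fun {n y} hy => by
      have := hφ₁ _ ⟨y, AInfinityAlgebra.mem_upper (hdeg hy)⟩ (hdeg hy)
      rwa [← hg'] at this
  let t : E.pos →ₗ[k] E'.pos := E'.posProj ∘ₗ g ∘ₗ E.pos.subtype
  have ht : ∀ {n : ℕ} {y : E.pos}, y ∈ M.deg (0, -(n : ℤ)) → (t y : V') = g y := fun {n y} hy =>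
    E'.posProj_of_mem (AInfinityAlgebra.mem_pos le_rfl (hgd hy))
  let L' : M'.LetterBasis 𝔛 := L.map t (fun n y hy => ?_) (fun n y hy h0 => ?_) fun n y hy => ?_
  · have key : ∀ (n : ℕ) (a : List X → k), ∑ v ∈ 𝔛.words n, a v • M.b (v.map L.e) = 0 ↔
        ∑ v ∈ 𝔛.words n, a v • M'.b (v.map L'.e) = 0 := by
      intro n a
      let ε : X → E.upper 1 := fun x => ⟨L.e x, AInfinityAlgebra.mem_upper (hdeg (L.mem x))⟩
      let s : List X → ℤˣ := fun v => (twSign (List.replicate v.length 1)).negOnePow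
      have h1 : ∀ v : List X, (M.b (v.map L.e) : V) =
          ((s v • E.restr v.length fun i => ε (v.get i) : E.upper 2) : V) :=
        AInfinityAlgebra.coe_posBar_map L.mem (ε := ε) fun x => rfl
      have h2 : ∀ v : List X, (M'.b (v.map L'.e) : V') =
          ((s v • E'.restr v.length fun i => φ₁ (ε (v.get i)) : E'.upper 2) : V') :=
        AInfinityAlgebra.coe_posBar_map L'.mem (ε := fun x => φ₁ (ε x)) fun x =>
          (ht (L.mem x)).trans (hg' (ε x))
      have h3 : ((∑ v ∈ 𝔛.words n, a v • M.b (v.map L.e) : E.pos) : V) =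
          ((∑ v ∈ 𝔛.words n, a v • s v • E.restr v.length fun i => ε (v.get i) :
            E.upper 2) : V) := by
        simp only [AddSubmonoidClass.coe_finsetSum, Submodule.coe_smul, h1]
      have h4 : ((∑ v ∈ 𝔛.words n, a v • M'.b (v.map L'.e) : E'.pos) : V') =
          ((∑ v ∈ 𝔛.words n, a v • s v • E'.restr v.length fun i => φ₁ (ε (v.get i)) :
            E'.upper 2) : V') := by
        simp only [AddSubmonoidClass.coe_finsetSum, Submodule.coe_smul, h2]
      -- The signs are common to both sides, so `φ₂` carries one expression to the other;
      -- injectivity of `φ₂` gives both implications.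
      have h5 : φ₂ (∑ v ∈ 𝔛.words n, a v • s v • E.restr v.length fun i => ε (v.get i)) =
          ∑ v ∈ 𝔛.words n, a v • s v • E'.restr v.length fun i => φ₁ (ε (v.get i)) := by
        simp only [map_sum, map_smul, ← hφ]
        refine Finset.sum_congr rfl fun v _ => ?_
        congr 1
        exact map_units_smul φ₂.toLinearMap _ _
      rw [← ZeroMemClass.coe_eq_zero, h3, ← ZeroMemClass.coe_eq_zero (x := ∑ v ∈ _, a v • M'.b _),
        h4, ZeroMemClass.coe_eq_zero, ZeroMemClass.coe_eq_zero, ← h5,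
        map_eq_zero_iff _ φ₂.injective]
    obtain ⟨χ, hχ⟩ := L'.exists_surjective_algHom L h𝒜' h𝒜 fun n a => (key n a).2
    obtain ⟨χ', hχ'⟩ := L.exists_surjective_algHom L' h𝒜 h𝒜' fun n a => (key n a).1
    exact exists_algEquiv_of_surjective h𝒜 h𝒜' χ χ' hχ hχ'
  · change (t y : V') ∈ E'.deg ((0, -(n : ℤ)) + (1, 0))
    rw [ht hy]
    simpa using hgd hy
  · have h1 := congrArg Subtype.val h0
    rw [ht hy] at h1
    have h2 := (hg' ⟨y, AInfinityAlgebra.mem_upper (hdeg hy)⟩).symm.trans h1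
    have h3 := (map_eq_zero_iff _ φ₁.injective).1 (Subtype.ext h2)
    exact Subtype.ext (congrArg (fun x : E.upper 1 => (x : V)) h3)
  · set x := φ₁.symm ⟨y, AInfinityAlgebra.mem_upper (hdeg' hy)⟩ 
    have hxd : (x : V) ∈ E.deg (1, -(n : ℤ)) := AInfinityAlgebra.symm_mem_deg φ₁ hφ₁ (hdeg' hy)
    have hxm : (⟨x, AInfinityAlgebra.mem_pos le_rfl hxd⟩ : E.pos) ∈ M.deg (0, -(n : ℤ)) := by
      change (x : V) ∈ E.deg ((0, -(n : ℤ)) + (1, 0))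
      simpa using hxd
    refine ⟨_, hxm, Subtype.ext ?_⟩
    rw [ht hxm, hg', φ₁.apply_symm_apply]

end Restriction
end ExtAInf

theorem corollary5p6 {k : Type*} [Field k]
    -- connected graded locally finite algebras `A` and `A'`
    {A A' : Type*} [Ring A] [Algebra k A] [Ring A'] [Algebra k A']
    (𝒜 : ℕ → Submodule k A) [GradedAlgebra 𝒜] (h𝒜 : ExtAInf.IsConnectedLocallyFinite 𝒜)
    (𝒜' : ℕ → Submodule k A') [GradedAlgebra 𝒜'] (h𝒜' : ExtAInf.IsConnectedLocallyFinite 𝒜')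
    -- graded free resolutions of the trivial modules
    {P P' : Type*} [AddCommGroup P] [Module k P] [Module Aᵐᵒᵖ P] [IsScalarTower k Aᵐᵒᵖ P]
    [AddCommGroup P'] [Module k P'] [Module A'ᵐᵒᵖ P'] [IsScalarTower k A'ᵐᵒᵖ P']
    (ρ : ExtAInf.FreeResolution 𝒜 P) (ρ' : ExtAInf.FreeResolution 𝒜' P')
    -- `E` and `E'` are `A_∞`-Ext-algebras of `A` and `A'`
    {V V' : Type*} [AddCommGroup V] [Module k V] [AddCommGroup V'] [Module k V']
    (E : ExtAInf.AInfinityAlgebra k V) (hE : ExtAInf.IsExtAlgebra ρ E)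
    (E' : ExtAInf.AInfinityAlgebra k V') (hE' : ExtAInf.IsExtAlgebra ρ' E')
    -- an isomorphism between the restricted multiplications `(E^1)^{⊗n} → E^2` and
    -- `(E'^1)^{⊗n} → E'^2`, for all `n`
    (φ₁ : E.upper 1 ≃ₗ[k] E'.upper 1) (φ₂ : E.upper 2 ≃ₗ[k] E'.upper 2)
    (hφ₁ : ∀ (i : ℤ) (x : E.upper 1), (x : V) ∈ E.deg (1, i) → (φ₁ x : V') ∈ E'.deg (1, i))
    (hφ₂ : ∀ (i : ℤ) (x : E.upper 2), (x : V) ∈ E.deg (2, i) → (φ₂ x : V') ∈ E'.deg (2, i))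
    (hφ : ∀ (n : ℕ) (v : Fin n → E.upper 1),
      φ₂ (E.restr n v) = E'.restr n fun j => φ₁ (v j)) :
    (∃ ψ : A ≃ₐ[k] A', ∀ i, (𝒜 i).map ψ.toLinearMap = 𝒜' i) ∧
      ∃ f : ExtAInf.AInfinityHom E E', f.IsQuasiIso := by
  -- The algebra isomorphism comes first: the second claim follows from it and from the uniqueness
  -- of minimal models over a fixed algebra.
  obtain ⟨ψ, hψ⟩ := hE.exists_algEquiv h𝒜 h𝒜' hE' φ₁ φ₂ hφ₁ hφ
  exact ⟨⟨ψ, hψ⟩, ExtAInf.IsExtAlgebra.exists_quasiIso h𝒜 hE hE' ψ hψ⟩
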